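/- **Theorem (two-phase thin film Stokes system).** Let $\mathbb T=[-\pi,\pi]$ with its endpoints identified, $\hat u(k)=\frac1{2\pi}\int_{\mathbb T}u\,e^{-ikx}dx$, $\langle u\rangle=\hat u(0)$, and for $s\ge 0$ let $\dot A^s(\mathbb T)$ and $\dot H^s(\mathbb T)$ be the spaces of zero mean functions $u$ (in $L^1$, resp. $L^2$) with $\|u\|_{\dot A^s}=\sum_{k}|k|^s|\hat u(k)|<\infty$, resp. $\|u\|^2_{\dot H^s}=\sum_k|k|^{2s}|\hat u(k)|^2<\infty$; $\dot A=\dot A^0$. Let $W^{n,p}(\mathbb T)=\{u\in L^p:\partial_x^nu\in L^p\}$, and let $\mathcal M(0,T;X)$ be the space of $X$-valued Radon measures (of bounded variation) on $[0,T]$, a function $u$ being identified with the measure $u(t)\,dt$. Consider either the gravity case $\mathscr D=\partial_x$, $\zeta=1$, or the capillary case $\mathscr D=-\partial_x^3$, $\zeta=3$. Let $\rho,\mu>0$ be the parameters of the system, let $f_0,g_0$ be the initial heights, with means $\langle f_0\rangle,\langle g_0\rangle$, and let $\bar f_0=f_0-\langle f_0\rangle$, $\bar g_0=g_0-\langle g_0\rangle$.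 With $f=\langle f_0\rangle+\bar f$, $g=\langle g_0\rangle+\bar g$ the system for $(\bar f,\bar g)$ with initial datum $(\bar f_0,\bar g_0)$ is $$\partial_t\bar f=\partial_x J_1,\quad J_1=(2\rho f^3+3f^2g)\mathscr D\bar f+(2f^3+3f^2g)\mathscr D\bar g,$$ $$\partial_t\bar g=\partial_x J_2,\quad J_2=(2\mu g^3+3\rho f^2g+6fg^2)\mathscr D\bar f+(2\mu g^3+3f^2g+6fg^2)\mathscr D\bar g.$$ A weak solution on $(0,T)$ is a pair $(\bar f,\bar g)\in (L^1(0,T;W^{\zeta,1}(\mathbb T)))^2$ with $J_1,J_2\in L^1((0,T)\times\mathbb T)$ such that $$\int_{\mathbb T}\bar f_0\,\phi(0)\,dx+\int_0^T\!\!\int_{\mathbb T}\bar f\,\partial_t\phi\,dxdt=\int_0^T\!\!\int_{\mathbb T}J_1\,\partial_x\phi\,dxdt,\qquad \int_{\mathbb T}\bar g_0\,\psi(0)\,dx+\int_0^T\!\!\int_{\mathbb T}\bar g\,\partial_t\psi\,dxdt=\int_0^T\!\!\int_{\mathbb T}J_2\,\partial_x\psi\,dxdt$$ for all $\phi,\psi\in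 C_c^\infty([0,T)\times\mathbb T)$; a global weak solution is a pair that is a weak solution on $(0,T)$ for every $T>0$. Suppose $\bar f_0,\bar g_0\in\dot A(\mathbb T)$, put $\mathcal E_0=\|\bar f_0\|_{\dot A}+\|\bar g_0\|_{\dot A}$, and assume $\mathcal E_0<\min\{\langle f_0\rangle,\langle g_0\rangle\}$ and $\min\{\Sigma_1,\Sigma_2\}>0$, where $$\begin{aligned}\Sigma_1={}&2\rho\langle f_0\rangle^3+3\langle f_0\rangle^2\langle g_0\rangle(1-\rho)-2\mu\langle g_0\rangle^3-6\langle f_0\rangle\langle g_0\rangle^2\\&-\mathcal E_0\big[(78+20\rho+14\mu)\mathcal E_0^2+\big((36\rho+84)\langle f_0\rangle+(81+30\mu+9\rho)\langle g_0\rangle\big)\mathcal E_0\big]\\&-\mathcal E_0\big[(18\mu+18)\langle g_0\rangle^2+(18\rho+18)\langle f_0\rangle^2+(12\rho+60)\langle f_0\rangle\langle g_0\rangle\big],\\ \Sigma_2={}&2\mu\langle g_0\rangle^3+6\langle f_0\rangle\langle g_0\rangle^2-2\langle f_0\rangle^3\\&-\mathcal E_0\big[(14\mu+15\rho+83)\mathcal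 E_0^2+\big((30\mu+6\rho+84)\langle g_0\rangle+(96+24\rho)\langle f_0\rangle\big)\mathcal E_0\big]\\&-\mathcal E_0\big[(18\mu+18)\langle g_0\rangle^2+(27+9\rho)\langle f_0\rangle^2+(6\rho+66)\langle f_0\rangle\langle g_0\rangle\big].\end{aligned}$$ Then there is $\varepsilon>0$, depending only on the initial heights, $\rho$, $\mu$ and $\zeta$, such that the following hold. a) (Existence) There is a global weak solution $(\bar f,\bar g)$ such that, for every $T>0$ and every $\alpha\in[0,\frac12)$, both components belong to $$L^\infty([0,T]\times\mathbb T)\cap L^{\frac{\zeta+1}{\zeta}}(0,T;W^{\zeta,\infty}(\mathbb T))\cap L^1(0,T;C^{\zeta+\alpha}(\mathbb T))\cap\mathcal M(0,T;W^{\zeta+1,\infty}(\mathbb T))\cap L^2(0,T;\dot H^{\frac{\zeta+1}2}(\mathbb T)).$$ b) (Exponential decay) This solution satisfies $\|\bar f(T)\|_{L^\infty}+\|\bar g(T)\|_{L^\infty}\le\mathcal E_0\,e^{-\varepsilon T}$ for all $T\ge0$. c) (Uniqueness) For every $T>0$, any two weak solutions on $(0,T)$ with this initial datum whose components belong to $L^\infty([0,T]\times\mathbb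 T)\cap L^1(0,T;\dot A^{\zeta+1}(\mathbb T))$ coincide almost everywhere on $(0,T)\times\mathbb T$. -/

import Mathlib

open MeasureTheory Set Filter Topology
open scoped ENNReal NNReal ContDiff

namespace ThinFilmStokes

noncomputable section

/-- The torus `[-π, π]` with its endpoints identified; `volume` has total mass `2 * π`. -/
abbrev Torus : Type := AddCircle (2 * Real.pi)

instance factTwoPiPos : Fact (0 < 2 * Real.pi) := ⟨Real.two_pi_pos⟩

/-! ### Function spaces on the torus

Each space is described by its norm, as a functional with values in `[0, ∞]` that is finite
exactly on the members of the space and depends only on the almost everywhere class. -/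

/-- The mean `⟨u⟩ = (2π)⁻¹ ∫ u`. -/
def mean (u : Torus → ℝ) : ℝ := (2 * Real.pi)⁻¹ * ∫ x, u x

/-- The zero mean part `u - ⟨u⟩`. -/
def fluct (u : Torus → ℝ) : Torus → ℝ := fun x => u x - mean u

/-- The Fourier coefficient `(2π)⁻¹ ∫ u(x) exp(-ikx) dx`. -/
def fourierC (u : Torus → ℝ) (k : ℤ) : ℂ := fourierCoeff (fun x => (u x : ℂ)) k

/-- The classical derivative of order `n` of a function on the torus. -/
def xDeriv (n : ℕ) (u : Torus → ℝ) : Torus → ℝ :=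
  fun x => iteratedDeriv n (fun y : ℝ => u (x + (y : Torus))) 0

/-- `u` is of class `C^n` on the torus. -/
def IsCn (n : ℕ∞) (u : Torus → ℝ) : Prop := ContDiff ℝ n (fun y : ℝ => u (y : Torus))

/-- `v` is the weak derivative of order `n` of `u` on the torus. -/
def IsWeakDeriv (n : ℕ) (u v : Torus → ℝ) : Prop :=
  Integrable u ∧ Integrable v ∧
    ∀ η : Torus → ℝ, IsCn ⊤ η → ∫ x, u x * xDeriv n η x = (-1) ^ n * ∫ x, v x * η x

/-- The norm `‖u‖_{L^p} + ‖∂ₓⁿ u‖_{L^p}` of `W^{n,p}`. -/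
def sobolevNorm (n : ℕ) (p : ℝ≥0∞) (u : Torus → ℝ) : ℝ≥0∞ :=
  eLpNorm u p volume + ⨅ (v : Torus → ℝ) (_ : IsWeakDeriv n u v), eLpNorm v p volume

/-- The norm of the Hölder space `C^{n+α}`, computed on the `C^n` representative of `u`. -/
def holderNorm (n : ℕ) (α : ℝ≥0) (u : Torus → ℝ) : ℝ≥0∞ :=
  ⨅ (v : Torus → ℝ) (_ : v =ᵐ[volume] u) (_ : IsCn n v),
    (∑ j ∈ Finset.range (n + 1), ⨆ x, ‖xDeriv j v x‖ₑ) + eHolderNorm α (xDeriv n v)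

open Classical in
/-- The norm `∑ |k|^s |û(k)|` of the space of zero mean functions in the Wiener space of order
`s`. -/
def wienerNorm (s : ℝ) (u : Torus → ℝ) : ℝ≥0∞ :=
  if Integrable u ∧ mean u = 0 then
    ∑' k : ℤ, ENNReal.ofReal (|(k : ℝ)| ^ s * ‖fourierC u k‖)
  else ⊤

open Classical in
/-- The norm `(∑ |k|^{2s} |û(k)|²)^{1/2}` of the space of zero mean functions in `H^s`. -/
def hNorm (s : ℝ) (u : Torus → ℝ) : ℝ≥0∞ :=
  if MemLp u 2 volume ∧ mean u = 0 then
    (∑' k : ℤ, ENNReal.ofReal (|(k : ℝ)| ^ (2 * s) * ‖fourierC u k‖ ^ 2)) ^ (1 / 2 : ℝ)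
  else ⊤

/-! ### Spaces of functions of time and space -/

/-- Lebesgue measure on `(0, T) × Torus`. -/
def spaceTime (T : ℝ) : Measure (ℝ × Torus) := (volume.restrict (Ioc 0 T)).prod volume

/-- `u ∈ L^∞([0, T] × Torus)`. -/
def MemLInf (T : ℝ) (u : ℝ → Torus → ℝ) : Prop :=
  MemLp (Function.uncurry u) ⊤ (spaceTime T)

/-- `u ∈ L^p(0, T; X)` in the sense of Bochner, where `N` is the norm of `X`: on `(0, T)`, `u` is
almost everywhere the limit in `X` of simple functions with values in `X`, and the `p`-th power of
its norm has finite integral. -/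
def MemBochner (N : (Torus → ℝ) → ℝ≥0∞) (p T : ℝ) (u : ℝ → Torus → ℝ) : Prop :=
  (∃ s : ℕ → SimpleFunc ℝ (Torus → ℝ), (∀ n t, N (s n t) < ⊤) ∧
    ∀ᵐ t ∂(volume.restrict (Ioc 0 T)), Tendsto (fun n => N (u t - s n t)) atTop (𝓝 0)) ∧
  ∫⁻ t in Ioc 0 T, N (u t) ^ p < ⊤

/-- `u ∈ 𝓜(0, T; X)`, where `N` is the norm of `X`: the set function `E ↦ ∫_E u(t) dt` is an
`X`-valued Borel measure of bounded variation on `[0, T]`. Its values lie in `X`, and countable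
additivity together with bounded variation is domination of the norm by a finite measure. -/
def MemRadon (N : (Torus → ℝ) → ℝ≥0∞) (T : ℝ) (u : ℝ → Torus → ℝ) : Prop :=
  Integrable (Function.uncurry u) (spaceTime T) ∧
  ∃ m : Measure ℝ, IsFiniteMeasure m ∧
    ∀ E : Set ℝ, MeasurableSet E → E ⊆ Icc 0 T → N (fun x => ∫ t in E, u t x) ≤ m E

/-! ### The system -/

/-- The driving mechanism of the flow. -/
inductive Flow
  | gravity
  | capillary

/-- The order of the operator `𝒟`. -/
def Flow.zeta : Flow → ℕ
  | .gravity => 1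
  | .capillary => 3

/-- `v = 𝒟 u` weakly, where `𝒟 = ∂ₓ` for gravity and `𝒟 = -∂ₓ³` for capillarity. -/
def Flow.IsD : Flow → (Torus → ℝ) → (Torus → ℝ) → Prop
  | .gravity, u, v => IsWeakDeriv 1 u v
  | .capillary, u, v => IsWeakDeriv 3 u (-v)

/-- The flux `(2ρf³ + 3f²g) 𝒟f + (2f³ + 3f²g) 𝒟g` in the equation for the lower layer, in terms of
the heights `f`, `g` and of the values `Df`, `Dg`. -/
def fluxF (ρ f g Df Dg : ℝ) : ℝ :=
  (2 * ρ * f ^ 3 + 3 * f ^ 2 * g) * Df + (2 * f ^ 3 + 3 * f ^ 2 * g) * Dg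

/-- The flux `(2μg³ + 3ρf²g + 6fg²) 𝒟f + (2μg³ + 3f²g + 6fg²) 𝒟g` in the equation for the upper
layer. -/
def fluxG (ρ μ f g Df Dg : ℝ) : ℝ :=
  (2 * μ * g ^ 3 + 3 * ρ * f ^ 2 * g + 6 * f * g ^ 2) * Df
    + (2 * μ * g ^ 3 + 3 * f ^ 2 * g + 6 * f * g ^ 2) * Dg

/-- Test functions in `C_c^∞([0, T) × Torus)`, given by smooth extensions to negative times. -/
def IsTest (T : ℝ) (φ : ℝ → Torus → ℝ) : Prop :=
  ContDiff ℝ ∞ (fun z : ℝ × ℝ => φ z.1 (z.2 : Torus)) ∧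
    ∃ T' < T, ∀ t, T' ≤ t → ∀ x, φ t x = 0

/-- `(f, g)` is a weak solution on `(0, T)` of the system for the zero mean parts of the heights,
with initial heights `f₀`, `g₀`. The heights are `⟨f₀⟩ + f` and `⟨g₀⟩ + g`, and the initial
datum of `(f, g)` is `(f₀ - ⟨f₀⟩, g₀ - ⟨g₀⟩)`. -/
def IsWeakSolution (d : Flow) (ρ μ : ℝ) (f₀ g₀ : Torus → ℝ) (T : ℝ) (f g : ℝ → Torus → ℝ) :
    Prop :=
  AEStronglyMeasurable (Function.uncurry f) (spaceTime T) ∧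
  AEStronglyMeasurable (Function.uncurry g) (spaceTime T) ∧
  MemBochner (sobolevNorm d.zeta 1) 1 T f ∧
  MemBochner (sobolevNorm d.zeta 1) 1 T g ∧
  ∃ Df Dg : ℝ → Torus → ℝ,
    Integrable (Function.uncurry Df) (spaceTime T) ∧
    Integrable (Function.uncurry Dg) (spaceTime T) ∧
    (∀ᵐ t ∂(volume.restrict (Ioc 0 T)), d.IsD (f t) (Df t) ∧ d.IsD (g t) (Dg t)) ∧
    Integrable (fun z : ℝ × Torus => fluxF ρ (mean f₀ + f z.1 z.2) (mean g₀ + g z.1 z.2)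
      (Df z.1 z.2) (Dg z.1 z.2)) (spaceTime T) ∧
    Integrable (fun z : ℝ × Torus => fluxG ρ μ (mean f₀ + f z.1 z.2) (mean g₀ + g z.1 z.2)
      (Df z.1 z.2) (Dg z.1 z.2)) (spaceTime T) ∧
    (∀ φ : ℝ → Torus → ℝ, IsTest T φ →
      (∫ x, fluct f₀ x * φ 0 x)
          + ∫ z, f z.1 z.2 * deriv (fun s => φ s z.2) z.1 ∂(spaceTime T)
        = ∫ z, fluxF ρ (mean f₀ + f z.1 z.2) (mean g₀ + g z.1 z.2) (Df z.1 z.2) (Dg z.1 z.2)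
            * xDeriv 1 (φ z.1) z.2 ∂(spaceTime T)) ∧
    (∀ ψ : ℝ → Torus → ℝ, IsTest T ψ →
      (∫ x, fluct g₀ x * ψ 0 x)
          + ∫ z, g z.1 z.2 * deriv (fun s => ψ s z.2) z.1 ∂(spaceTime T)
        = ∫ z, fluxG ρ μ (mean f₀ + f z.1 z.2) (mean g₀ + g z.1 z.2) (Df z.1 z.2) (Dg z.1 z.2)
            * xDeriv 1 (ψ z.1) z.2 ∂(spaceTime T))

/-- The regularity of each component of a solution on `(0, T)`. -/
def HasRegularity (d : Flow) (T : ℝ) (u : ℝ → Torus → ℝ) : Prop :=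
  MemLInf T u ∧
  MemBochner (sobolevNorm d.zeta ⊤) (((d.zeta : ℝ) + 1) / d.zeta) T u ∧
  (∀ α : ℝ≥0, α < 1 / 2 → MemBochner (holderNorm d.zeta α) 1 T u) ∧
  MemRadon (sobolevNorm (d.zeta + 1) ⊤) T u ∧
  MemBochner (hNorm (((d.zeta : ℝ) + 1) / 2)) 2 T u

/-- `𝓔₀`, the sum of the Wiener norms of the zero mean parts of the initial heights (a real
number when both norms are finite). -/
def energy0 (f₀ g₀ : Torus → ℝ) : ℝ :=
  (wienerNorm 0 (fluct f₀)).toReal + (wienerNorm 0 (fluct g₀)).toReal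

/-- The constant `Σ₁`, with `F`, `G` the means of the initial heights and `E = 𝓔₀`. -/
def Sigma1 (ρ μ F G E : ℝ) : ℝ :=
  2 * ρ * F ^ 3 + 3 * F ^ 2 * G * (1 - ρ) - (2 * μ * G ^ 3 + 6 * F * G ^ 2)
    - E * ((78 + 20 * ρ + 14 * μ) * E ^ 2
        + (F * (36 * ρ + 84) + (81 + 30 * μ + 9 * ρ) * G) * E)
    - E * ((18 * μ + 18) * G ^ 2 + (18 * ρ + 18) * F ^ 2 + (12 * ρ + 60) * G * F)

/-- The constant `Σ₂`, with `F`, `G` the means of the initial heights and `E = 𝓔₀`. -/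
def Sigma2 (ρ μ F G E : ℝ) : ℝ :=
  2 * μ * G ^ 3 + 6 * F * G ^ 2 - 2 * F ^ 3
    - E * ((14 * μ + 15 * ρ + 83) * E ^ 2
        + ((30 * μ + 6 * ρ + 84) * G + (96 + 24 * ρ) * F) * E)
    - E * ((18 * μ + 18) * G ^ 2 + (27 + 9 * ρ) * F ^ 2 + (6 * ρ + 66) * F * G)

end

end ThinFilmStokes

/-!
The whole argument takes place in the Wiener algebra, on the level of Fourier coefficients.

*A priori bound.* Both `∂ₓ` and `-∂ₓ³` are the multiplier `i k ^ ζ` with `ζ` odd, so that the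
linearization of the system at the means damps the mode `k` at a rate of order `|k| ^ (ζ + 1)`. In the
sum of the norms `∑ |k|^s |û(k)|` of the two components the off-diagonal linear terms and the nonlinear
terms are bounded with absolute values everywhere: the norm of order zero is submultiplicative, a
derivative that falls on a mobility costs the norm of order one, and Young's inequality for pairs of
frequencies turns the products of norms of orders one and `ζ` into products of norms of orders zero and
`ζ + 1` (`TrigPoly.nrm_mul_nrm_le`). What is left in front of the norms of order `ζ + 1` is at most
`-Σ₁` and `-Σ₂`; this comparison is an inequality between polynomials with nonnegative coefficients
(`TrigPoly.absorb_f`, `TrigPoly.absorb_g`). Hence the energy decreases at the rate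
`σ = min Σ₁ Σ₂` times the norm of order `ζ + 1` (`TrigPoly.energy_step`). As the mean of a solution is
preserved, this norm dominates the energy, which gives the exponential decay, and its time integral is
at most `𝓔₀ / σ`.

*Existence.* No theory of ordinary differential equations is needed: the system truncated to finitely
many frequencies is discretized by explicit Euler steps, so short that the damping factors stay between
zero and one, and the a priori bound holds for the iterates (`exists_euler`). The modes of these
approximations are bounded and asymptotically equicontinuous in time, so a subsequence converges at all
times in all modes (`exists_subseq_tendsto`). The bound for the norm of order `ζ + 1` controls the high
frequencies, the norms of order `ζ` converge in `L¹` in time, and the fluxes, which are linear in the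
derivatives of order `ζ`, pass to the limit (`IsCurve.tendsto_flux`, `nonempty_solution`). The regularity
of the limit follows by interpolation between the norm of order zero, bounded in time, and the norm of
order `ζ + 1`, integrable in time (`hasRegularity_rser`).

*The equation in physical space.* The derivative of the flux contains products of derivatives of the
orders one and `ζ`. Landau's inequality `‖u'‖² ≤ 8 ‖u‖ ‖u''‖` for supremum norms bounds them by the
derivative of order `ζ + 1` (`abs_fluxDiv_le`), so that the divergence of the flux is integrable in space
and time whenever the heights are bounded. The equations therefore hold in the form
`u(t, x) = u₀(x) + ∫₀ᵗ ∂ₓJ(s, x) ds` for almost all `(t, x)`. For the solution constructed above this gives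
the weak formulation (`Solution.isWeakSolution`). Conversely, every weak solution in the uniqueness class
has this form (`exists_bddCurve`).

*Uniqueness.* An arbitrary solution of the class is compared with the constructed one, whose heights
are bounded below by the means minus `𝓔₀`. For the differences `X`, `Y` of the two components consider the
energy `½ ∫ (ρ X² + 2 X Y + Y²)`. It is positive definite, because the positivity of `Σ₁` and `Σ₂` forces
`ρ > 1` (`one_lt_of_Sigma_pos`). Paired with its derivatives `ρ X + Y` and `X + Y`, the fluxes have a
symmetric mobility matrix, positive definite for positive heights (`mobility_ge`), and the production of
energy consists of a dissipation and of terms in which the mobilities are differentiated or differ. By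
Landau's inequality the latter are absorbed up to a multiple of the energy whose rate is linear in the
norms of order `ζ + 1`, thus integrable in time (`exists_integral_energyProd_le`), and Gronwall's lemma
gives uniqueness (`BddCurve.ae_eq`).
-/
open MeasureTheory Set Filter Topology
open scoped ENNReal NNReal ContDiff

namespace ThinFilmStokes

/-! ### Trigonometric polynomials and their weighted Wiener norms -/

/-- Trigonometric polynomials on the torus, as Laurent polynomials: `AddMonoidAlgebra.single k c`
stands for `c * exp (i k x)`, and multiplication is convolution of Fourier coefficients. -/
abbrev TrigPoly : Type := AddMonoidAlgebra ℂ ℤ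

namespace TrigPoly

/-- The weighted Wiener norm `∑ |k|^s |a_k|`. -/
noncomputable def nrm (s : ℕ) (a : TrigPoly) : ℝ :=
  a.coeff.sum fun k c => |(k : ℝ)| ^ s * ‖c‖

theorem nrm_eq_sum (s : ℕ) (a : TrigPoly) {S : Finset ℤ} (hS : a.coeff.support ⊆ S) :
    nrm s a = ∑ k ∈ S, |(k : ℝ)| ^ s * ‖a.coeff k‖ :=
  Finsupp.sum_of_support_subset _ hS _ (by simp)

theorem nrm_nonneg (s : ℕ) (a : TrigPoly) : 0 ≤ nrm s a :=
  Finset.sum_nonneg fun _ _ => by positivity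

theorem nrm_zero (s : ℕ) : nrm s 0 = 0 := by simp [nrm]

theorem nrm_add_le (s : ℕ) (a b : TrigPoly) : nrm s (a + b) ≤ nrm s a + nrm s b := by
  classical
  rw [nrm_eq_sum s a (Finset.subset_union_left (s₂ := b.coeff.support)),
    nrm_eq_sum s b (Finset.subset_union_right (s₁ := a.coeff.support)),
    nrm_eq_sum s (a + b) (S := a.coeff.support ∪ b.coeff.support) Finsupp.support_add,
    ← Finset.sum_add_distrib]
  refine Finset.sum_le_sum fun k _ => ?_
  rw [← mul_add]
  gcongr
  exact norm_add_le _ _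

theorem nrm_sum_le {ι : Type*} (s : ℕ) (t : Finset ι) (f : ι → TrigPoly) :
    nrm s (∑ i ∈ t, f i) ≤ ∑ i ∈ t, nrm s (f i) := by
  classical
  induction t using Finset.induction_on with
  | empty => simp [nrm_zero]
  | insert i t hi ih =>
    rw [Finset.sum_insert hi, Finset.sum_insert hi]
    exact (nrm_add_le _ _ _).trans (by gcongr)

theorem nrm_single (s : ℕ) (k : ℤ) (c : ℂ) :
    nrm s (AddMonoidAlgebra.single k c) = |(k : ℝ)| ^ s * ‖c‖ := by
  rw [nrm, AddMonoidAlgebra.coeff_single, Finsupp.sum_single_index (by simp)]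

theorem nrm_mul_le_sum (s : ℕ) (a b : TrigPoly) :
    nrm s (a * b) ≤ ∑ m ∈ a.coeff.support, ∑ n ∈ b.coeff.support,
      |((m + n : ℤ) : ℝ)| ^ s * (‖a.coeff m‖ * ‖b.coeff n‖) := by
  rw [AddMonoidAlgebra.mul_def]
  refine (nrm_sum_le s _ _).trans (Finset.sum_le_sum fun m _ => ?_)
  refine (nrm_sum_le s _ _).trans (Finset.sum_le_sum fun n _ => ?_)
  rw [nrm_single, norm_mul]

theorem nrm_zero_mul_le (a b : TrigPoly) : nrm 0 (a * b) ≤ nrm 0 a * nrm 0 b := by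
  refine (nrm_mul_le_sum 0 a b).trans (le_of_eq ?_)
  simp [nrm, Finsupp.sum, Finset.sum_mul_sum]

theorem nrm_one_mul_le (a b : TrigPoly) :
    nrm 1 (a * b) ≤ nrm 1 a * nrm 0 b + nrm 0 a * nrm 1 b := by
  refine (nrm_mul_le_sum 1 a b).trans ?_
  simp only [nrm, Finsupp.sum, Finset.sum_mul_sum, ← Finset.sum_add_distrib]
  refine Finset.sum_le_sum fun m _ => Finset.sum_le_sum fun n _ => ?_
  have : |((m + n : ℤ) : ℝ)| ≤ |(m : ℝ)| + |(n : ℝ)| := by push_cast; exact abs_add_le _ _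
  calc _ ≤ (|(m : ℝ)| + |(n : ℝ)|) * (‖a.coeff m‖ * ‖b.coeff n‖) := by
        rw [pow_one]; gcongr
    _ = _ := by ring

/-- Young's inequality for products of weighted norms. -/
theorem nrm_mul_nrm_le (z : ℕ) (hz : ∀ x y : ℝ, 0 ≤ x → 0 ≤ y →
      (z + 1) * (x * y ^ z) ≤ x ^ (z + 1) + z * y ^ (z + 1)) (a b : TrigPoly) :
    (z + 1) * (nrm 1 a * nrm z b) ≤ nrm (z + 1) a * nrm 0 b + z * (nrm 0 a * nrm (z + 1) b) := by
  simp only [nrm, Finsupp.sum, Finset.sum_mul_sum]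
  simp only [Finset.mul_sum, ← Finset.sum_add_distrib]
  refine Finset.sum_le_sum fun m _ => Finset.sum_le_sum fun n _ => ?_
  have h := mul_le_mul_of_nonneg_right (hz |(m : ℝ)| |(n : ℝ)| (abs_nonneg _) (abs_nonneg _))
    (mul_nonneg (norm_nonneg (a.coeff m)) (norm_nonneg (b.coeff n)))
  calc _ = (z + 1) * (|(m : ℝ)| * |(n : ℝ)| ^ z) * (‖a.coeff m‖ * ‖b.coeff n‖) := by ring
    _ ≤ _ := h
    _ = _ := by ring

/-- The Fourier multiplier with symbol `σ`. -/
noncomputable def mult (σ : ℤ → ℂ) (a : TrigPoly) : TrigPoly :=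
  .ofCoeff (Finsupp.onFinset a.coeff.support (fun k => σ k * a.coeff k) fun k hk => by
    rw [Finsupp.mem_support_iff]; exact right_ne_zero_of_mul hk)

@[simp] theorem coeff_mult (σ : ℤ → ℂ) (a : TrigPoly) (k : ℤ) :
    (mult σ a).coeff k = σ k * a.coeff k := rfl

theorem support_mult (σ : ℤ → ℂ) (a : TrigPoly) :
    (mult σ a).coeff.support ⊆ a.coeff.support   := by
  intro k hk
  rw [Finsupp.mem_support_iff, coeff_mult] at hk
  exact Finsupp.mem_support_iff.2 (right_ne_zero_of_mul hk)

theorem nrm_mult_eq {σ : ℤ → ℂ} {z : ℕ} (hσ : ∀ k, ‖σ k‖ = |(k : ℝ)| ^ z) (s : ℕ) (a : TrigPoly) :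
    nrm s (mult σ a) = nrm (s + z) a := by
  rw [nrm_eq_sum s _ (support_mult σ a), nrm_eq_sum (s + z) a le_rfl]
  refine Finset.sum_congr rfl fun k _ => ?_
  rw [coeff_mult, norm_mul, hσ]; ring

theorem nrm_mono_zero {a : TrigPoly} (ha : a.coeff 0 = 0) (s : ℕ) : nrm 0 a ≤ nrm s a := by
  refine Finset.sum_le_sum fun k hk => ?_
  have hk0 : k ≠ 0 := by rintro rfl; simp [ha] at hk
  have : (1 : ℝ) ≤ |(k : ℝ)| := by exact_mod_cast Int.one_le_abs hk0
  refine mul_le_mul_of_nonneg_right ?_ (norm_nonneg _)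
  simpa using one_le_pow₀ this

/-- Constants as trigonometric polynomials. -/
noncomputable def const : ℝ →+* TrigPoly := (algebraMap ℂ TrigPoly).comp Complex.ofRealHom

theorem const_eq (r : ℝ) : const r = AddMonoidAlgebra.single 0 (r : ℂ) := by
  simp [const]

/-- `p` and `q` bound the norms of orders zero and one of `m`. These bounds propagate through
polynomial expressions as the values and the directional derivatives of the expression. -/
def Maj (m : TrigPoly) (p q : ℝ) : Prop := nrm 0 m ≤ p ∧ nrm 1 m ≤ q

theorem Maj.self (a : TrigPoly) : Maj a (nrm 0 a) (nrm 1 a) := ⟨le_rfl, le_rfl⟩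

theorem Maj.const {r : ℝ} (hr : 0 ≤ r) : Maj (const r) r 0 := by
  constructor <;> rw [const_eq, nrm_single] <;> simp [abs_of_nonneg hr]

theorem Maj.add {m n : TrigPoly} {p q p' q' : ℝ} (h : Maj m p q) (h' : Maj n p' q') :
    Maj (m + n) (p + p') (q + q') :=
  ⟨(nrm_add_le _ _ _).trans (add_le_add h.1 h'.1), (nrm_add_le _ _ _).trans (add_le_add h.2 h'.2)⟩

theorem Maj.mul {m n : TrigPoly} {p q p' q' : ℝ} (h : Maj m p q) (h' : Maj n p' q') :
    Maj (m * n) (p * p') (q * p' + p * q') := by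
  have h0 := nrm_nonneg 0 m
  have h1 := nrm_nonneg 1 m
  have h2 := nrm_nonneg 0 n
  have h3 := nrm_nonneg 1 n
  refine ⟨(nrm_zero_mul_le _ _).trans ?_, (nrm_one_mul_le _ _).trans ?_⟩
  · exact mul_le_mul h.1 h'.1 h2 (h0.trans h.1)
  · exact add_le_add (mul_le_mul h.2 h'.1 h2 (h1.trans h.2)) (mul_le_mul h.1 h'.2 h3 (h0.trans h.1))

theorem Maj.congr {m : TrigPoly} {p q p' q' : ℝ} (h : Maj m p q) (hp : p = p') (hq : q = q') :
    Maj m p' q' := hp ▸ hq ▸ h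

end TrigPoly

/-! ### The fluxes as cubic forms and the explicit Euler scheme -/

/-- The cubic form `c₁ A³ + c₂ A² B + c₃ A B² + c₄ B³`, the shape of all mobilities. -/
def cubic {R : Type*} [Semiring R] (c₁ c₂ c₃ c₄ A B : R) : R :=
  c₁ * A ^ 3 + c₂ * (A ^ 2 * B) + c₃ * (A * B ^ 2) + c₄ * B ^ 3

namespace TrigPoly

/-- The operator `𝒟`: both `∂ₓ` and `-∂ₓ³` have the symbol `i k ^ ζ`. -/
noncomputable def opD (z : ℕ) : TrigPoly → TrigPoly := mult fun k => Complex.I * (k : ℂ) ^ z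

theorem nrm_opD (z s : ℕ) (a : TrigPoly) : nrm s (opD z a) = nrm (s + z) a :=
  nrm_mult_eq (fun k => by simp) s a

/-- The increment of a cubic form is majorized by the increment of the same form at the norms. -/
theorem Maj.cubic {c₁ c₂ c₃ c₄ F G : ℝ} (h₁ : 0 ≤ c₁) (h₂ : 0 ≤ c₂) (h₃ : 0 ≤ c₃) (h₄ : 0 ≤ c₄)
    (hF : 0 ≤ F) (hG : 0 ≤ G) (a b : TrigPoly) :
    Maj (cubic (TrigPoly.const c₁) (TrigPoly.const c₂) (TrigPoly.const c₃) (TrigPoly.const c₄)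
          (TrigPoly.const F + a) (TrigPoly.const G + b) -
          TrigPoly.const (cubic c₁ c₂ c₃ c₄ F G))
      (cubic c₁ c₂ c₃ c₄ (F + nrm 0 a) (G + nrm 0 b) - cubic c₁ c₂ c₃ c₄ F G)
      ((3 * c₁ * (F + nrm 0 a) ^ 2 + 2 * c₂ * (F + nrm 0 a) * (G + nrm 0 b)
          + c₃ * (G + nrm 0 b) ^ 2) * nrm 1 a
        + (c₂ * (F + nrm 0 a) ^ 2 + 2 * c₃ * (F + nrm 0 a) * (G + nrm 0 b)
          + 3 * c₄ * (G + nrm 0 b) ^ 2) * nrm 1 b) := by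
  have ha := Maj.self a
  have hb := Maj.self b
  have hA := (Maj.const hF).add ha
  have hB := (Maj.const hG).add hb
  have k1 := Maj.const h₁
  have k2 := Maj.const h₂
  have k3 := Maj.const h₃
  have k4 := Maj.const h₄
  have kF := Maj.const hF
  have kG := Maj.const hG
  -- increments of the powers, written without subtractions
  have hA2 := (hA.add kF).mul ha
  have hB2 := (hB.add kG).mul hb
  have hA3 := ((hA.mul hA).add ((hA.mul kF).add (kF.mul kF))).mul ha
  have hB3 := ((hB.mul hB).add ((hB.mul kG).add (kG.mul kG))).mul hb
  have hAB := (hA2.mul hB).add ((kF.mul kF).mul hb)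
  have hBA := (ha.mul (hB.mul hB)).add (kF.mul hB2)
  have key := (((k1.mul hA3).add (k2.mul hAB)).add (k3.mul hBA)).add (k4.mul hB3)
  have e : ∀ x y : TrigPoly, x = y → ∀ p q, Maj x p q → Maj y p q := by rintro x _ rfl p q h; exact h
  refine (e _ _ ?_ _ _ key).congr ?_ ?_
  · simp only [ThinFilmStokes.cubic, map_add, map_mul, map_pow]; ring
  · simp only [ThinFilmStokes.cubic]; ring
  · ring

/-- The increment produced by one explicit Euler step of size `h` for `∂ₜ a = ∂ₓ J`, truncated to
the frequencies `|k| ≤ N`. -/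
noncomputable def eulerStep (N : ℕ) (h : ℝ) (a J : TrigPoly) : TrigPoly :=
  a + mult (fun k => if |k| ≤ N then (h : ℂ) * (Complex.I * k) else 0) J

theorem coeff_eulerStep (N : ℕ) (h : ℝ) (a J : TrigPoly) (k : ℤ) :
    (eulerStep N h a J).coeff k =
      a.coeff k + (if |k| ≤ N then (h : ℂ) * (Complex.I * k) else 0) * J.coeff k := rfl

/-- The frequencies of `a` lie in `[-N, N]`. -/
def Trunc (N : ℕ) (a : TrigPoly) : Prop := ∀ k : ℤ, (N : ℤ) < |k| → a.coeff k = 0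

theorem Trunc.support {N : ℕ} {a : TrigPoly} (h : Trunc N a) :
    a.coeff.support ⊆ Finset.Icc (-(N : ℤ)) N := by
  intro k hk
  rw [Finset.mem_Icc, ← abs_le]
  by_contra hc
  exact (Finsupp.mem_support_iff.1 hk) (h k (not_le.1 hc))

theorem Trunc.eulerStep {N : ℕ} {a : TrigPoly} (ha : Trunc N a) (h : ℝ) (J : TrigPoly) :
    Trunc N (eulerStep N h a J) := by
  intro k hk
  rw [coeff_eulerStep, ha k hk, if_neg (not_le.2 hk)]; simp

/-- One Euler step contracts the norm of order zero by the diagonal part of the principal term; the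
step size has to be small against the highest frequency. -/
theorem nrm_eulerStep_le {N z : ℕ} {h α β : ℝ} (hh : 0 ≤ h) (hβ : 0 ≤ β)
    (hz : Odd z) (hN : h * α * (N : ℝ) ^ (z + 1) ≤ 1) (hα : 0 ≤ α)
    {a b : TrigPoly} (ha : Trunc N a) (hb : Trunc N b) (R : TrigPoly) :
    nrm 0 (eulerStep N h a (const α * opD z a + const β * opD z b + R)) ≤
      nrm 0 a - h * α * nrm (z + 1) a + h * β * nrm (z + 1) b + h * nrm 1 R := by
  classical
  have hR : (∑ k ∈ Finset.Icc (-(N : ℤ)) N, |(k : ℝ)| ^ 1 * ‖R.coeff k‖) ≤ nrm 1 R := by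
    rw [nrm_eq_sum 1 R (Finset.subset_union_right (s₁ := Finset.Icc (-(N : ℤ)) N))]
    exact Finset.sum_le_sum_of_subset_of_nonneg Finset.subset_union_left
      fun _ _ _ => by positivity
  refine le_trans ?_ (add_le_add_right (mul_le_mul_of_nonneg_left hR hh) _)
  rw [nrm_eq_sum 0 _ (ha.eulerStep h _).support, nrm_eq_sum 0 a ha.support,
    nrm_eq_sum (z + 1) a ha.support, nrm_eq_sum (z + 1) b hb.support, Finset.mul_sum,
    Finset.mul_sum, Finset.mul_sum, ← Finset.sum_sub_distrib, ← Finset.sum_add_distrib,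
    ← Finset.sum_add_distrib]
  refine Finset.sum_le_sum fun k hk => ?_
  rw [Finset.mem_Icc, ← abs_le] at hk
  have hkN : |(k : ℝ)| ≤ N := by exact_mod_cast hk
  -- the step size is so small that the diagonal factor `1 - h α |k| ^ (z + 1)` stays nonnegative
  have hk1 : h * α * |(k : ℝ)| ^ (z + 1) ≤ 1 :=
    le_trans (mul_le_mul_of_nonneg_left (pow_le_pow_left₀ (abs_nonneg _) hkN _)
      (mul_nonneg hh hα)) hN
  have hev : (k : ℝ) ^ (z + 1) = |(k : ℝ)| ^ (z + 1) := ((hz.add_one).pow_abs _).symm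
  have hc : (const α * opD z a + const β * opD z b + R).coeff k =
      (α : ℂ) * (Complex.I * (k : ℂ) ^ z * a.coeff k) +
        (β : ℂ) * (Complex.I * (k : ℂ) ^ z * b.coeff k) + R.coeff k := by
    rw [AddMonoidAlgebra.coeff_add, AddMonoidAlgebra.coeff_add, const_eq, const_eq,
      Finsupp.add_apply, Finsupp.add_apply,
      AddMonoidAlgebra.coeff_single_zero_mul, AddMonoidAlgebra.coeff_single_zero_mul]
    rfl
  have e : (eulerStep N h a (const α * opD z a + const β * opD z b + R)).coeff k =
      ((1 - h * α * |(k : ℝ)| ^ (z + 1) : ℝ) : ℂ) * a.coeff k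
        + ((-(h * β * |(k : ℝ)| ^ (z + 1)) : ℝ) : ℂ) * b.coeff k
        + (h : ℂ) * (Complex.I * k) * R.coeff k := by
    rw [coeff_eulerStep, if_pos hk, hc, ← hev]
    push_cast
    linear_combination (h * k ^ (z + 1) * (α * a.coeff k + β * b.coeff k) : ℂ) * Complex.I_sq
  rw [e, pow_zero, one_mul]
  refine norm_add₃_le.trans (le_of_eq ?_)
  rw [norm_mul, norm_mul, norm_mul, norm_mul, norm_mul, Complex.norm_real, Complex.norm_real,
    Complex.norm_real, Complex.norm_I, Complex.norm_intCast, Real.norm_of_nonneg hh,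
    Real.norm_of_nonneg (by linarith), Real.norm_eq_abs, abs_neg,
    abs_of_nonneg (a := h * β * |(k : ℝ)| ^ (z + 1)) (by positivity)]
  ring


/-- The flux of the lower layer at the heights `F + a`, `G + b`. -/
noncomputable def polyFluxF (z : ℕ) (ρ F G : ℝ) (a b : TrigPoly) : TrigPoly :=
  cubic (const (2 * ρ)) (const 3) (const 0) (const 0) (const F + a) (const G + b) * opD z a +
    cubic (const 2) (const 3) (const 0) (const 0) (const F + a) (const G + b) * opD z b

/-- The flux of the upper layer at the heights `F + a`, `G + b`. -/
noncomputable def polyFluxG (z : ℕ) (ρ μ F G : ℝ) (a b : TrigPoly) : TrigPoly :=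
  cubic (const 0) (const (3 * ρ)) (const 6) (const (2 * μ)) (const F + a) (const G + b) * opD z a +
    cubic (const 0) (const 3) (const 6) (const (2 * μ)) (const F + a) (const G + b) * opD z b

/-- The norm of order one of a product `m 𝒟 v` decides the size of `∂ₓ (m 𝒟 v)`. -/
theorem nrm_one_mul_opD_le {z : ℕ} {m v : TrigPoly} {p q : ℝ} (h : Maj m p q) :
    nrm 1 (m * opD z v) ≤ q * nrm z v + p * nrm (z + 1) v := by
  refine (nrm_one_mul_le _ _).trans ?_
  rw [nrm_opD, nrm_opD, zero_add, add_comm 1 z]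
  exact add_le_add (mul_le_mul_of_nonneg_right h.2 (nrm_nonneg _ _))
    (mul_le_mul_of_nonneg_right h.1 (nrm_nonneg _ _))

/-- The instance of Young's inequality behind the interpolation of `‖a‖₁ ‖b‖_z` between the norms of
orders zero and `z + 1`. -/
theorem young_pow {z : ℕ} (hz : z = 1 ∨ z = 3) (x y : ℝ) :
    (z + 1) * (x * y ^ z) ≤ x ^ (z + 1) + z * y ^ (z + 1) := by
  rcases hz with rfl | rfl
  · have : x ^ 2 + 1 * y ^ 2 - (1 + 1) * (x * y ^ 1) = (x - y) ^ 2 := by ring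
    push_cast
    linarith [sq_nonneg (x - y)]
  · have : x ^ 4 + 3 * y ^ 4 - (3 + 1) * (x * y ^ 3) = (x - y) ^ 2 * ((x + y) ^ 2 + 2 * y ^ 2) := by
      ring
    have h : 0 ≤ (x - y) ^ 2 * ((x + y) ^ 2 + 2 * y ^ 2) := by positivity
    push_cast
    linarith

/-- The nonlinear contributions to the coefficient of the top norm of the lower layer are absorbed
by the part of `Σ₁` that carries a factor `E`. -/
theorem absorb_f {z ρ μ F G x y E : ℝ} (hz : z = 1 ∨ z = 3) (hρ : 0 < ρ) (hμ : 0 < μ)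
    (hF : 0 < F) (hG : 0 < G) (hx : 0 ≤ x) (hy : 0 ≤ y) (hE : x + y ≤ E) :
    (z + 1) * (cubic (2 * ρ) (3 + 3 * ρ) 6 (2 * μ) (F + x) (G + y)
        - cubic (2 * ρ) (3 + 3 * ρ) 6 (2 * μ) F G)
      + (6 * ρ * (F + x) ^ 2 + 2 * (3 + 3 * ρ) * (F + x) * (G + y) + 6 * (G + y) ^ 2) *
          ((z + 1) * x)
      + ((3 + 3 * ρ) * (F + x) ^ 2 + 12 * (F + x) * (G + y) + 6 * μ * (G + y) ^ 2) * (z * y)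
      + (6 * (F + x) ^ 2 + 12 * (F + x) * (G + y) + 6 * (G + y) ^ 2) * y ≤
    (z + 1) * ((2 * ρ * F ^ 3 + 3 * F ^ 2 * G) - (2 * μ * G ^ 3 + 3 * ρ * (F ^ 2 * G)
      + 6 * (F * G ^ 2)) - Sigma1 ρ μ F G E) := by
  -- in terms of the excess `e` of `E` over `x + y` all coefficients of the difference are nonnegative
  obtain ⟨e, rfl⟩ : ∃ e, E = x + y + e := ⟨E - (x + y), by ring⟩
  have he : 0 ≤ e := by linarith
  unfold cubic Sigma1
  rcases hz with rfl | rfl <;>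
  · rw [← sub_nonneg]
    ring_nf
    positivity

/-- The nonlinear contributions to the coefficient of the top norm of the upper layer are absorbed
by the part of `Σ₂` that carries a factor `E`. -/
theorem absorb_g {z ρ μ F G x y E : ℝ} (hz : z = 1 ∨ z = 3) (hρ : 0 < ρ) (hμ : 0 < μ)
    (hF : 0 < F) (hG : 0 < G) (hx : 0 ≤ x) (hy : 0 ≤ y) (hE : x + y ≤ E) :
    (z + 1) * (cubic 2 6 6 (2 * μ) (F + x) (G + y) - cubic 2 6 6 (2 * μ) F G)
      + (6 * (F + x) ^ 2 + 12 * (F + x) * (G + y) + 6 * μ * (G + y) ^ 2) * ((z + 1) * y)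
      + (6 * (F + x) ^ 2 + 12 * (F + x) * (G + y) + 6 * (G + y) ^ 2) * (z * x)
      + ((3 + 3 * ρ) * (F + x) ^ 2 + 12 * (F + x) * (G + y) + 6 * μ * (G + y) ^ 2) * x ≤
    (z + 1) * ((2 * μ * G ^ 3 + 3 * (F ^ 2 * G) + 6 * (F * G ^ 2)) - (2 * F ^ 3 + 3 * (F ^ 2 * G))
      - Sigma2 ρ μ F G E) := by
  -- in terms of the excess `e` of `E` over `x + y` all coefficients of the difference are nonnegative
  obtain ⟨e, rfl⟩ : ∃ e, E = x + y + e := ⟨E - (x + y), by ring⟩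
  have he : 0 ≤ e := by linarith
  unfold cubic Sigma2
  rcases hz with rfl | rfl <;>
  · rw [← sub_nonneg]
    ring_nf
    positivity


/-- The coercivity estimate behind the a priori bound: one Euler step decreases the energy by the
step size times `σ ≤ min {Σ₁, Σ₂}` times the norm of order `ζ + 1`. -/
theorem energy_step {N z : ℕ} {ρ μ F G E σ h : ℝ} (hz : z = 1 ∨ z = 3) (hρ : 0 < ρ) (hμ : 0 < μ)
    (hF : 0 < F) (hG : 0 < G) {a b : TrigPoly} (ha : Trunc N a) (hb : Trunc N b)
    (hE : nrm 0 a + nrm 0 b ≤ E) (hσ₁ : σ ≤ Sigma1 ρ μ F G E) (hσ₂ : σ ≤ Sigma2 ρ μ F G E)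
    (hh : 0 ≤ h) (hN₁ : h * (2 * ρ * F ^ 3 + 3 * F ^ 2 * G) * (N : ℝ) ^ (z + 1) ≤ 1)
    (hN₂ : h * (2 * μ * G ^ 3 + 3 * (F ^ 2 * G) + 6 * (F * G ^ 2)) * (N : ℝ) ^ (z + 1) ≤ 1) :
    nrm 0 (eulerStep N h a (polyFluxF z ρ F G a b)) +
        nrm 0 (eulerStep N h b (polyFluxG z ρ μ F G a b)) ≤
      nrm 0 a + nrm 0 b - h * σ * (nrm (z + 1) a + nrm (z + 1) b) := by
  have hodd : Odd z := by rcases hz with rfl | rfl <;> decide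
  have hx := nrm_nonneg 0 a
  have hy := nrm_nonneg 0 b
  have hX := nrm_nonneg (z + 1) a
  have hY := nrm_nonneg (z + 1) b
  -- the deviations of the mobilities from their values at the means
  have m11 := Maj.cubic (c₁ := 2 * ρ) (c₂ := 3) (c₃ := 0) (c₄ := 0) (by positivity) (by norm_num)
    le_rfl le_rfl hF.le hG.le a b
  have m12 := Maj.cubic (c₁ := 2) (c₂ := 3) (c₃ := 0) (c₄ := 0) (by norm_num) (by norm_num)
    le_rfl le_rfl hF.le hG.le a b
  have m21 := Maj.cubic (c₁ := 0) (c₂ := 3 * ρ) (c₃ := 6) (c₄ := 2 * μ) le_rfl (by positivity)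
    (by norm_num) (by positivity) hF.le hG.le a b
  have m22 := Maj.cubic (c₁ := 0) (c₂ := 3) (c₃ := 6) (c₄ := 2 * μ) le_rfl (by norm_num)
    (by norm_num) (by positivity) hF.le hG.le a b
  have r11 := nrm_one_mul_opD_le (z := z) (v := a) m11
  have r12 := nrm_one_mul_opD_le (z := z) (v := b) m12
  have r21 := nrm_one_mul_opD_le (z := z) (v := a) m21
  have r22 := nrm_one_mul_opD_le (z := z) (v := b) m22
  -- the fluxes as linearization at the means plus quadratic remainder
  have e1 : polyFluxF z ρ F G a b =
      const (2 * ρ * F ^ 3 + 3 * F ^ 2 * G) * opD z a + const (2 * F ^ 3 + 3 * (F ^ 2 * G)) * opD z b +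
      ((cubic (const (2 * ρ)) (const 3) (const 0) (const 0) (const F + a) (const G + b) -
          const (cubic (2 * ρ) 3 0 0 F G)) * opD z a +
        (cubic (const 2) (const 3) (const 0) (const 0) (const F + a) (const G + b) -
          const (cubic 2 3 0 0 F G)) * opD z b) := by
    simp only [polyFluxF, cubic, map_add, map_mul, map_pow, map_zero]; ring
  have e2 : polyFluxG z ρ μ F G a b =
      const (2 * μ * G ^ 3 + 3 * (F ^ 2 * G) + 6 * (F * G ^ 2)) * opD z b +
        const (2 * μ * G ^ 3 + 3 * ρ * (F ^ 2 * G) + 6 * (F * G ^ 2)) * opD z a +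
      ((cubic (const 0) (const (3 * ρ)) (const 6) (const (2 * μ)) (const F + a) (const G + b) -
          const (cubic 0 (3 * ρ) 6 (2 * μ) F G)) * opD z a +
        (cubic (const 0) (const 3) (const 6) (const (2 * μ)) (const F + a) (const G + b) -
          const (cubic 0 3 6 (2 * μ) F G)) * opD z b) := by
    simp only [polyFluxG, cubic, map_add, map_mul, map_pow, map_zero]; ring
  have s1 := nrm_eulerStep_le hh (β := 2 * F ^ 3 + 3 * (F ^ 2 * G)) (by positivity) hodd hN₁
    (by positivity) ha hb
    ((cubic (const (2 * ρ)) (const 3) (const 0) (const 0) (const F + a) (const G + b) -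
          const (cubic (2 * ρ) 3 0 0 F G)) * opD z a +
        (cubic (const 2) (const 3) (const 0) (const 0) (const F + a) (const G + b) -
          const (cubic 2 3 0 0 F G)) * opD z b)
  have s2 := nrm_eulerStep_le hh (β := 2 * μ * G ^ 3 + 3 * ρ * (F ^ 2 * G) + 6 * (F * G ^ 2))
    (by positivity) hodd hN₂ (by positivity) hb ha
    ((cubic (const 0) (const (3 * ρ)) (const 6) (const (2 * μ)) (const F + a) (const G + b) -
          const (cubic 0 (3 * ρ) 6 (2 * μ) F G)) * opD z a +
        (cubic (const 0) (const 3) (const 6) (const (2 * μ)) (const F + a) (const G + b) -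
          const (cubic 0 3 6 (2 * μ) F G)) * opD z b)
  rw [← e1] at s1
  rw [← e2] at s2
  have t1 := (nrm_add_le 1 _ _).trans (add_le_add r11 r12)
  have t2 := (nrm_add_le 1 _ _).trans (add_le_add r21 r22)
  clear e1 e2 m11 m12 m21 m22 r11 r12 r21 r22
  -- interpolation of the products `‖·‖₁ ‖·‖_z` between the norms of orders zero and `z + 1`
  have y11 := nrm_mul_nrm_le z (fun x y _ _ => young_pow hz x y) a a
  have y12 := nrm_mul_nrm_le z (fun x y _ _ => young_pow hz x y) a b
  have y21 := nrm_mul_nrm_le z (fun x y _ _ => young_pow hz x y) b a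
  have y22 := nrm_mul_nrm_le z (fun x y _ _ => young_pow hz x y) b b
  have hz' : (z : ℝ) = 1 ∨ (z : ℝ) = 3 := by rcases hz with rfl | rfl <;> simp
  have b1 := mul_le_mul_of_nonneg_right (absorb_f hz' hρ hμ hF hG hx hy hE) hX
  have b2 := mul_le_mul_of_nonneg_right (absorb_g hz' hρ hμ hF hG hx hy hE) hY
  have hz0 : (0 : ℝ) < z + 1 := by positivity
  -- what remains is arithmetic in the norms
  generalize nrm 0 a = x at *
  generalize nrm 0 b = y at *
  generalize nrm (z + 1) a = X at *
  generalize nrm (z + 1) b = Y at *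
  generalize nrm 1 a = x1 at *
  generalize nrm 1 b = y1 at *
  generalize nrm z a = xz at *
  generalize nrm z b = yz at *
  have hFx : 0 < F + x := by linarith
  have hGy : 0 < G + y := by linarith
  have w11 := mul_le_mul_of_nonneg_left y11 (a := 6 * ρ * (F + x) ^ 2 +
    2 * (3 + 3 * ρ) * (F + x) * (G + y) + 6 * (G + y) ^ 2) (by positivity)
  have w21 := mul_le_mul_of_nonneg_left y21 (a := (3 + 3 * ρ) * (F + x) ^ 2 +
    12 * (F + x) * (G + y) + 6 * μ * (G + y) ^ 2) (by positivity)
  have w12 := mul_le_mul_of_nonneg_left y12 (a := 6 * (F + x) ^ 2 +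
    12 * (F + x) * (G + y) + 6 * (G + y) ^ 2) (by positivity)
  have w22 := mul_le_mul_of_nonneg_left y22 (a := 6 * (F + x) ^ 2 +
    12 * (F + x) * (G + y) + 6 * μ * (G + y) ^ 2) (by positivity)
  have v1 := mul_le_mul_of_nonneg_right hσ₁ (mul_nonneg hz0.le hX)
  have v2 := mul_le_mul_of_nonneg_right hσ₂ (mul_nonneg hz0.le hY)
  generalize nrm 1 (_ * opD z a + _ * opD z b) = R₁ at s1 t1
  generalize nrm 1 (_ * opD z a + _ * opD z b) = R₂ at s2 t2
  have t := mul_le_mul_of_nonneg_left (add_le_add t1 t2) hz0.le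
  have key : R₁ + R₂ ≤ ((2 * ρ * F ^ 3 + 3 * F ^ 2 * G) -
        (2 * μ * G ^ 3 + 3 * ρ * (F ^ 2 * G) + 6 * (F * G ^ 2)) - σ) * X +
      ((2 * μ * G ^ 3 + 3 * (F ^ 2 * G) + 6 * (F * G ^ 2)) -
        (2 * F ^ 3 + 3 * (F ^ 2 * G)) - σ) * Y := by
    refine le_of_mul_le_mul_left (t.trans ?_) hz0
    unfold cubic at *
    linarith
  have key' := mul_le_mul_of_nonneg_left key hh
  linarith

end TrigPoly

/-! ### Fourier series with summable weighted coefficients -/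

/-- The weighted Wiener norm `∑ |k|^s |c_k|` of a family of coefficients. -/
noncomputable def wn (s : ℕ) (c : ℤ → ℂ) : ℝ≥0∞ :=
  ∑' k : ℤ, ENNReal.ofReal (|(k : ℝ)| ^ s * ‖c k‖)

/-- The Fourier series with coefficients `c`. -/
noncomputable def ser (c : ℤ → ℂ) (x : Torus) : ℂ := ∑' k, c k * fourier k x

/-- The real part of the Fourier series with coefficients `c`. -/
noncomputable def rser (c : ℤ → ℂ) (x : Torus) : ℝ := (ser c x).re

/-- The coefficients of the `j`-th derivative. -/
noncomputable def dcoef (j : ℕ) (c : ℤ → ℂ) : ℤ → ℂ := fun k => (Complex.I * k) ^ j * c k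

/-- The coefficients of the series with coefficients `c` with `𝒟` applied. -/
noncomputable def Dcoef (z : ℕ) (c : ℤ → ℂ) : ℤ → ℂ := fun k => Complex.I * (k : ℂ) ^ z * c k

/-- The symmetry of the Fourier coefficients of real functions. -/
def Sym (c : ℤ → ℂ) : Prop := ∀ k, c (-k) = (starRingEnd ℂ) (c k)

theorem norm_fourier_apply (k : ℤ) (x : Torus) : ‖(fourier k x : ℂ)‖ = 1 := by
  rw [fourier_apply, Circle.norm_coe]

theorem wn_zero (c : ℤ → ℂ) : wn 0 c = ∑' k, ‖c k‖ₑ := by simp [wn]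

theorem summable_of_wn {s : ℕ} {c : ℤ → ℂ} (h : wn s c ≠ ⊤) :
    Summable fun k : ℤ => |(k : ℝ)| ^ s * ‖c k‖ := by
  have := ENNReal.summable_toReal h
  refine this.congr fun k => ENNReal.toReal_ofReal (by positivity)

theorem wn_eq_ofReal {s : ℕ} {c : ℤ → ℂ} (h : Summable fun k : ℤ => |(k : ℝ)| ^ s * ‖c k‖) :
    wn s c = ENNReal.ofReal (∑' k : ℤ, |(k : ℝ)| ^ s * ‖c k‖) :=
  (ENNReal.ofReal_tsum_of_nonneg (fun k => by positivity) h).symm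

theorem summable_norm_of_wn {c : ℤ → ℂ} (h : wn 0 c ≠ ⊤) : Summable fun k => ‖c k‖ := by
  simpa using summable_of_wn h

theorem wn_mono {s s' : ℕ} (hs : s ≤ s') {c : ℤ → ℂ} (h0 : c 0 = 0) : wn s c ≤ wn s' c := by
  refine ENNReal.tsum_le_tsum fun k => ENNReal.ofReal_le_ofReal ?_
  rcases eq_or_ne k 0 with rfl | hk
  · simp [h0]
  · have : (1 : ℝ) ≤ |(k : ℝ)| := by exact_mod_cast Int.one_le_abs hk
    gcongr

theorem wn_ne_top_mono {s s' : ℕ} (hs : s ≤ s') {c : ℤ → ℂ} (h0 : c 0 = 0) (h : wn s' c ≠ ⊤) :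
    wn s c ≠ ⊤ := ne_top_of_le_ne_top h (wn_mono hs h0)

theorem wn_dcoef (s j : ℕ) (c : ℤ → ℂ) : wn s (dcoef j c) = wn (s + j) c := by
  refine tsum_congr fun k => ?_
  congr 1
  simp [dcoef, pow_add, mul_assoc]

theorem wn_Dcoef (s z : ℕ) (c : ℤ → ℂ) : wn s (Dcoef z c) = wn (s + z) c := by
  refine tsum_congr fun k => ?_
  congr 1
  simp [Dcoef, pow_add, mul_assoc]

theorem dcoef_zero_apply {j : ℕ} {c : ℤ → ℂ} (h0 : c 0 = 0) : dcoef j c 0 = 0 := by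
  simp [dcoef, h0]

theorem dcoef_dcoef (i j : ℕ) (c : ℤ → ℂ) : dcoef i (dcoef j c) = dcoef (i + j) c := by
  ext k; simp only [dcoef]; ring

theorem dcoef_zero (c : ℤ → ℂ) : dcoef 0 c = c := by ext k; simp [dcoef]

theorem Sym.Dcoef {c : ℤ → ℂ} (h : Sym c) {z : ℕ} (hz : Odd z) : Sym (Dcoef z c) := by
  intro k
  simp [ThinFilmStokes.Dcoef, h k, hz.neg_pow]

theorem wn_add_le (s : ℕ) (c d : ℤ → ℂ) : wn s (c + d) ≤ wn s c + wn s d := by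
  rw [wn, wn, wn, ← ENNReal.tsum_add]
  refine ENNReal.tsum_le_tsum fun k => ?_
  rw [← ENNReal.ofReal_add (by positivity) (by positivity), ← mul_add]
  gcongr
  exact norm_add_le _ _

theorem wn_sub_le (s : ℕ) (c d : ℤ → ℂ) : wn s (c - d) ≤ wn s c + wn s d := by
  rw [wn, wn, wn, ← ENNReal.tsum_add]
  refine ENNReal.tsum_le_tsum fun k => ?_
  rw [← ENNReal.ofReal_add (by positivity) (by positivity), ← mul_add]
  gcongr
  exact norm_sub_le _ _

theorem summable_ser {c : ℤ → ℂ} (h : wn 0 c ≠ ⊤) (x : Torus) :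
    Summable fun k => c k * fourier k x :=
  .of_norm ((summable_norm_of_wn h).congr fun k => by rw [norm_mul, norm_fourier_apply, mul_one])

theorem ser_sub {c d : ℤ → ℂ} (hc : wn 0 c ≠ ⊤) (hd : wn 0 d ≠ ⊤) (x : Torus) :
    ser (c - d) x = ser c x - ser d x := by
  rw [ser, ser, ser, ← (summable_ser hc x).tsum_sub (summable_ser hd x)]
  exact tsum_congr fun k => by simp only [Pi.sub_apply]; ring

theorem rser_sub {c d : ℤ → ℂ} (hc : wn 0 c ≠ ⊤) (hd : wn 0 d ≠ ⊤) (x : Torus) :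
    rser (c - d) x = rser c x - rser d x := by
  rw [rser, ser_sub hc hd, Complex.sub_re, rser, rser]

theorem enorm_ser_le (c : ℤ → ℂ) (x : Torus) : ‖ser c x‖ₑ ≤ wn 0 c := by
  by_cases h : wn 0 c = ⊤
  · simp [h]
  refine (enorm_tsum_le_tsum_enorm ).trans (le_of_eq ?_)
  rw [wn_zero]
  refine tsum_congr fun k => ?_
  rw [enorm_mul, ← ofReal_norm (fourier k x), norm_fourier_apply]; simp

theorem enorm_rser_le (c : ℤ → ℂ) (x : Torus) : ‖rser c x‖ₑ ≤ wn 0 c := by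
  refine le_trans ?_ (enorm_ser_le c x)
  rw [← ofReal_norm, ← ofReal_norm]
  exact ENNReal.ofReal_le_ofReal (Complex.abs_re_le_norm _)

theorem abs_rser_le {c : ℤ → ℂ} (h : wn 0 c ≠ ⊤) (x : Torus) : |rser c x| ≤ (wn 0 c).toReal := by
  have := ENNReal.toReal_mono h (enorm_rser_le c x)
  simpa using this

theorem continuous_ser {c : ℤ → ℂ} (h : wn 0 c ≠ ⊤) : Continuous (ser c) :=
  continuous_tsum (fun k => continuous_const.mul (fourier k).continuous) (summable_norm_of_wn h)
    fun k x => by rw [norm_mul, norm_fourier_apply, mul_one]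

theorem continuous_rser {c : ℤ → ℂ} (h : wn 0 c ≠ ⊤) : Continuous (rser c) :=
  Complex.continuous_re.comp (continuous_ser h)

theorem hasDerivAt_ser {c : ℤ → ℂ} (h0 : wn 0 c ≠ ⊤) (h1 : wn 1 c ≠ ⊤) (y : ℝ) :
    HasDerivAt (fun y : ℝ => ser c (y : Torus)) (ser (dcoef 1 c) (y : Torus)) y := by
  refine hasDerivAt_tsum (g := fun (k : ℤ) (y : ℝ) => c k * fourier k (y : Torus))
    (g' := fun (k : ℤ) (y : ℝ) => dcoef 1 c k * fourier k (y : Torus))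
    (summable_of_wn h1) (y₀ := 0) (fun k y => ?_) (fun k y => ?_) (summable_ser h0 _) y
  · have := (hasDerivAt_fourier (2 * Real.pi) k y).const_mul (c k)
    refine this.congr_deriv ?_
    have e : ∀ w : ℂ, c k * (2 * Real.pi * Complex.I * k / (2 * Real.pi : ℝ) * w) =
        dcoef 1 c k * w := by
      intro w
      have : (Real.pi : ℂ) ≠ 0 := by exact_mod_cast Real.pi_ne_zero
      rw [dcoef]
      push_cast
      field_simp
    exact e _
  · rw [norm_mul, norm_fourier_apply, mul_one, dcoef]
    simp

theorem hasDerivAt_rser {c : ℤ → ℂ} (h0 : wn 0 c ≠ ⊤) (h1 : wn 1 c ≠ ⊤) (y : ℝ) :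
    HasDerivAt (fun y : ℝ => rser c (y : Torus)) (rser (dcoef 1 c) (y : Torus)) y := by
  exact Complex.reCLM.hasFDerivAt.comp_hasDerivAt y (hasDerivAt_ser h0 h1 y)

theorem xDeriv_coe (n : ℕ) (u : Torus → ℝ) (x : ℝ) :
    xDeriv n u (x : Torus) = iteratedDeriv n (fun y : ℝ => u (y : Torus)) x := by
  have := iteratedDeriv_comp_const_add n (fun y : ℝ => u (y : Torus)) x
  have h2 := congrFun this 0
  simp only [add_zero] at h2
  rw [← h2, xDeriv]
  congr 1

theorem xDeriv_zero (u : Torus → ℝ) : xDeriv 0 u = u := by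
  ext x; simp [xDeriv]

theorem xDeriv_eq_of_hasDerivAt {u u' : Torus → ℝ}
    (h : ∀ y : ℝ, HasDerivAt (fun y : ℝ => u (y : Torus)) (u' (y : Torus)) y) (n : ℕ) :
    xDeriv (n + 1) u = xDeriv n u' := by
  ext x
  induction x using QuotientAddGroup.induction_on with
  | H x =>
    rw [xDeriv_coe, xDeriv_coe, iteratedDeriv_succ']
    congr 1
    exact funext fun y => (h y).deriv

theorem xDeriv_rser {c : ℤ → ℂ} (hc0 : c 0 = 0) {n : ℕ} (h : wn n c ≠ ⊤) :
    xDeriv n (rser c) = rser (dcoef n c) := by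
  induction n generalizing c with
  | zero => rw [xDeriv_zero, dcoef_zero]
  | succ n ih =>
    have h0 := wn_ne_top_mono (Nat.zero_le _) hc0 h
    have h1 := wn_ne_top_mono (Nat.le_add_left 1 n) hc0 h
    rw [xDeriv_eq_of_hasDerivAt (hasDerivAt_rser h0 h1),
      ih (dcoef_zero_apply hc0) (by rwa [wn_dcoef]), dcoef_dcoef]

theorem isCn_rser {c : ℤ → ℂ} (hc0 : c 0 = 0) {n : ℕ} (h : wn n c ≠ ⊤) : IsCn n (rser c) := by
  unfold IsCn
  induction n generalizing c with
  | zero =>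
    exact contDiff_zero.2 ((continuous_rser h).comp (AddCircle.continuous_mk' _))
  | succ n ih =>
    have h0 := wn_ne_top_mono (Nat.zero_le _) hc0 h
    have h1 := wn_ne_top_mono (Nat.le_add_left 1 n) hc0 h
    have hd := hasDerivAt_rser h0 h1
    have e : (((n + 1 : ℕ) : ℕ∞) : WithTop ℕ∞) = (n : WithTop ℕ∞) + 1 := by push_cast; rfl
    rw [e, contDiff_succ_iff_deriv]
    refine ⟨fun y => (hd y).differentiableAt, by simp, ?_⟩
    rw [show deriv (fun y : ℝ => rser c (y : Torus)) = fun y : ℝ => rser (dcoef 1 c) (y : Torus) from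
      funext fun y => (hd y).deriv]
    exact ih (dcoef_zero_apply hc0) (by rwa [wn_dcoef])

/-- Integration by parts on the torus. -/
theorem integral_mul_deriv_torus {A : Type*} [NormedCommRing A] [NormedAlgebra ℝ A]
    [CompleteSpace A] {u v u' v' : Torus → A}
    (hu : ∀ y : ℝ, HasDerivAt (fun y : ℝ => u (y : Torus)) (u' (y : Torus)) y)
    (hv : ∀ y : ℝ, HasDerivAt (fun y : ℝ => v (y : Torus)) (v' (y : Torus)) y)
    (hu' : Continuous u') (hv' : Continuous v') :
    ∫ x, u x * v' x = -∫ x, u' x * v x := by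
  have hmk : Continuous fun y : ℝ => (y : Torus) := AddCircle.continuous_mk' _
  have e := intervalIntegral.integral_mul_deriv_eq_deriv_mul (a := 0) (b := 2 * Real.pi)
    (fun y _ => hu y) (fun y _ => hv y) ((hu'.comp hmk).intervalIntegrable _ _)
    ((hv'.comp hmk).intervalIntegrable _ _)
  have h2 : ((2 * Real.pi : ℝ) : Torus) = ((0 : ℝ) : Torus) := by
    rw [AddCircle.coe_period]; rfl
  rw [h2, sub_self, zero_sub] at e
  have i1 := AddCircle.intervalIntegral_preimage (2 * Real.pi) 0 (fun x : Torus => u x * v' x)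
  have i2 := AddCircle.intervalIntegral_preimage (2 * Real.pi) 0 (fun x : Torus => u' x * v x)
  rw [zero_add] at i1 i2
  rw [← i1, ← i2]
  exact e

theorem IsCn.hasDerivAt {η : Torus → ℝ} (h : IsCn ⊤ η) (n : ℕ) (y : ℝ) :
    HasDerivAt (fun y : ℝ => xDeriv n η (y : Torus)) (xDeriv (n + 1) η (y : Torus)) y := by
  simp_rw [xDeriv_coe]
  rw [iteratedDeriv_succ]
  refine DifferentiableAt.hasDerivAt ?_
  exact (h.differentiable_iteratedDeriv n (by exact_mod_cast ENat.natCast_lt_top n)) y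

theorem continuous_torus {u : Torus → ℝ} (h : Continuous fun y : ℝ => u (y : Torus)) :
    Continuous u := (QuotientAddGroup.isQuotientMap_mk (AddSubgroup.zmultiples (2 * Real.pi))).continuous_iff.2 h

theorem IsCn.continuous_xDeriv {η : Torus → ℝ} (h : IsCn ⊤ η) (n : ℕ) : Continuous (xDeriv n η) := by
  refine continuous_torus ?_
  simp_rw [xDeriv_coe]
  exact h.continuous_iteratedDeriv n (by exact_mod_cast le_top)

theorem Continuous.integrable_torus {u : Torus → ℝ} (h : Continuous u) : Integrable u :=
  h.integrable_of_hasCompactSupport (HasCompactSupport.of_compactSpace _)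

theorem isWeakDeriv_rser {c : ℤ → ℂ} (hc0 : c 0 = 0) {n : ℕ} (h : wn n c ≠ ⊤) :
    IsWeakDeriv n (rser c) (rser (dcoef n c)) := by
  refine ⟨Continuous.integrable_torus (continuous_rser (wn_ne_top_mono (Nat.zero_le _) hc0 h)),
    Continuous.integrable_torus (continuous_rser (by rwa [wn_dcoef, zero_add])), fun η hη => ?_⟩
  induction n generalizing c with
  | zero => rw [dcoef_zero, xDeriv_zero]; simp
  | succ n ih =>
    have h0 := wn_ne_top_mono (Nat.zero_le _) hc0 h
    have h1 := wn_ne_top_mono (Nat.le_add_left 1 n) hc0 h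
    rw [integral_mul_deriv_torus (hasDerivAt_rser h0 h1) (hη.hasDerivAt n)
      (continuous_rser (by rwa [wn_dcoef, zero_add])) (hη.continuous_xDeriv _),
      ih (dcoef_zero_apply hc0) (by rwa [wn_dcoef]), dcoef_dcoef, pow_succ]
    ring

/-! ### Fourier coefficients -/

theorem integrable_haar_iff {E : Type*} [NormedAddCommGroup E] {u : Torus → E} :
    Integrable u AddCircle.haarAddCircle ↔ Integrable u := by
  rw [AddCircle.volume_eq_smul_haarAddCircle, integrable_smul_measure]
  · exact (ENNReal.ofReal_pos.2 Real.two_pi_pos).ne'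
  · exact ENNReal.ofReal_ne_top

theorem fourierCoeff_eq (u : Torus → ℂ) (k : ℤ) :
    fourierCoeff u k = (2 * Real.pi : ℝ)⁻¹ • ∫ x, fourier (-k) x * u x := by
  rw [fourierCoeff, AddCircle.integral_haarAddCircle]; rfl

theorem fourierCoeff_ser {c : ℤ → ℂ} (h : wn 0 c ≠ ⊤) (k : ℤ) : fourierCoeff (ser c) k = c k := by
  have hs : HasSum (fun n => ∫ x, fourier (-k) x * (c n * fourier n x)
      ∂(AddCircle.haarAddCircle : Measure Torus)) (fourierCoeff (ser c) k) := by
    have := hasSum_integral_of_summable_integral_norm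
      (μ := (AddCircle.haarAddCircle : Measure Torus))
      (F := fun n x => fourier (-k) x * (c n * fourier n x)) (fun n => ?_) ?_
    · convert! this using 1
      rw [fourierCoeff]
      refine integral_congr_ae (.of_forall fun x => ?_)
      simp only [ser, smul_eq_mul]
      rw [tsum_mul_left]
    · refine integrable_haar_iff.2 (Continuous.integrable_of_hasCompactSupport ?_
        (HasCompactSupport.of_compactSpace _))
      exact (fourier (-k)).continuous.mul (continuous_const.mul (fourier n).continuous)
    · refine (summable_norm_of_wn h).congr fun n => ?_
      simp only [norm_mul, norm_fourier_apply, one_mul, mul_one]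
      simp
  refine hs.unique ?_
  have e : ∀ n, ∫ x, fourier (-k) x * (c n * fourier n x)
      ∂(AddCircle.haarAddCircle : Measure Torus) = if n = k then c k else 0 := by
    intro n
    have h1 := congrFun (fourierCoeff_fourier (T := 2 * Real.pi) n) k
    rw [fourierCoeff] at h1
    have h2 : ∀ x : Torus, fourier (-k) x * (c n * fourier n x) =
        c n * (fourier (-k) x • fourier n x) := fun x => by rw [smul_eq_mul]; ring
    simp_rw [h2]
    rw [integral_const_mul, h1, Pi.single_apply]
    by_cases hk : n = k
    · subst hk; simp
    · simp [hk, Ne.symm hk]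
  simp_rw [e]
  exact hasSum_ite_eq k (c k)

/-- An integrable function on the torus is determined by its Fourier coefficients. -/
theorem ae_eq_zero_of_fourierCoeff {d : Torus → ℂ} (hd : Integrable d)
    (h : ∀ k, fourierCoeff d k = 0) : d =ᵐ[volume] 0 := by
  have hd' := hd
  -- testing against a continuous function is continuous for the uniform norm
  have h1 : ∀ φ : C(Torus, ℂ), ∫ x, φ x * d x = 0 := by
    have hlin : ∀ φ ∈ Submodule.span ℂ (range (fourier (T := 2 * Real.pi))),
        ∫ x, φ x * d x = 0 := by
      intro φ hφ
      have hi : ∀ φ : C(Torus, ℂ), Integrable fun x => φ x * d x := fun φ =>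
        hd.bdd_mul φ.continuous.aestronglyMeasurable (c := ‖φ‖)
          (.of_forall fun x => φ.norm_coe_le_norm x)
      induction hφ using Submodule.span_induction with
      | mem φ hφ =>
        obtain ⟨k, rfl⟩ := hφ
        have := h (-k)
        rw [fourierCoeff_eq, neg_neg, smul_eq_zero] at this
        exact this.resolve_left (inv_ne_zero Real.two_pi_pos.ne')
      | zero => simp
      | add φ ψ _ _ h1 h2 =>
        simp only [ContinuousMap.add_apply, add_mul]
        rw [integral_add (hi _) (hi _), h1, h2, add_zero]
      | smul a φ _ h1 =>
        simp only [ContinuousMap.smul_apply, smul_eq_mul, mul_assoc]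
        rw [integral_const_mul, h1, mul_zero]
    intro φ
    have hφ : φ ∈ closure (Submodule.span ℂ (range (fourier (T := 2 * Real.pi))) :
        Set C(Torus, ℂ)) := by
      have := span_fourier_closure_eq_top (T := 2 * Real.pi)
      rw [← Submodule.topologicalClosure_coe, this]; trivial
    rw [← norm_eq_zero]
    refine le_antisymm (le_of_forall_pos_le_add fun ε hε => ?_) (norm_nonneg _)
    obtain ⟨ψ, hψ, hd⟩ := Metric.mem_closure_iff.1 hφ (ε / (1 + ∫ x, ‖d x‖))
      (div_pos hε (by positivity))
    have hi : ∀ φ : C(Torus, ℂ), Integrable fun x => φ x * d x := fun φ =>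
        hd'.bdd_mul φ.continuous.aestronglyMeasurable (c := ‖φ‖)
          (.of_forall fun x => φ.norm_coe_le_norm x)
    have e : ∫ x, φ x * d x = ∫ x, (φ - ψ) x * d x := by
      simp only [ContinuousMap.sub_apply, sub_mul]
      rw [integral_sub (hi _) (hi _), hlin ψ hψ, sub_zero]
    rw [e, zero_add]
    calc ‖∫ x, (φ - ψ) x * d x‖ ≤ ∫ x, ‖φ - ψ‖ * ‖d x‖ := by
          refine norm_integral_le_of_norm_le (hd'.norm.const_mul _) (.of_forall fun x => ?_)
          rw [norm_mul]
          gcongr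
          exact (φ - ψ).norm_coe_le_norm x
      _ = ‖φ - ψ‖ * ∫ x, ‖d x‖ := integral_const_mul _ _
      _ ≤ ε / (1 + ∫ x, ‖d x‖) * (1 + ∫ x, ‖d x‖) := by
          rw [dist_eq_norm] at hd
          gcongr
          linarith
      _ = ε := div_mul_cancel₀ _ (by positivity)
  -- indicators of closed sets are bounded limits of continuous functions
  refine ae_eq_zero_of_forall_setIntegral_isClosed_eq_zero hd fun s hs => ?_
  have hδ : ∀ n : ℕ, (0 : ℝ) < 1 / ((n : ℝ) + 1) := fun n => by positivity
  have hlim := thickenedIndicator_tendsto_indicator_closure hδ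
    tendsto_one_div_add_atTop_nhds_zero_nat s
  rw [tendsto_pi_nhds] at hlim
  have hT : Tendsto (fun n : ℕ => ∫ x, ((thickenedIndicator (hδ n) s x : ℝ) : ℂ) * d x) atTop
      (𝓝 (∫ x, s.indicator d x)) := by
    refine tendsto_integral_of_dominated_convergence (fun x => ‖d x‖) (fun n => ?_) hd.norm
      (fun n => .of_forall fun x => ?_) (.of_forall fun x => ?_)
    · refine AEStronglyMeasurable.mul (Continuous.aestronglyMeasurable ?_) hd.1
      exact Complex.continuous_ofReal.comp (NNReal.continuous_coe.comp (map_continuous _))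
    · rw [norm_mul, Complex.norm_real, Real.norm_of_nonneg (NNReal.coe_nonneg _)]
      exact mul_le_of_le_one_left (norm_nonneg _) (by exact_mod_cast thickenedIndicator_le_one _ _ x)
    · have h2 : Tendsto (fun n : ℕ => ((thickenedIndicator (hδ n) s x : ℝ) : ℂ)) atTop
          (𝓝 (((s.indicator (fun _ => (1 : ℝ≥0)) x : ℝ≥0) : ℝ) : ℂ)) := by
        have := hlim x
        rw [hs.closure_eq] at this
        exact (Complex.continuous_ofReal.comp NNReal.continuous_coe).continuousAt.tendsto.comp this
      convert! h2.mul_const (d x) using 2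
      by_cases hx : x ∈ s <;> simp [hx]
  rw [← integral_indicator hs.measurableSet]
  refine tendsto_nhds_unique hT ?_
  have hz : ∀ n : ℕ, ∫ x, ((thickenedIndicator (hδ n) s x : ℝ) : ℂ) * d x = 0 := fun n =>
    h1 ⟨fun x => ((thickenedIndicator (hδ n) s x : ℝ) : ℂ),
      Complex.continuous_ofReal.comp (NNReal.continuous_coe.comp (map_continuous _))⟩
  simp only [hz]
  exact tendsto_const_nhds

theorem fourierCoeff_sub {u v : Torus → ℂ} (hu : Integrable u) (hv : Integrable v) (k : ℤ) :
    fourierCoeff (fun x => u x - v x) k = fourierCoeff u k - fourierCoeff v k := by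
  simp only [fourierCoeff, smul_sub]
  exact integral_sub ((integrable_haar_iff.2 hu).fourier_smul _)
    ((integrable_haar_iff.2 hv).fourier_smul _)

/-- Real integrable functions with equal Fourier coefficients agree almost everywhere. -/
theorem ae_eq_of_fourierC {u v : Torus → ℝ} (hu : Integrable u) (hv : Integrable v)
    (h : ∀ k, fourierC u k = fourierC v k) : u =ᵐ[volume] v := by
  have h1 := ae_eq_zero_of_fourierCoeff (hu.ofReal.sub hv.ofReal) (fun k => by
    have := fourierCoeff_sub (hu.ofReal (𝕜 := ℂ)) hv.ofReal k
    exact this.trans (sub_eq_zero.2 (h k)))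
  filter_upwards [h1] with x hx
  have : ((u x : ℂ)) - (v x : ℂ) = 0 := hx
  exact_mod_cast sub_eq_zero.1 this

theorem fourierC_zero (u : Torus → ℝ) : fourierC u 0 = (mean u : ℂ) := by
  rw [fourierC, fourierCoeff_eq, mean]
  simp only [neg_zero, fourier_zero, one_mul]
  rw [integral_complex_ofReal, Complex.real_smul]
  push_cast; ring

theorem sym_fourierC (u : Torus → ℝ) : Sym (fourierC u) := by
  intro k
  rw [fourierC, fourierC, fourierCoeff_eq, fourierCoeff_eq, Complex.real_smul, Complex.real_smul,
    map_mul, Complex.conj_ofReal, ← integral_conj]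
  congr 2
  ext x
  rw [map_mul, Complex.conj_ofReal, ← fourier_neg]

theorem ser_eq_ofReal {c : ℤ → ℂ} (hc : Sym c) (x : Torus) : ser c x = (rser c x : ℂ) := by
  have : (starRingEnd ℂ) (ser c x) = ser c x := by
    rw [ser, Complex.conj_tsum, ← (Equiv.neg ℤ).tsum_eq]
    refine tsum_congr fun k => ?_
    rw [Equiv.neg_apply, hc k, map_mul, Complex.conj_conj, fourier_neg, Complex.conj_conj]
  exact (Complex.conj_eq_iff_re.1 this).symm

theorem fourierC_rser {c : ℤ → ℂ} (hc : Sym c) (h : wn 0 c ≠ ⊤) (k : ℤ) :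
    fourierC (rser c) k = c k := by
  rw [fourierC, ← fourierCoeff_ser h k]
  congr 1
  exact funext fun x => (ser_eq_ofReal hc x).symm

/-- The symmetric part of a family of coefficients; it belongs to the same real function. -/
noncomputable def symPart (c : ℤ → ℂ) : ℤ → ℂ := fun k => (c k + (starRingEnd ℂ) (c (-k))) / 2

theorem sym_symPart (c : ℤ → ℂ) : Sym (symPart c) := by
  intro k
  have : (starRingEnd ℂ) 2 = 2 := map_ofNat _ 2
  simp [symPart, add_comm, this]

theorem wn_symPart_le (s : ℕ) (c : ℤ → ℂ) : wn s (symPart c) ≤ wn s c := by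
  have h1 : wn s c = ∑' k : ℤ, ENNReal.ofReal (|(k : ℝ)| ^ s * ‖c (-k)‖) := by
    rw [wn, ← (Equiv.neg ℤ).tsum_eq]
    simp
  have h2 : wn s c = ∑' k : ℤ, (ENNReal.ofReal (|(k : ℝ)| ^ s * ‖c k‖) / 2 +
      ENNReal.ofReal (|(k : ℝ)| ^ s * ‖c (-k)‖) / 2) := by
    rw [ENNReal.tsum_add]
    simp only [div_eq_mul_inv, ENNReal.tsum_mul_right]
    rw [← h1, ← wn, ← mul_add, ENNReal.inv_two_add_inv_two, mul_one]
  rw [h2]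
  refine ENNReal.tsum_le_tsum fun k => ?_
  have e2 : (2 : ℝ≥0∞) = ENNReal.ofReal 2 := by simp
  rw [e2, ← ENNReal.ofReal_div_of_pos two_pos, ← ENNReal.ofReal_div_of_pos two_pos,
    ← ENNReal.ofReal_add (by positivity) (by positivity)]
  refine ENNReal.ofReal_le_ofReal ?_
  rw [symPart, norm_div, Complex.norm_two, ← add_div, ← mul_add, mul_div_assoc]
  gcongr
  refine (norm_add_le _ _).trans (by rw [RCLike.norm_conj])

theorem rser_symPart {c : ℤ → ℂ} (h : wn 0 c ≠ ⊤) (x : Torus) : rser (symPart c) x = rser c x := by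
  have hn : wn 0 (fun k => c (-k)) ≠ ⊤ := by
    rw [wn_zero] at h ⊢
    rw [← (Equiv.neg ℤ).tsum_eq] at h
    exact h
  have e : ser (symPart c) x = (ser c x + (starRingEnd ℂ) (ser c x)) / 2 := by
    have e1 : (starRingEnd ℂ) (ser c x) = ∑' k, (starRingEnd ℂ) (c (-k)) * fourier k x := by
      rw [ser, Complex.conj_tsum, ← (Equiv.neg ℤ).tsum_eq]
      refine tsum_congr fun k => ?_
      rw [Equiv.neg_apply, map_mul, fourier_neg, Complex.conj_conj]
    have hs : Summable fun k => (starRingEnd ℂ) (c (-k)) * fourier k x :=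
      .of_norm ((summable_norm_of_wn hn).congr fun k => by
        rw [norm_mul, norm_fourier_apply, mul_one, RCLike.norm_conj])
    rw [e1, ser, ser, ← (summable_ser h x).tsum_add hs, ← tsum_div_const]
    refine tsum_congr fun k => ?_
    rw [symPart]; ring
  rw [rser, e, rser, Complex.add_conj]
  simp

theorem wienerNorm_natCast_lt_top {s : ℕ} {u : Torus → ℝ} (h : wienerNorm s u < ⊤) :
    Integrable u ∧ fourierC u 0 = 0 ∧ wn s (fourierC u) = wienerNorm s u := by
  rw [wienerNorm] at h ⊢
  split_ifs at h ⊢ with h1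
  · refine ⟨h1.1, by rw [fourierC_zero, h1.2]; simp, ?_⟩
    simp [wn]
  · exact absurd h (lt_irrefl _)

/-- A function of finite Wiener norm agrees almost everywhere with its Fourier series. -/
theorem ae_eq_rser_of_wn {u : Torus → ℝ} (hu : Integrable u) (h : wn 0 (fourierC u) ≠ ⊤) :
    u =ᵐ[volume] rser (fourierC u) :=
  ae_eq_of_fourierC hu (Continuous.integrable_torus (continuous_rser h))
    fun k => (fourierC_rser (sym_fourierC u) h k).symm

theorem mean_rser {c : ℤ → ℂ} (h0 : c 0 = 0) (h : wn 0 c ≠ ⊤) : mean (rser c) = 0 := by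
  have e : rser (symPart c) = rser c := funext (rser_symPart h)
  have h1 := fourierC_rser (sym_symPart c) (ne_top_of_le_ne_top h (wn_symPart_le 0 c)) 0
  rw [e, fourierC_zero] at h1
  have : symPart c 0 = 0 := by simp [symPart, h0]
  rw [this] at h1
  exact_mod_cast h1

/-! ### The Galerkin scheme in physical variables -/

/-- The flux `Φ` at the heights `F + c`, `G + d`, with `c`, `d` given by their Fourier
coefficients. -/
noncomputable def phys (Φ : ℝ → ℝ → ℝ → ℝ → ℝ) (z : ℕ) (F G : ℝ) (c d : ℤ → ℂ) (x : Torus) : ℝ :=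
  Φ (F + rser c x) (G + rser d x) (rser (Dcoef z c) x) (rser (Dcoef z d) x)

namespace TrigPoly

theorem wn_coeff (s : ℕ) (a : TrigPoly) : wn s a.coeff = ENNReal.ofReal (nrm s a) := by
  rw [nrm, Finsupp.sum, ENNReal.ofReal_sum_of_nonneg (fun _ _ => by positivity), wn]
  refine tsum_eq_sum fun k hk => ?_
  simp [Finsupp.notMem_support_iff.1 hk]

theorem wn_coeff_ne_top (s : ℕ) (a : TrigPoly) : wn s a.coeff ≠ ⊤ := by
  rw [wn_coeff]; exact ENNReal.ofReal_ne_top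

/-- Evaluation of a trigonometric polynomial at a point. -/
noncomputable def evalAt (x : Torus) : TrigPoly →ₐ[ℂ] ℂ :=
  AddMonoidAlgebra.lift ℂ ℂ ℤ
    { toFun := fun k => fourier k.toAdd x
      map_one' := by simp
      map_mul' := fun k l => by rw [toAdd_mul, fourier_add] }

theorem evalAt_eq_ser (x : Torus) (a : TrigPoly) : evalAt x a = ser a.coeff x := by
  rw [evalAt, AddMonoidAlgebra.lift_apply, ser, tsum_eq_sum (s := a.coeff.support)]
  · rfl
  · intro k hk
    rw [Finsupp.notMem_support_iff.1 hk, zero_mul]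

theorem evalAt_const (x : Torus) (r : ℝ) : evalAt x (const r) = r := by
  rw [const, RingHom.comp_apply, AlgHom.commutes]; rfl

theorem evalAt_opD (x : Torus) (z : ℕ) (a : TrigPoly) :
    evalAt x (opD z a) = ser (Dcoef z a.coeff) x := evalAt_eq_ser x _

theorem coeff_polyFluxF {z : ℕ} (hz : Odd z) (ρ F G : ℝ) {a b : TrigPoly} (ha : Sym a.coeff)
    (hb : Sym b.coeff) (k : ℤ) :
    (polyFluxF z ρ F G a b).coeff k = fourierC (phys (fluxF ρ) z F G a.coeff b.coeff) k := by
  rw [← fourierCoeff_ser (wn_coeff_ne_top 0 _) k, fourierC]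
  congr 1
  ext x
  rw [← evalAt_eq_ser, polyFluxF, phys, fluxF]
  simp only [cubic, map_add, map_mul, map_pow, evalAt_const, evalAt_opD]
  simp only [evalAt_eq_ser, ser_eq_ofReal ha, ser_eq_ofReal hb, ser_eq_ofReal (ha.Dcoef hz),
    ser_eq_ofReal (hb.Dcoef hz)]
  push_cast
  ring

theorem coeff_polyFluxG {z : ℕ} (hz : Odd z) (ρ μ F G : ℝ) {a b : TrigPoly} (ha : Sym a.coeff)
    (hb : Sym b.coeff) (k : ℤ) :
    (polyFluxG z ρ μ F G a b).coeff k = fourierC (phys (fluxG ρ μ) z F G a.coeff b.coeff) k := by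
  rw [← fourierCoeff_ser (wn_coeff_ne_top 0 _) k, fourierC]
  congr 1
  ext x
  rw [← evalAt_eq_ser, polyFluxG, phys, fluxG]
  simp only [cubic, map_add, map_mul, map_pow, evalAt_const, evalAt_opD]
  simp only [evalAt_eq_ser, ser_eq_ofReal ha, ser_eq_ofReal hb, ser_eq_ofReal (ha.Dcoef hz),
    ser_eq_ofReal (hb.Dcoef hz)]
  push_cast
  ring

theorem sym_eulerStep {N : ℕ} {h : ℝ} {a J : TrigPoly} (ha : Sym a.coeff) {u : Torus → ℝ}
    (hJ : ∀ k, J.coeff k = fourierC u k) : Sym (eulerStep N h a J).coeff := by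
  intro k
  rw [coeff_eulerStep, coeff_eulerStep, ha k, hJ, hJ, sym_fourierC u k, abs_neg, map_add, map_mul]
  split_ifs <;> simp

/-- The truncation of a family of coefficients to the frequencies `|k| ≤ N`. -/
noncomputable def ofTrunc (N : ℕ) (c : ℤ → ℂ) : TrigPoly :=
  .ofCoeff (Finsupp.onFinset (Finset.Icc (-(N : ℤ)) N) (fun k => if |k| ≤ N then c k else 0)
    fun k hk => by
      rw [Finset.mem_Icc, ← abs_le]
      by_contra hc
      exact hk (if_neg hc))

theorem coeff_ofTrunc (N : ℕ) (c : ℤ → ℂ) (k : ℤ) :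
    (ofTrunc N c).coeff k = if |k| ≤ N then c k else 0 := rfl

/-- The iterates of the explicit Euler scheme for the system truncated to `|k| ≤ N`. -/
noncomputable def eulerSeq (N z : ℕ) (h ρ μ F G : ℝ) (c d : ℤ → ℂ) : ℕ → TrigPoly × TrigPoly
  | 0 => (ofTrunc N c, ofTrunc N d)
  | n + 1 =>
    let u := eulerSeq N z h ρ μ F G c d n
    (eulerStep N h u.1 (polyFluxF z ρ F G u.1 u.2), eulerStep N h u.2 (polyFluxG z ρ μ F G u.1 u.2))

end TrigPoly

open TrigPoly in
/-- The Galerkin approximations, discretized in time by explicit Euler steps, satisfy the a priori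
bounds of the system uniformly in the truncation. -/
theorem exists_euler {z : ℕ} {ρ μ F G E σ : ℝ} (hz : z = 1 ∨ z = 3) (hρ : 0 < ρ) (hμ : 0 < μ)
    (hF : 0 < F) (hG : 0 < G) (hσ : 0 < σ) (hσ₁ : σ ≤ Sigma1 ρ μ F G E)
    (hσ₂ : σ ≤ Sigma2 ρ μ F G E) {c₀ d₀ : ℤ → ℂ} (hc : Sym c₀) (hd : Sym d₀) (hc0 : c₀ 0 = 0)
    (hd0 : d₀ 0 = 0) (hE0 : 0 ≤ E) (hE : wn 0 c₀ + wn 0 d₀ ≤ ENNReal.ofReal E) (N : ℕ) :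
    ∃ h : ℝ, 0 < h ∧ h ≤ 1 / ((N : ℝ) + 1) ∧ ∃ c d : ℕ → ℤ → ℂ,
      (∀ n, Sym (c n) ∧ Sym (d n) ∧ c n 0 = 0 ∧ d n 0 = 0) ∧
      (∀ n s, wn s (c n) ≠ ⊤ ∧ wn s (d n) ≠ ⊤) ∧
      (∀ k, c 0 k = (if |k| ≤ N then c₀ k else 0) ∧ d 0 k = (if |k| ≤ N then d₀ k else 0)) ∧
      (∀ n : ℕ, wn 0 (c n) + wn 0 (d n) ≤ ENNReal.ofReal (E * Real.exp (-σ * (n * h)))) ∧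
      (∀ m : ℕ, ∑ n ∈ Finset.range m, ENNReal.ofReal h * (wn (z + 1) (c n) + wn (z + 1) (d n)) ≤
        ENNReal.ofReal (E / σ)) ∧
      (∀ n k, c (n + 1) k = c n k + (if |k| ≤ N then (h : ℂ) * (Complex.I * k) else 0) *
          fourierC (phys (fluxF ρ) z F G (c n) (d n)) k) ∧
      (∀ n k, d (n + 1) k = d n k + (if |k| ≤ N then (h : ℂ) * (Complex.I * k) else 0) *
          fourierC (phys (fluxG ρ μ) z F G (c n) (d n)) k) := by
  have hodd : Odd z := by rcases hz with rfl | rfl <;> decide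
  set α := 2 * ρ * F ^ 3 + 3 * F ^ 2 * G with hα
  set β := 2 * μ * G ^ 3 + 3 * (F ^ 2 * G) + 6 * (F * G ^ 2) with hβ
  have hα0 : 0 < α := by positivity
  have hβ0 : 0 < β := by positivity
  -- the step size is dictated by the highest frequency
  set h : ℝ := 1 / (((N : ℝ) + 1) * (1 + (α + β) * (N : ℝ) ^ (z + 1))) with hh
  have hden : 0 < ((N : ℝ) + 1) * (1 + (α + β) * (N : ℝ) ^ (z + 1)) := by positivity
  have hh0 : 0 < h := by positivity
  have hN0 : (0 : ℝ) ≤ N := N.cast_nonneg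
  have hp : (0 : ℝ) ≤ (N : ℝ) ^ (z + 1) := by positivity
  have hN₁ : h * α * (N : ℝ) ^ (z + 1) ≤ 1 := by
    rw [hh, mul_assoc, one_div_mul_eq_div, div_le_one hden]
    nlinarith [mul_nonneg hα0.le hp, mul_nonneg hβ0.le hp,
      mul_nonneg hN0 (mul_nonneg hα0.le hp), mul_nonneg hN0 (mul_nonneg hβ0.le hp)]
  have hN₂ : h * β * (N : ℝ) ^ (z + 1) ≤ 1 := by
    rw [hh, mul_assoc, one_div_mul_eq_div, div_le_one hden]
    nlinarith [mul_nonneg hα0.le hp, mul_nonneg hβ0.le hp,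
      mul_nonneg hN0 (mul_nonneg hα0.le hp), mul_nonneg hN0 (mul_nonneg hβ0.le hp)]
  set U := eulerSeq N z h ρ μ F G c₀ d₀ with hU
  have hstep1 : ∀ n, (U (n + 1)).1 = eulerStep N h (U n).1 (polyFluxF z ρ F G (U n).1 (U n).2) :=
    fun n => rfl
  have hstep2 : ∀ n, (U (n + 1)).2 = eulerStep N h (U n).2 (polyFluxG z ρ μ F G (U n).1 (U n).2) :=
    fun n => rfl
  -- real valuedness, zero means and the truncation are preserved
  have hsym : ∀ n, Sym (U n).1.coeff ∧ Sym (U n).2.coeff := by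
    intro n
    induction n with
    | zero =>
      constructor <;> intro k
      · change (ofTrunc N c₀).coeff (-k) = (starRingEnd ℂ) ((ofTrunc N c₀).coeff k)
        rw [coeff_ofTrunc, coeff_ofTrunc, abs_neg, hc k]; split_ifs <;> simp
      · change (ofTrunc N d₀).coeff (-k) = (starRingEnd ℂ) ((ofTrunc N d₀).coeff k)
        rw [coeff_ofTrunc, coeff_ofTrunc, abs_neg, hd k]; split_ifs <;> simp
    | succ n ih =>
      rw [hstep1, hstep2]
      exact ⟨sym_eulerStep ih.1 (coeff_polyFluxF hodd ρ F G ih.1 ih.2),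
        sym_eulerStep ih.2 (coeff_polyFluxG hodd ρ μ F G ih.1 ih.2)⟩
  have hzero : ∀ n, (U n).1.coeff 0 = 0 ∧ (U n).2.coeff 0 = 0 := by
    intro n
    induction n with
    | zero =>
      change (ofTrunc N c₀).coeff 0 = 0 ∧ (ofTrunc N d₀).coeff 0 = 0
      simp [coeff_ofTrunc, hc0, hd0]
    | succ n ih =>
      rw [hstep1, hstep2, coeff_eulerStep, coeff_eulerStep]
      simp [ih]
  have htr : ∀ n, Trunc N (U n).1 ∧ Trunc N (U n).2 := by
    intro n
    induction n with
    | zero => exact ⟨fun k hk => if_neg (not_le.2 hk), fun k hk => if_neg (not_le.2 hk)⟩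
    | succ n ih => exact ⟨ih.1.eulerStep h _, ih.2.eulerStep h _⟩
  have hinit : nrm 0 (U 0).1 + nrm 0 (U 0).2 ≤ E := by
    rw [← ENNReal.ofReal_le_ofReal_iff hE0, ENNReal.ofReal_add (nrm_nonneg _ _) (nrm_nonneg _ _),
      ← wn_coeff, ← wn_coeff]
    refine le_trans (add_le_add ?_ ?_) hE <;>
    · refine ENNReal.tsum_le_tsum fun k => ENNReal.ofReal_le_ofReal ?_
      gcongr
      change ‖(ofTrunc N _).coeff k‖ ≤ _
      rw [coeff_ofTrunc]
      split_ifs <;> simp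
  -- the energy decreases; the bound `E` that the estimate needs is propagated by induction
  have hdec : ∀ n, nrm 0 (U n).1 + nrm 0 (U n).2 ≤ E →
      nrm 0 (U (n + 1)).1 + nrm 0 (U (n + 1)).2 ≤
      nrm 0 (U n).1 + nrm 0 (U n).2 - h * σ * (nrm (z + 1) (U n).1 + nrm (z + 1) (U n).2) :=
    fun n hn => energy_step hz hρ hμ hF hG (htr n).1 (htr n).2 hn hσ₁ hσ₂ hh0.le hN₁ hN₂
  have hexp : ∀ n : ℕ, nrm 0 (U n).1 + nrm 0 (U n).2 ≤ E * Real.exp (-σ * (n * h)) ∧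
      nrm 0 (U n).1 + nrm 0 (U n).2 ≤ E := by
    intro n
    induction n with
    | zero => simpa using hinit
    | succ n ih =>
      have h1 := hdec n ih.2
      have m1 := nrm_mono_zero (hzero n).1 (z + 1)
      have m2 := nrm_mono_zero (hzero n).2 (z + 1)
      have q0 := nrm_nonneg 0 (U n).1
      have q1 := nrm_nonneg 0 (U n).2
      have hσh : 0 < h * σ := by positivity
      constructor
      · have e1 : 1 - h * σ ≤ Real.exp (-σ * h) := by
          have := Real.add_one_le_exp (-σ * h); linarith
        calc _ ≤ (nrm 0 (U n).1 + nrm 0 (U n).2) * (1 - h * σ) := by nlinarith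
          _ ≤ (nrm 0 (U n).1 + nrm 0 (U n).2) * Real.exp (-σ * h) := by gcongr
          _ ≤ E * Real.exp (-σ * (n * h)) * Real.exp (-σ * h) := by gcongr; exact ih.1
          _ = _ := by rw [mul_assoc, ← Real.exp_add]; push_cast; ring_nf
      · nlinarith
  -- summing the dissipation telescopes
  have hsum : ∀ m, (∑ n ∈ Finset.range m, h * (nrm (z + 1) (U n).1 + nrm (z + 1) (U n).2)) * σ ≤
      E - (nrm 0 (U m).1 + nrm 0 (U m).2) := by
    intro m
    induction m with
    | zero => simpa using hinit
    | succ m ih =>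
      rw [Finset.sum_range_succ]
      have := hdec m (hexp m).2
      linarith
  refine ⟨h, hh0, ?_, fun n => (U n).1.coeff, fun n => (U n).2.coeff,
    fun n => ⟨(hsym n).1, (hsym n).2, (hzero n).1, (hzero n).2⟩,
    fun n s => ⟨wn_coeff_ne_top _ _, wn_coeff_ne_top _ _⟩, fun k => ⟨rfl, rfl⟩, fun n => ?_,
    fun m => ?_, fun n k => ?_, fun n k => ?_⟩
  · rw [hh]
    refine one_div_le_one_div_of_le (by positivity) ?_
    refine le_mul_of_one_le_right (by positivity) ?_
    have := mul_nonneg (add_pos hα0 hβ0).le hp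
    linarith
  · rw [wn_coeff, wn_coeff, ← ENNReal.ofReal_add (nrm_nonneg _ _) (nrm_nonneg _ _)]
    exact ENNReal.ofReal_le_ofReal (hexp n).1
  · simp_rw [wn_coeff, ← ENNReal.ofReal_add (nrm_nonneg _ _) (nrm_nonneg _ _),
      ← ENNReal.ofReal_mul hh0.le]
    rw [← ENNReal.ofReal_sum_of_nonneg fun n _ =>
      mul_nonneg hh0.le (add_nonneg (nrm_nonneg _ _) (nrm_nonneg _ _))]
    refine ENNReal.ofReal_le_ofReal ?_
    rw [le_div_iff₀ hσ]
    have := hsum m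
    have q0 := nrm_nonneg 0 (U m).1
    have q1 := nrm_nonneg 0 (U m).2
    linarith
  · beta_reduce
    rw [hstep1, coeff_eulerStep, coeff_polyFluxF hodd ρ F G (hsym n).1 (hsym n).2]
  · beta_reduce
    rw [hstep2, coeff_eulerStep, coeff_polyFluxG hodd ρ μ F G (hsym n).1 (hsym n).2]

/-! ### Bounds for the fluxes -/

theorem abs_cubic_le {c₁ c₂ c₃ c₄ A B L : ℝ} (h₁ : 0 ≤ c₁) (h₂ : 0 ≤ c₂) (h₃ : 0 ≤ c₃)
    (h₄ : 0 ≤ c₄) (hA : |A| ≤ L) (hB : |B| ≤ L) :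
    |cubic c₁ c₂ c₃ c₄ A B| ≤ (c₁ + c₂ + c₃ + c₄) * L ^ 3 := by
  have hL : 0 ≤ L := (abs_nonneg _).trans hA
  have a0 := abs_nonneg A
  have b0 := abs_nonneg B
  unfold cubic
  calc _ ≤ |c₁ * A ^ 3| + |c₂ * (A ^ 2 * B)| + |c₃ * (A * B ^ 2)| + |c₄ * B ^ 3| :=
        (abs_add_le _ _).trans (add_le_add_left ((abs_add_le _ _).trans
          (add_le_add_left (abs_add_le _ _) _)) _)
    _ = c₁ * |A| ^ 3 + c₂ * (|A| ^ 2 * |B|) + c₃ * (|A| * |B| ^ 2) + c₄ * |B| ^ 3 := by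
        simp only [abs_mul, abs_pow, abs_of_nonneg h₁, abs_of_nonneg h₂, abs_of_nonneg h₃,
          abs_of_nonneg h₄]
    _ ≤ c₁ * L ^ 3 + c₂ * (L ^ 2 * L) + c₃ * (L * L ^ 2) + c₄ * L ^ 3 := by gcongr
    _ = _ := by ring

theorem abs_cubic_sub_le {c₁ c₂ c₃ c₄ A B A' B' L : ℝ} (h₁ : 0 ≤ c₁) (h₂ : 0 ≤ c₂) (h₃ : 0 ≤ c₃)
    (h₄ : 0 ≤ c₄) (hA : |A| ≤ L) (hB : |B| ≤ L) (hA' : |A'| ≤ L) (hB' : |B'| ≤ L) :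
    |cubic c₁ c₂ c₃ c₄ A B - cubic c₁ c₂ c₃ c₄ A' B'| ≤
      3 * (c₁ + c₂ + c₃ + c₄) * L ^ 2 * (|A - A'| + |B - B'|) := by
  have hL : 0 ≤ L := (abs_nonneg _).trans hA
  have e : cubic c₁ c₂ c₃ c₄ A B - cubic c₁ c₂ c₃ c₄ A' B' =
      (c₁ * (A * A + A * A' + A' * A') + c₂ * (A * B + A' * B) + c₃ * (B * B)) * (A - A') +
      (c₂ * (A' * A') + c₃ * (A' * B + A' * B') + c₄ * (B * B + B * B' + B' * B')) * (B - B') := by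
    unfold cubic; ring
  have p : ∀ {x y : ℝ}, |x| ≤ L → |y| ≤ L → |x * y| ≤ L ^ 2 := fun hx hy => by
    rw [abs_mul, sq]; exact mul_le_mul hx hy (abs_nonneg _) hL
  have q1 : |c₁ * (A * A + A * A' + A' * A') + c₂ * (A * B + A' * B) + c₃ * (B * B)| ≤
      3 * (c₁ + c₂ + c₃ + c₄) * L ^ 2 := by
    have k1 := abs_le.1 (p hA hA); have k2 := abs_le.1 (p hA hA'); have k3 := abs_le.1 (p hA' hA')
    have k4 := abs_le.1 (p hA hB); have k5 := abs_le.1 (p hA' hB); have k6 := abs_le.1 (p hB hB)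
    have hL2 : 0 ≤ L ^ 2 := by positivity
    rw [abs_le]
    constructor <;> nlinarith [mul_nonneg h₂ hL2, mul_nonneg h₃ hL2, mul_nonneg h₄ hL2]
  have q2 : |c₂ * (A' * A') + c₃ * (A' * B + A' * B') + c₄ * (B * B + B * B' + B' * B')| ≤
      3 * (c₁ + c₂ + c₃ + c₄) * L ^ 2 := by
    have k1 := abs_le.1 (p hB hB); have k2 := abs_le.1 (p hB hB'); have k3 := abs_le.1 (p hB' hB')
    have k4 := abs_le.1 (p hA' hB); have k5 := abs_le.1 (p hA' hB'); have k6 := abs_le.1 (p hA' hA')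
    have hL2 : 0 ≤ L ^ 2 := by positivity
    rw [abs_le]
    constructor <;> nlinarith [mul_nonneg h₂ hL2, mul_nonneg h₃ hL2, mul_nonneg h₁ hL2]
  rw [e]
  refine (abs_add_le _ _).trans ?_
  rw [abs_mul, abs_mul, mul_add (3 * (c₁ + c₂ + c₃ + c₄) * L ^ 2)]
  exact add_le_add (mul_le_mul_of_nonneg_right q1 (abs_nonneg _))
    (mul_le_mul_of_nonneg_right q2 (abs_nonneg _))

theorem fluxF_eq_cubic (ρ f g p q : ℝ) :
    fluxF ρ f g p q = cubic (2 * ρ) 3 0 0 f g * p + cubic 2 3 0 0 f g * q := by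
  unfold fluxF cubic; ring

theorem fluxG_eq_cubic (ρ μ f g p q : ℝ) :
    fluxG ρ μ f g p q = cubic 0 (3 * ρ) 6 (2 * μ) f g * p + cubic 0 3 6 (2 * μ) f g * q := by
  unfold fluxG cubic; ring

/-- A flux `Φ` is a locally Lipschitz function of the heights times a linear function of their
derivatives; `C` is a constant for heights bounded by `L`. -/
structure FluxBound (Φ : ℝ → ℝ → ℝ → ℝ → ℝ) (L C : ℝ) : Prop where
  nonneg : 0 ≤ C
  bound : ∀ f g p q, |f| ≤ L → |g| ≤ L → |Φ f g p q| ≤ C * (|p| + |q|)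
  lip : ∀ f g p q f' g' p' q', |f| ≤ L → |g| ≤ L → |f'| ≤ L → |g'| ≤ L →
    |Φ f g p q - Φ f' g' p' q'| ≤
      C * (|p - p'| + |q - q'|) + C * ((|f - f'| + |g - g'|) * (|p'| + |q'|))

theorem FluxBound.of_cubic {Φ : ℝ → ℝ → ℝ → ℝ → ℝ} {c₁ c₂ c₃ c₄ d₁ d₂ d₃ d₄ L : ℝ} (hL : 0 ≤ L)
    (hc₁ : 0 ≤ c₁) (hc₂ : 0 ≤ c₂) (hc₃ : 0 ≤ c₃) (hc₄ : 0 ≤ c₄)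
    (hd₁ : 0 ≤ d₁) (hd₂ : 0 ≤ d₂) (hd₃ : 0 ≤ d₃) (hd₄ : 0 ≤ d₄)
    (hΦ : ∀ f g p q, Φ f g p q = cubic c₁ c₂ c₃ c₄ f g * p + cubic d₁ d₂ d₃ d₄ f g * q) :
    ∃ C, FluxBound Φ L C := by
  set s := c₁ + c₂ + c₃ + c₄ + (d₁ + d₂ + d₃ + d₄) with hs
  have hs0 : 0 ≤ s := by positivity
  refine ⟨s * L ^ 3 + 3 * s * L ^ 2, by positivity, fun f g p q hf hg => ?_,
    fun f g p q f' g' p' q' hf hg hf' hg' => ?_⟩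
  · have h1 := abs_cubic_le hc₁ hc₂ hc₃ hc₄ hf hg
    have h2 := abs_cubic_le hd₁ hd₂ hd₃ hd₄ hf hg
    rw [hΦ, mul_add]
    refine (abs_add_le _ _).trans (add_le_add ?_ ?_) <;> rw [abs_mul] <;> gcongr
    · refine h1.trans ?_
      rw [hs]
      nlinarith [pow_nonneg hL 3, pow_nonneg hL 2, mul_nonneg hs0 (pow_nonneg hL 2)]
    · refine h2.trans ?_
      rw [hs]
      nlinarith [pow_nonneg hL 3, pow_nonneg hL 2, mul_nonneg hs0 (pow_nonneg hL 2)]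
  · have h1 := abs_cubic_le hc₁ hc₂ hc₃ hc₄ hf hg
    have h2 := abs_cubic_le hd₁ hd₂ hd₃ hd₄ hf hg
    have l1 := abs_cubic_sub_le hc₁ hc₂ hc₃ hc₄ hf hg hf' hg'
    have l2 := abs_cubic_sub_le hd₁ hd₂ hd₃ hd₄ hf hg hf' hg'
    have a0 : 0 ≤ |f - f'| + |g - g'| := by positivity
    have g1 : |cubic c₁ c₂ c₃ c₄ f g| ≤ s * L ^ 3 + 3 * s * L ^ 2 := by
      refine h1.trans ?_
      rw [hs]
      nlinarith [pow_nonneg hL 3, pow_nonneg hL 2, mul_nonneg hs0 (pow_nonneg hL 2)]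
    have g2 : |cubic d₁ d₂ d₃ d₄ f g| ≤ s * L ^ 3 + 3 * s * L ^ 2 := by
      refine h2.trans ?_
      rw [hs]
      nlinarith [pow_nonneg hL 3, pow_nonneg hL 2, mul_nonneg hs0 (pow_nonneg hL 2)]
    have g3 : |cubic c₁ c₂ c₃ c₄ f g - cubic c₁ c₂ c₃ c₄ f' g'| ≤
        (s * L ^ 3 + 3 * s * L ^ 2) * (|f - f'| + |g - g'|) := by
      refine l1.trans (mul_le_mul_of_nonneg_right ?_ a0)
      rw [hs]
      nlinarith [pow_nonneg hL 3, pow_nonneg hL 2, mul_nonneg hs0 (pow_nonneg hL 3)]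
    have g4 : |cubic d₁ d₂ d₃ d₄ f g - cubic d₁ d₂ d₃ d₄ f' g'| ≤
        (s * L ^ 3 + 3 * s * L ^ 2) * (|f - f'| + |g - g'|) := by
      refine l2.trans (mul_le_mul_of_nonneg_right ?_ a0)
      rw [hs]
      nlinarith [pow_nonneg hL 3, pow_nonneg hL 2, mul_nonneg hs0 (pow_nonneg hL 3)]
    have e : Φ f g p q - Φ f' g' p' q' =
        (cubic c₁ c₂ c₃ c₄ f g * (p - p') + cubic d₁ d₂ d₃ d₄ f g * (q - q')) +
        ((cubic c₁ c₂ c₃ c₄ f g - cubic c₁ c₂ c₃ c₄ f' g') * p' +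
          (cubic d₁ d₂ d₃ d₄ f g - cubic d₁ d₂ d₃ d₄ f' g') * q') := by
      rw [hΦ, hΦ]; ring
    rw [e]
    refine (abs_add_le _ _).trans (add_le_add ?_ ?_)
    · rw [mul_add]
      refine (abs_add_le _ _).trans (add_le_add ?_ ?_) <;> rw [abs_mul] <;> gcongr
    · rw [← mul_assoc, mul_add]
      refine (abs_add_le _ _).trans (add_le_add ?_ ?_) <;> rw [abs_mul] <;> gcongr

theorem exists_fluxBound_F {ρ : ℝ} (hρ : 0 < ρ) {L : ℝ} (hL : 0 ≤ L) :
    ∃ C, FluxBound (fluxF ρ) L C :=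
  FluxBound.of_cubic hL (by positivity) (by norm_num) le_rfl le_rfl (by norm_num) (by norm_num) le_rfl le_rfl
    (fluxF_eq_cubic ρ)

theorem exists_fluxBound_G {ρ μ : ℝ} (hρ : 0 < ρ) (hμ : 0 < μ) {L : ℝ} (hL : 0 ≤ L) :
    ∃ C, FluxBound (fluxG ρ μ) L C :=
  FluxBound.of_cubic hL le_rfl (by positivity) (by norm_num) (by positivity) le_rfl (by norm_num)
    (by norm_num) (by positivity) (fluxG_eq_cubic ρ μ)

theorem FluxBound.mono {Φ : ℝ → ℝ → ℝ → ℝ → ℝ} {L C C' : ℝ} (h : FluxBound Φ L C) (hC : C ≤ C') :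
    FluxBound Φ L C' :=
  ⟨h.nonneg.trans hC, fun f g p q hf hg => (h.bound f g p q hf hg).trans (by gcongr),
    fun f g p q f' g' p' q' hf hg hf' hg' => (h.lip f g p q f' g' p' q' hf hg hf' hg').trans
      (by gcongr)⟩

theorem continuous_fluxF (ρ : ℝ) :
    Continuous fun y : ℝ × ℝ × ℝ × ℝ => fluxF ρ y.1 y.2.1 y.2.2.1 y.2.2.2 := by
  unfold fluxF; fun_prop

theorem continuous_fluxG (ρ μ : ℝ) :
    Continuous fun y : ℝ × ℝ × ℝ × ℝ => fluxG ρ μ y.1 y.2.1 y.2.2.1 y.2.2.2 := by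
  unfold fluxG; fun_prop

/-- The sum of the weighted Wiener norms of the two components. -/
noncomputable def pairNorm (s : ℕ) (c d : ℤ → ℂ) : ℝ≥0∞ := wn s c + wn s d

theorem norm_fourierC_le {u : Torus → ℝ} {B : ℝ} (h : ∀ x, |u x| ≤ B) (k : ℤ) :
    ‖fourierC u k‖ ≤ B := by
  rw [fourierC, fourierCoeff]
  refine (norm_integral_le_of_norm_le_const (C := B) (.of_forall fun x => ?_)).trans ?_
  · rw [norm_smul, norm_fourier_apply, one_mul, Complex.norm_real]; exact h x
  · simp

theorem abs_rser_le_of_le {c : ℤ → ℂ} {B : ℝ} (hB : 0 ≤ B) (h : wn 0 c ≤ ENNReal.ofReal B)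
    (x : Torus) : |rser c x| ≤ B :=
  (abs_rser_le (ne_top_of_le_ne_top ENNReal.ofReal_ne_top h) x).trans
    (ENNReal.toReal_le_of_le_ofReal hB h)

theorem abs_add_rser_le {F E : ℝ} (hF : 0 ≤ F) (hE : 0 ≤ E) {c : ℤ → ℂ} {L : ℝ} (hL : F + E ≤ L)
    (hc : wn 0 c ≤ ENNReal.ofReal E) (x : Torus) : |F + rser c x| ≤ L :=
  (abs_add_le _ _).trans
    ((add_le_add (abs_of_nonneg hF).le (abs_rser_le_of_le hE hc x)).trans hL)

theorem pairNorm_toReal_eq {s : ℕ} {c d : ℤ → ℂ} (h : pairNorm s c d ≠ ⊤) :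
    (pairNorm s c d).toReal = (wn s c).toReal + (wn s d).toReal := by
  obtain ⟨h1, h2⟩ := ENNReal.add_ne_top.1 h
  exact ENNReal.toReal_add h1 h2

theorem abs_Dcoef_le {z : ℕ} {c d : ℤ → ℂ} (h : pairNorm z c d ≠ ⊤) (x : Torus) :
    |rser (Dcoef z c) x| + |rser (Dcoef z d) x| ≤ (pairNorm z c d).toReal := by
  obtain ⟨h1, h2⟩ := ENNReal.add_ne_top.1 h
  rw [pairNorm_toReal_eq h]
  have e1 := abs_rser_le (c := Dcoef z c) (by rwa [wn_Dcoef, zero_add]) x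
  have e2 := abs_rser_le (c := Dcoef z d) (by rwa [wn_Dcoef, zero_add]) x
  rw [wn_Dcoef, zero_add] at e1 e2
  exact add_le_add e1 e2

theorem FluxBound.abs_phys_le {Φ : ℝ → ℝ → ℝ → ℝ → ℝ} {L C F G E : ℝ} (h : FluxBound Φ L C)
    (hF : 0 ≤ F) (hG : 0 ≤ G) (hE : 0 ≤ E) (hFL : F + E ≤ L) (hGL : G + E ≤ L) {z : ℕ}
    {c d : ℤ → ℂ} (h0 : pairNorm 0 c d ≤ ENNReal.ofReal E) (hz : pairNorm z c d ≠ ⊤) (x : Torus) :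
    |phys Φ z F G c d x| ≤ C * (pairNorm z c d).toReal := by
  refine (h.bound _ _ _ _ (abs_add_rser_le hF hE hFL (le_self_add.trans h0) x)
    (abs_add_rser_le hG hE hGL (le_add_self.trans h0) x)).trans ?_
  exact mul_le_mul_of_nonneg_left (abs_Dcoef_le hz x) h.nonneg

theorem Dcoef_sub (z : ℕ) (c d : ℤ → ℂ) : Dcoef z (c - d) = Dcoef z c - Dcoef z d := by
  ext k; simp only [Dcoef, Pi.sub_apply]; ring

/-- The difference of two fluxes is controlled by the difference of the norms of order `z`, up to a
term that carries the difference of the heights only in the norm of order zero. -/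
theorem FluxBound.abs_phys_sub_le {Φ : ℝ → ℝ → ℝ → ℝ → ℝ} {L C F G E : ℝ} (h : FluxBound Φ L C)
    (hF : 0 ≤ F) (hG : 0 ≤ G) (hE : 0 ≤ E) (hFL : F + E ≤ L) (hGL : G + E ≤ L) {z : ℕ}
    {c d c' d' : ℤ → ℂ} (h0 : pairNorm 0 c d ≤ ENNReal.ofReal E)
    (h0' : pairNorm 0 c' d' ≤ ENNReal.ofReal E) (hz : pairNorm z c d ≠ ⊤)
    (hz' : pairNorm z c' d' ≠ ⊤) (x : Torus) :
    |phys Φ z F G c d x - phys Φ z F G c' d' x| ≤ C * (pairNorm z (c - c') (d - d')).toReal +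
      C * ((pairNorm 0 (c - c') (d - d')).toReal * (pairNorm z c' d').toReal) := by
  have t0 := ne_top_of_le_ne_top ENNReal.ofReal_ne_top h0
  have t0' := ne_top_of_le_ne_top ENNReal.ofReal_ne_top h0'
  obtain ⟨a1, a2⟩ := ENNReal.add_ne_top.1 t0
  obtain ⟨b1, b2⟩ := ENNReal.add_ne_top.1 t0'
  obtain ⟨a3, a4⟩ := ENNReal.add_ne_top.1 hz
  obtain ⟨b3, b4⟩ := ENNReal.add_ne_top.1 hz'
  have n0 : pairNorm 0 (c - c') (d - d') ≠ ⊤ := ENNReal.add_ne_top.2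
    ⟨ne_top_of_le_ne_top (ENNReal.add_ne_top.2 ⟨a1, b1⟩) (wn_sub_le _ _ _),
      ne_top_of_le_ne_top (ENNReal.add_ne_top.2 ⟨a2, b2⟩) (wn_sub_le _ _ _)⟩
  have nz : pairNorm z (c - c') (d - d') ≠ ⊤ := ENNReal.add_ne_top.2
    ⟨ne_top_of_le_ne_top (ENNReal.add_ne_top.2 ⟨a3, b3⟩) (wn_sub_le _ _ _),
      ne_top_of_le_ne_top (ENNReal.add_ne_top.2 ⟨a4, b4⟩) (wn_sub_le _ _ _)⟩
  refine (h.lip _ _ _ _ _ _ _ _ (abs_add_rser_le hF hE hFL (le_self_add.trans h0) x)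
    (abs_add_rser_le hG hE hGL (le_add_self.trans h0) x)
    (abs_add_rser_le hF hE hFL (le_self_add.trans h0') x)
    (abs_add_rser_le hG hE hGL (le_add_self.trans h0') x)).trans ?_
  have hD : ∀ e : ℤ → ℂ, wn z e ≠ ⊤ → wn 0 (Dcoef z e) ≠ ⊤ := fun e he => by
    rwa [wn_Dcoef, zero_add]
  have k1 := abs_Dcoef_le nz x
  rw [Dcoef_sub, Dcoef_sub, rser_sub (hD _ a3) (hD _ b3), rser_sub (hD _ a4) (hD _ b4)] at k1
  have k2 := abs_Dcoef_le hz' x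
  have k3 : |F + rser c x - (F + rser c' x)| + |G + rser d x - (G + rser d' x)| ≤
      (pairNorm 0 (c - c') (d - d')).toReal := by
    rw [pairNorm_toReal_eq n0, add_sub_add_left_eq_sub, add_sub_add_left_eq_sub,
      ← rser_sub a1 b1, ← rser_sub a2 b2]
    obtain ⟨n1, n2⟩ := ENNReal.add_ne_top.1 n0
    exact add_le_add (abs_rser_le n1 x) (abs_rser_le n2 x)
  have hC := h.nonneg
  gcongr

/-! ### Measurability -/

theorem measurable_wn {c : ℝ → ℤ → ℂ} (hc : ∀ k, Measurable fun t => c t k) (s : ℕ) :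
    Measurable fun t => wn s (c t) := by
  refine Measurable.tsum fun k => ?_
  exact (((hc k).norm).const_mul _).ennreal_ofReal

theorem measurable_rser {c : ℝ → ℤ → ℂ} (hc : ∀ k, Measurable fun t => c t k)
    (h : ∀ t, wn 0 (c t) ≠ ⊤) : Measurable fun p : ℝ × Torus => rser (c p.1) p.2 := by
  have : Measurable fun p : ℝ × Torus => ser (c p.1) p.2 := by
    refine measurable_of_tendsto_metrizable' (atTop : Filter (Finset ℤ))
      (f := fun S (p : ℝ × Torus) => ∑ k ∈ S, c p.1 k * fourier k p.2) (fun S => ?_) ?_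
    · refine Finset.measurable_sum S fun k _ => ?_
      exact ((hc k).comp measurable_fst).mul ((fourier k).continuous.measurable.comp measurable_snd)
    · rw [tendsto_pi_nhds]
      exact fun p => (summable_ser (h p.1) p.2).hasSum
  exact Complex.measurable_re.comp this

theorem measurable_Dcoef {c : ℝ → ℤ → ℂ} (hc : ∀ k, Measurable fun t => c t k) (z : ℕ) (k : ℤ) :
    Measurable fun t => Dcoef z (c t) k := (hc k).const_mul _

theorem measurable_phys {Φ : ℝ → ℝ → ℝ → ℝ → ℝ}
    (hΦ : Continuous fun y : ℝ × ℝ × ℝ × ℝ => Φ y.1 y.2.1 y.2.2.1 y.2.2.2) {z : ℕ} (F G : ℝ)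
    {c d : ℝ → ℤ → ℂ} (hc : ∀ k, Measurable fun t => c t k) (hd : ∀ k, Measurable fun t => d t k)
    (h0c : ∀ t, wn 0 (c t) ≠ ⊤) (h0d : ∀ t, wn 0 (d t) ≠ ⊤)
    (hzc : ∀ t, wn z (c t) ≠ ⊤) (hzd : ∀ t, wn z (d t) ≠ ⊤) :
    Measurable fun p : ℝ × Torus => phys Φ z F G (c p.1) (d p.1) p.2 := by
  have m1 := measurable_rser hc h0c
  have m2 := measurable_rser hd h0d
  have m3 := measurable_rser (measurable_Dcoef hc z) (fun t => by
    rw [wn_Dcoef, zero_add]; exact hzc t)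
  have m4 := measurable_rser (measurable_Dcoef hd z) (fun t => by
    rw [wn_Dcoef, zero_add]; exact hzd t)
  exact hΦ.measurable.comp ((m1.const_add F).prodMk ((m2.const_add G).prodMk (m3.prodMk m4)))

theorem measurable_fourierC {u : ℝ → Torus → ℝ} (hu : Measurable fun p : ℝ × Torus => u p.1 p.2)
    (k : ℤ) : Measurable fun t => fourierC (u t) k := by
  have : StronglyMeasurable fun p : ℝ × Torus => fourier (-k) p.2 • (u p.1 p.2 : ℂ) :=
    (((fourier (-k)).continuous.measurable.comp measurable_snd).mul
      (Complex.measurable_ofReal.comp hu)).stronglyMeasurable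
  exact this.integral_prod_right.measurable

/-! ### Approximate solutions, piecewise constant in time -/

theorem lintegral_step {h : ℝ} (hh : 0 < h) (φ : ℕ → ℝ≥0∞) :
    ∫⁻ t in Ioi (0 : ℝ), φ ⌊t / h⌋₊ = ∑' n, ENNReal.ofReal h * φ n := by
  have hm : Measurable fun t : ℝ => ⌊t / h⌋₊ := Nat.measurable_floor.comp (measurable_id.div_const h)
  rw [setLIntegral_congr Ioi_ae_eq_Ici,
    ← lintegral_map (f := φ) (g := fun t : ℝ => ⌊t / h⌋₊) (measurable_of_countable _) hm,
    lintegral_countable']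
  refine tsum_congr fun n => ?_
  rw [mul_comm, Measure.map_apply hm (measurableSet_singleton n),
    Measure.restrict_apply (hm (measurableSet_singleton n))]
  congr 1
  have : (fun t : ℝ => ⌊t / h⌋₊) ⁻¹' {n} ∩ Ici 0 = Ico (n * h) ((n + 1) * h) := by
    ext t
    simp only [mem_inter_iff, mem_preimage, mem_singleton_iff, mem_Ici, mem_Ico]
    constructor
    · rintro ⟨h1, h2⟩
      rw [Nat.floor_eq_iff (by positivity), le_div_iff₀ hh, div_lt_iff₀ hh] at h1
      exact h1
    · rintro ⟨h1, h2⟩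
      have h3 : 0 ≤ t := le_trans (by positivity) h1
      refine ⟨?_, h3⟩
      rw [Nat.floor_eq_iff (by positivity), le_div_iff₀ hh, div_lt_iff₀ hh]
      exact ⟨h1, h2⟩
  rw [this, Real.volume_Ico]
  congr 1; ring

theorem integral_step {h : ℝ} (hh : 0 < h) (φ : ℕ → ℂ) (m : ℕ) :
    IntervalIntegrable (fun t => φ ⌊t / h⌋₊) volume 0 (h * m) ∧
      ∫ t in (0 : ℝ)..(h * m), φ ⌊t / h⌋₊ = ∑ n ∈ Finset.range m, (h : ℂ) * φ n := by
  induction m with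
  | zero => simp
  | succ m ih =>
    have hle : h * (m : ℝ) ≤ h * ((m + 1 : ℕ) : ℝ) := by push_cast; nlinarith
    have hc : ∀ᵐ t, t ∈ Set.uIoc (h * (m : ℝ)) (h * ((m + 1 : ℕ) : ℝ)) →
        φ ⌊t / h⌋₊ = φ m := by
      have hne : ∀ᵐ t : ℝ, t ≠ h * ((m + 1 : ℕ) : ℝ) := by
        simp [ae_iff, measure_singleton]
      filter_upwards [hne] with t ht hmem
      rw [uIoc_of_le hle] at hmem
      congr 1
      have h0 : 0 < t := lt_of_le_of_lt (by positivity) hmem.1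
      rw [Nat.floor_eq_iff (by positivity), le_div_iff₀ hh, div_lt_iff₀ hh]
      have h3 := lt_of_le_of_ne hmem.2 ht
      push_cast at h3
      exact ⟨by linarith [hmem.1], by linarith⟩
    have hi : IntervalIntegrable (fun t => φ ⌊t / h⌋₊) volume (h * (m : ℝ))
        (h * ((m + 1 : ℕ) : ℝ)) := by
      refine (intervalIntegrable_const (c := φ m)).congr_ae ?_
      rw [Filter.EventuallyEq, ae_restrict_iff' measurableSet_uIoc]
      filter_upwards [hc] with t ht hm using (ht hm).symm
    refine ⟨ih.1.trans hi, ?_⟩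
    rw [← intervalIntegral.integral_add_adjacent_intervals ih.1 hi, ih.2,
      intervalIntegral.integral_congr_ae hc, intervalIntegral.integral_const,
      Finset.sum_range_succ, Complex.real_smul]
    push_cast
    ring

/-- An approximate solution at truncation level `N`: a path of coefficients that is piecewise
constant in time, satisfies the a priori bounds of the system, and solves the truncated system in
integrated form up to rounding of the time to a multiple of the step size `h`. -/
structure Approx (Φ Ψ : ℝ → ℝ → ℝ → ℝ → ℝ) (z : ℕ) (F G E σ : ℝ) (c₀ d₀ : ℤ → ℂ) (N : ℕ) where
  h : ℝ
  h_pos : 0 < h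
  h_le : h ≤ 1 / ((N : ℝ) + 1)
  c : ℝ → ℤ → ℂ
  d : ℝ → ℤ → ℂ
  sym_c : ∀ t, Sym (c t)
  sym_d : ∀ t, Sym (d t)
  zero_c : ∀ t, c t 0 = 0
  zero_d : ∀ t, d t 0 = 0
  wn_c : ∀ t s, wn s (c t) ≠ ⊤
  wn_d : ∀ t s, wn s (d t) ≠ ⊤
  meas_c : ∀ k, Measurable fun t => c t k
  meas_d : ∀ k, Measurable fun t => d t k
  le_E : ∀ t, pairNorm 0 (c t) (d t) ≤ ENNReal.ofReal E
  decay : ∀ t, 0 ≤ t → pairNorm 0 (c t) (d t) ≤ ENNReal.ofReal (E * Real.exp (-σ * (t - h)))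
  top_le : ∫⁻ t in Ioi (0 : ℝ), pairNorm (z + 1) (c t) (d t) ≤ ENNReal.ofReal (E / σ)
  eq_c : ∀ t k, c t k = (if |k| ≤ N then c₀ k else 0) + ∫ s in (0 : ℝ)..(h * ⌊t / h⌋₊),
    (if |k| ≤ N then Complex.I * k else 0) * fourierC (phys Φ z F G (c s) (d s)) k
  eq_d : ∀ t k, d t k = (if |k| ≤ N then d₀ k else 0) + ∫ s in (0 : ℝ)..(h * ⌊t / h⌋₊),
    (if |k| ≤ N then Complex.I * k else 0) * fourierC (phys Ψ z F G (c s) (d s)) k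

theorem eq_of_step {h : ℝ} (hh : 0 < h) (a : ℕ → ℂ) (κ : ℂ) (J : ℕ → ℂ)
    (ha : ∀ n, a (n + 1) = a n + h * κ * J n) (t : ℝ) :
    a ⌊t / h⌋₊ = a 0 + ∫ s in (0 : ℝ)..(h * ⌊t / h⌋₊), κ * J ⌊s / h⌋₊ := by
  rw [(integral_step hh (fun n => κ * J n) ⌊t / h⌋₊).2]
  generalize ⌊t / h⌋₊ = m
  induction m with
  | zero => simp
  | succ m ih => rw [ha, ih, Finset.sum_range_succ]; ring

/-- The Euler iterates, extended to be constant on the time steps, form an approximate solution. -/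
theorem nonempty_approx {z : ℕ} {ρ μ F G E σ : ℝ} (hz : z = 1 ∨ z = 3) (hρ : 0 < ρ) (hμ : 0 < μ)
    (hF : 0 < F) (hG : 0 < G) (hσ : 0 < σ) (hσ₁ : σ ≤ Sigma1 ρ μ F G E)
    (hσ₂ : σ ≤ Sigma2 ρ μ F G E) {c₀ d₀ : ℤ → ℂ} (hc : Sym c₀) (hd : Sym d₀) (hc0 : c₀ 0 = 0)
    (hd0 : d₀ 0 = 0) (hE0 : 0 ≤ E) (hE : wn 0 c₀ + wn 0 d₀ ≤ ENNReal.ofReal E) (N : ℕ) :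
    Nonempty (Approx (fluxF ρ) (fluxG ρ μ) z F G E σ c₀ d₀ N) := by
  obtain ⟨h, hh, hhN, c, d, h1, h2, h3, h4, h5, h6, h7⟩ :=
    exists_euler hz hρ hμ hF hG hσ hσ₁ hσ₂ hc hd hc0 hd0 hE0 hE N
  have hm : Measurable fun t : ℝ => ⌊t / h⌋₊ := Nat.measurable_floor.comp (measurable_id.div_const h)
  refine ⟨⟨h, hh, hhN, fun t => c ⌊t / h⌋₊, fun t => d ⌊t / h⌋₊, fun t => (h1 _).1,
    fun t => (h1 _).2.1, fun t => (h1 _).2.2.1, fun t => (h1 _).2.2.2, fun t s => (h2 _ s).1,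
    fun t s => (h2 _ s).2, fun k => (measurable_of_countable fun n : ℕ => c n k).comp hm,
    fun k => (measurable_of_countable fun n : ℕ => d n k).comp hm, fun t => ?_, fun t ht => ?_,
    ?_, fun t k => ?_, fun t k => ?_⟩⟩
  · refine (h4 _).trans (ENNReal.ofReal_le_ofReal ?_)
    refine mul_le_of_le_one_right hE0 (Real.exp_le_one_iff.2 ?_)
    have : (0 : ℝ) ≤ ⌊t / h⌋₊ * h := by positivity
    nlinarith
  · refine (h4 _).trans (ENNReal.ofReal_le_ofReal ?_)
    have h8 : t - h ≤ ⌊t / h⌋₊ * h := by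
      have := (Nat.lt_floor_add_one (t / h)).le
      rw [div_le_iff₀ hh] at this
      linarith
    gcongr E * Real.exp ?_
    nlinarith
  · rw [lintegral_step hh (fun n => pairNorm (z + 1) (c n) (d n)), ENNReal.tsum_eq_iSup_nat]
    exact iSup_le h5
  · rw [← (h3 k).1]
    refine eq_of_step hh (fun n => c n k) _ (fun n => fourierC (phys (fluxF ρ) z F G (c n) (d n)) k)
      (fun n => ?_) t
    rw [h6]
    split_ifs <;> ring
  · rw [← (h3 k).2]
    refine eq_of_step hh (fun n => d n k) _
      (fun n => fourierC (phys (fluxG ρ μ) z F G (c n) (d n)) k) (fun n => ?_) t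
    rw [h7]
    split_ifs <;> ring

/-! ### Compactness -/

/-- A bounded, asymptotically equicontinuous sequence of paths indexed by a countable set of modes
has a subsequence that converges at all times in all modes. -/
theorem exists_subseq_tendsto {ι : Type*} [Countable ι] {V : Type*} [NormedAddCommGroup V]
    [ProperSpace V] {a : ℕ → ℝ → ι → V} {B : ℝ} (hB : ∀ N t i, ‖a N t i‖ ≤ B)
    (heq : ∀ i t, ∀ ε > 0, ∃ δ > 0, ∃ N₀, ∀ N ≥ N₀, ∀ s, |s - t| < δ → ‖a N s i - a N t i‖ < ε) :
    ∃ φ : ℕ → ℕ, StrictMono φ ∧ ∃ b : ℝ → ι → V, ∀ t i,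
      Tendsto (fun n => a (φ n) t i) atTop (𝓝 (b t i)) := by
  -- the diagonal argument for rational times is sequential compactness of a countable product
  have hcomp : IsCompact (Set.pi univ fun _ : ℚ × ι => Metric.closedBall (0 : V) B) :=
    isCompact_univ_pi fun _ => isCompact_closedBall _ _
  obtain ⟨x, _, φ, hφ, hx⟩ := hcomp.isSeqCompact
    (x := fun N (p : ℚ × ι) => a N (p.1 : ℝ) p.2)
    (fun N p _ => mem_closedBall_zero_iff.2 (hB N _ _))
  refine ⟨φ, hφ, ?_⟩
  have hlim : ∀ t i, ∃ b, Tendsto (fun n => a (φ n) t i) atTop (𝓝 b) := by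
    intro t i
    refine cauchySeq_tendsto_of_complete (Metric.cauchySeq_iff'.2 fun ε hε => ?_)
    obtain ⟨δ, hδ, N₀, hN₀⟩ := heq i t (ε / 3) (by positivity)
    obtain ⟨q, hq1, hq2⟩ := exists_rat_btwn (show t - δ < t by linarith)
    have hqt : |(q : ℝ) - t| < δ := by rw [abs_lt]; constructor <;> linarith
    have hc : CauchySeq fun n => a (φ n) (q : ℝ) i :=
      ((tendsto_pi_nhds.1 hx) (q, i)).cauchySeq
    obtain ⟨N₁, hN₁⟩ := Metric.cauchySeq_iff'.1 hc (ε / 3) (by positivity)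
    obtain ⟨N₂, hN₂⟩ := Metric.cauchySeq_iff.1 hc (ε / 3) (by positivity)
    refine ⟨max N₀ N₂, fun n hn => ?_⟩
    have g1 := hN₀ (φ n) (le_trans ((le_max_left _ _).trans hn) (hφ.id_le n)) q hqt
    have g2 := hN₀ (φ (max N₀ N₂)) (le_trans (le_max_left _ _) (hφ.id_le _)) q hqt
    have g3 := hN₂ n ((le_max_right _ _).trans hn) (max N₀ N₂) (le_max_right _ _)
    rw [dist_eq_norm] at g3 ⊢
    calc _ = ‖-(a (φ n) q i - a (φ n) t i) + (a (φ n) q i - a (φ (max N₀ N₂)) q i) +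
          (a (φ (max N₀ N₂)) q i - a (φ (max N₀ N₂)) t i)‖ := by congr 1; abel
      _ ≤ _ := norm_add₃_le
      _ < ε := by rw [norm_neg]; linarith
  choose b hb using hlim
  exact ⟨b, hb⟩

/-- Interpolation of the norm of order `z` with a small multiple of the norm of order `z + 1`. -/
theorem wn_interp {z : ℕ} {δ : ℝ} (hδ : 0 < δ) (c : ℤ → ℂ) :
    wn z c ≤ ENNReal.ofReal δ * wn (z + 1) c + ENNReal.ofReal (δ⁻¹ ^ z) * wn 0 c := by
  simp only [wn]
  rw [← ENNReal.tsum_mul_left, ← ENNReal.tsum_mul_left, ← ENNReal.tsum_add]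
  refine ENNReal.tsum_le_tsum fun k => ?_
  rw [← ENNReal.ofReal_mul hδ.le, ← ENNReal.ofReal_mul (by positivity),
    ← ENNReal.ofReal_add (by positivity) (by positivity)]
  refine ENNReal.ofReal_le_ofReal ?_
  have hk := abs_nonneg (k : ℝ)
  have : |(k : ℝ)| ^ z ≤ δ * |(k : ℝ)| ^ (z + 1) + δ⁻¹ ^ z := by
    rcases le_total (|(k : ℝ)|) δ⁻¹ with h | h
    · have := pow_le_pow_left₀ hk h z
      have : 0 ≤ δ * |(k : ℝ)| ^ (z + 1) := by positivity
      linarith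
    · have h1 : 1 ≤ δ * |(k : ℝ)| := by
        rw [inv_le_iff_one_le_mul₀ hδ] at h; linarith
      have h2 : |(k : ℝ)| ^ z ≤ δ * |(k : ℝ)| ^ (z + 1) := by
        calc _ ≤ |(k : ℝ)| ^ z * (δ * |(k : ℝ)|) := le_mul_of_one_le_right (by positivity) h1
          _ = _ := by ring
      have : 0 ≤ δ⁻¹ ^ z := by positivity
      linarith
  calc _ ≤ (δ * |(k : ℝ)| ^ (z + 1) + δ⁻¹ ^ z) * ‖c k‖ := by gcongr
    _ = _ := by ring

theorem pairNorm_interp {z : ℕ} {δ : ℝ} (hδ : 0 < δ) (c d : ℤ → ℂ) :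
    pairNorm z c d ≤ ENNReal.ofReal δ * pairNorm (z + 1) c d +
      ENNReal.ofReal (δ⁻¹ ^ z) * pairNorm 0 c d := by
  refine (add_le_add (wn_interp hδ c) (wn_interp hδ d)).trans (le_of_eq ?_)
  simp only [pairNorm]; ring

namespace Approx

variable {Φ Ψ : ℝ → ℝ → ℝ → ℝ → ℝ} {z : ℕ} {F G E σ : ℝ} {c₀ d₀ : ℤ → ℂ} {N : ℕ}

theorem abs_round_sub_le (A : Approx Φ Ψ z F G E σ c₀ d₀ N) (s t : ℝ) :
    |A.h * ⌊s / A.h⌋₊ - A.h * ⌊t / A.h⌋₊| ≤ |s - t| + A.h := by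
  have key : ∀ s t : ℝ, s ≤ t → A.h * ⌊t / A.h⌋₊ - A.h * ⌊s / A.h⌋₊ ≤ t - s + A.h := by
    intro s t hst
    have hh := A.h_pos
    rcases le_total t 0 with ht | ht
    · rw [Nat.floor_of_nonpos (div_nonpos_of_nonpos_of_nonneg ht hh.le),
        Nat.floor_of_nonpos (div_nonpos_of_nonpos_of_nonneg (hst.trans ht) hh.le)]
      simp only [Nat.cast_zero, mul_zero, sub_zero]
      linarith
    · have h1 := Nat.floor_le (div_nonneg ht hh.le)
      rw [le_div_iff₀ hh] at h1
      have h2 := (Nat.lt_floor_add_one (s / A.h)).le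
      rw [div_le_iff₀ hh] at h2
      linarith
  have mono : ∀ s t : ℝ, s ≤ t → A.h * (⌊s / A.h⌋₊ : ℝ) ≤ A.h * ⌊t / A.h⌋₊ := fun s t hst => by
    have hh := A.h_pos
    gcongr
  rcases le_total s t with h | h
  · rw [abs_sub_comm, abs_of_nonneg (sub_nonneg.2 (mono s t h)), abs_sub_comm,
      abs_of_nonneg (sub_nonneg.2 h)]
    exact key s t h
  · rw [abs_of_nonneg (sub_nonneg.2 (mono t s h)), abs_of_nonneg (sub_nonneg.2 h)]
    exact key t s h

theorem wn_pair (A : Approx Φ Ψ z F G E σ c₀ d₀ N) (t : ℝ) (s : ℕ) :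
    pairNorm s (A.c t) (A.d t) ≠ ⊤ := ENNReal.add_ne_top.2 ⟨A.wn_c t s, A.wn_d t s⟩

theorem measurable_pairNorm (A : Approx Φ Ψ z F G E σ c₀ d₀ N) (s : ℕ) :
    Measurable fun t => pairNorm s (A.c t) (A.d t) :=
  (measurable_wn A.meas_c s).add (measurable_wn A.meas_d s)

/-- Over short times the norm of order `ζ` has small integral, uniformly in the approximation. -/
theorem setLIntegral_le (A : Approx Φ Ψ z F G E σ c₀ d₀ N) {δ : ℝ} (hδ : 0 < δ) {a b : ℝ}
    (ha : 0 ≤ a) :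
    ∫⁻ t in Ioc a b, pairNorm z (A.c t) (A.d t) ≤ ENNReal.ofReal δ * ENNReal.ofReal (E / σ) +
      ENNReal.ofReal (δ⁻¹ ^ z) * (ENNReal.ofReal E * ENNReal.ofReal (b - a)) := by
  refine (lintegral_mono fun t => pairNorm_interp hδ _ _).trans ?_
  rw [lintegral_add_left ((A.measurable_pairNorm _).const_mul _),
    lintegral_const_mul _ (A.measurable_pairNorm _), lintegral_const_mul _ (A.measurable_pairNorm _)]
  gcongr
  · exact (lintegral_mono_set fun t ht => lt_of_le_of_lt ha ht.1).trans A.top_le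
  · refine (lintegral_mono fun t => A.le_E t).trans ?_
    rw [setLIntegral_const, Real.volume_Ioc]

theorem norm_integral_le (A : Approx Φ Ψ z F G E σ c₀ d₀ N) {Θ : ℝ → ℝ → ℝ → ℝ → ℝ} {L C : ℝ}
    (hΘ : FluxBound Θ L C) (hF : 0 ≤ F) (hG : 0 ≤ G) (hE : 0 ≤ E) (hFL : F + E ≤ L)
    (hGL : G + E ≤ L) {κ : ℂ} (k : ℤ) {a b : ℝ} (hab : a ≤ b) :
    ENNReal.ofReal ‖∫ s in a..b, κ * fourierC (phys Θ z F G (A.c s) (A.d s)) k‖ ≤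
      ENNReal.ofReal (‖κ‖ * C) * ∫⁻ t in Ioc a b, pairNorm z (A.c t) (A.d t) := by
  rw [intervalIntegral.integral_of_le hab, ofReal_norm]
  refine (enorm_integral_le_lintegral_enorm _).trans ?_
  rw [← lintegral_const_mul _ (A.measurable_pairNorm _)]
  refine lintegral_mono fun t => ?_
  have h1 := norm_fourierC_le (hΘ.abs_phys_le hF hG hE hFL hGL (A.le_E t) (A.wn_pair t z)) k
  rw [← ofReal_norm, norm_mul, ← ENNReal.ofReal_toReal (A.wn_pair t z),
    ← ENNReal.ofReal_mul (mul_nonneg (norm_nonneg _) hΘ.nonneg), mul_assoc]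
  exact ENNReal.ofReal_le_ofReal (mul_le_mul_of_nonneg_left h1 (norm_nonneg _))

theorem intervalIntegrable (A : Approx Φ Ψ z F G E σ c₀ d₀ N) {Θ : ℝ → ℝ → ℝ → ℝ → ℝ} {L C : ℝ}
    (hΘ : FluxBound Θ L C) (hΘc : Continuous fun y : ℝ × ℝ × ℝ × ℝ => Θ y.1 y.2.1 y.2.2.1 y.2.2.2)
    (hF : 0 ≤ F) (hG : 0 ≤ G) (hE : 0 ≤ E) (hFL : F + E ≤ L)
    (hGL : G + E ≤ L) (κ : ℂ) (k : ℤ) {b : ℝ} (hb : 0 ≤ b) :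
    IntervalIntegrable (fun s => κ * fourierC (phys Θ z F G (A.c s) (A.d s)) k) volume 0 b := by
  rw [intervalIntegrable_iff_integrableOn_Ioc_of_le hb]
  refine ⟨((measurable_fourierC (measurable_phys hΘc F G A.meas_c A.meas_d (fun t => A.wn_c t 0)
    (fun t => A.wn_d t 0) (fun t => A.wn_c t z) (fun t => A.wn_d t z)) k).const_mul
      κ).aestronglyMeasurable, ?_⟩
  have h1 : ∫⁻ t in Ioc 0 b, ENNReal.ofReal (‖κ‖ * C) * pairNorm z (A.c t) (A.d t) < ⊤ := by
    rw [lintegral_const_mul _ (A.measurable_pairNorm _)]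
    refine ENNReal.mul_lt_top ENNReal.ofReal_lt_top
      ((A.setLIntegral_le one_pos le_rfl).trans_lt ?_)
    finiteness
  refine lt_of_le_of_lt (lintegral_mono fun t => ?_) h1
  have h1 := norm_fourierC_le (hΘ.abs_phys_le hF hG hE hFL hGL (A.le_E t) (A.wn_pair t z)) k
  rw [← ofReal_norm, norm_mul, ← ENNReal.ofReal_toReal (A.wn_pair t z),
    ← ENNReal.ofReal_mul (mul_nonneg (norm_nonneg _) hΘ.nonneg), mul_assoc]
  exact ENNReal.ofReal_le_ofReal (mul_le_mul_of_nonneg_left h1 (norm_nonneg _))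

/-- Asymptotic equicontinuity of each mode, for one component of the approximations. -/
theorem equicontinuous {A : ∀ N, Approx Φ Ψ z F G E σ c₀ d₀ N} {Θ : ℝ → ℝ → ℝ → ℝ → ℝ} {L C : ℝ}
    (hΘ : FluxBound Θ L C) (hΘc : Continuous fun y : ℝ × ℝ × ℝ × ℝ => Θ y.1 y.2.1 y.2.2.1 y.2.2.2)
    (hF : 0 ≤ F) (hG : 0 ≤ G) (hE : 0 ≤ E) (hσ : 0 < σ) (hFL : F + E ≤ L)
    (hGL : G + E ≤ L) {e : ℕ → ℝ → ℤ → ℂ} {e₀ : ℤ → ℂ}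
    (he : ∀ N t k, e N t k = (if |k| ≤ N then e₀ k else 0) +
      ∫ s in (0 : ℝ)..((A N).h * ⌊t / (A N).h⌋₊), (if |k| ≤ N then Complex.I * k else 0) *
        fourierC (phys Θ z F G ((A N).c s) ((A N).d s)) k)
    (k : ℤ) (t ε : ℝ) (hε : 0 < ε) : ∃ δ > 0, ∃ N₀ : ℕ, ∀ N ≥ N₀, ∀ s, |s - t| < δ →
      ‖e N s k - e N t k‖ < ε := by
  -- On a time interval of length `ℓ` the flux is at most `η` times the integral of the norm of order
  -- `z + 1`, which is bounded, plus a constant depending on `η` times `ℓ`.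
  set K := |(k : ℝ)| * C with hK
  have hK0 : 0 ≤ K := mul_nonneg (abs_nonneg _) hΘ.nonneg
  have hEσ : 0 ≤ E / σ := by positivity
  set η := ε / (4 * (K * (E / σ) + 1)) with hη
  have hη0 : 0 < η := by positivity
  set P := K * (η⁻¹ ^ z * E) with hP
  have hP0 : 0 ≤ P := by positivity
  obtain ⟨N₀, hN₀⟩ := exists_nat_one_div_lt (show 0 < ε / (8 * (P + 1)) by positivity)
  refine ⟨ε / (8 * (P + 1)), by positivity, N₀, fun N hN s hs => ?_⟩
  have hhN : (A N).h ≤ ε / (8 * (P + 1)) := by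
    refine (A N).h_le.trans (le_trans ?_ hN₀.le)
    exact one_div_le_one_div_of_le (by positivity) (by exact_mod_cast Nat.succ_le_succ hN)
  have hround : |(A N).h * ⌊s / (A N).h⌋₊ - (A N).h * ⌊t / (A N).h⌋₊| ≤ ε / (4 * (P + 1)) := by
    refine ((A N).abs_round_sub_le s t).trans ?_
    have : ε / (4 * (P + 1)) = ε / (8 * (P + 1)) + ε / (8 * (P + 1)) := by field_simp; norm_num
    linarith
  have hh := (A N).h_pos
  set κ : ℂ := if |k| ≤ N then Complex.I * k else 0 with hκ
  have hκn : ‖κ‖ ≤ |(k : ℝ)| := by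
    rw [hκ]; split_ifs <;> simp
  -- the difference is an integral over the interval between the rounded times
  have main : ∀ a b : ℝ, 0 ≤ a → a ≤ b → b - a ≤ ε / (4 * (P + 1)) →
      ‖∫ s in a..b, κ * fourierC (phys Θ z F G ((A N).c s) ((A N).d s)) k‖ < ε := by
    intro a b ha hab hlen
    have h1 := (A N).norm_integral_le hΘ hF hG hE hFL hGL (κ := κ) k hab
    have h2 := h1.trans (mul_le_mul_right ((A N).setLIntegral_le hη0 ha) _)
    rw [← ENNReal.ofReal_mul hη0.le, ← ENNReal.ofReal_mul hE, ← ENNReal.ofReal_mul (by positivity),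
      ← ENNReal.ofReal_add (by positivity)
        (mul_nonneg (by positivity) (mul_nonneg hE (sub_nonneg.2 hab))),
      ← ENNReal.ofReal_mul (mul_nonneg (norm_nonneg _) hΘ.nonneg),
      ENNReal.ofReal_le_ofReal_iff (mul_nonneg (mul_nonneg (norm_nonneg _) hΘ.nonneg)
        (add_nonneg (by positivity) (mul_nonneg (by positivity)
          (mul_nonneg hE (sub_nonneg.2 hab)))))] at h2
    refine h2.trans_lt ?_
    have hba := sub_nonneg.2 hab
    have hC := hΘ.nonneg
    calc ‖κ‖ * C * (η * (E / σ) + η⁻¹ ^ z * (E * (b - a)))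
        ≤ K * (η * (E / σ) + η⁻¹ ^ z * (E * (b - a))) :=
          mul_le_mul_of_nonneg_right (mul_le_mul_of_nonneg_right hκn hC) (by positivity)
      _ = K * (E / σ) * η + P * (b - a) := by rw [hP]; ring
      _ ≤ ε / 4 + P * (ε / (4 * (P + 1))) := by
          gcongr
          rw [hη, ← mul_div_assoc, div_le_iff₀ (by positivity)]
          nlinarith [mul_nonneg hK0 hEσ]
      _ ≤ ε / 4 + ε / 4 := by
          gcongr
          rw [← mul_div_assoc, div_le_iff₀ (by positivity)]
          nlinarith
      _ < ε := by linarith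
  have i1 := (A N).intervalIntegrable hΘ hΘc hF hG hE hFL hGL κ k
    (b := (A N).h * ⌊s / (A N).h⌋₊) (by positivity)
  have i2 := (A N).intervalIntegrable hΘ hΘc hF hG hE hFL hGL κ k
    (b := (A N).h * ⌊t / (A N).h⌋₊) (by positivity)
  rw [he, he, add_sub_add_left_eq_sub]
  rw [abs_le] at hround
  rcases le_total ((A N).h * (⌊s / (A N).h⌋₊ : ℝ)) ((A N).h * ⌊t / (A N).h⌋₊) with hle | hle
  · rw [norm_sub_rev, intervalIntegral.integral_interval_sub_left i2 i1]
    exact main _ _ (by positivity) hle (by linarith)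
  · rw [intervalIntegral.integral_interval_sub_left i1 i2]
    exact main _ _ (by positivity) hle (by linarith)

end Approx

/-! ### Passage to the limit -/

/-- Lower semicontinuity of the norms (Fatou's lemma for the counting measure). -/
theorem pairNorm_le_liminf (s : ℕ) {c d : ℕ → ℤ → ℂ} {c' d' : ℤ → ℂ}
    (hc : ∀ k, Tendsto (fun n => c n k) atTop (𝓝 (c' k)))
    (hd : ∀ k, Tendsto (fun n => d n k) atTop (𝓝 (d' k))) :
    pairNorm s c' d' ≤ liminf (fun n => pairNorm s (c n) (d n)) atTop := by
  have key : ∀ e e' : ℤ → ℂ, pairNorm s e e' =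
      ∫⁻ k, (ENNReal.ofReal (|(k : ℝ)| ^ s * ‖e k‖) + ENNReal.ofReal (|(k : ℝ)| ^ s * ‖e' k‖))
        ∂(Measure.count : Measure ℤ) := fun e e' => by
    rw [lintegral_count, ENNReal.tsum_add]; rfl
  simp only [key]
  refine le_trans (lintegral_mono fun k => ?_)
    (lintegral_liminf_le fun n => measurable_of_countable _)
  have : Tendsto (fun n => ENNReal.ofReal (|(k : ℝ)| ^ s * ‖c n k‖) +
      ENNReal.ofReal (|(k : ℝ)| ^ s * ‖d n k‖)) atTop
      (𝓝 (ENNReal.ofReal (|(k : ℝ)| ^ s * ‖c' k‖) + ENNReal.ofReal (|(k : ℝ)| ^ s * ‖d' k‖))) :=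
    (ENNReal.tendsto_ofReal (((hc k).norm).const_mul _)).add
      (ENNReal.tendsto_ofReal (((hd k).norm).const_mul _))
  exact this.liminf_eq.ge

/-- Splitting of the norm of order `z` into finitely many modes and a tail, which is small against
the norm of order `z + 1`. -/
theorem wn_le_low_add_high (z M : ℕ) (c : ℤ → ℂ) :
    wn z c ≤ (∑ k ∈ Finset.Icc (-(M : ℤ)) M, ENNReal.ofReal (|(k : ℝ)| ^ z) * ‖c k‖ₑ) +
      ENNReal.ofReal (1 / ((M : ℝ) + 1)) * wn (z + 1) c := by
  have e : (∑ k ∈ Finset.Icc (-(M : ℤ)) M, ENNReal.ofReal (|(k : ℝ)| ^ z) * ‖c k‖ₑ) =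
      ∑' k : ℤ, (if k ∈ Finset.Icc (-(M : ℤ)) M then
        ENNReal.ofReal (|(k : ℝ)| ^ z) * ‖c k‖ₑ else 0) := by
    rw [tsum_eq_sum (s := Finset.Icc (-(M : ℤ)) M) (fun k hk => if_neg hk)]
    exact Finset.sum_congr rfl fun k hk => (if_pos hk).symm
  rw [e, wn, wn, ← ENNReal.tsum_mul_left, ← ENNReal.tsum_add]
  refine ENNReal.tsum_le_tsum fun k => ?_
  split_ifs with hk
  · refine le_add_right (le_of_eq ?_)
    rw [ENNReal.ofReal_mul (by positivity), ofReal_norm]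
  · rw [zero_add, ← ENNReal.ofReal_mul (by positivity)]
    refine ENNReal.ofReal_le_ofReal ?_
    rw [Finset.mem_Icc, ← abs_le, not_le] at hk
    have h1 : (M : ℝ) + 1 ≤ |(k : ℝ)| := by exact_mod_cast hk
    have h2 : 1 ≤ 1 / ((M : ℝ) + 1) * |(k : ℝ)| := by
      rw [one_div_mul_eq_div, le_div_iff₀ (by positivity)]; linarith
    calc _ ≤ (|(k : ℝ)| ^ z * ‖c k‖) * (1 / ((M : ℝ) + 1) * |(k : ℝ)|) :=
          le_mul_of_one_le_right (by positivity) h2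
      _ = _ := by ring

/-- Convergence of all modes and a bound in `L¹` of the norm of order `z + 1` give convergence in
`L¹` of the norm of order `z`. -/
theorem tendsto_lintegral_wn_sub {z : ℕ} {μ : Measure ℝ} [IsFiniteMeasure μ] {c : ℕ → ℝ → ℤ → ℂ}
    {c' : ℝ → ℤ → ℂ} {K M : ℝ≥0∞} (hK : K ≠ ⊤) (hM : M ≠ ⊤)
    (hm : ∀ n k, Measurable fun t => c n t k) (hm' : ∀ k, Measurable fun t => c' t k)
    (h0 : ∀ n t, wn 0 (c n t) ≤ K) (h0' : ∀ t, wn 0 (c' t) ≤ K)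
    (h1 : ∀ n, ∫⁻ t, wn (z + 1) (c n t) ∂μ ≤ M) (h1' : ∫⁻ t, wn (z + 1) (c' t) ∂μ ≤ M)
    (hlim : ∀ᵐ t ∂μ, ∀ k, Tendsto (fun n => c n t k) atTop (𝓝 (c' t k))) :
    Tendsto (fun n => ∫⁻ t, wn z (c n t - c' t) ∂μ) atTop (𝓝 0) := by
  have hmode : ∀ e : ℤ → ℂ, ∀ k, ‖e k‖ₑ ≤ wn 0 e := fun e k => by
    rw [wn_zero]; exact ENNReal.le_tsum k
  have hmd : ∀ n k, Measurable fun t => (c n t - c' t) k := fun n k => (hm n k).sub (hm' k)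
  have hlow : ∀ k, Tendsto (fun n => ∫⁻ t, ‖(c n t - c' t) k‖ₑ ∂μ) atTop (𝓝 0) := by
    intro k
    have := tendsto_lintegral_of_dominated_convergence (μ := μ) (f := fun _ => (0 : ℝ≥0∞))
      (F := fun n t => ‖(c n t - c' t) k‖ₑ) (fun _ => K + K) (fun n => (hmd n k).enorm)
      (fun n => .of_forall fun t => ?_) ?_ ?_
    · simpa using this
    · exact (hmode _ k).trans ((wn_sub_le _ _ _).trans (add_le_add (h0 n t) (h0' t)))
    · rw [lintegral_const]
      exact ENNReal.mul_ne_top (ENNReal.add_ne_top.2 ⟨hK, hK⟩) (measure_ne_top μ _)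
    · filter_upwards [hlim] with t ht
      have := ((ht k).sub_const (c' t k)).enorm
      simpa using this
  rw [ENNReal.tendsto_nhds_zero]
  intro ε hε
  have hhigh : Tendsto (fun m : ℕ => ENNReal.ofReal (1 / ((m : ℝ) + 1)) * (M + M)) atTop (𝓝 0) := by
    have := ENNReal.Tendsto.mul_const (b := M + M)
      (ENNReal.tendsto_ofReal tendsto_one_div_add_atTop_nhds_zero_nat)
      (Or.inr (ENNReal.add_ne_top.2 ⟨hM, hM⟩))
    simpa using this
  obtain ⟨m, hm1⟩ := ((ENNReal.tendsto_nhds_zero.1 hhigh) (ε / 2) (ENNReal.half_pos hε.ne')).exists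
  have hsum : Tendsto (fun n => ∑ k ∈ Finset.Icc (-(m : ℤ)) m, ENNReal.ofReal (|(k : ℝ)| ^ z) *
      ∫⁻ t, ‖(c n t - c' t) k‖ₑ ∂μ) atTop (𝓝 0) := by
    have := tendsto_finsetSum (Finset.Icc (-(m : ℤ)) m) fun k _ =>
      ENNReal.Tendsto.const_mul (hlow k) (Or.inr (ENNReal.ofReal_ne_top (r := |(k : ℝ)| ^ z)))
    simpa using this
  filter_upwards [(ENNReal.tendsto_nhds_zero.1 hsum) (ε / 2) (ENNReal.half_pos hε.ne')] with n hn
  calc ∫⁻ t, wn z (c n t - c' t) ∂μ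
      ≤ ∫⁻ t, ((∑ k ∈ Finset.Icc (-(m : ℤ)) m,
          ENNReal.ofReal (|(k : ℝ)| ^ z) * ‖(c n t - c' t) k‖ₑ) +
          ENNReal.ofReal (1 / ((m : ℝ) + 1)) * wn (z + 1) (c n t - c' t)) ∂μ :=
        lintegral_mono fun t => wn_le_low_add_high z m _
    _ = (∑ k ∈ Finset.Icc (-(m : ℤ)) m, ENNReal.ofReal (|(k : ℝ)| ^ z) *
          ∫⁻ t, ‖(c n t - c' t) k‖ₑ ∂μ) +
          ENNReal.ofReal (1 / ((m : ℝ) + 1)) * ∫⁻ t, wn (z + 1) (c n t - c' t) ∂μ := by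
        rw [lintegral_add_right _ ((measurable_wn (hmd n) _).const_mul _),
          lintegral_const_mul _ (measurable_wn (hmd n) _),
          lintegral_finsetSum _ fun k _ => ((hmd n k).enorm).const_mul _]
        congr 1
        exact Finset.sum_congr rfl fun k _ => lintegral_const_mul _ (hmd n k).enorm
    _ ≤ ε / 2 + ENNReal.ofReal (1 / ((m : ℝ) + 1)) * (M + M) := by
        gcongr
        refine (lintegral_mono fun t => wn_sub_le _ _ _).trans ?_
        rw [lintegral_add_left (measurable_wn (hm n) _)]
        exact add_le_add (h1 n) h1'
    _ ≤ ε / 2 + ε / 2 := by gcongr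
    _ = ε := ENNReal.add_halves ε

/-- A bounded sequence that tends to zero in `L¹` tends to zero in `L¹` also after multiplication
by a fixed integrable function. -/
theorem tendsto_lintegral_mul_zero {μ : Measure ℝ} {D : ℕ → ℝ → ℝ≥0∞} {w : ℝ → ℝ≥0∞} {K : ℝ≥0∞}
    (hK : K ≠ ⊤) (hD : ∀ n t, D n t ≤ K) (hw : Measurable w) (hDm : ∀ n, Measurable (D n))
    (hwi : ∫⁻ t, w t ∂μ ≠ ⊤)
    (hlim : Tendsto (fun n => ∫⁻ t, D n t ∂μ) atTop (𝓝 0)) :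
    Tendsto (fun n => ∫⁻ t, D n t * w t ∂μ) atTop (𝓝 0) := by
  rw [ENNReal.tendsto_nhds_zero]
  intro ε hε
  obtain ⟨ε', hε', hKε⟩ : ∃ ε' : ℝ≥0∞, ε' ≠ 0 ∧ K * ε' ≤ ε / 2 := by
    rcases eq_or_ne K 0 with rfl | hK0
    · exact ⟨1, one_ne_zero, by simp⟩
    · refine ⟨ε / 2 / K, (ENNReal.div_pos (ENNReal.half_pos hε.ne').ne' hK).ne', ?_⟩
      rw [ENNReal.mul_div_cancel hK0 hK]
  -- where `w ≥ L` the integral of `w` is small, elsewhere `w` is bounded by `L`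
  obtain ⟨δ, hδ, hs⟩ := exists_pos_setLIntegral_lt_of_measure_lt hwi hε'
  have hL : ∃ L : ℝ≥0∞, L ≠ 0 ∧ L ≠ ⊤ ∧ (∫⁻ t, w t ∂μ) / L < δ := by
    have h1 : Tendsto (fun n : ℕ => (∫⁻ t, w t ∂μ) / (n : ℝ≥0∞)) atTop (𝓝 0) := by
      have := ENNReal.Tendsto.const_mul (a := ∫⁻ t, w t ∂μ) ENNReal.tendsto_inv_nat_nhds_zero
        (Or.inr hwi)
      simpa [div_eq_mul_inv] using this
    obtain ⟨n, hn1, hn2⟩ := ((h1.eventually_lt_const hδ).and (eventually_gt_atTop 0)).exists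
    exact ⟨n, by exact_mod_cast hn2.ne', ENNReal.natCast_ne_top n, hn1⟩
  obtain ⟨L, hL0, hLt, hLδ⟩ := hL
  have hS : MeasurableSet {t | L ≤ w t} := measurableSet_le measurable_const hw
  have hμS : μ {t | L ≤ w t} < δ :=
    (meas_ge_le_lintegral_div hw.aemeasurable hL0 hLt).trans_lt hLδ
  have hlim' : Tendsto (fun n => L * ∫⁻ t, D n t ∂μ) atTop (𝓝 0) := by
    simpa using ENNReal.Tendsto.const_mul hlim (Or.inr hLt)
  filter_upwards [(ENNReal.tendsto_nhds_zero.1 hlim') (ε / 2) (ENNReal.half_pos hε.ne')] with n hn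
  rw [← lintegral_add_compl _ hS]
  calc _ ≤ (∫⁻ t in {t | L ≤ w t}, K * w t ∂μ) + ∫⁻ t in {t | L ≤ w t}ᶜ, L * D n t ∂μ := by
        refine add_le_add (lintegral_mono fun t => by gcongr; exact hD n t)
          (setLIntegral_mono' hS.compl fun t ht => ?_)
        rw [mul_comm]
        gcongr
        exact (not_le.1 (show ¬ L ≤ w t from ht)).le
    _ ≤ K * ε' + L * ∫⁻ t, D n t ∂μ := by
        rw [lintegral_const_mul _ hw, lintegral_const_mul _ (hDm n)]
        gcongr
        · exact (hs _ hμS).le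
        · exact Measure.restrict_le_self
    _ ≤ ε / 2 + ε / 2 := add_le_add hKε hn
    _ = ε := ENNReal.add_halves ε

/-- A global solution of the system in terms of Fourier coefficients, in the Wiener algebra and
with integrable norm of order `ζ + 1`. The times at which this norm is infinite form a null set, on
which the coefficients are set to zero. -/
structure Solution (Φ Ψ : ℝ → ℝ → ℝ → ℝ → ℝ) (z : ℕ) (F G E σ : ℝ) (c₀ d₀ : ℤ → ℂ) where
  c : ℝ → ℤ → ℂ
  d : ℝ → ℤ → ℂ
  sym_c : ∀ t, Sym (c t)
  sym_d : ∀ t, Sym (d t)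
  zero_c : ∀ t, c t 0 = 0
  zero_d : ∀ t, d t 0 = 0
  top_ne : ∀ t, pairNorm (z + 1) (c t) (d t) ≠ ⊤
  meas_c : ∀ k, Measurable fun t => c t k
  meas_d : ∀ k, Measurable fun t => d t k
  le_E : ∀ t, pairNorm 0 (c t) (d t) ≤ ENNReal.ofReal E
  decay : ∀ t, 0 ≤ t → pairNorm 0 (c t) (d t) ≤ ENNReal.ofReal (E * Real.exp (-σ * t))
  top_le : ∫⁻ t in Ioi (0 : ℝ), pairNorm (z + 1) (c t) (d t) ≤ ENNReal.ofReal (E / σ)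
  eq_c : ∀ᵐ t ∂(volume.restrict (Ioi (0 : ℝ))), ∀ k, c t k = c₀ k + ∫ s in (0 : ℝ)..t,
    Complex.I * k * fourierC (phys Φ z F G (c s) (d s)) k
  eq_d : ∀ᵐ t ∂(volume.restrict (Ioi (0 : ℝ))), ∀ k, d t k = d₀ k + ∫ s in (0 : ℝ)..t,
    Complex.I * k * fourierC (phys Ψ z F G (c s) (d s)) k

/-! ### Existence of a solution in the Wiener algebra -/

/-- A time dependent pair of real zero mean Fourier series, bounded by `E` in the Wiener algebra
and integrable in time with respect to the norm of order `z + 1`. -/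
structure IsCurve (z : ℕ) (E : ℝ) (c d : ℝ → ℤ → ℂ) : Prop where
  sym_c : ∀ t, Sym (c t)
  sym_d : ∀ t, Sym (d t)
  zero_c : ∀ t, c t 0 = 0
  zero_d : ∀ t, d t 0 = 0
  top_ne : ∀ t, pairNorm (z + 1) (c t) (d t) ≠ ⊤
  meas_c : ∀ k, Measurable fun t => c t k
  meas_d : ∀ k, Measurable fun t => d t k
  le_E : ∀ t, pairNorm 0 (c t) (d t) ≤ ENNReal.ofReal E
  lint_ne : ∫⁻ t in Ioi (0 : ℝ), pairNorm (z + 1) (c t) (d t) ≠ ⊤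

theorem pairNorm_mono {s s' : ℕ} (hs : s ≤ s') {c d : ℤ → ℂ} (hc : c 0 = 0) (hd : d 0 = 0) :
    pairNorm s c d ≤ pairNorm s' c d := add_le_add (wn_mono hs hc) (wn_mono hs hd)

theorem fourierC_sub {u v : Torus → ℝ} (hu : Integrable u) (hv : Integrable v) (k : ℤ) :
    fourierC (fun x => u x - v x) k = fourierC u k - fourierC v k := by
  refine Eq.trans ?_ (fourierCoeff_sub (hu.ofReal (𝕜 := ℂ)) hv.ofReal k)
  unfold fourierC
  congr 1; ext x; push_cast; rfl

theorem continuous_phys {Φ : ℝ → ℝ → ℝ → ℝ → ℝ}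
    (hΦ : Continuous fun y : ℝ × ℝ × ℝ × ℝ => Φ y.1 y.2.1 y.2.2.1 y.2.2.2) {z : ℕ} (F G : ℝ)
    {c d : ℤ → ℂ} (h0c : wn 0 c ≠ ⊤) (h0d : wn 0 d ≠ ⊤) (hzc : wn z c ≠ ⊤) (hzd : wn z d ≠ ⊤) :
    Continuous (phys Φ z F G c d) := by
  have m1 := continuous_rser h0c
  have m2 := continuous_rser h0d
  have m3 := continuous_rser (c := Dcoef z c) (by rwa [wn_Dcoef, zero_add])
  have m4 := continuous_rser (c := Dcoef z d) (by rwa [wn_Dcoef, zero_add])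
  exact hΦ.comp ((continuous_const.add m1).prodMk ((continuous_const.add m2).prodMk (m3.prodMk m4)))

namespace IsCurve

variable {z : ℕ} {E : ℝ} {c d : ℝ → ℤ → ℂ}

theorem measurable_pairNorm (h : IsCurve z E c d) (s : ℕ) :
    Measurable fun t => pairNorm s (c t) (d t) :=
  (measurable_wn h.meas_c s).add (measurable_wn h.meas_d s)

theorem pairNorm_ne (h : IsCurve z E c d) {s : ℕ} (hs : s ≤ z + 1) (t : ℝ) :
    pairNorm s (c t) (d t) ≠ ⊤ :=
  ne_top_of_le_ne_top (h.top_ne t) (pairNorm_mono hs (h.zero_c t) (h.zero_d t))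

theorem wn_c_ne (h : IsCurve z E c d) {s : ℕ} (hs : s ≤ z + 1) (t : ℝ) : wn s (c t) ≠ ⊤ :=
  (ENNReal.add_ne_top.1 (h.pairNorm_ne hs t)).1

theorem wn_d_ne (h : IsCurve z E c d) {s : ℕ} (hs : s ≤ z + 1) (t : ℝ) : wn s (d t) ≠ ⊤ :=
  (ENNReal.add_ne_top.1 (h.pairNorm_ne hs t)).2

theorem lintegral_ne (h : IsCurve z E c d) {s : ℕ} (hs : s ≤ z + 1) :
    ∫⁻ t in Ioi (0 : ℝ), pairNorm s (c t) (d t) ≠ ⊤ :=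
  ne_top_of_le_ne_top h.lint_ne
    (lintegral_mono fun t => pairNorm_mono hs (h.zero_c t) (h.zero_d t))

variable {Θ : ℝ → ℝ → ℝ → ℝ → ℝ} {F G : ℝ}

theorem measurable_fourierC (h : IsCurve z E c d)
    (hΘc : Continuous fun y : ℝ × ℝ × ℝ × ℝ => Θ y.1 y.2.1 y.2.2.1 y.2.2.2) (F G : ℝ) (k : ℤ) :
    Measurable fun s => fourierC (phys Θ z F G (c s) (d s)) k :=
  ThinFilmStokes.measurable_fourierC (measurable_phys hΘc F G h.meas_c h.meas_d
    (h.wn_c_ne (by omega)) (h.wn_d_ne (by omega)) (h.wn_c_ne (by omega)) (h.wn_d_ne (by omega))) k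

theorem continuous_phys (h : IsCurve z E c d)
    (hΘc : Continuous fun y : ℝ × ℝ × ℝ × ℝ => Θ y.1 y.2.1 y.2.2.1 y.2.2.2) (F G : ℝ) (t : ℝ) :
    Continuous (phys Θ z F G (c t) (d t)) :=
  ThinFilmStokes.continuous_phys hΘc F G
    (h.wn_c_ne (by omega) t) (h.wn_d_ne (by omega) t) (h.wn_c_ne (by omega) t)
    (h.wn_d_ne (by omega) t)

theorem integrableOn_fourierC (h : IsCurve z E c d) {L C : ℝ} (hΘ : FluxBound Θ L C)
    (hΘc : Continuous fun y : ℝ × ℝ × ℝ × ℝ => Θ y.1 y.2.1 y.2.2.1 y.2.2.2)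
    (hF : 0 ≤ F) (hG : 0 ≤ G) (hE : 0 ≤ E) (hFL : F + E ≤ L)
    (hGL : G + E ≤ L) (k : ℤ) :
    IntegrableOn (fun s => fourierC (phys Θ z F G (c s) (d s)) k) (Ioi 0) := by
  refine ⟨(h.measurable_fourierC hΘc F G k).aestronglyMeasurable, ?_⟩
  have h1 : ∫⁻ t in Ioi (0 : ℝ), ENNReal.ofReal C * pairNorm z (c t) (d t) < ⊤ := by
    rw [lintegral_const_mul _ (h.measurable_pairNorm _)]
    exact ENNReal.mul_lt_top ENNReal.ofReal_lt_top (h.lintegral_ne (by omega)).lt_top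
  refine lt_of_le_of_lt (lintegral_mono fun t => ?_) h1
  have h1 := norm_fourierC_le
    (hΘ.abs_phys_le hF hG hE hFL hGL (h.le_E t) (h.pairNorm_ne (s := z) (by omega) t)) k
  rw [← ofReal_norm, ← ENNReal.ofReal_toReal (h.pairNorm_ne (s := z) (by omega) t),
    ← ENNReal.ofReal_mul hΘ.nonneg]
  exact ENNReal.ofReal_le_ofReal h1

end IsCurve

theorem Approx.isCurve {Φ Ψ : ℝ → ℝ → ℝ → ℝ → ℝ} {z : ℕ} {F G E σ : ℝ} {c₀ d₀ : ℤ → ℂ} {N : ℕ}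
    (A : Approx Φ Ψ z F G E σ c₀ d₀ N) : IsCurve z E A.c A.d :=
  ⟨A.sym_c, A.sym_d, A.zero_c, A.zero_d, fun t => A.wn_pair t _, A.meas_c, A.meas_d, A.le_E,
    ne_top_of_le_ne_top ENNReal.ofReal_ne_top A.top_le⟩

theorem Solution.isCurve {Φ Ψ : ℝ → ℝ → ℝ → ℝ → ℝ} {z : ℕ} {F G E σ : ℝ} {c₀ d₀ : ℤ → ℂ}
    (A : Solution Φ Ψ z F G E σ c₀ d₀) : IsCurve z E A.c A.d :=
  ⟨A.sym_c, A.sym_d, A.zero_c, A.zero_d, A.top_ne, A.meas_c, A.meas_d, A.le_E,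
    ne_top_of_le_ne_top ENNReal.ofReal_ne_top A.top_le⟩

/-- If all modes converge at almost all times, the modes of the fluxes converge in `L¹` in time: the
top order is controlled by the compactness in the norm of order `z`, the heights converge boundedly
against an integrable weight. -/
theorem IsCurve.tendsto_flux {z : ℕ} {E : ℝ} {cn dn : ℕ → ℝ → ℤ → ℂ} {c d : ℝ → ℤ → ℂ}
    (hn : ∀ n, IsCurve z E (cn n) (dn n)) (h : IsCurve z E c d) {M : ℝ≥0∞} (hM : M ≠ ⊤)
    (hMn : ∀ n, ∫⁻ t in Ioi (0 : ℝ), pairNorm (z + 1) (cn n t) (dn n t) ≤ M)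
    (hM' : ∫⁻ t in Ioi (0 : ℝ), pairNorm (z + 1) (c t) (d t) ≤ M)
    (hc : ∀ᵐ t ∂(volume.restrict (Ioi (0 : ℝ))), ∀ k,
      Tendsto (fun n => cn n t k) atTop (𝓝 (c t k)))
    (hd : ∀ᵐ t ∂(volume.restrict (Ioi (0 : ℝ))), ∀ k,
      Tendsto (fun n => dn n t k) atTop (𝓝 (d t k)))
    {Θ : ℝ → ℝ → ℝ → ℝ → ℝ} {F G L C : ℝ} (hΘ : FluxBound Θ L C)
    (hΘc : Continuous fun y : ℝ × ℝ × ℝ × ℝ => Θ y.1 y.2.1 y.2.2.1 y.2.2.2)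
    (hF : 0 ≤ F) (hG : 0 ≤ G) (hE : 0 ≤ E) (hFL : F + E ≤ L) (hGL : G + E ≤ L) (k : ℤ) (T : ℝ) :
    Tendsto (fun n => ∫⁻ s in Ioc 0 T, ‖fourierC (phys Θ z F G (cn n s) (dn n s)) k -
      fourierC (phys Θ z F G (c s) (d s)) k‖ₑ) atTop (𝓝 0) := by
  have hsub : Ioc (0 : ℝ) T ⊆ Ioi 0 := fun t ht => ht.1
  have hae : volume.restrict (Ioc (0 : ℝ) T) ≤ volume.restrict (Ioi (0 : ℝ)) :=
    Measure.restrict_mono hsub le_rfl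
  have mono : ∀ φ : ℝ → ℝ≥0∞, ∫⁻ t in Ioc 0 T, φ t ≤ ∫⁻ t in Ioi (0 : ℝ), φ t := fun φ =>
    lintegral_mono_set hsub
  have tc := tendsto_lintegral_wn_sub (z := z) (μ := volume.restrict (Ioc (0 : ℝ) T))
    (ENNReal.ofReal_ne_top (r := E)) hM (fun n => (hn n).meas_c) h.meas_c
    (fun n t => le_self_add.trans ((hn n).le_E t)) (fun t => le_self_add.trans (h.le_E t))
    (fun n => (mono _).trans ((lintegral_mono fun t => le_self_add).trans (hMn n)))
    ((mono _).trans ((lintegral_mono fun t => le_self_add).trans hM')) (ae_mono hae hc)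
  have td := tendsto_lintegral_wn_sub (z := z) (μ := volume.restrict (Ioc (0 : ℝ) T))
    (ENNReal.ofReal_ne_top (r := E)) hM (fun n => (hn n).meas_d) h.meas_d
    (fun n t => le_add_self.trans ((hn n).le_E t)) (fun t => le_add_self.trans (h.le_E t))
    (fun n => (mono _).trans ((lintegral_mono fun t => le_add_self).trans (hMn n)))
    ((mono _).trans ((lintegral_mono fun t => le_add_self).trans hM')) (ae_mono hae hd)
  have mdc : ∀ n k, Measurable fun t => (cn n t - c t) k := fun n k =>
    ((hn n).meas_c k).sub (h.meas_c k)
  have mdd : ∀ n k, Measurable fun t => (dn n t - d t) k := fun n k =>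
    ((hn n).meas_d k).sub (h.meas_d k)
  have mp : ∀ n s, Measurable fun t => pairNorm s (cn n t - c t) (dn n t - d t) := fun n s =>
    (measurable_wn (mdc n) s).add (measurable_wn (mdd n) s)
  have tz : Tendsto (fun n => ∫⁻ t in Ioc 0 T, pairNorm z (cn n t - c t) (dn n t - d t)) atTop
      (𝓝 0) := by
    have := tc.add td
    rw [add_zero] at this
    refine this.congr fun n => ?_
    rw [← lintegral_add_left (measurable_wn (mdc n) z)]
    rfl
  have t0 : Tendsto (fun n => ∫⁻ t in Ioc 0 T, pairNorm 0 (cn n t - c t) (dn n t - d t)) atTop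
      (𝓝 0) := by
    refine tendsto_of_tendsto_of_tendsto_of_le_of_le tendsto_const_nhds tz
      (fun _ => zero_le) fun n => lintegral_mono fun t => pairNorm_mono (Nat.zero_le _) ?_ ?_
    · simp [(hn n).zero_c t, h.zero_c t]
    · simp [(hn n).zero_d t, h.zero_d t]
  have b0 : ∀ n t, pairNorm 0 (cn n t - c t) (dn n t - d t) ≤
      ENNReal.ofReal E + ENNReal.ofReal E := fun n t => by
    refine (add_le_add (wn_sub_le _ _ _) (wn_sub_le _ _ _)).trans ?_
    rw [add_add_add_comm]
    exact add_le_add ((hn n).le_E t) (h.le_E t)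
  -- the heights converge only in `L¹` in time, but they are bounded, so the fixed integrable weight
  -- `pairNorm z (c t) (d t)` does no harm
  have tw := tendsto_lintegral_mul_zero (μ := volume.restrict (Ioc (0 : ℝ) T))
    (ENNReal.add_ne_top.2 ⟨ENNReal.ofReal_ne_top (r := E), ENNReal.ofReal_ne_top (r := E)⟩) b0
    (h.measurable_pairNorm z) (fun n => mp n 0)
    (ne_top_of_le_ne_top (h.lintegral_ne (by omega)) (mono _)) t0
  have tot := ENNReal.Tendsto.const_mul (a := ENNReal.ofReal C) (tz.add tw)
    (Or.inr ENNReal.ofReal_ne_top)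
  simp only [add_zero, mul_zero] at tot
  refine tendsto_of_tendsto_of_tendsto_of_le_of_le tendsto_const_nhds tot (fun _ => zero_le)
    fun n => ?_
  rw [← lintegral_add_left (mp n z), ← lintegral_const_mul' _ _ ENNReal.ofReal_ne_top]
  refine lintegral_mono fun t => ?_
  have e1 := hΘ.abs_phys_sub_le hF hG hE hFL hGL ((hn n).le_E t) (h.le_E t)
    ((hn n).pairNorm_ne (s := z) (by omega) t) (h.pairNorm_ne (s := z) (by omega) t)
  have i1 := Continuous.integrable_torus ((hn n).continuous_phys hΘc F G t)
  have i2 := Continuous.integrable_torus (h.continuous_phys hΘc F G t)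
  have e2 := norm_fourierC_le (u := fun x => phys Θ z F G (cn n t) (dn n t) x -
    phys Θ z F G (c t) (d t) x) e1 k
  have n0 := ne_top_of_le_ne_top (by finiteness) (b0 n t)
  have nz : pairNorm z (cn n t - c t) (dn n t - d t) ≠ ⊤ := by
    refine ne_top_of_le_ne_top ?_ (add_le_add (wn_sub_le _ _ _) (wn_sub_le _ _ _))
    have a1 := (hn n).wn_c_ne (s := z) (by omega) t
    have a2 := (hn n).wn_d_ne (s := z) (by omega) t
    have a3 := h.wn_c_ne (s := z) (by omega) t
    have a4 := h.wn_d_ne (s := z) (by omega) t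
    finiteness
  have nw := h.pairNorm_ne (s := z) (by omega) t
  rw [fourierC_sub i1 i2, ← mul_add] at e2
  calc _ = ENNReal.ofReal ‖fourierC (phys Θ z F G (cn n t) (dn n t)) k -
        fourierC (phys Θ z F G (c t) (d t)) k‖ := (ofReal_norm _).symm
    _ ≤ _ := ENNReal.ofReal_le_ofReal e2
    _ = _ := by
      rw [ENNReal.ofReal_mul hΘ.nonneg, ENNReal.ofReal_add (by positivity) (by positivity),
        ENNReal.ofReal_mul (by positivity), ENNReal.ofReal_toReal n0, ENNReal.ofReal_toReal nz,
        ENNReal.ofReal_toReal nw]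

/-- Integrals up to converging endpoints of an `L¹`-convergent sequence. -/
theorem tendsto_integral_of_lintegral {J : ℕ → ℝ → ℂ} {J' : ℝ → ℂ} {t : ℝ} {τ : ℕ → ℝ}
    (hτ0 : ∀ n, 0 ≤ τ n) (hτt : ∀ n, τ n ≤ t) (hτ : Tendsto τ atTop (𝓝 t))
    (hJ' : IntegrableOn J' (Ioc 0 t)) (hJ : ∀ n, IntegrableOn (J n) (Ioc 0 t))
    (h : Tendsto (fun n => ∫⁻ s in Ioc 0 t, ‖J n s - J' s‖ₑ) atTop (𝓝 0)) :
    Tendsto (fun n => ∫ s in (0 : ℝ)..τ n, J n s) atTop (𝓝 (∫ s in (0 : ℝ)..t, J' s)) := by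
  have ht : 0 ≤ t := (hτ0 0).trans (hτt 0)
  have i1 : IntervalIntegrable J' volume 0 t :=
    (intervalIntegrable_iff_integrableOn_Ioc_of_le ht).2 hJ'
  have c1 : Tendsto (fun n => ∫ s in (0 : ℝ)..τ n, J' s) atTop (𝓝 (∫ s in (0 : ℝ)..t, J' s)) := by
    have := intervalIntegral.continuousOn_primitive_interval' i1 left_mem_uIcc
    have h2 := (this t right_mem_uIcc).tendsto
    refine h2.comp (tendsto_nhdsWithin_iff.2 ⟨hτ, .of_forall fun n => ?_⟩)
    rw [uIcc_of_le ht]; exact ⟨hτ0 n, hτt n⟩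
  have c2 : Tendsto (fun n => ∫ s in (0 : ℝ)..τ n, (J n s - J' s)) atTop (𝓝 0) := by
    rw [tendsto_zero_iff_enorm_tendsto_zero]
    refine tendsto_of_tendsto_of_tendsto_of_le_of_le tendsto_const_nhds h (fun _ => zero_le)
      fun n => ?_
    rw [intervalIntegral.integral_of_le (hτ0 n)]
    exact (enorm_integral_le_lintegral_enorm _).trans
      (lintegral_mono_set (Ioc_subset_Ioc_right (hτt n)))
  have := c2.add c1
  rw [zero_add] at this
  refine this.congr fun n => ?_
  have g : ∀ {f : ℝ → ℂ}, IntegrableOn f (Ioc 0 t) → IntervalIntegrable f volume 0 (τ n) :=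
    fun hf => (intervalIntegrable_iff_integrableOn_Ioc_of_le (hτ0 n)).2
      (hf.mono_set (Ioc_subset_Ioc_right (hτt n)))
  rw [intervalIntegral.integral_sub (g (hJ n)) (g hJ'), sub_add_cancel]

theorem tendsto_round {h : ℕ → ℝ} (hh : ∀ n, 0 < h n) (hlim : Tendsto h atTop (𝓝 0)) {t : ℝ}
    (ht : 0 ≤ t) : (∀ n, h n * ⌊t / h n⌋₊ ≤ t) ∧
      Tendsto (fun n => h n * (⌊t / h n⌋₊ : ℝ)) atTop (𝓝 t) := by
  have h1 : ∀ n, h n * ⌊t / h n⌋₊ ≤ t := fun n => by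
    have := Nat.floor_le (div_nonneg ht (hh n).le)
    rw [le_div_iff₀ (hh n)] at this
    linarith
  refine ⟨h1, ?_⟩
  have h2 : Tendsto (fun n => t - h n) atTop (𝓝 t) := by simpa using hlim.const_sub t
  refine tendsto_of_tendsto_of_tendsto_of_le_of_le h2 tendsto_const_nhds (fun n => ?_) h1
  have := (Nat.lt_floor_add_one (t / h n)).le
  rw [div_le_iff₀ (hh n)] at this
  show t - h n ≤ _
  linarith

/-- The limit equation for one component. -/
theorem eq_of_tendsto {z : ℕ} {E : ℝ} {cn dn : ℕ → ℝ → ℤ → ℂ} {c d : ℝ → ℤ → ℂ}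
    (hn : ∀ n, IsCurve z E (cn n) (dn n)) (h : IsCurve z E c d) {M : ℝ≥0∞} (hM : M ≠ ⊤)
    (hMn : ∀ n, ∫⁻ t in Ioi (0 : ℝ), pairNorm (z + 1) (cn n t) (dn n t) ≤ M)
    (hM' : ∫⁻ t in Ioi (0 : ℝ), pairNorm (z + 1) (c t) (d t) ≤ M)
    (hc : ∀ᵐ t ∂(volume.restrict (Ioi (0 : ℝ))), ∀ k,
      Tendsto (fun n => cn n t k) atTop (𝓝 (c t k)))
    (hd : ∀ᵐ t ∂(volume.restrict (Ioi (0 : ℝ))), ∀ k,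
      Tendsto (fun n => dn n t k) atTop (𝓝 (d t k)))
    {Θ : ℝ → ℝ → ℝ → ℝ → ℝ} {F G L C : ℝ} (hΘ : FluxBound Θ L C)
    (hΘc : Continuous fun y : ℝ × ℝ × ℝ × ℝ => Θ y.1 y.2.1 y.2.2.1 y.2.2.2)
    (hF : 0 ≤ F) (hG : 0 ≤ G) (hE : 0 ≤ E) (hFL : F + E ≤ L) (hGL : G + E ≤ L)
    {τ : ℕ → ℝ} (hτ : ∀ n, 0 < τ n) (hτ0 : Tendsto τ atTop (𝓝 0)) {φ : ℕ → ℕ} (hφ : StrictMono φ)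
    {e : ℕ → ℝ → ℤ → ℂ} {e₀ : ℤ → ℂ} {e' : ℝ → ℤ → ℂ}
    (he : ∀ n t k, e n t k = (if |k| ≤ (φ n : ℤ) then e₀ k else 0) +
      ∫ s in (0 : ℝ)..(τ n * ⌊t / τ n⌋₊), (if |k| ≤ (φ n : ℤ) then Complex.I * k else 0) *
        fourierC (phys Θ z F G (cn n s) (dn n s)) k)
    {t : ℝ} (ht : 0 ≤ t) (hlim : ∀ k, Tendsto (fun n => e n t k) atTop (𝓝 (e' t k))) (k : ℤ) :
    e' t k = e₀ k + ∫ s in (0 : ℝ)..t,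
      Complex.I * k * fourierC (phys Θ z F G (c s) (d s)) k := by
  obtain ⟨r1, r2⟩ := tendsto_round hτ hτ0 ht
  have hsub : Ioc (0 : ℝ) t ⊆ Ioi 0 := fun t ht => ht.1
  have l1 := tendsto_integral_of_lintegral (fun n => mul_nonneg (hτ n).le (Nat.cast_nonneg _)) r1 r2
    ((h.integrableOn_fourierC hΘ hΘc hF hG hE hFL hGL k).mono_set hsub)
    (fun n => ((hn n).integrableOn_fourierC hΘ hΘc hF hG hE hFL hGL k).mono_set hsub)
    (IsCurve.tendsto_flux hn h hM hMn hM' hc hd hΘ hΘc hF hG hE hFL hGL k t)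
  have l2 := (l1.const_mul (Complex.I * k)).const_add (e₀ k)
  refine tendsto_nhds_unique (hlim k) ?_
  rw [intervalIntegral.integral_const_mul]
  refine l2.congr' ?_
  filter_upwards [eventually_ge_atTop k.natAbs] with n hkn
  have hk : |k| ≤ (φ n : ℤ) := by
    rw [Int.abs_eq_natAbs]
    exact_mod_cast hkn.trans (hφ.id_le n)
  rw [he, if_pos hk, if_pos hk, intervalIntegral.integral_const_mul]

theorem wn_zero_coef (s : ℕ) : wn s 0 = 0 := by simp [wn]

/-- Existence of a global solution in the Wiener algebra, as a limit of approximate solutions. -/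
theorem nonempty_solution {z : ℕ} {ρ μ F G E σ : ℝ} (hz : z = 1 ∨ z = 3) (hρ : 0 < ρ) (hμ : 0 < μ)
    (hF : 0 < F) (hG : 0 < G) (hσ : 0 < σ) (hσ₁ : σ ≤ Sigma1 ρ μ F G E)
    (hσ₂ : σ ≤ Sigma2 ρ μ F G E) {c₀ d₀ : ℤ → ℂ} (hc : Sym c₀) (hd : Sym d₀) (hc0 : c₀ 0 = 0)
    (hd0 : d₀ 0 = 0) (hE0 : 0 ≤ E) (hE : wn 0 c₀ + wn 0 d₀ ≤ ENNReal.ofReal E) :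
    Nonempty (Solution (fluxF ρ) (fluxG ρ μ) z F G E σ c₀ d₀) := by
  classical
  have A : ∀ N, Approx (fluxF ρ) (fluxG ρ μ) z F G E σ c₀ d₀ N := fun N =>
    (nonempty_approx hz hρ hμ hF hG hσ hσ₁ hσ₂ hc hd hc0 hd0 hE0 hE N).some
  have hL : 0 ≤ F + G + E := by positivity
  have hFL : F + E ≤ F + G + E := by linarith
  have hGL : G + E ≤ F + G + E := by linarith
  obtain ⟨C₁, hΦ⟩ := exists_fluxBound_F hρ hL
  obtain ⟨C₂, hΨ⟩ := exists_fluxBound_G hρ hμ hL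
  have hmode : ∀ e : ℤ → ℂ, wn 0 e ≤ ENNReal.ofReal E → ∀ k, ‖e k‖ ≤ E := fun e he k => by
    have : ‖e k‖ₑ ≤ ENNReal.ofReal E := by
      refine le_trans ?_ he
      rw [wn_zero]; exact ENNReal.le_tsum k
    rwa [← ofReal_norm, ENNReal.ofReal_le_ofReal_iff hE0] at this
  obtain ⟨φ, hφ, b, hb⟩ := exists_subseq_tendsto (B := E)
    (a := fun N t (k : ℤ) => ((A N).c t k, (A N).d t k))
    (fun N t k => max_le (hmode _ (le_self_add.trans ((A N).le_E t)) k)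
      (hmode _ (le_add_self.trans ((A N).le_E t)) k)) (fun k t ε hε => by
      obtain ⟨δ₁, hδ₁, N₁, h₁⟩ := Approx.equicontinuous hΦ (continuous_fluxF ρ) hF.le hG.le hE0 hσ
        hFL hGL (fun N t k => (A N).eq_c t k) k t ε hε
      obtain ⟨δ₂, hδ₂, N₂, h₂⟩ := Approx.equicontinuous hΨ (continuous_fluxG ρ μ) hF.le hG.le hE0 hσ
        hFL hGL (fun N t k => (A N).eq_d t k) k t ε hε
      refine ⟨min δ₁ δ₂, lt_min hδ₁ hδ₂, max N₁ N₂, fun N hN s hs => max_lt ?_ ?_⟩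
      · exact h₁ N (le_trans (le_max_left _ _) hN) s (hs.trans_le (min_le_left _ _))
      · exact h₂ N (le_trans (le_max_right _ _) hN) s (hs.trans_le (min_le_right _ _)))
  set c' : ℝ → ℤ → ℂ := fun t k => (b t k).1 with hc'
  set d' : ℝ → ℤ → ℂ := fun t k => (b t k).2 with hd'
  have lc : ∀ t k, Tendsto (fun n => (A (φ n)).c t k) atTop (𝓝 (c' t k)) := fun t k =>
    (continuous_fst.tendsto _).comp (hb t k)
  have ld : ∀ t k, Tendsto (fun n => (A (φ n)).d t k) atTop (𝓝 (d' t k)) := fun t k =>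
    (continuous_snd.tendsto _).comp (hb t k)
  have mc : ∀ k, Measurable fun t => c' t k := fun k =>
    measurable_of_tendsto_metrizable (fun n => (A (φ n)).meas_c k) (tendsto_pi_nhds.2 fun t => lc t k)
  have md : ∀ k, Measurable fun t => d' t k := fun k =>
    measurable_of_tendsto_metrizable (fun n => (A (φ n)).meas_d k) (tendsto_pi_nhds.2 fun t => ld t k)
  have mp : ∀ s, Measurable fun t => pairNorm s (c' t) (d' t) := fun s =>
    (measurable_wn mc s).add (measurable_wn md s)
  -- the bounds pass to the limit by lower semicontinuity
  have fat : ∀ s t, pairNorm s (c' t) (d' t) ≤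
      liminf (fun n => pairNorm s ((A (φ n)).c t) ((A (φ n)).d t)) atTop := fun s t =>
    pairNorm_le_liminf s (lc t) (ld t)
  have leE : ∀ t, pairNorm 0 (c' t) (d' t) ≤ ENNReal.ofReal E := fun t =>
    (fat 0 t).trans (liminf_le_of_le ⟨0, by simp⟩ fun b hb =>
      (hb.exists.choose_spec).trans ((A _).le_E t))
  have hτ0 : Tendsto (fun n => (A (φ n)).h) atTop (𝓝 0) := by
    refine tendsto_of_tendsto_of_tendsto_of_le_of_le tendsto_const_nhds
      (tendsto_one_div_add_atTop_nhds_zero_nat.comp hφ.tendsto_atTop) (fun n => (A _).h_pos.le)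
      fun n => (A _).h_le
  have dec : ∀ t, 0 ≤ t → pairNorm 0 (c' t) (d' t) ≤ ENNReal.ofReal (E * Real.exp (-σ * t)) := by
    intro t ht
    have l : Tendsto (fun n => ENNReal.ofReal (E * Real.exp (-σ * (t - (A (φ n)).h)))) atTop
        (𝓝 (ENNReal.ofReal (E * Real.exp (-σ * (t - 0))))) :=
      ENNReal.tendsto_ofReal (((Real.continuous_exp.tendsto _).comp
        ((hτ0.const_sub t).const_mul (-σ))).const_mul E)
    rw [sub_zero] at l
    rw [← l.liminf_eq]
    exact (fat 0 t).trans (liminf_le_liminf (.of_forall fun n => (A (φ n)).decay t ht))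
  have topl : ∫⁻ t in Ioi (0 : ℝ), pairNorm (z + 1) (c' t) (d' t) ≤ ENNReal.ofReal (E / σ) := by
    refine (lintegral_mono fun t => fat (z + 1) t).trans
      ((lintegral_liminf_le fun n => (A (φ n)).measurable_pairNorm _).trans ?_)
    exact liminf_le_of_le ⟨0, by simp⟩ fun b hb => (hb.exists.choose_spec).trans ((A _).top_le)
  -- the curve is modified on the null set of times at which the norm of order `z + 1` is infinite
  set S : Set ℝ := {t | pairNorm (z + 1) (c' t) (d' t) ≠ ⊤} with hS
  have mS : MeasurableSet S := (measurableSet_eq_fun (mp _) measurable_const).compl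
  have aeS : ∀ᵐ t ∂(volume.restrict (Ioi (0 : ℝ))), t ∈ S :=
    (ae_lt_top (mp _) (ne_top_of_le_ne_top ENNReal.ofReal_ne_top topl)).mono fun t ht => ht.ne
  set c : ℝ → ℤ → ℂ := S.indicator c' with hcdef
  set d : ℝ → ℤ → ℂ := S.indicator d' with hddef
  have ec : ∀ t, t ∈ S → c t = c' t := fun t ht => indicator_of_mem ht _
  have ed : ∀ t, t ∈ S → d t = d' t := fun t ht => indicator_of_mem ht _
  have ec0 : ∀ t, t ∉ S → c t = 0 := fun t ht => indicator_of_notMem ht _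
  have ed0 : ∀ t, t ∉ S → d t = 0 := fun t ht => indicator_of_notMem ht _
  have ple : ∀ s t, pairNorm s (c t) (d t) ≤ pairNorm s (c' t) (d' t) := fun s t => by
    by_cases ht : t ∈ S
    · rw [ec t ht, ed t ht]
    · rw [ec0 t ht, ed0 t ht, pairNorm, wn_zero_coef, add_zero]; exact zero_le
  have symlim : ∀ (a : ℕ → ℤ → ℂ) (a' : ℤ → ℂ), (∀ n, Sym (a n)) →
      (∀ k, Tendsto (fun n => a n k) atTop (𝓝 (a' k))) → Sym a' := fun a a' ha hl k => by
    refine tendsto_nhds_unique (hl (-k)) ?_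
    simp only [fun n => ha n k]
    exact (Complex.continuous_conj.tendsto _).comp (hl k)
  have sym0 : Sym 0 := fun k => by simp
  have main : IsCurve z E c d := by
    refine ⟨fun t => ?_, fun t => ?_, fun t => ?_, fun t => ?_, fun t => ?_, fun k => ?_,
      fun k => ?_, fun t => (ple 0 t).trans (leE t), ?_⟩
    · by_cases ht : t ∈ S
      · rw [ec t ht]; exact symlim _ _ (fun n => (A (φ n)).sym_c t) (lc t)
      · rw [ec0 t ht]; exact sym0
    · by_cases ht : t ∈ S
      · rw [ed t ht]; exact symlim _ _ (fun n => (A (φ n)).sym_d t) (ld t)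
      · rw [ed0 t ht]; exact sym0
    · by_cases ht : t ∈ S
      · rw [ec t ht]
        exact tendsto_nhds_unique (lc t 0) (by simp [(A (φ _)).zero_c t])
      · rw [ec0 t ht]; rfl
    · by_cases ht : t ∈ S
      · rw [ed t ht]
        exact tendsto_nhds_unique (ld t 0) (by simp [(A (φ _)).zero_d t])
      · rw [ed0 t ht]; rfl
    · by_cases ht : t ∈ S
      · rw [ec t ht, ed t ht]; exact ht
      · rw [ec0 t ht, ed0 t ht, pairNorm, wn_zero_coef]; simp
    · have : (fun t => c t k) = S.indicator fun t => c' t k := by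
        ext t; by_cases ht : t ∈ S <;> simp [hcdef, ht]
      rw [this]; exact (mc k).indicator mS
    · have : (fun t => d t k) = S.indicator fun t => d' t k := by
        ext t; by_cases ht : t ∈ S <;> simp [hddef, ht]
      rw [this]; exact (md k).indicator mS
    · exact ne_top_of_le_ne_top ENNReal.ofReal_ne_top ((lintegral_mono fun t => ple _ t).trans topl)
  have topl' := (lintegral_mono (μ := volume.restrict (Ioi (0 : ℝ))) fun t => ple (z + 1) t).trans
    topl
  have aec : ∀ᵐ t ∂(volume.restrict (Ioi (0 : ℝ))), ∀ k,
      Tendsto (fun n => (A (φ n)).c t k) atTop (𝓝 (c t k)) :=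
    aeS.mono fun t ht => by rw [ec t ht]; exact lc t
  have aed : ∀ᵐ t ∂(volume.restrict (Ioi (0 : ℝ))), ∀ k,
      Tendsto (fun n => (A (φ n)).d t k) atTop (𝓝 (d t k)) :=
    aeS.mono fun t ht => by rw [ed t ht]; exact ld t
  -- the equation passes to the limit because the fluxes converge in `L¹`
  refine ⟨⟨c, d, main.sym_c, main.sym_d, main.zero_c, main.zero_d, main.top_ne, main.meas_c,
    main.meas_d, main.le_E, fun t ht => (ple 0 t).trans (dec t ht), topl', ?_, ?_⟩⟩
  · filter_upwards [aec, ae_restrict_mem measurableSet_Ioi] with t ht ht0 k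
    exact eq_of_tendsto (fun n => (A (φ n)).isCurve) main ENNReal.ofReal_ne_top
      (fun n => (A (φ n)).top_le) topl' aec aed hΦ (continuous_fluxF ρ) hF.le hG.le hE0 hFL hGL
      (fun n => (A (φ n)).h_pos) hτ0 hφ (fun n t k => (A (φ n)).eq_c t k) (le_of_lt ht0) ht k
  · filter_upwards [aed, ae_restrict_mem measurableSet_Ioi] with t ht ht0 k
    exact eq_of_tendsto (fun n => (A (φ n)).isCurve) main ENNReal.ofReal_ne_top
      (fun n => (A (φ n)).top_le) topl' aec aed hΨ (continuous_fluxG ρ μ) hF.le hG.le hE0 hFL hGL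
      (fun n => (A (φ n)).h_pos) hτ0 hφ (fun n t k => (A (φ n)).eq_d t k) (le_of_lt ht0) ht k

/-! ### Norms of Fourier series -/

theorem eLpNorm_top_rser_le (a : ℤ → ℂ) : eLpNorm (rser a) ⊤ volume ≤ wn 0 a := by
  rw [eLpNorm_exponent_top]
  exact eLpNormEssSup_le_of_ae_enorm_bound (.of_forall fun x => enorm_rser_le a x)

theorem eLpNorm_one_rser_le (a : ℤ → ℂ) :
    eLpNorm (rser a) 1 volume ≤ wn 0 a * ENNReal.ofReal (2 * Real.pi) := by
  rw [eLpNorm_one_eq_lintegral_enorm]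
  refine (lintegral_mono fun x => enorm_rser_le a x).trans ?_
  rw [lintegral_const, AddCircle.measure_univ]

theorem sobolevNorm_top_rser_le {n s : ℕ} (hn : n ≤ s) {a : ℤ → ℂ} (h0 : a 0 = 0)
    (h : wn s a ≠ ⊤) : sobolevNorm n ⊤ (rser a) ≤ 2 * wn n a := by
  have hw := isWeakDeriv_rser h0 (wn_ne_top_mono hn h0 h)
  rw [two_mul]
  refine add_le_add ((eLpNorm_top_rser_le a).trans (wn_mono (Nat.zero_le _) h0))
    ((iInf₂_le _ hw).trans ((eLpNorm_top_rser_le _).trans ?_))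
  rw [wn_dcoef, zero_add]

theorem sobolevNorm_one_rser_le {n s : ℕ} (hn : n ≤ s) {a : ℤ → ℂ} (h0 : a 0 = 0)
    (h : wn s a ≠ ⊤) : sobolevNorm n 1 (rser a) ≤ (2 * ENNReal.ofReal (2 * Real.pi)) * wn s a := by
  have hw := isWeakDeriv_rser h0 (wn_ne_top_mono hn h0 h)
  rw [mul_assoc, two_mul, mul_comm (ENNReal.ofReal _)]
  refine add_le_add ((eLpNorm_one_rser_le a).trans (mul_le_mul_left (wn_mono (Nat.zero_le _) h0) _))
    ((iInf₂_le _ hw).trans ((eLpNorm_one_rser_le _).trans (mul_le_mul_left ?_ _)))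
  rw [wn_dcoef, zero_add]
  exact wn_mono hn h0

theorem edist_rser_le {a : ℤ → ℂ} (h0 : a 0 = 0) (h : wn 1 a ≠ ⊤) (x y : Torus) :
    edist (rser a x) (rser a y) ≤ wn 1 a * edist x y := by
  have h00 := wn_ne_top_mono (Nat.zero_le _) h0 h
  have hlip : ∀ s t : ℝ, |rser a (s : Torus) - rser a (t : Torus)| ≤ (wn 1 a).toReal * |s - t| := by
    intro s t
    have := Convex.norm_image_sub_le_of_norm_hasDerivWithin_le (s := univ) (C := (wn 1 a).toReal)
      (f := fun y : ℝ => rser a (y : Torus)) (x := t) (y := s)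
      (fun y _ => (hasDerivAt_rser h00 h y).hasDerivWithinAt) (fun y _ => ?_) convex_univ
      (mem_univ _) (mem_univ _)
    · simpa [Real.norm_eq_abs] using this
    · have := abs_rser_le (c := dcoef 1 a) (by rwa [wn_dcoef, zero_add]) (y : Torus)
      rwa [wn_dcoef, zero_add] at this
  induction y using QuotientAddGroup.induction_on with
  | H t =>
    obtain ⟨r, hr, hr'⟩ : ∃ r : ℝ, (r : Torus) = x - (t : Torus) ∧ |r| = ‖x - (t : Torus)‖ := by
      generalize x - (t : Torus) = w
      induction w using QuotientAddGroup.induction_on with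
      | H w =>
        refine ⟨w - round ((2 * Real.pi)⁻¹ * w) * (2 * Real.pi), ?_, (AddCircle.norm_eq _).symm⟩
        have e : ((round ((2 * Real.pi)⁻¹ * w) * (2 * Real.pi) : ℝ) : Torus) = 0 := by
          rw [← zsmul_eq_mul, AddCircle.coe_zsmul, AddCircle.coe_period, smul_zero]
        rw [AddCircle.coe_sub, e, sub_zero]
    have hx : x = ((t + r : ℝ) : Torus) := by
      rw [AddCircle.coe_add, hr]; exact (add_sub_cancel _ _).symm
    have h1 := hlip (t + r) t
    rw [← hx, add_sub_cancel_left, hr'] at h1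
    rw [edist_dist, edist_dist, dist_eq_norm, dist_eq_norm, ← ENNReal.ofReal_toReal h,
      ← ENNReal.ofReal_mul ENNReal.toReal_nonneg]
    exact ENNReal.ofReal_le_ofReal h1

theorem eHolderNorm_rser_le {a : ℤ → ℂ} (h0 : a 0 = 0) (h : wn 1 a ≠ ⊤) {α : ℝ≥0} (hα : α ≤ 1) :
    eHolderNorm α (rser a) ≤ 2 * wn 1 a := by
  have hH : HolderWith (2 * wn 1 a).toNNReal α (rser a) := by
    intro x y
    rw [ENNReal.coe_toNNReal (by finiteness)]
    rcases le_total (edist x y) 1 with hd | hd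
    · refine (edist_rser_le h0 h x y).trans (mul_le_mul' ?_ ?_)
      · rw [two_mul]; exact le_self_add
      · exact (ENNReal.rpow_one _).symm.trans_le
          (ENNReal.rpow_le_rpow_of_exponent_ge hd (by exact_mod_cast hα))
    · calc edist (rser a x) (rser a y) ≤ ‖rser a x‖ₑ + ‖rser a y‖ₑ := by
            rw [edist_eq_enorm_sub]; exact enorm_sub_le
        _ ≤ 2 * wn 1 a := by
            rw [two_mul]
            exact add_le_add ((enorm_rser_le _ _).trans (wn_mono (Nat.zero_le _) h0))
              ((enorm_rser_le _ _).trans (wn_mono (Nat.zero_le _) h0))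
        _ ≤ 2 * wn 1 a * edist x y ^ (α : ℝ) :=
            le_mul_of_one_le_right zero_le ((ENNReal.one_rpow _).symm.trans_le
              (ENNReal.rpow_le_rpow hd (by positivity)))
  exact hH.eHolderNorm_le.trans (ENNReal.coe_toNNReal (by finiteness)).le

theorem holderNorm_rser_le {n : ℕ} {a : ℤ → ℂ} (h0 : a 0 = 0) (h : wn (n + 1) a ≠ ⊤) {α : ℝ≥0}
    (hα : α ≤ 1) : holderNorm n α (rser a) ≤ ((n + 1 : ℕ) + 2 : ℝ≥0∞) * wn (n + 1) a := by
  refine (iInf_le_of_le (rser a) (iInf₂_le (EventuallyEq.refl _ _)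
    (isCn_rser h0 (wn_ne_top_mono (Nat.le_succ n) h0 h)))).trans ?_
  rw [add_mul]
  refine add_le_add ?_ ?_
  · refine (Finset.sum_le_card_nsmul _ _ (wn (n + 1) a) fun j hj => ?_).trans ?_
    · have hj' : j ≤ n + 1 := (Finset.mem_range.1 hj).le
      rw [xDeriv_rser h0 (wn_ne_top_mono hj' h0 h)]
      refine iSup_le fun x => (enorm_rser_le _ x).trans ?_
      rw [wn_dcoef, zero_add]
      exact wn_mono hj' h0
    · rw [Finset.card_range, nsmul_eq_mul]
  · rw [xDeriv_rser h0 (wn_ne_top_mono (Nat.le_succ n) h0 h)]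
    have := eHolderNorm_rser_le (a := dcoef n a) (dcoef_zero_apply h0)
      (by rwa [wn_dcoef, add_comm]) hα
    rwa [wn_dcoef, add_comm 1 n] at this

theorem memLp_rser {a : ℤ → ℂ} (h : wn 0 a ≠ ⊤) (p : ℝ≥0∞) : MemLp (rser a) p volume :=
  (memLp_top_of_bound (continuous_rser h).aestronglyMeasurable _
    (.of_forall fun x => abs_rser_le h x)).mono_exponent le_top

/-- Interpolation of `H^{s/2}` between the Wiener spaces of orders `0` and `s`. -/
theorem hNorm_rser_le {s : ℕ} {a : ℤ → ℂ} (h0 : a 0 = 0) (h : wn s a ≠ ⊤) :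
    hNorm ((s : ℝ) / 2) (rser a) ≤ (wn 0 a * wn s a) ^ (1 / 2 : ℝ) := by
  have h00 := wn_ne_top_mono (Nat.zero_le _) h0 h
  rw [hNorm, if_pos ⟨memLp_rser h00 2, mean_rser h0 h00⟩]
  refine ENNReal.rpow_le_rpow ?_ (by norm_num)
  have e : fourierC (rser a) = symPart a := by
    rw [← show rser (symPart a) = rser a from funext (rser_symPart h00)]
    exact funext fun k => fourierC_rser (sym_symPart a) (ne_top_of_le_ne_top h00 (wn_symPart_le 0 a)) k
  rw [e]
  calc _ ≤ ∑' k : ℤ, wn 0 (symPart a) * ENNReal.ofReal (|(k : ℝ)| ^ s * ‖symPart a k‖) := by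
        refine ENNReal.tsum_le_tsum fun k => ?_
        have h1 : ENNReal.ofReal ‖symPart a k‖ ≤ wn 0 (symPart a) := by
          rw [wn_zero, ofReal_norm]; exact ENNReal.le_tsum k
        refine le_trans (le_of_eq ?_) (mul_le_mul_left h1 _)
        rw [← ENNReal.ofReal_mul (norm_nonneg _), mul_div_cancel₀ _ (two_ne_zero' ℝ),
          Real.rpow_natCast]
        congr 1; ring
    _ = wn 0 (symPart a) * wn s (symPart a) := by rw [ENNReal.tsum_mul_left]; rfl
    _ ≤ _ := mul_le_mul' (wn_symPart_le _ _) (wn_symPart_le _ _)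

/-- Interpolation between the Wiener norms of orders `0` and `z + 1`. -/
theorem wn_rpow_le {z : ℕ} (hz : 0 < z) (a : ℤ → ℂ) :
    wn z a ^ (((z : ℝ) + 1) / z) ≤ wn 0 a ^ (1 / (z : ℝ)) * wn (z + 1) a := by
  have hz' : (0 : ℝ) < z := by exact_mod_cast hz
  have hc : ∀ (s : ℕ), wn s a = ∫⁻ k, ENNReal.ofReal (|(k : ℝ)| ^ s * ‖a k‖)
      ∂(Measure.count : Measure ℤ) := fun s => (lintegral_count _).symm
  have hpq : ((z : ℝ) + 1).HolderConjugate (((z : ℝ) + 1) / z) :=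
    Real.holderConjugate_iff.2 ⟨by linarith, by field_simp; ring⟩
  have H := ENNReal.lintegral_mul_le_Lp_mul_Lq (Measure.count : Measure ℤ) hpq
    (f := fun k => ENNReal.ofReal ‖a k‖ ^ (1 / ((z : ℝ) + 1)))
    (g := fun k => ENNReal.ofReal (|(k : ℝ)| ^ (z + 1) * ‖a k‖) ^ ((z : ℝ) / (z + 1)))
    (measurable_of_countable _).aemeasurable (measurable_of_countable _).aemeasurable
  have e1 : ∀ k : ℤ, (ENNReal.ofReal ‖a k‖ ^ (1 / ((z : ℝ) + 1))) ^ ((z : ℝ) + 1) =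
      ENNReal.ofReal (|(k : ℝ)| ^ 0 * ‖a k‖) := fun k => by
    rw [← ENNReal.rpow_mul, one_div_mul_cancel (by positivity), ENNReal.rpow_one, pow_zero, one_mul]
  have e2 : ∀ k : ℤ, (ENNReal.ofReal (|(k : ℝ)| ^ (z + 1) * ‖a k‖) ^ ((z : ℝ) / (z + 1))) ^
      (((z : ℝ) + 1) / z) = ENNReal.ofReal (|(k : ℝ)| ^ (z + 1) * ‖a k‖) := fun k => by
    rw [← ENNReal.rpow_mul, div_mul_div_cancel₀ (by positivity), div_self hz'.ne',
      ENNReal.rpow_one]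
  have e3 : ∀ k : ℤ, ENNReal.ofReal ‖a k‖ ^ (1 / ((z : ℝ) + 1)) *
      ENNReal.ofReal (|(k : ℝ)| ^ (z + 1) * ‖a k‖) ^ ((z : ℝ) / (z + 1)) =
      ENNReal.ofReal (|(k : ℝ)| ^ z * ‖a k‖) := fun k => by
    rw [ENNReal.ofReal_rpow_of_nonneg (norm_nonneg _) (by positivity),
      ENNReal.ofReal_rpow_of_nonneg (by positivity) (by positivity),
      ← ENNReal.ofReal_mul (by positivity)]
    congr 1
    rw [Real.mul_rpow (by positivity) (norm_nonneg _), ← Real.rpow_natCast, ← Real.rpow_mul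
      (abs_nonneg _), mul_left_comm, ← Real.rpow_add_of_nonneg (norm_nonneg _) (by positivity)
      (by positivity)]
    congr 1
    · rw [← Real.rpow_natCast]
      congr 1; push_cast; field_simp
    · rw [← add_div, add_comm (1 : ℝ), div_self (by positivity), Real.rpow_one]
  simp only [Pi.mul_apply, e1, e2, e3] at H
  rw [← hc, ← hc, ← hc] at H
  have H2 := ENNReal.rpow_le_rpow H (show 0 ≤ ((z : ℝ) + 1) / z by positivity)
  refine H2.trans (le_of_eq ?_)
  rw [ENNReal.mul_rpow_of_nonneg _ _ (by positivity), ← ENNReal.rpow_mul, ← ENNReal.rpow_mul]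
  congr 1
  · congr 1; field_simp
  · rw [one_div_mul_cancel (by positivity), ENNReal.rpow_one]

/-! ### Regularity of curves of Fourier series -/

theorem exists_simpleFunc_coef (a : ℤ → SimpleFunc ℝ ℂ) (S : Finset ℤ) :
    ∃ φ : SimpleFunc ℝ (ℤ → ℂ), ∀ t k, φ t k = if k ∈ S then a k t else 0 := by
  induction S using Finset.induction_on with
  | empty => exact ⟨0, fun t k => by simp⟩
  | insert j S hj ih =>
    obtain ⟨φ, hφ⟩ := ih
    refine ⟨φ + (a j).map (fun w => Pi.single j w), fun t k => ?_⟩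
    rw [SimpleFunc.add_apply, Pi.add_apply, hφ, SimpleFunc.map_apply, Pi.single_apply]
    rcases eq_or_ne k j with rfl | hkj
    · simp [hj]
    · simp [hkj]

/-- Measurable curves of Fourier coefficients are limits of simple functions in each Wiener
space. -/
theorem exists_simpleFunc_tendsto {s : ℕ} {c : ℝ → ℤ → ℂ} (hm : ∀ k, Measurable fun t => c t k)
    (h0 : ∀ t, c t 0 = 0) (h : ∀ t, wn s (c t) ≠ ⊤) :
    ∃ φ : ℕ → SimpleFunc ℝ (ℤ → ℂ), (∀ n t, φ n t 0 = 0) ∧ (∀ n t, wn s (φ n t) ≠ ⊤) ∧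
      ∀ t, Tendsto (fun n => wn s (c t - φ n t)) atTop (𝓝 0) := by
  choose φ hφ using fun n : ℕ => exists_simpleFunc_coef
    (fun k => SimpleFunc.approxOn (fun t => c t k) (hm k) univ 0 (mem_univ _) n)
    (Finset.Icc (-(n : ℤ)) n)
  have hle : ∀ n t k, ‖φ n t k‖ ≤ 2 * ‖c t k‖ := fun n t k => by
    rw [hφ]
    split_ifs
    · have := SimpleFunc.norm_approxOn_zero_le (hm k) (mem_univ (0 : ℂ)) t n
      linarith
    · rw [norm_zero]; positivity
  refine ⟨φ, fun n t => ?_, fun n t => ?_, fun t => ?_⟩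
  · have := hle n t 0
    rw [h0, norm_zero, mul_zero] at this
    exact norm_le_zero_iff.1 this
  · have : wn s (φ n t) ≤ 2 * wn s (c t) := by
      rw [wn, wn, ← ENNReal.tsum_mul_left]
      refine ENNReal.tsum_le_tsum fun k => ?_
      rw [← ENNReal.ofReal_ofNat, ← ENNReal.ofReal_mul (by norm_num)]
      refine ENNReal.ofReal_le_ofReal ?_
      have := mul_le_mul_of_nonneg_left (hle n t k) (show 0 ≤ |(k : ℝ)| ^ s by positivity)
      linarith
    exact ne_top_of_le_ne_top (ENNReal.mul_ne_top (by norm_num) (h t)) this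
  · have hs := summable_of_wn (h t)
    have hb : ∀ (n : ℕ) (k : ℤ), |(k : ℝ)| ^ s * ‖(c t - φ n t) k‖ ≤ 3 * (|(k : ℝ)| ^ s * ‖c t k‖) := by
      intro n k
      have h1 : ‖(c t - φ n t) k‖ ≤ 3 * ‖c t k‖ := by
        refine (norm_sub_le _ _).trans ?_
        linarith [hle n t k]
      have := mul_le_mul_of_nonneg_left h1 (show 0 ≤ |(k : ℝ)| ^ s by positivity)
      linarith
    have hlim : Tendsto (fun n => ∑' k : ℤ, |(k : ℝ)| ^ s * ‖(c t - φ n t) k‖) atTop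
        (𝓝 (∑' _ : ℤ, (0 : ℝ))) := by
      refine tendsto_tsum_of_dominated_convergence (hs.mul_left 3) (fun k => ?_)
        (.of_forall fun n k => ?_)
      · have h1 : Tendsto (fun n => φ n t k) atTop (𝓝 (c t k)) := by
          have := SimpleFunc.tendsto_approxOn (hm k) (mem_univ (0 : ℂ)) (x := t) (by simp)
          refine this.congr' ?_
          filter_upwards [eventually_ge_atTop k.natAbs] with n hn
          rw [hφ, if_pos]
          rw [Finset.mem_Icc, ← abs_le, Int.abs_eq_natAbs]
          exact_mod_cast hn
        have h2 := ((h1.const_sub (c t k)).norm).const_mul (|(k : ℝ)| ^ s)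
        simpa using h2
      · rw [Real.norm_of_nonneg (by positivity)]
        exact hb n k
    rw [tsum_zero] at hlim
    have := ENNReal.tendsto_ofReal hlim
    rw [ENNReal.ofReal_zero] at this
    refine this.congr fun n => (wn_eq_ofReal ?_).symm
    exact Summable.of_nonneg_of_le (fun k => by positivity) (hb n) (hs.mul_left 3)

theorem memBochner_rser {N : (Torus → ℝ) → ℝ≥0∞} {p T : ℝ} {s : ℕ} {c : ℝ → ℤ → ℂ} {C : ℝ≥0∞}
    (hm : ∀ k, Measurable fun t => c t k) (h0 : ∀ t, c t 0 = 0) (h : ∀ t, wn s (c t) ≠ ⊤)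
    (hC : C ≠ ⊤) (hN : ∀ a : ℤ → ℂ, a 0 = 0 → wn s a ≠ ⊤ → N (rser a) ≤ C * wn s a)
    (hp : ∫⁻ t in Ioc 0 T, N (rser (c t)) ^ p < ⊤) :
    MemBochner N p T fun t => rser (c t) := by
  obtain ⟨φ, hφ0, hφt, hφ⟩ := exists_simpleFunc_tendsto hm h0 h
  refine ⟨⟨fun n => (φ n).map rser, fun n t => ?_, .of_forall fun t => ?_⟩, hp⟩
  · exact (hN _ (hφ0 n t) (hφt n t)).trans_lt
      (ENNReal.mul_lt_top hC.lt_top (hφt n t).lt_top)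
  · have hlim := ENNReal.Tendsto.const_mul (a := C) (hφ t) (Or.inr hC)
    rw [mul_zero] at hlim
    refine tendsto_of_tendsto_of_tendsto_of_le_of_le tendsto_const_nhds hlim (fun _ => zero_le)
      fun n => ?_
    have e : rser (c t) - (φ n).map rser t = rser (c t - φ n t) := by
      ext x
      rw [SimpleFunc.map_apply, Pi.sub_apply,
        rser_sub (wn_ne_top_mono (Nat.zero_le _) (h0 t) (h t))
          (wn_ne_top_mono (Nat.zero_le _) (hφ0 n t) (hφt n t))]
    show N (rser (c t) - (φ n).map rser t) ≤ _
    rw [e]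
    refine hN _ (by simp [h0 t, hφ0 n t]) ?_
    exact ne_top_of_le_ne_top (ENNReal.add_ne_top.2 ⟨h t, hφt n t⟩) (wn_sub_le _ _ _)

/-- The integral in time of a curve of Fourier series is the Fourier series of the integrals of the
coefficients. -/
theorem integral_rser {c : ℝ → ℤ → ℂ} {μ : Measure ℝ} (hm : ∀ k, Measurable fun t => c t k)
    (h : ∫⁻ t, wn 0 (c t) ∂μ ≠ ⊤) (x : Torus) :
    ∫ t, rser (c t) x ∂μ = rser (fun k => ∫ t, c t k ∂μ) x := by
  have hlt : ∑' k, ∫⁻ t, ‖c t k * fourier k x‖ₑ ∂μ ≠ ⊤ := by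
    rw [← lintegral_tsum fun k => ((hm k).mul_const _).enorm.aemeasurable]
    refine ne_top_of_le_ne_top h (lintegral_mono fun t => ?_)
    rw [wn_zero]
    refine ENNReal.tsum_le_tsum fun k => ?_
    rw [enorm_mul, ← ofReal_norm (fourier k x), norm_fourier_apply]; simp
  have key := integral_tsum (μ := μ) (f := fun k t => c t k * fourier k x)
    (fun k => ((hm k).mul_const _).aestronglyMeasurable) hlt
  have hint : Integrable (fun t => ser (c t) x) μ := by
    refine ⟨Measurable.aestronglyMeasurable ?_, ?_⟩
    · have hm' : ∀ k, Measurable fun t => c t k * fourier k x := fun k => (hm k).mul_const _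
      exact Measurable.tsum hm'
    · exact lt_of_le_of_lt (lintegral_mono fun t => enorm_ser_le _ x) h.lt_top
  have hre : ∫ t, (ser (c t) x).re ∂μ = (∫ t, ser (c t) x ∂μ).re := integral_re hint
  show ∫ t, (ser (c t) x).re ∂μ = _
  rw [hre]
  show (∫ t, ∑' k, c t k * fourier k x ∂μ).re = _
  rw [key, rser, ser]
  congr 1
  exact tsum_congr fun k => integral_mul_const _ _

theorem wn_integral_le {c : ℝ → ℤ → ℂ} {μ : Measure ℝ} (hm : ∀ k, Measurable fun t => c t k)
    (s : ℕ) : wn s (fun k => ∫ t, c t k ∂μ) ≤ ∫⁻ t, wn s (c t) ∂μ := by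
  have hm' : ∀ k : ℤ, Measurable fun t => ENNReal.ofReal (|(k : ℝ)| ^ s * ‖c t k‖) := fun k =>
    (((hm k).norm).const_mul _).ennreal_ofReal
  unfold wn
  rw [lintegral_tsum fun k => (hm' k).aemeasurable]
  refine ENNReal.tsum_le_tsum fun k => ?_
  have e : ∀ w : ℂ, ENNReal.ofReal (|(k : ℝ)| ^ s * ‖w‖) = ENNReal.ofReal (|(k : ℝ)| ^ s) * ‖w‖ₑ :=
    fun w => by rw [ENNReal.ofReal_mul (by positivity), ofReal_norm]
  simp only [e]
  rw [lintegral_const_mul _ (hm k).enorm]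
  gcongr
  exact enorm_integral_le_lintegral_enorm _

instance isFiniteMeasure_spaceTime (T : ℝ) : IsFiniteMeasure (spaceTime T) := by
  unfold spaceTime; infer_instance

/-- The regularity of bounded curves in the Wiener algebra that are integrable in the Wiener space
of order `ζ + 1`. -/
theorem hasRegularity_rser (d : Flow) {E : ℝ} {c : ℝ → ℤ → ℂ} (hm : ∀ k, Measurable fun t => c t k)
    (h0 : ∀ t, c t 0 = 0) (h : ∀ t, wn (d.zeta + 1) (c t) ≠ ⊤)
    (hE : ∀ t, wn 0 (c t) ≤ ENNReal.ofReal E)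
    (hi : ∫⁻ t in Ioi (0 : ℝ), wn (d.zeta + 1) (c t) ≠ ⊤) (T : ℝ) :
    HasRegularity d T fun t => rser (c t) := by
  have hz : 0 < d.zeta := by cases d <;> simp [Flow.zeta]
  have hz' : (0 : ℝ) < d.zeta := by exact_mod_cast hz
  have hfin : ∀ t, wn 0 (c t) ≠ ⊤ := fun t => ne_top_of_le_ne_top ENNReal.ofReal_ne_top (hE t)
  have hiT : ∫⁻ t in Ioc 0 T, wn (d.zeta + 1) (c t) ≠ ⊤ :=
    ne_top_of_le_ne_top hi (lintegral_mono_set fun t ht => ht.1)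
  have hbd : MemLInf T fun t => rser (c t) := by
    refine memLp_top_of_bound (measurable_rser hm hfin).aestronglyMeasurable (ENNReal.ofReal E).toReal
      (.of_forall fun p => ?_)
    exact (abs_rser_le (hfin p.1) p.2).trans (ENNReal.toReal_mono ENNReal.ofReal_ne_top (hE p.1))
  -- every norm occurring, raised to its power, is at most linear in the norm of order `ζ + 1`
  have hlin : ∀ (N : (Torus → ℝ) → ℝ≥0∞) (p : ℝ) (C : ℝ≥0∞), C ≠ ⊤ →
      (∀ t, N (rser (c t)) ^ p ≤ C * wn (d.zeta + 1) (c t)) →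
      ∫⁻ t in Ioc 0 T, N (rser (c t)) ^ p < ⊤ := fun N p C hC hN => by
    refine (lintegral_mono hN).trans_lt ?_
    rw [lintegral_const_mul _ (measurable_wn hm _)]
    exact ENNReal.mul_lt_top hC.lt_top hiT.lt_top
  have htop : ∀ a : ℤ → ℂ, a 0 = 0 → wn (d.zeta + 1) a ≠ ⊤ →
      sobolevNorm d.zeta ⊤ (rser a) ≤ 2 * wn (d.zeta + 1) a := fun a ha0 ha =>
    (sobolevNorm_top_rser_le (Nat.le_succ _) ha0 ha).trans
      (mul_le_mul_right (wn_mono (Nat.le_succ _) ha0) _)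
  refine ⟨hbd, ?_, fun α hα => ?_, ?_, ?_⟩
  · refine memBochner_rser hm h0 h (by norm_num) htop
      (hlin _ _ (2 ^ (((d.zeta : ℝ) + 1) / d.zeta) * ENNReal.ofReal E ^ (1 / (d.zeta : ℝ)))
        (by finiteness) fun t => ?_)
    refine (ENNReal.rpow_le_rpow (sobolevNorm_top_rser_le (Nat.le_succ _) (h0 t) (h t))
      (by positivity)).trans ?_
    rw [ENNReal.mul_rpow_of_nonneg _ _ (by positivity), mul_assoc]
    refine mul_le_mul_right ((wn_rpow_le hz _).trans (mul_le_mul_left ?_ _)) _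
    exact ENNReal.rpow_le_rpow (hE t) (by positivity)
  · have hα' : α ≤ 1 := hα.le.trans (by norm_num)
    refine memBochner_rser hm h0 h (C := ((d.zeta + 1 : ℕ) + 2 : ℝ≥0∞)) (by finiteness)
      (fun a ha0 ha => holderNorm_rser_le ha0 ha hα')
      (hlin _ _ ((d.zeta + 1 : ℕ) + 2 : ℝ≥0∞) (by finiteness) fun t => ?_)
    rw [ENNReal.rpow_one]
    exact holderNorm_rser_le (h0 t) (h t) hα'
  -- integrals over sets of times are dominated by the measure with density `2 ‖·‖_{ζ + 1}`
  · refine ⟨hbd.integrable le_top, (volume.restrict (Icc 0 T)).withDensity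
      (fun t => 2 * wn (d.zeta + 1) (c t)), ?_, fun S hS hST => ?_⟩
    · refine isFiniteMeasure_withDensity ?_
      rw [lintegral_const_mul _ (measurable_wn hm _), restrict_Ioc_eq_restrict_Icc.symm]
      exact ENNReal.mul_ne_top (by norm_num) hiT
    · rw [withDensity_apply _ hS, Measure.restrict_restrict hS, inter_eq_left.2 hST,
        lintegral_const_mul _ (measurable_wn hm _)]
      have hS0 : ∀ s ≤ d.zeta + 1, ∫⁻ t in S, wn s (c t) ≠ ⊤ := fun s hs => by
        refine ne_top_of_le_ne_top ?_ (lintegral_mono fun t => wn_mono hs (h0 t))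
        refine ne_top_of_le_ne_top hiT ((lintegral_mono_set hST).trans_eq ?_)
        rw [restrict_Ioc_eq_restrict_Icc]
      rw [show (fun x => ∫ t in S, rser (c t) x) = rser (fun k => ∫ t in S, c t k) from
        funext fun x => integral_rser hm (hS0 0 (Nat.zero_le _)) x]
      have hw := wn_integral_le (μ := volume.restrict S) hm (d.zeta + 1)
      refine (sobolevNorm_top_rser_le le_rfl ?_ (ne_top_of_le_ne_top (hS0 _ le_rfl) hw)).trans
        (mul_le_mul_right hw _)
      simp [h0]
  · have e : (((d.zeta : ℝ) + 1) / 2) = ((d.zeta + 1 : ℕ) : ℝ) / 2 := by push_cast; rfl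
    rw [e]
    refine memBochner_rser hm h0 h (C := 1) (by norm_num) (fun a ha0 ha => ?_)
      (hlin _ _ (ENNReal.ofReal E) (by finiteness) fun t => ?_)
    · rw [one_mul]
      refine (hNorm_rser_le ha0 ha).trans ?_
      refine (ENNReal.rpow_le_rpow (mul_le_mul_left (wn_mono (Nat.zero_le (d.zeta + 1)) ha0) _)
        (by norm_num)).trans (le_of_eq ?_)
      rw [← sq, ← ENNReal.rpow_natCast, ← ENNReal.rpow_mul]
      norm_num
    · refine (ENNReal.rpow_le_rpow (hNorm_rser_le (h0 t) (h t)) (by norm_num)).trans ?_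
      rw [← ENNReal.rpow_mul]
      norm_num
      exact mul_le_mul_left (hE t) _

theorem memBochner_sobolev_one (d : Flow) {c : ℝ → ℤ → ℂ} (hm : ∀ k, Measurable fun t => c t k)
    (h0 : ∀ t, c t 0 = 0) (h : ∀ t, wn (d.zeta + 1) (c t) ≠ ⊤)
    (hi : ∫⁻ t in Ioi (0 : ℝ), wn (d.zeta + 1) (c t) ≠ ⊤) (T : ℝ) :
    MemBochner (sobolevNorm d.zeta 1) 1 T fun t => rser (c t) := by
  refine memBochner_rser hm h0 h (C := 2 * ENNReal.ofReal (2 * Real.pi)) (by finiteness)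
    (fun a ha0 ha => sobolevNorm_one_rser_le (Nat.le_succ _) ha0 ha) ?_
  simp only [ENNReal.rpow_one]
  refine (lintegral_mono fun t => sobolevNorm_one_rser_le (Nat.le_succ _) (h0 t) (h t)).trans_lt ?_
  rw [lintegral_const_mul _ (measurable_wn hm _)]
  refine ENNReal.mul_lt_top (by finiteness) ?_
  exact lt_of_le_of_lt (lintegral_mono_set fun t ht => ht.1) hi.lt_top

/-! ### The divergence of the flux -/

/-- Landau's inequality for one Fourier series: the first derivative is bounded by the geometric mean
of the function and its second derivative. -/
theorem landau {c : ℤ → ℂ} (h0 : c 0 = 0) (h2 : wn 2 c ≠ ⊤) {A B : ℝ}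
    (hA : ∀ x, |rser c x| ≤ A) (hB : ∀ x, |rser (dcoef 2 c) x| ≤ B) (x : Torus) :
    rser (dcoef 1 c) x ^ 2 ≤ 8 * A * B := by
  have h00 := wn_ne_top_mono (Nat.zero_le _) h0 h2
  have h1 := wn_ne_top_mono (show 1 ≤ 2 by norm_num) h0 h2
  have d1 := hasDerivAt_rser h00 h1
  have d2 := hasDerivAt_rser (c := dcoef 1 c) (by rwa [wn_dcoef]) (by rwa [wn_dcoef])
  rw [dcoef_dcoef] at d2
  have hA0 : 0 ≤ A := (abs_nonneg _).trans (hA 0)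
  have hB0 : 0 ≤ B := (abs_nonneg _).trans (hB 0)
  -- a second order Taylor expansion with step `h`
  have key : ∀ h : ℝ, 0 < h → h * |rser (dcoef 1 c) x| ≤ 2 * A + h ^ 2 * B := by
    intro h hh
    induction x using QuotientAddGroup.induction_on with
    | H y =>
      have g1 := (convex_Icc y (y + h)).norm_image_sub_le_of_norm_hasDerivWithin_le
        (f := fun s : ℝ => rser c (s : Torus) - (s - y) * rser (dcoef 1 c) (y : Torus))
        (f' := fun s : ℝ => rser (dcoef 1 c) (s : Torus) - 1 * rser (dcoef 1 c) (y : Torus))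
        (C := h * B) (x := y) (y := y + h)
        (fun s _ => ((d1 s).sub (((hasDerivAt_id s).sub_const y).mul_const _)).hasDerivWithinAt)
        (fun s hs => ?_) (left_mem_Icc.2 (by linarith)) (right_mem_Icc.2 (by linarith))
      · simp only [Real.norm_eq_abs, add_sub_cancel_left, sub_self, zero_mul, sub_zero,
          abs_of_pos hh] at g1
        have a1 := abs_le.1 (hA ((y + h : ℝ) : Torus))
        have a2 := abs_le.1 (hA (y : Torus))
        have a3 := abs_le.1 g1
        show h * |rser (dcoef 1 c) (y : Torus)| ≤ _
        rw [← abs_of_pos hh, ← abs_mul, abs_of_pos hh, abs_le]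
        constructor <;> nlinarith
      · have g2 := (convex_Icc y (y + h)).norm_image_sub_le_of_norm_hasDerivWithin_le
          (f := fun s : ℝ => rser (dcoef 1 c) (s : Torus))
          (f' := fun s : ℝ => rser (dcoef 2 c) (s : Torus)) (C := B) (x := y) (y := s)
          (fun r _ => (d2 r).hasDerivWithinAt) (fun r _ => hB _)
          (left_mem_Icc.2 (by linarith)) hs
        rw [one_mul]
        refine g2.trans ?_
        rw [Real.norm_eq_abs, abs_of_nonneg (sub_nonneg.2 hs.1), mul_comm]
        exact mul_le_mul_of_nonneg_right (by linarith [hs.2]) hB0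
  set p := |rser (dcoef 1 c) x| with hp
  rw [← sq_abs, ← hp]
  have hp0 : 0 ≤ p := abs_nonneg _
  -- nonnegativity for all step sizes is the inequality, by way of the discriminant
  have hq : ∀ h : ℝ, 0 ≤ B * (h * h) + -p * h + 2 * A := fun h => by
    rcases le_or_gt h 0 with hh | hh
    · nlinarith [mul_nonneg hB0 (mul_self_nonneg h), mul_nonneg hp0 (neg_nonneg.2 hh)]
    · linarith [key h hh]
  have := discrim_le_zero hq
  rw [discrim] at this
  linarith

/-- The logarithmic convexity of a sequence of norms up to constants, between the orders zero and
four. -/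
theorem mul_le_of_landau {m₀ m₁ m₂ m₃ m₄ : ℝ} (h₀ : 0 ≤ m₀) (h₁ : 0 ≤ m₁) (h₂ : 0 ≤ m₂)
    (h₃ : 0 ≤ m₃) (h₄ : 0 ≤ m₄) (l₁ : m₁ ^ 2 ≤ 8 * m₀ * m₂) (l₂ : m₂ ^ 2 ≤ 8 * m₁ * m₃)
    (l₃ : m₃ ^ 2 ≤ 8 * m₂ * m₄) : m₁ * m₃ ≤ 512 * (m₀ * m₄) := by
  rcases (mul_nonneg h₁ h₃).eq_or_lt with h | h
  · rw [← h]; positivity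
  · refine le_of_mul_le_mul_right ?_ h
    calc m₁ * m₃ * (m₁ * m₃) = m₁ ^ 2 * m₃ ^ 2 := by ring
      _ ≤ 8 * m₀ * m₂ * (8 * m₂ * m₄) := by gcongr
      _ = 64 * (m₀ * m₄) * m₂ ^ 2 := by ring
      _ ≤ 64 * (m₀ * m₄) * (8 * m₁ * m₃) := by gcongr
      _ = _ := by ring

/-- The larger of the supremum norms of the derivatives of order `j` of two Fourier series. -/
noncomputable def supNorm (j : ℕ) (c d : ℤ → ℂ) : ℝ :=
  ⨆ x : Torus, max |rser (dcoef j c) x| |rser (dcoef j d) x|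

section supNorm

variable {c d : ℤ → ℂ} {j : ℕ}

theorem bddAbove_supNorm (hj : pairNorm j c d ≠ ⊤) :
    BddAbove (range fun x : Torus => max |rser (dcoef j c) x| |rser (dcoef j d) x|) := by
  obtain ⟨h1, h2⟩ := ENNReal.add_ne_top.1 hj
  refine ⟨(pairNorm j c d).toReal, ?_⟩
  rintro _ ⟨x, rfl⟩
  have e1 := abs_rser_le (c := dcoef j c) (by rwa [wn_dcoef, zero_add]) x
  have e2 := abs_rser_le (c := dcoef j d) (by rwa [wn_dcoef, zero_add]) x
  rw [wn_dcoef, zero_add] at e1 e2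
  rw [pairNorm_toReal_eq hj]
  refine max_le (e1.trans ?_) (e2.trans ?_)
  · linarith [ENNReal.toReal_nonneg (a := wn j d)]
  · linarith [ENNReal.toReal_nonneg (a := wn j c)]

theorem le_supNorm_left (hj : pairNorm j c d ≠ ⊤) (x : Torus) :
    |rser (dcoef j c) x| ≤ supNorm j c d :=
  (le_max_left _ _).trans (le_ciSup (bddAbove_supNorm hj) x)

theorem le_supNorm_right (hj : pairNorm j c d ≠ ⊤) (x : Torus) :
    |rser (dcoef j d) x| ≤ supNorm j c d :=
  (le_max_right _ _).trans (le_ciSup (bddAbove_supNorm hj) x)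

theorem supNorm_nonneg : 0 ≤ supNorm j c d :=
  Real.iSup_nonneg fun _ => le_max_of_le_left (abs_nonneg _)

theorem supNorm_le_pairNorm (hj : pairNorm j c d ≠ ⊤) : supNorm j c d ≤ (pairNorm j c d).toReal := by
  obtain ⟨h1, h2⟩ := ENNReal.add_ne_top.1 hj
  refine ciSup_le fun x => ?_
  have e1 := abs_rser_le (c := dcoef j c) (by rwa [wn_dcoef, zero_add]) x
  have e2 := abs_rser_le (c := dcoef j d) (by rwa [wn_dcoef, zero_add]) x
  rw [wn_dcoef, zero_add] at e1 e2
  rw [pairNorm_toReal_eq hj]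
  refine max_le (e1.trans ?_) (e2.trans ?_)
  · linarith [ENNReal.toReal_nonneg (a := wn j d)]
  · linarith [ENNReal.toReal_nonneg (a := wn j c)]

/-- Landau's inequality. -/
theorem supNorm_sq_le (hc : c 0 = 0) (hd : d 0 = 0) (hj : pairNorm (j + 2) c d ≠ ⊤) :
    supNorm (j + 1) c d ^ 2 ≤ 8 * supNorm j c d * supNorm (j + 2) c d := by
  have n0 := ne_top_of_le_ne_top hj (pairNorm_mono (show j ≤ j + 2 by omega) hc hd)
  obtain ⟨h1, h2⟩ := ENNReal.add_ne_top.1 hj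
  have key : ∀ e : ℤ → ℂ, e 0 = 0 → wn (j + 2) e ≠ ⊤ → (∀ x, |rser (dcoef j e) x| ≤ supNorm j c d) →
      (∀ x, |rser (dcoef (j + 2) e) x| ≤ supNorm (j + 2) c d) → ∀ x,
      |rser (dcoef (j + 1) e) x| ≤ √(8 * supNorm j c d * supNorm (j + 2) c d) :=
    fun e he hw l1 l2 x => by
      refine Real.abs_le_sqrt ?_
      have := landau (c := dcoef j e) (dcoef_zero_apply he) (by rwa [wn_dcoef, add_comm]) l1
        (by rw [dcoef_dcoef, add_comm]; exact l2) x
      rwa [dcoef_dcoef, add_comm] at this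
  have hle : supNorm (j + 1) c d ≤ √(8 * supNorm j c d * supNorm (j + 2) c d) :=
    ciSup_le fun x => max_le (key c hc h1 (le_supNorm_left n0) (le_supNorm_left hj) x)
      (key d hd h2 (le_supNorm_right n0) (le_supNorm_right hj) x)
  have h0 : 0 ≤ 8 * supNorm j c d * supNorm (j + 2) c d :=
    mul_nonneg (mul_nonneg (by norm_num) supNorm_nonneg) supNorm_nonneg
  calc _ ≤ √(8 * supNorm j c d * supNorm (j + 2) c d) ^ 2 :=
        pow_le_pow_left₀ supNorm_nonneg hle 2
    _ = _ := Real.sq_sqrt h0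

/-- The product of derivatives that arises from differentiating a mobility is no worse than the
derivative of top order. -/
theorem supNorm_one_mul_le {z : ℕ} (hz : z = 1 ∨ z = 3) (hc : c 0 = 0) (hd : d 0 = 0)
    (h : pairNorm (z + 1) c d ≠ ⊤) :
    supNorm 1 c d * supNorm z c d ≤ 512 * (supNorm 0 c d * supNorm (z + 1) c d) := by
  rcases hz with rfl | rfl
  · have := supNorm_sq_le (j := 0) hc hd h
    simp only [zero_add] at this ⊢
    nlinarith [mul_nonneg (supNorm_nonneg (j := 0) (c := c) (d := d))
      (supNorm_nonneg (j := 2) (c := c) (d := d))]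
  · have n : ∀ s ≤ 4, pairNorm s c d ≠ ⊤ := fun s hs => ne_top_of_le_ne_top h
      (pairNorm_mono hs hc hd)
    exact mul_le_of_landau supNorm_nonneg supNorm_nonneg supNorm_nonneg supNorm_nonneg
      supNorm_nonneg (supNorm_sq_le (j := 0) hc hd (n 2 (by norm_num)))
      (supNorm_sq_le (j := 1) hc hd (n 3 (by norm_num)))
      (supNorm_sq_le (j := 2) hc hd (n 4 (by norm_num)))

end supNorm

/-- The derivative in space of the flux `Φ` along the curve of heights `F + f`, `G + g`, by the
chain rule. -/
noncomputable def fluxDiv (Φ : ℝ → ℝ → ℝ → ℝ → ℝ) (z : ℕ) (F G : ℝ) (c d : ℤ → ℂ) (x : Torus) : ℝ :=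
  fderiv ℝ (fun y : ℝ × ℝ × ℝ × ℝ => Φ y.1 y.2.1 y.2.2.1 y.2.2.2)
    (F + rser c x, G + rser d x, rser (Dcoef z c) x, rser (Dcoef z d) x)
    (rser (dcoef 1 c) x, rser (dcoef 1 d) x, rser (dcoef 1 (Dcoef z c)) x,
      rser (dcoef 1 (Dcoef z d)) x)

theorem contDiff_fluxF (ρ : ℝ) :
    ContDiff ℝ 1 fun y : ℝ × ℝ × ℝ × ℝ => fluxF ρ y.1 y.2.1 y.2.2.1 y.2.2.2 := by
  unfold fluxF; fun_prop

theorem contDiff_fluxG (ρ μ : ℝ) :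
    ContDiff ℝ 1 fun y : ℝ × ℝ × ℝ × ℝ => fluxG ρ μ y.1 y.2.1 y.2.2.1 y.2.2.2 := by
  unfold fluxG; fun_prop

section fluxDiv

variable {Φ : ℝ → ℝ → ℝ → ℝ → ℝ} {z : ℕ} {c d : ℤ → ℂ} {F G L C : ℝ}

theorem hasDerivAt_phys (hΦ : ContDiff ℝ 1 fun y : ℝ × ℝ × ℝ × ℝ => Φ y.1 y.2.1 y.2.2.1 y.2.2.2)
    (hc : c 0 = 0) (hd : d 0 = 0) (h : pairNorm (z + 1) c d ≠ ⊤) (y : ℝ) :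
    HasDerivAt (fun y : ℝ => phys Φ z F G c d (y : Torus)) (fluxDiv Φ z F G c d (y : Torus)) y := by
  obtain ⟨h1, h2⟩ := ENNReal.add_ne_top.1 h
  have key : ∀ e : ℤ → ℂ, e 0 = 0 → wn (z + 1) e ≠ ⊤ →
      HasDerivAt (fun y : ℝ => rser e (y : Torus)) (rser (dcoef 1 e) (y : Torus)) y ∧
      HasDerivAt (fun y : ℝ => rser (Dcoef z e) (y : Torus))
        (rser (dcoef 1 (Dcoef z e)) (y : Torus)) y := fun e he hw =>
    ⟨hasDerivAt_rser (wn_ne_top_mono (Nat.zero_le _) he hw)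
      (wn_ne_top_mono (Nat.le_add_left 1 z) he hw) y,
    hasDerivAt_rser (by rw [wn_Dcoef, zero_add]; exact wn_ne_top_mono (Nat.le_succ z) he hw)
      (by rwa [wn_Dcoef, add_comm]) y⟩
  obtain ⟨a1, a2⟩ := key c hc h1
  obtain ⟨b1, b2⟩ := key d hd h2
  have := (hΦ.differentiable one_ne_zero _).hasFDerivAt.comp_hasDerivAt y
    ((a1.const_add F).prodMk ((b1.const_add G).prodMk (a2.prodMk b2)))
  exact this

theorem continuous_fluxDiv
    (hΦ : ContDiff ℝ 1 fun y : ℝ × ℝ × ℝ × ℝ => Φ y.1 y.2.1 y.2.2.1 y.2.2.2)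
    (hc : c 0 = 0) (hd : d 0 = 0) (h : pairNorm (z + 1) c d ≠ ⊤) :
    Continuous (fluxDiv Φ z F G c d) := by
  obtain ⟨h1, h2⟩ := ENNReal.add_ne_top.1 h
  have key : ∀ e : ℤ → ℂ, e 0 = 0 → wn (z + 1) e ≠ ⊤ → Continuous (rser e) ∧
      Continuous (rser (Dcoef z e)) ∧ Continuous (rser (dcoef 1 e)) ∧
      Continuous (rser (dcoef 1 (Dcoef z e))) := fun e he hw =>
    ⟨continuous_rser (wn_ne_top_mono (Nat.zero_le _) he hw),
      continuous_rser (by rw [wn_Dcoef, zero_add]; exact wn_ne_top_mono (Nat.le_succ z) he hw),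
      continuous_rser (by rw [wn_dcoef, zero_add]; exact wn_ne_top_mono (Nat.le_add_left 1 z) he hw),
      continuous_rser (by rwa [wn_dcoef, zero_add, wn_Dcoef, add_comm])⟩
  obtain ⟨a1, a2, a3, a4⟩ := key c hc h1
  obtain ⟨b1, b2, b3, b4⟩ := key d hd h2
  exact ((hΦ.continuous_fderiv one_ne_zero).comp ((continuous_const.add a1).prodMk
    ((continuous_const.add b1).prodMk (a2.prodMk b2)))).clm_apply
    (a3.prodMk (b3.prodMk (a4.prodMk b4)))

/-- The Lipschitz bound of a flux bounds its derivative; the margin `1` leaves room for small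
increments of the heights. -/
theorem FluxBound.abs_fderiv_le (hΦ : FluxBound Φ (L + 1) C)
    (hd : Differentiable ℝ fun y : ℝ × ℝ × ℝ × ℝ => Φ y.1 y.2.1 y.2.2.1 y.2.2.2)
    {f g p q f' g' p' q' : ℝ} (hf : |f| ≤ L) (hg : |g| ≤ L) :
    |fderiv ℝ (fun y : ℝ × ℝ × ℝ × ℝ => Φ y.1 y.2.1 y.2.2.1 y.2.2.2) (f, g, p, q) (f', g', p', q')|
      ≤ C * (|p'| + |q'|) + C * ((|f'| + |g'|) * (|p| + |q|)) := by
  have l : HasDerivAt (fun s : ℝ => ((f, g, p, q) : ℝ × ℝ × ℝ × ℝ) + s • (f', g', p', q'))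
      (f', g', p', q') 0 := by
    simpa using ((hasDerivAt_id (0 : ℝ)).smul_const ((f', g', p', q') : ℝ × ℝ × ℝ × ℝ)).const_add
      ((f, g, p, q) : ℝ × ℝ × ℝ × ℝ)
  have l2 := (hd _).hasFDerivAt.comp_hasDerivAt (0 : ℝ) l
  rw [zero_smul, add_zero] at l2
  rw [← Real.norm_eq_abs]
  refine l2.le_of_lip' (C := C * (|p'| + |q'|) + C * ((|f'| + |g'|) * (|p| + |q|)))
    (add_nonneg (mul_nonneg hΦ.nonneg (by positivity)) (mul_nonneg hΦ.nonneg (by positivity))) ?_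
  have e1 : ∀ᶠ s : ℝ in 𝓝 0, |f + s * f'| < L + 1 :=
    (Continuous.tendsto (by fun_prop) (0 : ℝ)).eventually_lt_const
      (by rw [zero_mul, add_zero]; linarith)
  have e2 : ∀ᶠ s : ℝ in 𝓝 0, |g + s * g'| < L + 1 :=
    (Continuous.tendsto (by fun_prop) (0 : ℝ)).eventually_lt_const
      (by rw [zero_mul, add_zero]; linarith)
  filter_upwards [e1, e2] with s h1 h2
  have := hΦ.lip (f + s * f') (g + s * g') (p + s * p') (q + s * q') f g p q h1.le h2.le
    (by linarith) (by linarith)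
  simp only [add_sub_cancel_left, abs_mul] at this
  simp only [Function.comp_apply, Real.norm_eq_abs, sub_zero, Prod.smul_mk, Prod.mk_add_mk,
    smul_eq_mul, zero_mul, add_zero]
  refine this.trans (le_of_eq ?_)
  ring

end fluxDiv

/-! ### Curves with bounded heights -/

/-- A time dependent pair of real zero mean Fourier series with heights bounded by `L`, integrable
in time with respect to the norm of order `z + 1`. -/
structure BddCurve (z : ℕ) (L F G : ℝ) (c d : ℝ → ℤ → ℂ) : Prop where
  sym_c : ∀ t, Sym (c t)
  sym_d : ∀ t, Sym (d t)
  zero_c : ∀ t, c t 0 = 0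
  zero_d : ∀ t, d t 0 = 0
  top_ne : ∀ t, pairNorm (z + 1) (c t) (d t) ≠ ⊤
  meas_c : ∀ k, Measurable fun t => c t k
  meas_d : ∀ k, Measurable fun t => d t k
  abs_le_c : ∀ t x, |F + rser (c t) x| ≤ L
  abs_le_d : ∀ t x, |G + rser (d t) x| ≤ L
  lint_ne : ∫⁻ t in Ioi (0 : ℝ), pairNorm (z + 1) (c t) (d t) ≠ ⊤

theorem IsCurve.bddCurve {z : ℕ} {E F G : ℝ} {c d : ℝ → ℤ → ℂ} (h : IsCurve z E c d)
    (hF : 0 ≤ F) (hG : 0 ≤ G) (hE : 0 ≤ E) : BddCurve z (F + G + E) F G c d :=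
  ⟨h.sym_c, h.sym_d, h.zero_c, h.zero_d, h.top_ne, h.meas_c, h.meas_d,
    fun t x => abs_add_rser_le hF hE (by linarith) (le_self_add.trans (h.le_E t)) x,
    fun t x => abs_add_rser_le hG hE (by linarith) (le_add_self.trans (h.le_E t)) x, h.lint_ne⟩

theorem rser_Dcoef_one (c : ℤ → ℂ) (x : Torus) : rser (Dcoef 1 c) x = rser (dcoef 1 c) x := by
  congr 2
  ext k; simp [Dcoef, dcoef]

theorem rser_Dcoef_three (c : ℤ → ℂ) (x : Torus) : rser (Dcoef 3 c) x = -rser (dcoef 3 c) x := by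
  have e : Dcoef 3 c = fun k => -dcoef 3 c k := by
    ext k; simp only [Dcoef, dcoef, mul_pow, Complex.I_pow_three]; ring
  have e2 : ser (fun k => -dcoef 3 c k) x = -ser (dcoef 3 c) x := by
    rw [ser, ser, ← tsum_neg]; exact tsum_congr fun k => by ring
  rw [e, rser, e2, Complex.neg_re, rser]

theorem abs_rser_Dcoef {z : ℕ} (hz : z = 1 ∨ z = 3) (c : ℤ → ℂ) (x : Torus) :
    |rser (Dcoef z c) x| = |rser (dcoef z c) x| := by
  rcases hz with rfl | rfl
  · rw [rser_Dcoef_one]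
  · rw [rser_Dcoef_three, abs_neg]

theorem Dcoef_comm_dcoef (j z : ℕ) (c : ℤ → ℂ) : dcoef j (Dcoef z c) = Dcoef z (dcoef j c) := by
  ext k; simp only [dcoef, Dcoef]; ring

theorem supNorm_zero_le {c d : ℤ → ℂ} {F G L : ℝ} (hcL : ∀ x, |F + rser c x| ≤ L)
    (hdL : ∀ x, |G + rser d x| ≤ L) : supNorm 0 c d ≤ L + |F| + |G| := by
  refine ciSup_le fun y => ?_
  rw [dcoef_zero, dcoef_zero]
  have a2 := hcL y; have a3 := hdL y
  refine max_le ?_ ?_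
  · calc |rser c y| = |(F + rser c y) - F| := by rw [add_sub_cancel_left]
      _ ≤ |F + rser c y| + |F| := abs_sub _ _
      _ ≤ _ := by linarith [abs_nonneg G]
  · calc |rser d y| = |(G + rser d y) - G| := by rw [add_sub_cancel_left]
      _ ≤ |G + rser d y| + |G| := abs_sub _ _
      _ ≤ _ := by linarith [abs_nonneg F]

/-- The divergence of the flux is bounded by the norm of top order alone, with a constant that depends
only on bounds for the heights; this makes it integrable in space and time. -/
theorem abs_fluxDiv_le {Φ : ℝ → ℝ → ℝ → ℝ → ℝ} {z : ℕ} (hz : z = 1 ∨ z = 3) {c d : ℤ → ℂ}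
    {F G L C : ℝ} (hΦ : FluxBound Φ (L + 1) C)
    (hdΦ : Differentiable ℝ fun y : ℝ × ℝ × ℝ × ℝ => Φ y.1 y.2.1 y.2.2.1 y.2.2.2)
    (hc : c 0 = 0) (hd : d 0 = 0) (h : pairNorm (z + 1) c d ≠ ⊤)
    (hcL : ∀ x, |F + rser c x| ≤ L) (hdL : ∀ x, |G + rser d x| ≤ L) (x : Torus) :
    |fluxDiv Φ z F G c d x| ≤
      C * (2 + 2048 * (L + |F| + |G|)) * supNorm (z + 1) c d := by
  refine (hΦ.abs_fderiv_le hdΦ (hcL x) (hdL x)).trans ?_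
  have n : ∀ s ≤ z + 1, pairNorm s c d ≠ ⊤ := fun s hs => ne_top_of_le_ne_top h
    (pairNorm_mono hs hc hd)
  have p1 := le_supNorm_left (n 1 (by omega)) x
  have q1 := le_supNorm_right (n 1 (by omega)) x
  have pz := le_supNorm_left (n z (by omega)) x
  have qz := le_supNorm_right (n z (by omega)) x
  have pt := le_supNorm_left h x
  have qt := le_supNorm_right h x
  rw [← abs_rser_Dcoef hz] at pz qz
  rw [← dcoef_dcoef, ← abs_rser_Dcoef hz, ← Dcoef_comm_dcoef] at pt qt
  have s0 : supNorm 0 c d ≤ L + |F| + |G| := supNorm_zero_le hcL hdL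
  have hl := supNorm_one_mul_le hz hc hd h
  have t0 : 0 ≤ supNorm (z + 1) c d := supNorm_nonneg
  have k0 : 0 ≤ supNorm 1 c d := supNorm_nonneg
  have k1 : 0 ≤ supNorm z c d := supNorm_nonneg
  have hC := hΦ.nonneg
  calc _ ≤ C * (supNorm (z + 1) c d + supNorm (z + 1) c d) +
        C * ((supNorm 1 c d + supNorm 1 c d) * (supNorm z c d + supNorm z c d)) := by gcongr
    _ = C * (2 * supNorm (z + 1) c d + 4 * (supNorm 1 c d * supNorm z c d)) := by ring
    _ ≤ C * (2 * supNorm (z + 1) c d + 4 * (512 * ((L + |F| + |G|) * supNorm (z + 1) c d))) := by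
        refine mul_le_mul_of_nonneg_left (add_le_add_right (mul_le_mul_of_nonneg_left
          (hl.trans ?_) (by norm_num)) _) hC
        gcongr
    _ = _ := by ring

theorem fourierC_of_hasDerivAt {u u' : Torus → ℝ}
    (h : ∀ y : ℝ, HasDerivAt (fun y : ℝ => u (y : Torus)) (u' (y : Torus)) y) (hc : Continuous u')
    (k : ℤ) : fourierC u' k = Complex.I * k * fourierC u k := by
  rw [fourierC, fourierC, fourierCoeff_eq, fourierCoeff_eq]
  have h1 : ∀ y : ℝ, HasDerivAt (fun y : ℝ => (fourier (-k) (y : Torus) : ℂ))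
      ((-(Complex.I * k)) * fourier (-k) (y : Torus)) y := fun y => by
    refine (hasDerivAt_fourier (2 * Real.pi) (-k) y).congr_deriv ?_
    have : (Real.pi : ℂ) ≠ 0 := by exact_mod_cast Real.pi_ne_zero
    congr 1
    push_cast
    field_simp
  have h2 : ∀ y : ℝ, HasDerivAt (fun y : ℝ => ((u (y : Torus) : ℝ) : ℂ)) ((u' (y : Torus) : ℝ) : ℂ) y :=
    fun y => (h y).ofReal_comp
  have := integral_mul_deriv_torus (u := fun x : Torus => (fourier (-k) x : ℂ))
    (u' := fun x => (-(Complex.I * k)) * fourier (-k) x) (v := fun x => (u x : ℂ))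
    (v' := fun x => (u' x : ℂ)) h1 h2 (continuous_const.mul (fourier (-k)).continuous)
    (Complex.continuous_ofReal.comp hc)
  rw [this]
  simp only [neg_mul, integral_neg, neg_neg, mul_assoc]
  rw [integral_const_mul, integral_const_mul, Complex.real_smul, Complex.real_smul]
  ring

namespace BddCurve

variable {z : ℕ} {L F G : ℝ} {c d : ℝ → ℤ → ℂ}

theorem measurable_pairNorm (h : BddCurve z L F G c d) (s : ℕ) :
    Measurable fun t => pairNorm s (c t) (d t) :=
  (measurable_wn h.meas_c s).add (measurable_wn h.meas_d s)

theorem pairNorm_ne (h : BddCurve z L F G c d) {s : ℕ} (hs : s ≤ z + 1) (t : ℝ) :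
    pairNorm s (c t) (d t) ≠ ⊤ :=
  ne_top_of_le_ne_top (h.top_ne t) (pairNorm_mono hs (h.zero_c t) (h.zero_d t))

theorem wn_c_ne (h : BddCurve z L F G c d) {s : ℕ} (hs : s ≤ z + 1) (t : ℝ) : wn s (c t) ≠ ⊤ :=
  (ENNReal.add_ne_top.1 (h.pairNorm_ne hs t)).1

theorem wn_d_ne (h : BddCurve z L F G c d) {s : ℕ} (hs : s ≤ z + 1) (t : ℝ) : wn s (d t) ≠ ⊤ :=
  (ENNReal.add_ne_top.1 (h.pairNorm_ne hs t)).2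

theorem integrable_pairNorm (h : BddCurve z L F G c d) {s : ℕ} (hs : s ≤ z + 1) :
    IntegrableOn (fun t => (pairNorm s (c t) (d t)).toReal) (Ioi 0) :=
  integrable_toReal_of_lintegral_ne_top (h.measurable_pairNorm s).aemeasurable
    (ne_top_of_le_ne_top h.lint_ne
      (lintegral_mono fun t => pairNorm_mono hs (h.zero_c t) (h.zero_d t)))

theorem integrable_of_le (h : BddCurve z L F G c d) {R : ℝ × Torus → ℝ} (hR : Measurable R) {K : ℝ}
    (hK : ∀ t x, |R (t, x)| ≤ K * (pairNorm (z + 1) (c t) (d t)).toReal) :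
    Integrable R ((volume.restrict (Ioi (0 : ℝ))).prod volume) := by
  have h1 := (h.integrable_pairNorm le_rfl).integrable.const_mul K
  exact (h1.comp_fst (volume : Measure Torus)).mono' hR.aestronglyMeasurable
    (.of_forall fun p => hK p.1 p.2)

variable {Φ : ℝ → ℝ → ℝ → ℝ → ℝ}

theorem measurable_phys (h : BddCurve z L F G c d)
    (hΦ : Continuous fun y : ℝ × ℝ × ℝ × ℝ => Φ y.1 y.2.1 y.2.2.1 y.2.2.2) :
    Measurable fun p : ℝ × Torus => phys Φ z F G (c p.1) (d p.1) p.2 :=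
  ThinFilmStokes.measurable_phys hΦ F G h.meas_c h.meas_d (h.wn_c_ne (by omega))
    (h.wn_d_ne (by omega)) (h.wn_c_ne (by omega)) (h.wn_d_ne (by omega))

theorem measurable_fluxDiv (h : BddCurve z L F G c d)
    (hΦ : ContDiff ℝ 1 fun y : ℝ × ℝ × ℝ × ℝ => Φ y.1 y.2.1 y.2.2.1 y.2.2.2) :
    Measurable fun p : ℝ × Torus => fluxDiv Φ z F G (c p.1) (d p.1) p.2 := by
  have key : ∀ e : ℝ → ℤ → ℂ, (∀ k, Measurable fun t => e t k) → (∀ s ≤ z + 1, ∀ t, wn s (e t) ≠ ⊤) →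
      Measurable (fun p : ℝ × Torus => rser (e p.1) p.2) ∧
      Measurable (fun p : ℝ × Torus => rser (Dcoef z (e p.1)) p.2) ∧
      Measurable (fun p : ℝ × Torus => rser (dcoef 1 (e p.1)) p.2) ∧
      Measurable (fun p : ℝ × Torus => rser (dcoef 1 (Dcoef z (e p.1))) p.2) := fun e he hw =>
    ⟨measurable_rser he (hw 0 (by omega)),
      measurable_rser (c := fun t => Dcoef z (e t)) (fun k => (he k).const_mul _) fun t => by
        rw [wn_Dcoef, zero_add]; exact hw z (by omega) t,
      measurable_rser (c := fun t => dcoef 1 (e t)) (fun k => (he k).const_mul _) fun t => by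
        rw [wn_dcoef, zero_add]; exact hw 1 (by omega) t,
      measurable_rser (c := fun t => dcoef 1 (Dcoef z (e t)))
        (fun k => ((he k).const_mul _).const_mul _) fun t => by
        rw [wn_dcoef, zero_add, wn_Dcoef, add_comm]; exact hw (z + 1) le_rfl t⟩
  obtain ⟨a1, a2, a3, a4⟩ := key c h.meas_c fun s hs => h.wn_c_ne hs
  obtain ⟨b1, b2, b3, b4⟩ := key d h.meas_d fun s hs => h.wn_d_ne hs
  have hcont : Continuous fun q : (ℝ × ℝ × ℝ × ℝ) × (ℝ × ℝ × ℝ × ℝ) =>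
      fderiv ℝ (fun y : ℝ × ℝ × ℝ × ℝ => Φ y.1 y.2.1 y.2.2.1 y.2.2.2) q.1 q.2 :=
    ((hΦ.continuous_fderiv one_ne_zero).comp continuous_fst).clm_apply continuous_snd
  exact hcont.measurable.comp (((measurable_const.add a1).prodMk
    ((measurable_const.add b1).prodMk (a2.prodMk b2))).prodMk (a3.prodMk (b3.prodMk (a4.prodMk b4))))

theorem integrable_phys (h : BddCurve z L F G c d) {C : ℝ} (hΦ : FluxBound Φ L C)
    (hΦc : Continuous fun y : ℝ × ℝ × ℝ × ℝ => Φ y.1 y.2.1 y.2.2.1 y.2.2.2) :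
    Integrable (fun p : ℝ × Torus => phys Φ z F G (c p.1) (d p.1) p.2)
      ((volume.restrict (Ioi (0 : ℝ))).prod volume) := by
  refine h.integrable_of_le (h.measurable_phys hΦc) (K := C) fun t x => ?_
  refine (hΦ.bound _ _ _ _ (h.abs_le_c t x) (h.abs_le_d t x)).trans
    (mul_le_mul_of_nonneg_left ?_ hΦ.nonneg)
  refine (abs_Dcoef_le (h.pairNorm_ne (by omega) t) x).trans ?_
  exact ENNReal.toReal_mono (h.top_ne t) (pairNorm_mono (by omega) (h.zero_c t) (h.zero_d t))

theorem integrable_fluxDiv (h : BddCurve z L F G c d) (hz : z = 1 ∨ z = 3) {C : ℝ}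
    (hΦ : FluxBound Φ (L + 1) C)
    (hΦc : ContDiff ℝ 1 fun y : ℝ × ℝ × ℝ × ℝ => Φ y.1 y.2.1 y.2.2.1 y.2.2.2) :
    Integrable (fun p : ℝ × Torus => fluxDiv Φ z F G (c p.1) (d p.1) p.2)
      ((volume.restrict (Ioi (0 : ℝ))).prod volume) := by
  refine h.integrable_of_le (h.measurable_fluxDiv hΦc) (K := C * (2 + 2048 * (L + |F| + |G|)))
    fun t x => ?_
  refine (abs_fluxDiv_le hz hΦ (hΦc.differentiable one_ne_zero) (h.zero_c t) (h.zero_d t)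
    (h.top_ne t) (h.abs_le_c t) (h.abs_le_d t) x).trans
    (mul_le_mul_of_nonneg_left (supNorm_le_pairNorm (h.top_ne t)) ?_)
  have := (abs_nonneg _).trans (h.abs_le_c 0 0)
  exact mul_nonneg hΦ.nonneg (by positivity)

theorem fourierC_fluxDiv (h : BddCurve z L F G c d)
    (hΦ : ContDiff ℝ 1 fun y : ℝ × ℝ × ℝ × ℝ => Φ y.1 y.2.1 y.2.2.1 y.2.2.2) (t : ℝ) (k : ℤ) :
    fourierC (fluxDiv Φ z F G (c t) (d t)) k =
      Complex.I * k * fourierC (phys Φ z F G (c t) (d t)) k :=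
  fourierC_of_hasDerivAt (hasDerivAt_phys hΦ (h.zero_c t) (h.zero_d t) (h.top_ne t))
    (continuous_fluxDiv hΦ (h.zero_c t) (h.zero_d t) (h.top_ne t)) k

end BddCurve

theorem fourierC_integral {R : ℝ × Torus → ℝ} {μ : Measure ℝ} [SFinite μ]
    (hR : Integrable R (μ.prod volume)) (k : ℤ) :
    fourierC (fun x => ∫ t, R (t, x) ∂μ) k = ∫ t, fourierC (fun x => R (t, x)) k ∂μ := by
  simp only [fourierC, fourierCoeff_eq]
  rw [integral_smul]
  congr 1
  have h1 : Integrable (fun p : ℝ × Torus => fourier (-k) p.2 * (R p : ℂ)) (μ.prod volume) := by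
    refine (hR.ofReal (𝕜 := ℂ)).bdd_mul (c := 1)
      ((fourier (-k)).continuous.comp continuous_snd).aestronglyMeasurable
      (.of_forall fun p => (norm_fourier_apply (-k) p.2).le)
  rw [integral_integral_swap h1]
  refine integral_congr_ae (.of_forall fun x => ?_)
  show fourier (-k) x * ((∫ t, R (t, x) ∂μ : ℝ) : ℂ) = ∫ t, fourier (-k) x * (R (t, x) : ℂ) ∂μ
  rw [integral_const_mul, integral_complex_ofReal]

theorem fourierC_add {u v : Torus → ℝ} (hu : Integrable u) (hv : Integrable v) (k : ℤ) :
    fourierC (fun x => u x + v x) k = fourierC u k + fourierC v k := by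
  have := fourierC_sub (u := fun x => u x + v x) (hu.add hv) hv k
  simp only [add_sub_cancel_right] at this
  rw [this, sub_add_cancel]

/-- The equations for the Fourier coefficients, in physical space. -/
theorem ae_eq_add_integral {u₀ : Torus → ℝ} (hu₀ : Integrable u₀) {e : ℤ → ℂ} (he : Sym e)
    (hw : wn 0 e ≠ ⊤) {t : ℝ} (ht : 0 ≤ t) {R : ℝ × Torus → ℝ}
    (hR : Integrable R ((volume.restrict (Ioc 0 t)).prod volume))
    (heq : ∀ k, e k = fourierC u₀ k + ∫ s in (0 : ℝ)..t, fourierC (fun x => R (s, x)) k) :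
    ∀ᵐ x, rser e x = u₀ x + ∫ s in (0 : ℝ)..t, R (s, x) := by
  simp only [intervalIntegral.integral_of_le ht] at heq ⊢
  refine ae_eq_of_fourierC (Continuous.integrable_torus (continuous_rser hw))
    (hu₀.add hR.integral_prod_right) fun k => ?_
  rw [fourierC_rser he hw, heq, fourierC_add hu₀ hR.integral_prod_right, fourierC_integral hR]

/-! ### The weak formulation -/

theorem continuous_of_lift {X : Type*} [TopologicalSpace X] {g : ℝ × Torus → X}
    (h : Continuous fun z : ℝ × ℝ => g (z.1, (z.2 : Torus))) : Continuous g :=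
  ((IsOpenQuotientMap.id (X := ℝ)).prodMap
    (QuotientAddGroup.isOpenQuotientMap_mk (N := AddSubgroup.zmultiples (2 * Real.pi)))).continuous_comp_iff.1 h

/-- The time derivative of a test function. -/
noncomputable def tDeriv (φ : ℝ → Torus → ℝ) (p : ℝ × Torus) : ℝ := deriv (fun s => φ s p.2) p.1

namespace IsTest

variable {T : ℝ} {φ : ℝ → Torus → ℝ}

theorem continuous (h : IsTest T φ) : Continuous (Function.uncurry φ) :=
  continuous_of_lift h.1.continuous

theorem hasDerivAt_time (h : IsTest T φ) (t : ℝ) (x : Torus) :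
    HasDerivAt (fun s => φ s x) (tDeriv φ (t, x)) t := by
  refine DifferentiableAt.hasDerivAt ?_
  induction x using QuotientAddGroup.induction_on with
  | H y =>
    have h1 : DifferentiableAt ℝ (fun z : ℝ × ℝ => φ z.1 (z.2 : Torus)) (t, y) :=
      (h.1.differentiable (by simp)) _
    exact h1.comp t (f := fun s : ℝ => (s, y)) (by fun_prop)

theorem continuous_tDeriv (h : IsTest T φ) : Continuous (tDeriv φ) := by
  refine continuous_of_lift ?_
  have e : ∀ z : ℝ × ℝ, tDeriv φ (z.1, (z.2 : Torus)) =
      fderiv ℝ (fun z : ℝ × ℝ => φ z.1 (z.2 : Torus)) z (1, 0) := fun z => by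
    have h1 := ((h.1.differentiable (by simp)) z).hasFDerivAt
    have h2 : HasDerivAt (fun s : ℝ => (s, z.2)) ((1 : ℝ), (0 : ℝ)) z.1 :=
      (hasDerivAt_id _).prodMk (hasDerivAt_const _ _)
    exact (h1.comp_hasDerivAt (f := fun s : ℝ => (s, z.2)) z.1 h2).deriv
  simp only [e]
  exact (h.1.continuous_fderiv (by simp)).clm_apply continuous_const

theorem hasDerivAt_space (h : IsTest T φ) (t y : ℝ) :
    HasDerivAt (fun y : ℝ => φ t (y : Torus)) (xDeriv 1 (φ t) (y : Torus)) y := by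
  rw [xDeriv_coe, iteratedDeriv_one]
  refine DifferentiableAt.hasDerivAt ?_
  have h1 : DifferentiableAt ℝ (fun z : ℝ × ℝ => φ z.1 (z.2 : Torus)) (t, y) :=
    (h.1.differentiable (by simp)) _
  exact h1.comp y (f := fun s : ℝ => (t, s)) (by fun_prop)

theorem continuous_xDeriv (h : IsTest T φ) :
    Continuous fun p : ℝ × Torus => xDeriv 1 (φ p.1) p.2 := by
  refine continuous_of_lift ?_
  have e : ∀ z : ℝ × ℝ, xDeriv 1 (φ z.1) (z.2 : Torus) =
      fderiv ℝ (fun z : ℝ × ℝ => φ z.1 (z.2 : Torus)) z (0, 1) := fun z => by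
    have h1 := ((h.1.differentiable (by simp)) z).hasFDerivAt
    have h2 : HasDerivAt (fun s : ℝ => (z.1, s)) ((0 : ℝ), (1 : ℝ)) z.2 :=
      (hasDerivAt_const _ _).prodMk (hasDerivAt_id _)
    rw [xDeriv_coe, iteratedDeriv_one]
    exact (h1.comp_hasDerivAt (f := fun s : ℝ => (z.1, s)) z.2 h2).deriv
  simp only [e]
  exact (h.1.continuous_fderiv (by simp)).clm_apply continuous_const

theorem eq_zero (h : IsTest T φ) (x : Torus) : φ T x = 0 := by
  obtain ⟨T', h1, h2⟩ := h.2
  exact h2 T h1.le x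

end IsTest

theorem ae_mem_spaceTime (T : ℝ) : ∀ᵐ p ∂(spaceTime T), p.1 ∈ Ioc 0 T := by
  have h1 : ∀ᵐ t ∂(volume.restrict (Ioc 0 T)), t ∈ Ioc 0 T := ae_restrict_mem measurableSet_Ioc
  exact Measure.quasiMeasurePreserving_fst.ae h1

theorem integrable_mul_continuous {T : ℝ} {u φ : ℝ × Torus → ℝ} (hu : Integrable u (spaceTime T))
    (hφ : Continuous φ) : Integrable (fun p => u p * φ p) (spaceTime T) := by
  obtain ⟨M, hM⟩ := (isCompact_Icc (a := (0 : ℝ)) (b := T)).prod (isCompact_univ (X := Torus))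
    |>.exists_bound_of_continuousOn hφ.continuousOn
  refine (hu.bdd_mul (c := M) hφ.aestronglyMeasurable ?_).congr
    (.of_forall fun p => mul_comm _ _)
  filter_upwards [ae_mem_spaceTime T] with p hp
  exact hM p ⟨⟨hp.1.le, hp.2⟩, mem_univ _⟩

/-- Integration by parts in time, for a function with integrable time derivative `R`. -/
theorem integral_mul_tDeriv {T : ℝ} (hT : 0 < T) {u : ℝ → Torus → ℝ} {u₀ : Torus → ℝ}
    {R : ℝ × Torus → ℝ} (hu₀ : Integrable u₀) (hu : Integrable (Function.uncurry u) (spaceTime T))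
    (hR : Integrable R (spaceTime T))
    (h : ∀ᵐ t ∂(volume.restrict (Ioc 0 T)), ∀ᵐ x, u t x = u₀ x + ∫ s in (0 : ℝ)..t, R (s, x))
    {φ : ℝ → Torus → ℝ} (hφ : IsTest T φ) :
    (∫ x, u₀ x * φ 0 x) + ∫ p, u p.1 p.2 * tDeriv φ p ∂(spaceTime T) =
      -∫ p, R p * φ p.1 p.2 ∂(spaceTime T) := by
  set μ := volume.restrict (Ioc 0 T) with hμ
  have hct := hφ.continuous_tDeriv
  have hderiv : ∀ s x, s ≤ T → ∫ t in s..T, tDeriv φ (t, x) = -φ s x := fun s x hs => by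
    rw [intervalIntegral.integral_eq_sub_of_hasDerivAt (f := fun s => φ s x)
      (fun t _ => hφ.hasDerivAt_time t x), hφ.eq_zero x, zero_sub]
    exact (hct.comp (by fun_prop)).intervalIntegrable _ _
  obtain ⟨M, hM⟩ := (isCompact_Icc (a := (0 : ℝ)) (b := T)).prod (isCompact_univ (X := Torus))
    |>.exists_bound_of_continuousOn hct.continuousOn
  -- the contribution of the initial datum
  have i0 : Integrable (fun p : ℝ × Torus => u₀ p.2 * tDeriv φ p) (spaceTime T) :=
    integrable_mul_continuous (u := fun p : ℝ × Torus => u₀ p.2) (hu₀.comp_snd μ) hct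
  have e0 : ∫ t, (∫ x, u₀ x * tDeriv φ (t, x)) ∂μ = -∫ x, u₀ x * φ 0 x := by
    rw [integral_integral_swap i0, ← integral_neg]
    refine integral_congr_ae (.of_forall fun x => ?_)
    show ∫ t, u₀ x * tDeriv φ (t, x) ∂μ = _
    rw [integral_const_mul, hμ, ← intervalIntegral.integral_of_le hT.le, hderiv 0 x hT.le]
    ring
  -- the contribution of the time derivative, by Fubini's theorem on a triangle
  set H : ℝ → ℝ × Torus → ℝ := fun t p =>
    (if p.1 ≤ t then 1 else 0) * tDeriv φ (t, p.2) * R p with hH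
  have hHm : Measurable fun q : ℝ × (ℝ × Torus) =>
      (if q.2.1 ≤ q.1 then (1 : ℝ) else 0) * tDeriv φ (q.1, q.2.2) :=
    (Measurable.ite (measurableSet_le (by fun_prop) (by fun_prop)) measurable_const
      measurable_const).mul (hct.measurable.comp (by fun_prop))
  have hHb : ∀ t ∈ Ioc 0 T, ∀ p : ℝ × Torus,
      ‖(if p.1 ≤ t then (1 : ℝ) else 0) * tDeriv φ (t, p.2)‖ ≤ M := fun t ht p => by
    have h1 := hM (t, p.2) ⟨⟨ht.1.le, ht.2⟩, mem_univ _⟩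
    split_ifs
    · simpa using h1
    · simpa using (norm_nonneg _).trans h1
  have hHi : Integrable (fun q : ℝ × (ℝ × Torus) => H q.1 q.2) (μ.prod (spaceTime T)) := by
    refine (hR.comp_snd μ).bdd_mul (c := M) hHm.aestronglyMeasurable ?_
    have h1 : ∀ᵐ t ∂μ, t ∈ Ioc 0 T := ae_restrict_mem measurableSet_Ioc
    filter_upwards [Measure.quasiMeasurePreserving_fst.ae h1] with q hq
    exact hHb q.1 hq q.2
  have hHt : ∀ t ∈ Ioc 0 T, Integrable (H t) (spaceTime T) := fun t ht =>
    hR.bdd_mul (c := M) (hHm.comp (measurable_const.prodMk measurable_id)).aestronglyMeasurable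
      (.of_forall fun p => hHb t ht p)
  have hHx : ∀ t ∈ Ioc 0 T, ∀ x, ∫ s, H t (s, x) ∂μ =
      (∫ s in (0 : ℝ)..t, R (s, x)) * tDeriv φ (t, x) := fun t ht x => by
    have e1 : ∀ s, H t (s, x) = tDeriv φ (t, x) * (Iic t).indicator (fun s => R (s, x)) s :=
      fun s => by
        by_cases hs : s ≤ t
        · simp [hH, hs]
        · simp [hH, hs]
    simp only [e1]
    rw [integral_const_mul, integral_indicator measurableSet_Iic, hμ,
      Measure.restrict_restrict measurableSet_Iic, intervalIntegral.integral_of_le ht.1.le, mul_comm,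
      show Iic t ∩ Ioc 0 T = Ioc 0 t by
        ext s; simp only [mem_inter_iff, mem_Iic, mem_Ioc]; constructor
        · rintro ⟨a, b, c⟩; exact ⟨b, a⟩
        · rintro ⟨a, b⟩; exact ⟨b, a, b.trans ht.2⟩]
  have e1 : ∫ t, (∫ p, H t p ∂(spaceTime T)) ∂μ = -∫ p, R p * φ p.1 p.2 ∂(spaceTime T) := by
    rw [integral_integral_swap hHi, ← integral_neg]
    refine integral_congr_ae ?_
    filter_upwards [ae_mem_spaceTime T] with p hp
    have e2 : ∀ t, H t p = R p * (Ici p.1).indicator (fun t => tDeriv φ (t, p.2)) t := fun t => by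
      by_cases ht : p.1 ≤ t
      · simp only [hH, if_pos ht, indicator_of_mem (show t ∈ Ici p.1 from ht)]; ring
      · simp only [hH, if_neg ht, indicator_of_notMem (show t ∉ Ici p.1 from ht)]; ring
    simp only [e2]
    rw [integral_const_mul, integral_indicator measurableSet_Ici, hμ,
      Measure.restrict_restrict measurableSet_Ici,
      show Ici p.1 ∩ Ioc 0 T = Icc p.1 T by
        ext s; simp only [mem_inter_iff, mem_Ici, mem_Ioc, mem_Icc]; constructor
        · rintro ⟨a, b, c⟩; exact ⟨a, c⟩
        · rintro ⟨a, b⟩; exact ⟨a, hp.1.trans_le a, b⟩,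
      integral_Icc_eq_integral_Ioc, ← intervalIntegral.integral_of_le hp.2, hderiv _ _ hp.2]
    ring
  have main : ∫ p, u p.1 p.2 * tDeriv φ p ∂(spaceTime T) =
      ∫ t, ((∫ x, u₀ x * tDeriv φ (t, x)) + ∫ p, H t p ∂(spaceTime T)) ∂μ := by
    have iu : Integrable (fun p : ℝ × Torus => u p.1 p.2 * tDeriv φ p) (spaceTime T) :=
      integrable_mul_continuous hu hct
    refine (integral_prod _ iu).trans (integral_congr_ae ?_)
    filter_upwards [h, ae_restrict_mem measurableSet_Ioc] with t ht htT
    have j1 : Integrable fun x => u₀ x * tDeriv φ (t, x) := by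
      obtain ⟨M', hM'⟩ := (isCompact_univ (X := Torus)).exists_bound_of_continuousOn
        (hct.comp (by fun_prop : Continuous fun x : Torus => (t, x))).continuousOn
      exact (hu₀.bdd_mul (c := M') (hct.comp (by fun_prop :
        Continuous fun x : Torus => (t, x))).aestronglyMeasurable
        (.of_forall fun x => hM' x (mem_univ _))).congr (.of_forall fun x => mul_comm _ _)
    have j2 := (hHt t htT).integral_prod_right
    have e3 : ∫ p, H t p ∂(spaceTime T) = ∫ x, ∫ s, H t (s, x) ∂μ := integral_prod_symm _ (hHt t htT)
    rw [e3, ← integral_add j1 j2]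
    refine integral_congr_ae ?_
    filter_upwards [ht] with x hx
    show u t x * tDeriv φ (t, x) = _
    rw [hx, hHx t htT x]
    ring
  rw [main, integral_add i0.integral_prod_left hHi.integral_prod_left, e0, e1]
  ring

/-- Integration by parts in space. -/
theorem integral_mul_xDeriv {T : ℝ} {J R : ℝ × Torus → ℝ} (hJ : Integrable J (spaceTime T))
    (hR : Integrable R (spaceTime T))
    (hd : ∀ t, ∀ y : ℝ, HasDerivAt (fun y : ℝ => J (t, (y : Torus))) (R (t, (y : Torus))) y)
    (hc : ∀ t, Continuous fun x => R (t, x)) {φ : ℝ → Torus → ℝ} (hφ : IsTest T φ) :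
    ∫ p, J p * xDeriv 1 (φ p.1) p.2 ∂(spaceTime T) = -∫ p, R p * φ p.1 p.2 ∂(spaceTime T) := by
  have iR : Integrable (fun p : ℝ × Torus => R p * φ p.1 p.2) (spaceTime T) :=
    integrable_mul_continuous hR hφ.continuous
  have eR : ∫ p, R p * φ p.1 p.2 ∂(spaceTime T) = ∫ t in Ioc 0 T, ∫ x, R (t, x) * φ t x :=
    integral_prod _ iR
  refine (integral_prod _ (integrable_mul_continuous hJ hφ.continuous_xDeriv)).trans ?_
  rw [eR, ← integral_neg]
  refine integral_congr_ae (.of_forall fun t => ?_)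
  exact integral_mul_deriv_torus (u := fun x => J (t, x)) (u' := fun x => R (t, x)) (v := φ t)
    (hd t) (hφ.hasDerivAt_space t) (hc t) (hφ.continuous_xDeriv.comp (by fun_prop))

/-! ### The global weak solution -/

theorem Flow.zeta_eq (d : Flow) : d.zeta = 1 ∨ d.zeta = 3 := by
  cases d <;> simp [Flow.zeta]

theorem isD_rser (d : Flow) {c : ℤ → ℂ} (h0 : c 0 = 0) (h : wn d.zeta c ≠ ⊤) :
    d.IsD (rser c) (rser (Dcoef d.zeta c)) := by
  cases d with
  | gravity =>
    show IsWeakDeriv 1 _ (rser (Dcoef 1 c))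
    rw [show rser (Dcoef 1 c) = rser (dcoef 1 c) from funext (rser_Dcoef_one c)]
    exact isWeakDeriv_rser h0 h
  | capillary =>
    have e : -rser (Dcoef 3 c) = rser (dcoef 3 c) := by
      ext x
      rw [Pi.neg_apply, rser_Dcoef_three, neg_neg]
    show IsWeakDeriv 3 _ (-rser (Dcoef 3 c))
    rw [e]
    exact isWeakDeriv_rser h0 h

theorem spaceTime_le (T : ℝ) : spaceTime T ≤ (volume.restrict (Ioi (0 : ℝ))).prod volume :=
  Measure.prod_mono (Measure.restrict_mono (fun _ ht => ht.1) le_rfl) le_rfl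

namespace BddCurve

variable {z : ℕ} {L F G : ℝ} {c d : ℝ → ℤ → ℂ}

theorem integrable_c (h : BddCurve z L F G c d) (T : ℝ) :
    Integrable (fun p : ℝ × Torus => rser (c p.1) p.2) (spaceTime T) := by
  refine ((integrable_const (L + |F|)).mono'
    (measurable_rser h.meas_c (h.wn_c_ne (by omega))).aestronglyMeasurable (.of_forall fun p => ?_))
  have h1 := h.abs_le_c p.1 p.2
  calc |rser (c p.1) p.2| = |(F + rser (c p.1) p.2) - F| := by rw [add_sub_cancel_left]
    _ ≤ |F + rser (c p.1) p.2| + |F| := abs_sub _ _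
    _ ≤ _ := by linarith

theorem swap (h : BddCurve z L F G c d) : BddCurve z L G F d c :=
  ⟨h.sym_d, h.sym_c, h.zero_d, h.zero_c, fun t => by rw [pairNorm, add_comm]; exact h.top_ne t,
    h.meas_d, h.meas_c, h.abs_le_d, h.abs_le_c, by
      simp only [pairNorm, add_comm (wn (z + 1) (d _))]; exact h.lint_ne⟩

/-- One of the two equations, in physical space. -/
theorem ae_eq_of_modes (h : BddCurve z L F G c d) (hz : z = 1 ∨ z = 3) {Φ : ℝ → ℝ → ℝ → ℝ → ℝ}
    {C : ℝ} (hΦ : FluxBound Φ (L + 1) C)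
    (hΦc : ContDiff ℝ 1 fun y : ℝ × ℝ × ℝ × ℝ => Φ y.1 y.2.1 y.2.2.1 y.2.2.2) {e : ℝ → ℤ → ℂ}
    (hs : ∀ t, Sym (e t)) (hw : ∀ t, wn 0 (e t) ≠ ⊤) {u₀ : Torus → ℝ} (hu₀ : Integrable u₀)
    (heq : ∀ᵐ t ∂(volume.restrict (Ioi (0 : ℝ))), ∀ k, e t k = fourierC u₀ k + ∫ s in (0 : ℝ)..t,
      Complex.I * k * fourierC (phys Φ z F G (c s) (d s)) k) :
    ∀ᵐ t ∂(volume.restrict (Ioi (0 : ℝ))), ∀ᵐ x, rser (e t) x = u₀ x +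
      ∫ s in (0 : ℝ)..t, fluxDiv Φ z F G (c s) (d s) x := by
  filter_upwards [heq, ae_restrict_mem measurableSet_Ioi] with t ht ht0
  have hR := (h.integrable_fluxDiv hz hΦ hΦc).mono_measure (spaceTime_le t)
  refine ae_eq_add_integral (R := fun p => fluxDiv Φ z F G (c p.1) (d p.1) p.2) hu₀ (hs t) (hw t)
    (le_of_lt ht0) hR fun k => ?_
  have e : (fun s => fourierC (fluxDiv Φ z F G (c s) (d s)) k) =
      fun s => Complex.I * k * fourierC (phys Φ z F G (c s) (d s)) k :=
    funext fun s => h.fourierC_fluxDiv hΦc s k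
  rw [ht k, ← e]

/-- The equation in physical space gives the weak formulation by integration by parts in time and in
space. -/
theorem weak_form (h : BddCurve z L F G c d) (hz : z = 1 ∨ z = 3) {Φ : ℝ → ℝ → ℝ → ℝ → ℝ}
    {C : ℝ} (hΦ : FluxBound Φ (L + 1) C) (hΦ' : FluxBound Φ L C)
    (hΦc : ContDiff ℝ 1 fun y : ℝ × ℝ × ℝ × ℝ => Φ y.1 y.2.1 y.2.2.1 y.2.2.2) {u : ℝ → Torus → ℝ}
    {u₀ : Torus → ℝ} (hu₀ : Integrable u₀) {T : ℝ} (hT : 0 < T)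
    (hu : Integrable (Function.uncurry u) (spaceTime T))
    (heq : ∀ᵐ t ∂(volume.restrict (Ioi (0 : ℝ))), ∀ᵐ x, u t x = u₀ x +
      ∫ s in (0 : ℝ)..t, fluxDiv Φ z F G (c s) (d s) x)
    {φ : ℝ → Torus → ℝ} (hφ : IsTest T φ) :
    (∫ x, u₀ x * φ 0 x) + ∫ p, u p.1 p.2 * deriv (fun s => φ s p.2) p.1 ∂(spaceTime T) =
      ∫ p, phys Φ z F G (c p.1) (d p.1) p.2 * xDeriv 1 (φ p.1) p.2 ∂(spaceTime T) := by
  have hR := (h.integrable_fluxDiv hz hΦ hΦc).mono_measure (spaceTime_le T)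
  have e1 := integral_mul_tDeriv hT hu₀ hu hR (ae_mono (Measure.restrict_mono
    (fun _ ht => ht.1) le_rfl) heq) hφ
  have e2 := integral_mul_xDeriv ((h.integrable_phys hΦ' hΦc.continuous).mono_measure
    (spaceTime_le T)) hR (fun t y => hasDerivAt_phys hΦc (h.zero_c t) (h.zero_d t) (h.top_ne t) y)
    (fun t => continuous_fluxDiv hΦc (h.zero_c t) (h.zero_d t) (h.top_ne t)) hφ
  exact e1.trans e2.symm

end BddCurve

theorem FluxBound.mono_left {Φ : ℝ → ℝ → ℝ → ℝ → ℝ} {L L' C : ℝ} (h : FluxBound Φ L' C)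
    (hL : L ≤ L') : FluxBound Φ L C :=
  ⟨h.nonneg, fun f g p q hf hg => h.bound f g p q (hf.trans hL) (hg.trans hL),
    fun f g p q f' g' p' q' hf hg hf' hg' => h.lip f g p q f' g' p' q' (hf.trans hL) (hg.trans hL)
      (hf'.trans hL) (hg'.trans hL)⟩

namespace Solution

variable {ρ μ F G E σ : ℝ} {f₀ g₀ : Torus → ℝ}

theorem ae_eq_c {z : ℕ} (hz : z = 1 ∨ z = 3)
    (S : Solution (fluxF ρ) (fluxG ρ μ) z F G E σ (fourierC f₀) (fourierC g₀)) (hρ : 0 < ρ)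
    (hF : 0 ≤ F) (hG : 0 ≤ G) (hE : 0 ≤ E) (hf₀ : Integrable f₀) :
    ∀ᵐ t ∂(volume.restrict (Ioi (0 : ℝ))), ∀ᵐ x, rser (S.c t) x = f₀ x +
      ∫ s in (0 : ℝ)..t, fluxDiv (fluxF ρ) z F G (S.c s) (S.d s) x := by
  obtain ⟨C, hC⟩ := exists_fluxBound_F hρ (L := F + G + E + 1) (by positivity)
  exact (S.isCurve.bddCurve hF hG hE).ae_eq_of_modes hz hC (contDiff_fluxF ρ) S.sym_c
    (S.isCurve.wn_c_ne (by omega)) hf₀ S.eq_c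

theorem ae_eq_d {z : ℕ} (hz : z = 1 ∨ z = 3)
    (S : Solution (fluxF ρ) (fluxG ρ μ) z F G E σ (fourierC f₀) (fourierC g₀)) (hρ : 0 < ρ)
    (hμ : 0 < μ) (hF : 0 ≤ F) (hG : 0 ≤ G) (hE : 0 ≤ E) (hg₀ : Integrable g₀) :
    ∀ᵐ t ∂(volume.restrict (Ioi (0 : ℝ))), ∀ᵐ x, rser (S.d t) x = g₀ x +
      ∫ s in (0 : ℝ)..t, fluxDiv (fluxG ρ μ) z F G (S.c s) (S.d s) x := by
  obtain ⟨C, hC⟩ := exists_fluxBound_G hρ hμ (L := F + G + E + 1) (by positivity)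
  exact (S.isCurve.bddCurve hF hG hE).ae_eq_of_modes hz hC (contDiff_fluxG ρ μ) S.sym_d
    (S.isCurve.wn_d_ne (by omega)) hg₀ S.eq_d

theorem isWeakSolution {d : Flow} {f₀ g₀ : Torus → ℝ}
    (S : Solution (fluxF ρ) (fluxG ρ μ) d.zeta (mean f₀) (mean g₀) E σ (fourierC (fluct f₀))
      (fourierC (fluct g₀))) (hρ : 0 < ρ) (hμ : 0 < μ)
    (hF : 0 ≤ mean f₀) (hG : 0 ≤ mean g₀) (hE : 0 ≤ E) (hf₀ : Integrable (fluct f₀))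
    (hg₀ : Integrable (fluct g₀)) {T : ℝ} (hT : 0 < T) :
    IsWeakSolution d ρ μ f₀ g₀ T (fun t => rser (S.c t)) fun t => rser (S.d t) := by
  have hz := d.zeta_eq
  have hb := S.isCurve.bddCurve hF hG hE
  obtain ⟨C₁, h₁⟩ := exists_fluxBound_F hρ (L := mean f₀ + mean g₀ + E + 1) (by positivity)
  obtain ⟨C₂, h₂⟩ := exists_fluxBound_G hρ hμ (L := mean f₀ + mean g₀ + E + 1) (by positivity)
  have h₁' := h₁.mono_left (show mean f₀ + mean g₀ + E ≤ _ by linarith)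
  have h₂' := h₂.mono_left (show mean f₀ + mean g₀ + E ≤ _ by linarith)
  have i1 := hb.integrable_c T
  have i2 := hb.swap.integrable_c T
  have hfin : ∀ (e : ℝ → ℤ → ℂ), (∀ t, wn (d.zeta + 1) (e t) ≤ pairNorm (d.zeta + 1) (S.c t) (S.d t)) →
      ∫⁻ t in Ioi (0 : ℝ), wn (d.zeta + 1) (e t) ≠ ⊤ := fun e he =>
    ne_top_of_le_ne_top hb.lint_ne (lintegral_mono fun t => he t)
  have hD : ∀ e : ℝ → ℤ → ℂ, (∀ k, Measurable fun t => e t k) →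
      (∀ t, e t 0 = 0) → (∀ t, wn (d.zeta + 1) (e t) ≠ ⊤) →
      (∀ t, wn (d.zeta + 1) (e t) ≤ pairNorm (d.zeta + 1) (S.c t) (S.d t)) →
      Integrable (fun p : ℝ × Torus => rser (Dcoef d.zeta (e p.1)) p.2) (spaceTime T) :=
    fun e hm h0 he hle => by
      refine (hb.integrable_of_le (K := 1) (measurable_rser (c := fun t => Dcoef d.zeta (e t))
        (fun k => (hm k).const_mul _) fun t => ?_) fun t x => ?_).mono_measure (spaceTime_le T)
      · rw [wn_Dcoef, zero_add]; exact wn_ne_top_mono (Nat.le_succ _) (h0 t) (he t)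
      · have hn := wn_ne_top_mono (Nat.le_succ d.zeta) (h0 t) (he t)
        refine (abs_rser_le (by rwa [wn_Dcoef, zero_add]) x).trans ?_
        rw [wn_Dcoef, zero_add, one_mul]
        exact ENNReal.toReal_mono (hb.top_ne t) ((wn_mono (Nat.le_succ _) (h0 t)).trans (hle t))
  refine ⟨i1.aestronglyMeasurable, i2.aestronglyMeasurable,
    memBochner_sobolev_one d S.meas_c S.zero_c (hb.wn_c_ne le_rfl) (hfin S.c fun t => le_self_add) T,
    memBochner_sobolev_one d S.meas_d S.zero_d (hb.wn_d_ne le_rfl) (hfin S.d fun t => le_add_self) T,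
    fun t => rser (Dcoef d.zeta (S.c t)), fun t => rser (Dcoef d.zeta (S.d t)),
    hD S.c S.meas_c S.zero_c (hb.wn_c_ne le_rfl) fun t => le_self_add,
    hD S.d S.meas_d S.zero_d (hb.wn_d_ne le_rfl) fun t => le_add_self,
    .of_forall fun t => ⟨isD_rser d (S.zero_c t) (hb.wn_c_ne (by omega) t),
      isD_rser d (S.zero_d t) (hb.wn_d_ne (by omega) t)⟩, ?_, ?_, fun φ hφ => ?_, fun φ hφ => ?_⟩
  · exact (hb.integrable_phys h₁' (continuous_fluxF ρ)).mono_measure (spaceTime_le T)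
  · exact (hb.integrable_phys h₂' (continuous_fluxG ρ μ)).mono_measure (spaceTime_le T)
  · exact hb.weak_form hz h₁ h₁' (contDiff_fluxF ρ) hf₀ hT
      (u := fun t => rser (S.c t)) i1 (S.ae_eq_c hz hρ hF hG hE hf₀) hφ
  · exact hb.weak_form hz h₂ h₂' (contDiff_fluxG ρ μ) hg₀ hT
      (u := fun t => rser (S.d t)) i2 (S.ae_eq_d hz hρ hμ hF hG hE hg₀) hφ

theorem hasRegularity {d : Flow} {c₀ d₀ : ℤ → ℂ}
    (S : Solution (fluxF ρ) (fluxG ρ μ) d.zeta F G E σ c₀ d₀) (T : ℝ) :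
    HasRegularity d T (fun t => rser (S.c t)) ∧ HasRegularity d T fun t => rser (S.d t) :=
  ⟨hasRegularity_rser d S.meas_c S.zero_c (S.isCurve.wn_c_ne le_rfl)
      (fun t => le_self_add.trans (S.le_E t))
      (ne_top_of_le_ne_top S.isCurve.lint_ne (lintegral_mono fun _ => le_self_add)) T,
    hasRegularity_rser d S.meas_d S.zero_d (S.isCurve.wn_d_ne le_rfl)
      (fun t => le_add_self.trans (S.le_E t))
      (ne_top_of_le_ne_top S.isCurve.lint_ne (lintegral_mono fun _ => le_add_self)) T⟩

end Solution

theorem integrable_fluct_of_wienerNorm {u : Torus → ℝ} (h : wienerNorm 0 u < ⊤) :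
    Integrable u ∧ fourierC u 0 = 0 ∧ wn 0 (fourierC u) = wienerNorm 0 u := by
  have := wienerNorm_natCast_lt_top (s := 0) (u := u) (by rwa [Nat.cast_zero])
  rwa [Nat.cast_zero] at this

/-- The solution in the Wiener algebra for the data of the system; the rate is `min Σ₁ Σ₂`. -/
theorem exists_solution (d : Flow) {ρ μ : ℝ} (hρ : 0 < ρ) (hμ : 0 < μ) {f₀ g₀ : Torus → ℝ}
    (hf₀ : wienerNorm 0 (fluct f₀) < ⊤) (hg₀ : wienerNorm 0 (fluct g₀) < ⊤)
    (hsmall : energy0 f₀ g₀ < min (mean f₀) (mean g₀))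
    (hSig : 0 < min (Sigma1 ρ μ (mean f₀) (mean g₀) (energy0 f₀ g₀))
      (Sigma2 ρ μ (mean f₀) (mean g₀) (energy0 f₀ g₀))) :
    ∃ σ > 0, Nonempty (Solution (fluxF ρ) (fluxG ρ μ) d.zeta (mean f₀) (mean g₀) (energy0 f₀ g₀) σ
      (fourierC (fluct f₀)) (fourierC (fluct g₀))) := by
  have hE : 0 ≤ energy0 f₀ g₀ := add_nonneg ENNReal.toReal_nonneg ENNReal.toReal_nonneg
  obtain ⟨h1, h2⟩ := lt_min_iff.1 hsmall
  obtain ⟨_, z1, w1⟩ := integrable_fluct_of_wienerNorm hf₀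
  obtain ⟨_, z2, w2⟩ := integrable_fluct_of_wienerNorm hg₀
  refine ⟨_, hSig, nonempty_solution d.zeta_eq hρ hμ (hE.trans_lt h1) (hE.trans_lt h2) hSig
    (min_le_left _ _) (min_le_right _ _) (sym_fourierC _) (sym_fourierC _) z1 z2 hE ?_⟩
  rw [w1, w2, energy0, ENNReal.ofReal_add ENNReal.toReal_nonneg ENNReal.toReal_nonneg,
    ENNReal.ofReal_toReal hf₀.ne, ENNReal.ofReal_toReal hg₀.ne]

/-! ### From the weak formulation to the equation in physical space -/

theorem isCn_fourier_re (k : ℤ) : IsCn ⊤ fun x : Torus => (fourier k x : ℂ).re := by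
  unfold IsCn
  simp only [fourier_coe_apply]
  have : ContDiff ℝ ∞ fun y : ℝ => Complex.exp (2 * Real.pi * Complex.I * k * y / (2 * Real.pi : ℝ)) := by
    have : ContDiff ℝ ∞ fun y : ℝ => (y : ℂ) := Complex.ofRealCLM.contDiff
    exact ((contDiff_const.mul this).div_const _).cexp
  exact Complex.reCLM.contDiff.comp this

theorem isCn_fourier_im (k : ℤ) : IsCn ⊤ fun x : Torus => (fourier k x : ℂ).im := by
  unfold IsCn
  simp only [fourier_coe_apply]
  have : ContDiff ℝ ∞ fun y : ℝ => Complex.exp (2 * Real.pi * Complex.I * k * y / (2 * Real.pi : ℝ)) := by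
    have : ContDiff ℝ ∞ fun y : ℝ => (y : ℂ) := Complex.ofRealCLM.contDiff
    exact ((contDiff_const.mul this).div_const _).cexp
  exact Complex.imCLM.contDiff.comp this

theorem IsCn.continuous {n : ℕ∞} {η : Torus → ℝ} (h : IsCn n η) : Continuous η :=
  continuous_torus (ContDiff.continuous h)

theorem fourierC_eq_re_im {u : Torus → ℝ} (hu : Integrable u) (k : ℤ) :
    fourierC u k = (2 * Real.pi : ℝ)⁻¹ * ((∫ x, u x * (fourier (-k) x : ℂ).re : ℝ) +
      (∫ x, u x * (fourier (-k) x : ℂ).im : ℝ) * Complex.I) := by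
  have hi : Integrable fun x : Torus => (fourier (-k) x : ℂ) * (u x : ℂ) :=
    (hu.ofReal (𝕜 := ℂ)).bdd_mul (c := 1) (fourier (-k)).continuous.aestronglyMeasurable
      (.of_forall fun x => (norm_fourier_apply (-k) x).le)
  rw [fourierC, fourierCoeff_eq, ← integral_re_add_im hi, Complex.real_smul]
  congr 2
  · simp [mul_comm]
  · refine congrArg₂ _ (congrArg _ (integral_congr_ae (.of_forall fun x => ?_))) rfl
    show ((fourier (-k) x : ℂ) * (u x : ℂ)).im = _
    rw [Complex.im_mul_ofReal, mul_comm]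

theorem ae_eq_of_forall_integral_smooth {u v : Torus → ℝ} (hu : Integrable u) (hv : Integrable v)
    (h : ∀ η, IsCn ⊤ η → ∫ x, u x * η x = ∫ x, v x * η x) : u =ᵐ[volume] v :=
  ae_eq_of_fourierC hu hv fun k => by
    rw [fourierC_eq_re_im hu, fourierC_eq_re_im hv, h _ (isCn_fourier_re _), h _ (isCn_fourier_im _)]

theorem IsWeakDeriv.ae_eq {n : ℕ} {u u' v v' : Torus → ℝ} (h : IsWeakDeriv n u v)
    (h' : IsWeakDeriv n u' v') (hu : u =ᵐ[volume] u') : v =ᵐ[volume] v' := by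
  refine ae_eq_of_forall_integral_smooth h.2.1 h'.2.1 fun η hη => ?_
  have e1 := h.2.2 η hη
  have e2 := h'.2.2 η hη
  have e3 : ∫ x, u x * xDeriv n η x = ∫ x, u' x * xDeriv n η x :=
    integral_congr_ae (hu.mono fun x hx => by show u x * _ = u' x * _; rw [hx])
  rw [e1, e2] at e3
  exact mul_left_cancel₀ (pow_ne_zero _ (by norm_num)) e3

theorem Flow.IsD.ae_eq {d : Flow} {u v : Torus → ℝ} (h : d.IsD u v) {c : ℤ → ℂ} (h0 : c 0 = 0)
    (hc : wn d.zeta c ≠ ⊤) (hu : u =ᵐ[volume] rser c) : v =ᵐ[volume] rser (Dcoef d.zeta c) := by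
  have h' := isD_rser d h0 hc
  cases d with
  | gravity => exact IsWeakDeriv.ae_eq h h' hu
  | capillary =>
    have := IsWeakDeriv.ae_eq h h' hu
    filter_upwards [this] with x hx
    exact neg_injective hx

/-- A function of one variable whose weak derivative on `(0, T)` is `b`, with initial value `α`. -/
theorem ae_eq_primitive {T : ℝ} (hT : 0 < T) {a b : ℝ → ℝ} (ha : IntegrableOn a (Ioc 0 T))
    (hb : IntegrableOn b (Ioc 0 T)) (α : ℝ)
    (h : ∀ θ : ℝ → ℝ, ContDiff ℝ ∞ θ → (∃ T' < T, ∀ t, T' ≤ t → θ t = 0) →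
      α * θ 0 + ∫ t in Ioc 0 T, a t * deriv θ t = -∫ t in Ioc 0 T, b t * θ t) :
    ∀ᵐ t ∂(volume.restrict (Ioc 0 T)), a t = α + ∫ s in (0 : ℝ)..t, b s := by
  have hb' : IntervalIntegrable b volume 0 T :=
    (intervalIntegrable_iff_integrableOn_Ioc_of_le hT.le).2 hb
  -- by integration by parts, the difference from the primitive has zero weak derivative
  set B : ℝ → ℝ := fun t => ∫ s in (0 : ℝ)..t, b s with hB
  have hBac : AbsolutelyContinuousOnInterval B 0 T :=
    hb'.absolutelyContinuousOnInterval_intervalIntegral left_mem_uIcc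
  have hBc : ContinuousOn B (Icc 0 T) := by
    have := hBac.continuousOn; rwa [uIcc_of_le hT.le] at this
  have hBi : IntegrableOn B (Ioc 0 T) := hBc.integrableOn_Icc.mono_set Ioc_subset_Icc_self
  have hBd : ∀ᵐ t, t ∈ Ioc 0 T → deriv B t = b t := by
    filter_upwards [hb'.ae_hasDerivAt_integral] with t ht htT
    exact (ht (by rw [uIcc_of_le hT.le]; exact Ioc_subset_Icc_self htT) 0 left_mem_uIcc).deriv
  have hfi : IntegrableOn (fun t => a t - (α + B t)) (Ioc 0 T) :=
    ha.sub ((integrableOn_const (by simp)).add hBi)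
  have key : ∀ θ : ℝ → ℝ, ContDiff ℝ ∞ θ → (∃ T' < T, ∀ t, T' ≤ t → θ t = 0) →
      ∫ t in Ioc 0 T, (a t - (α + B t)) * deriv θ t = 0 := by
    intro θ hθ hθT
    have h1 := h θ hθ hθT
    have hθ0 : θ T = 0 := by obtain ⟨T', h1, h2⟩ := hθT; exact h2 T h1.le
    have hθc : Continuous (deriv θ) := hθ.continuous_deriv (by simp)
    have hθac : AbsolutelyContinuousOnInterval θ 0 T :=
      (hθ.of_le (by simp)).contDiffOn.absolutelyContinuousOnInterval
    have h2 := hBac.integral_mul_deriv_eq_deriv_mul hθac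
    have h3 : ∫ t in (0 : ℝ)..T, deriv B t * θ t = ∫ t in (0 : ℝ)..T, b t * θ t := by
      refine intervalIntegral.integral_congr_ae ?_
      filter_upwards [hBd] with t ht htT
      rw [uIoc_of_le hT.le] at htT
      rw [ht htT]
    have h4 : ∫ t in (0 : ℝ)..T, α * deriv θ t = α * (θ T - θ 0) := by
      rw [intervalIntegral.integral_const_mul, intervalIntegral.integral_deriv_eq_sub
        (fun t _ => hθ.differentiable (by simp) t) (hθc.intervalIntegrable _ _)]
    have hB0 : B 0 = 0 := intervalIntegral.integral_same
    rw [h3, hθ0, hB0] at h2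
    rw [hθ0] at h4
    rw [intervalIntegral.integral_of_le hT.le, intervalIntegral.integral_of_le hT.le] at h2
    rw [intervalIntegral.integral_of_le hT.le] at h4
    have im : ∀ {f : ℝ → ℝ}, IntegrableOn f (Ioc 0 T) →
        IntegrableOn (fun t => f t * deriv θ t) (Ioc 0 T) := fun {f} hf => by
      obtain ⟨M, hM⟩ := (isCompact_Icc (a := (0 : ℝ)) (b := T)).exists_bound_of_continuousOn
        hθc.continuousOn
      exact (hf.integrable.bdd_mul (c := M) hθc.aestronglyMeasurable (by
        filter_upwards [ae_restrict_mem measurableSet_Ioc] with t ht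
        exact hM t (Ioc_subset_Icc_self ht))).congr (.of_forall fun x => mul_comm _ _)
    have e : ∀ t, (a t - (α + B t)) * deriv θ t =
        a t * deriv θ t - (α * deriv θ t + B t * deriv θ t) := fun t => by ring
    simp only [e]
    have i1 : IntegrableOn (fun t => α * deriv θ t) (Ioc 0 T) :=
      im (f := fun _ => α) (integrableOn_const (by simp))
    have i2 : IntegrableOn (fun t => α * deriv θ t + B t * deriv θ t) (Ioc 0 T) := i1.add (im hBi)
    rw [integral_sub (im ha) i2, integral_add i1 (im hBi), h4, h2]
    linarith
  have hz := isOpen_Ioo.ae_eq_zero_of_integral_contDiff_smul_eq_zero (μ := volume)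
    (U := Ioo 0 T) (f := fun t => a t - (α + B t))
    (hfi.mono_set Ioo_subset_Ioc_self).locallyIntegrableOn ?_
  · rw [← Measure.restrict_congr_set Ioo_ae_eq_Ioc, ae_restrict_iff' measurableSet_Ioo]
    filter_upwards [hz] with t ht htT
    exact sub_eq_zero.1 (ht htT)
  · intro η hη hηc hηs
    -- the primitive of `η` that vanishes near `T` is an admissible test function
    obtain ⟨T', hT', hT'0⟩ : ∃ T' < T, ∀ s, T' < s → η s = 0 := by
      rcases (tsupport η).eq_empty_or_nonempty with he | hne
      · refine ⟨0, hT, fun s _ => ?_⟩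
        rw [tsupport_eq_empty_iff.1 he]; rfl
      · obtain ⟨m, hm, hmax⟩ := hηc.isCompact.exists_isGreatest hne
        exact ⟨m, (hηs hm).2, fun s hs => by
          by_contra hne
          exact absurd (hmax (subset_tsupport _ hne)) (not_le.2 hs)⟩
    have hd : ∀ t, HasDerivAt (fun t => ∫ s in T..t, η s) (η t) t := fun t =>
      intervalIntegral.integral_hasDerivAt_right (hη.continuous.intervalIntegrable _ _)
        (hη.continuous.stronglyMeasurableAtFilter _ _) hη.continuous.continuousAt
    have hde : deriv (fun t => ∫ s in T..t, η s) = η := funext fun t => (hd t).deriv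
    have k1 := key (fun t => ∫ s in T..t, η s) ?_ ⟨T', hT', fun t ht => ?_⟩
    · rw [hde] at k1
      rw [← k1, ← setIntegral_eq_integral_of_forall_compl_eq_zero (s := Ioc 0 T)]
      · refine integral_congr_ae (.of_forall fun t => ?_)
        show η t * _ = _
        ring
      · intro t ht
        have : η t = 0 := by
          by_contra hne
          exact ht (Ioo_subset_Ioc_self (hηs (subset_tsupport _ hne)))
        rw [this, zero_smul]
    · rw [contDiff_infty_iff_deriv, hde]
      exact ⟨fun t => (hd t).differentiableAt, hη⟩
    · rw [intervalIntegral.integral_congr_ae (g := fun _ => (0 : ℝ)) (.of_forall fun s hs => ?_),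
        intervalIntegral.integral_zero]
      refine hT'0 s (lt_of_le_of_lt (le_min hT'.le ht) hs.1)

theorem isTest_mul {T : ℝ} {θ : ℝ → ℝ} {χ : Torus → ℝ} (hθ : ContDiff ℝ ∞ θ)
    (hθT : ∃ T' < T, ∀ t, T' ≤ t → θ t = 0) (hχ : IsCn ⊤ χ) : IsTest T fun t x => θ t * χ x := by
  obtain ⟨T', h1, h2⟩ := hθT
  refine ⟨(hθ.comp contDiff_fst).mul ((show ContDiff ℝ ∞ fun y : ℝ => χ (y : Torus)
    from hχ).comp contDiff_snd), T', h1, fun t ht x => ?_⟩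
  show θ t * χ x = 0
  rw [h2 t ht, zero_mul]

/-- The weak formulation, tested with products, determines the Fourier coefficients. -/
theorem ae_fourierC_eq {T : ℝ} (hT : 0 < T) {u : ℝ → Torus → ℝ} {u₀ : Torus → ℝ}
    {R : ℝ × Torus → ℝ} (hu₀ : Integrable u₀) (hu : Integrable (Function.uncurry u) (spaceTime T))
    (hR : Integrable R (spaceTime T))
    (h : ∀ φ, IsTest T φ → (∫ x, u₀ x * φ 0 x) + ∫ p, u p.1 p.2 * tDeriv φ p ∂(spaceTime T) =
      -∫ p, R p * φ p.1 p.2 ∂(spaceTime T)) :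
    ∀ᵐ t ∂(volume.restrict (Ioc 0 T)), ∀ k, fourierC (u t) k = fourierC u₀ k +
      ∫ s in (0 : ℝ)..t, fourierC (fun x => R (s, x)) k := by
  -- testing with `θ(t) χ(x)` gives an equation in time for the moment against `χ`
  have key : ∀ χ, IsCn ⊤ χ → IntegrableOn (fun s => ∫ x, R (s, x) * χ x) (Ioc 0 T) ∧
      ∀ᵐ t ∂(volume.restrict (Ioc 0 T)), ∫ x, u t x * χ x = (∫ x, u₀ x * χ x) +
        ∫ s in (0 : ℝ)..t, ∫ x, R (s, x) * χ x := by
    intro χ hχ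
    have c2 : Continuous fun p : ℝ × Torus => χ p.2 := hχ.continuous.comp continuous_snd
    have iu : Integrable (fun p : ℝ × Torus => u p.1 p.2 * χ p.2) (spaceTime T) :=
      integrable_mul_continuous hu c2
    have iR : Integrable (fun p : ℝ × Torus => R p * χ p.2) (spaceTime T) :=
      integrable_mul_continuous hR c2
    refine ⟨iR.integral_prod_left, ae_eq_primitive hT iu.integral_prod_left iR.integral_prod_left _
      fun θ hθ hθT => ?_⟩
    have htest := isTest_mul hθ hθT hχ
    have e0 := h _ htest
    have hθd : ∀ t x, tDeriv (fun t x => θ t * χ x) (t, x) = deriv θ t * χ x := fun t x =>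
      ((hθ.differentiable (by simp) t).hasDerivAt.mul_const (χ x)).deriv
    have e1 : ∫ p, u p.1 p.2 * tDeriv (fun t x => θ t * χ x) p ∂(spaceTime T) =
        ∫ t in Ioc 0 T, (∫ x, u t x * χ x) * deriv θ t := by
      have i1 : Integrable (fun p : ℝ × Torus => u p.1 p.2 * tDeriv (fun t x => θ t * χ x) p)
          (spaceTime T) := integrable_mul_continuous hu htest.continuous_tDeriv
      refine (integral_prod _ i1).trans (integral_congr_ae (.of_forall fun t => ?_))
      show ∫ x, u t x * tDeriv (fun t x => θ t * χ x) (t, x) = (∫ x, u t x * χ x) * deriv θ t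
      rw [← integral_mul_const]
      refine integral_congr_ae (.of_forall fun x => ?_)
      show u t x * tDeriv (fun t x => θ t * χ x) (t, x) = _
      rw [hθd]; ring
    have e2 : ∫ p, R p * (θ p.1 * χ p.2) ∂(spaceTime T) =
        ∫ t in Ioc 0 T, (∫ x, R (t, x) * χ x) * θ t := by
      have i1 : Integrable (fun p : ℝ × Torus => R p * (θ p.1 * χ p.2)) (spaceTime T) :=
        integrable_mul_continuous hR htest.continuous
      refine (integral_prod _ i1).trans (integral_congr_ae (.of_forall fun t => ?_))
      show ∫ x, R (t, x) * (θ t * χ x) = (∫ x, R (t, x) * χ x) * θ t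
      rw [← integral_mul_const]
      refine integral_congr_ae (.of_forall fun x => ?_)
      show R (t, x) * (θ t * χ x) = _
      ring
    rw [e1, e2] at e0
    rw [← e0, ← integral_mul_const]
    congr 1
    refine integral_congr_ae (.of_forall fun x => ?_)
    show u₀ x * χ x * θ 0 = u₀ x * (θ 0 * χ x)
    ring
  rw [ae_all_iff]
  intro k
  obtain ⟨j1, l1⟩ := key _ (isCn_fourier_re (-k))
  obtain ⟨j2, l2⟩ := key _ (isCn_fourier_im (-k))
  have aeR : ∀ᵐ s ∂(volume.restrict (Ioc 0 T)), Integrable fun x => R (s, x) :=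
    hR.prod_right_ae
  have aeu : ∀ᵐ s ∂(volume.restrict (Ioc 0 T)), Integrable (u s) := hu.prod_right_ae
  filter_upwards [l1, l2, aeu, ae_restrict_mem measurableSet_Ioc] with t h1 h2 h3 htT
  have hsub : Ioc 0 t ⊆ Ioc 0 T := Ioc_subset_Ioc_right htT.2
  rw [fourierC_eq_re_im h3, fourierC_eq_re_im hu₀, h1, h2,
    intervalIntegral.integral_of_le htT.1.le, intervalIntegral.integral_of_le htT.1.le,
    intervalIntegral.integral_of_le htT.1.le]
  have e : ∫ s in Ioc 0 t, fourierC (fun x => R (s, x)) k =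
      ∫ s in Ioc 0 t, ((2 * Real.pi : ℝ)⁻¹ * (((∫ x, R (s, x) * (fourier (-k) x : ℂ).re : ℝ) : ℂ) +
        (∫ x, R (s, x) * (fourier (-k) x : ℂ).im : ℝ) * Complex.I) : ℂ) := by
    refine integral_congr_ae ?_
    filter_upwards [ae_mono (Measure.restrict_mono hsub le_rfl) aeR] with s hs
    exact fourierC_eq_re_im hs k
  have i1 := (j1.mono_set hsub).integrable.ofReal (𝕜 := ℂ)
  have i2 := ((j2.mono_set hsub).integrable.ofReal (𝕜 := ℂ)).mul_const Complex.I
  have e' : ∫ s in Ioc 0 t, (((∫ x, R (s, x) * (fourier (-k) x : ℂ).re : ℝ) : ℂ) +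
      (∫ x, R (s, x) * (fourier (-k) x : ℂ).im : ℝ) * Complex.I) =
      ((∫ s in Ioc 0 t, ∫ x, R (s, x) * (fourier (-k) x : ℂ).re : ℝ) : ℂ) +
      (∫ s in Ioc 0 t, ∫ x, R (s, x) * (fourier (-k) x : ℂ).im : ℝ) * Complex.I :=
    (integral_add i1 i2).trans (congrArg₂ (· + ·) integral_complex_ofReal
      ((integral_mul_const _ _).trans (congrArg (· * Complex.I) integral_complex_ofReal)))
  rw [e, integral_const_mul, e', Complex.ofReal_add, Complex.ofReal_add]
  ring

/-! ### Fourier series of weak solutions -/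

theorem ae_eq_of_ae_ae {T : ℝ} {u v : ℝ × Torus → ℝ} (hu : AEStronglyMeasurable u (spaceTime T))
    (hv : AEStronglyMeasurable v (spaceTime T))
    (h : ∀ᵐ t ∂(volume.restrict (Ioc 0 T)), ∀ᵐ x, u (t, x) = v (t, x)) : u =ᵐ[spaceTime T] v := by
  have h1 : ∀ᵐ t ∂(volume.restrict (Ioc 0 T)), ∀ᵐ x, u (t, x) = hu.mk u (t, x) :=
    Measure.ae_ae_of_ae_prod hu.ae_eq_mk
  have h2 : ∀ᵐ t ∂(volume.restrict (Ioc 0 T)), ∀ᵐ x, v (t, x) = hv.mk v (t, x) :=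
    Measure.ae_ae_of_ae_prod hv.ae_eq_mk
  have h3 : hu.mk u =ᵐ[spaceTime T] hv.mk v := by
    refine (Measure.ae_prod_iff_ae_ae (measurableSet_eq_fun hu.stronglyMeasurable_mk.measurable
      hv.stronglyMeasurable_mk.measurable)).2 ?_
    filter_upwards [h, h1, h2] with t a1 a2 a3
    filter_upwards [a1, a2, a3] with x b1 b2 b3
    rw [← b2, ← b3, b1]
  exact hu.ae_eq_mk.trans (h3.trans hv.ae_eq_mk.symm)

theorem ae_ne_top_of_memBochner {s : ℕ} {p T : ℝ} {u : ℝ → Torus → ℝ}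
    (h : MemBochner (wienerNorm s) p T u) : ∀ᵐ t ∂(volume.restrict (Ioc 0 T)),
      Integrable (u t) ∧ fourierC (u t) 0 = 0 ∧ wn s (fourierC (u t)) ≠ ⊤ := by
  obtain ⟨⟨v, hv, hlim⟩, -⟩ := h
  filter_upwards [hlim] with t ht
  obtain ⟨n, hn⟩ := (ht.eventually_lt_const (show (0 : ℝ≥0∞) < ⊤ by simp)).exists
  obtain ⟨i1, z1, w1⟩ := wienerNorm_natCast_lt_top hn
  obtain ⟨i2, z2, w2⟩ := wienerNorm_natCast_lt_top (hv n t)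
  have e : u t = fun x => (u t - v n t) x + v n t x := by ext x; simp
  have ef : fourierC (u t) = fourierC (u t - v n t) + fourierC (v n t) := by
    ext k
    conv_lhs => rw [e]
    exact fourierC_add i1 i2 k
  refine ⟨by rw [e]; exact i1.add i2, by rw [ef, Pi.add_apply, z1, z2, add_zero], ?_⟩
  rw [ef]
  exact ne_top_of_le_ne_top (ENNReal.add_ne_top.2 ⟨w1 ▸ hn.ne, w2 ▸ (hv n t).ne⟩) (wn_add_le _ _ _)

/-- A bounded curve, integrable in time with respect to a Wiener norm, is given by measurable
Fourier coefficients with good properties at every time. -/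
theorem exists_coef {s : ℕ} {T : ℝ} {u : ℝ → Torus → ℝ} (hu : MemLInf T u)
    (h : MemBochner (wienerNorm s) 1 T u) : ∃ (L : ℝ) (c : ℝ → ℤ → ℂ), 0 ≤ L ∧
      (∀ k, Measurable fun t => c t k) ∧ (∀ t, Sym (c t)) ∧ (∀ t, c t 0 = 0) ∧
      (∀ t, wn s (c t) ≠ ⊤) ∧ (∀ t x, |rser (c t) x| ≤ L) ∧
      ∫⁻ t in Ioi (0 : ℝ), wn s (c t) ≠ ⊤ ∧
      ∀ᵐ t ∂(volume.restrict (Ioc 0 T)), u t =ᵐ[volume] rser (c t) := by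
  obtain ⟨hm, hb⟩ := hu
  set L := (eLpNorm (Function.uncurry u) ⊤ (spaceTime T)).toReal with hL
  have hL1 : ∀ᵐ t ∂(volume.restrict (Ioc 0 T)), ∀ᵐ x, |u t x| ≤ L := by
    refine Measure.ae_ae_of_ae_prod (p := fun p => |u p.1 p.2| ≤ L) ?_
    rw [eLpNorm_exponent_top] at hb hL
    filter_upwards [ae_le_eLpNormEssSup (f := Function.uncurry u) (μ := spaceTime T)] with p hp
    have := ENNReal.toReal_mono hb.ne hp
    rwa [toReal_enorm, ← hL, Real.norm_eq_abs] at this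
  have hmk : ∀ᵐ t ∂(volume.restrict (Ioc 0 T)), ∀ᵐ x, u t x = hm.mk _ (t, x) :=
    Measure.ae_ae_of_ae_prod hm.ae_eq_mk
  -- the coefficients of a jointly measurable representative are measurable in time
  set c₀ : ℝ → ℤ → ℂ := fun t => fourierC fun x => hm.mk _ (t, x) with hc₀
  have hc₀m : ∀ k, Measurable fun t => c₀ t k := fun k =>
    measurable_fourierC (u := fun t x => hm.mk _ (t, x)) hm.stronglyMeasurable_mk.measurable k
  have good : ∀ᵐ t ∂(volume.restrict (Ioc 0 T)), wn s (c₀ t) ≠ ⊤ ∧ c₀ t 0 = 0 ∧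
      (∀ x, |rser (c₀ t) x| ≤ L) ∧ u t =ᵐ[volume] rser (c₀ t) ∧ wn s (c₀ t) ≤ wienerNorm s (u t) := by
    filter_upwards [ae_ne_top_of_memBochner h, hL1, hmk] with t ⟨t1, t2, t3⟩ t4 t5
    have e : c₀ t = fourierC (u t) := by
      ext k
      simp only [hc₀, fourierC, fourierCoeff_eq]
      congr 1
      refine integral_congr_ae (t5.mono fun x hx => ?_)
      show fourier (-k) x * ((hm.mk _ (t, x) : ℝ) : ℂ) = fourier (-k) x * ((u t x : ℝ) : ℂ)
      rw [hx]
    have hw : wn 0 (fourierC (u t)) ≠ ⊤ := wn_ne_top_mono (Nat.zero_le _) t2 t3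
    have hae := ae_eq_rser_of_wn t1 hw
    rw [e]
    refine ⟨t3, t2, fun x => ?_, hae, ?_⟩
      -- a bound almost everywhere holds everywhere, by continuity
    · have hd : Dense {x | |rser (fourierC (u t)) x| ≤ L} := Measure.dense_of_ae (by
        filter_upwards [t4, hae] with x a1 a2
        rwa [← a2])
      have hcl : IsClosed {x | |rser (fourierC (u t)) x| ≤ L} :=
        isClosed_le (continuous_rser hw).abs continuous_const
      have := hcl.closure_eq ▸ hd x
      exact this
    · have hmean : mean (u t) = 0 := by
        rw [fourierC_zero] at t2; exact_mod_cast t2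
      rw [wienerNorm, if_pos ⟨t1, hmean⟩]
      simp [wn]
  obtain ⟨A, hA, hAm, hAg⟩ := good.exists_measurable_mem
  -- the curve is set to zero at the exceptional times
  set B := A ∩ Ioc 0 T with hB
  have hBm : MeasurableSet B := hAm.inter measurableSet_Ioc
  classical
  set c : ℝ → ℤ → ℂ := fun t => if t ∈ B then c₀ t else 0 with hc
  have hpos : ∀ t ∈ B, c t = c₀ t := fun t ht => if_pos ht
  have hneg : ∀ t ∉ B, c t = 0 := fun t ht => if_neg ht
  have hr0 : ∀ x, rser 0 x = 0 := fun x => by simp [rser, ser]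
  have hL0 : 0 ≤ L := ENNReal.toReal_nonneg
  refine ⟨L, c, hL0, fun k => ?_, fun t => ?_, fun t => ?_, fun t => ?_, fun t x => ?_, ?_, ?_⟩
  · have : (fun t => c t k) = fun t => if t ∈ B then c₀ t k else 0 := by
      ext t
      by_cases ht : t ∈ B
      · rw [hpos t ht, if_pos ht]
      · rw [hneg t ht, if_neg ht]; rfl
    rw [this]
    exact Measurable.ite hBm (hc₀m k) measurable_const
  · by_cases ht : t ∈ B
    · rw [hpos t ht]; exact sym_fourierC _
    · rw [hneg t ht]; intro k; simp
  · by_cases ht : t ∈ B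
    · rw [hpos t ht]; exact (hAg t ht.1).2.1
    · rw [hneg t ht]; rfl
  · by_cases ht : t ∈ B
    · rw [hpos t ht]; exact (hAg t ht.1).1
    · rw [hneg t ht, wn_zero_coef]; simp
  · by_cases ht : t ∈ B
    · rw [hpos t ht]; exact (hAg t ht.1).2.2.1 x
    · rw [hneg t ht, hr0, abs_zero]; exact hL0
  · have hle : ∫⁻ t in Ioi (0 : ℝ), wn s (c t) ≤ ∫⁻ t in Ioc 0 T, wn s (c₀ t) := by
      rw [← lintegral_indicator measurableSet_Ioc]
      refine (setLIntegral_le_lintegral _ _).trans (lintegral_mono fun t => ?_)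
      by_cases ht : t ∈ B
      · rw [hpos t ht, indicator_of_mem ht.2]
      · rw [hneg t ht, wn_zero_coef]; exact zero_le
    refine ne_top_of_le_ne_top h.2.ne (hle.trans (lintegral_mono_ae ?_))
    filter_upwards [good] with t ht
    rw [ENNReal.rpow_one]
    exact ht.2.2.2.2
  · filter_upwards [hA, ae_restrict_mem measurableSet_Ioc] with t h1 h2
    rw [hpos t ⟨h1, h2⟩]
    exact (hAg t h1).2.2.2.1

/-- One equation of a weak solution, in physical space. -/
theorem BddCurve.ae_eq_of_weak {z : ℕ} {L F G T : ℝ} {c d : ℝ → ℤ → ℂ} (h : BddCurve z L F G c d)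
    (hT : 0 < T) (hz : z = 1 ∨ z = 3) {Φ : ℝ → ℝ → ℝ → ℝ → ℝ} {C : ℝ} (hΦ : FluxBound Φ (L + 1) C)
    (hΦc : ContDiff ℝ 1 fun y : ℝ × ℝ × ℝ × ℝ => Φ y.1 y.2.1 y.2.2.1 y.2.2.2)
    {e : ℝ → ℤ → ℂ} (hs : ∀ t, Sym (e t)) (hw : ∀ t, wn 0 (e t) ≠ ⊤)
    (he : Integrable (fun p : ℝ × Torus => rser (e p.1) p.2) (spaceTime T))
    {u₀ : Torus → ℝ} (hu₀ : Integrable u₀) {u Df Dg f g : ℝ → Torus → ℝ}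
    (hum : AEStronglyMeasurable (Function.uncurry u) (spaceTime T))
    (hu : ∀ᵐ t ∂(volume.restrict (Ioc 0 T)), u t =ᵐ[volume] rser (e t))
    (hf : ∀ᵐ t ∂(volume.restrict (Ioc 0 T)), f t =ᵐ[volume] rser (c t))
    (hg : ∀ᵐ t ∂(volume.restrict (Ioc 0 T)), g t =ᵐ[volume] rser (d t))
    (hDf : ∀ᵐ t ∂(volume.restrict (Ioc 0 T)), Df t =ᵐ[volume] rser (Dcoef z (c t)))
    (hDg : ∀ᵐ t ∂(volume.restrict (Ioc 0 T)), Dg t =ᵐ[volume] rser (Dcoef z (d t)))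
    (hJ : Integrable (fun p : ℝ × Torus => Φ (F + f p.1 p.2) (G + g p.1 p.2) (Df p.1 p.2)
      (Dg p.1 p.2)) (spaceTime T))
    (hweak : ∀ φ, IsTest T φ → (∫ x, u₀ x * φ 0 x) +
      ∫ p, u p.1 p.2 * deriv (fun s => φ s p.2) p.1 ∂(spaceTime T) =
      ∫ p, Φ (F + f p.1 p.2) (G + g p.1 p.2) (Df p.1 p.2) (Dg p.1 p.2) * xDeriv 1 (φ p.1) p.2
        ∂(spaceTime T)) :
    ∀ᵐ t ∂(volume.restrict (Ioc 0 T)), ∀ᵐ x, rser (e t) x = u₀ x +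
      ∫ s in (0 : ℝ)..t, fluxDiv Φ z F G (c s) (d s) x := by
  have iJ := (h.integrable_phys (hΦ.mono_left (by linarith)) hΦc.continuous).mono_measure
    (spaceTime_le T)
  have iR := (h.integrable_fluxDiv hz hΦ hΦc).mono_measure (spaceTime_le T)
  -- the weak formulation with the unknown and the flux replaced by their Fourier series
  have e1 : Function.uncurry u =ᵐ[spaceTime T] fun p => rser (e p.1) p.2 :=
    ae_eq_of_ae_ae hum he.aestronglyMeasurable hu
  have e2 : (fun p : ℝ × Torus => Φ (F + f p.1 p.2) (G + g p.1 p.2) (Df p.1 p.2) (Dg p.1 p.2))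
      =ᵐ[spaceTime T] fun p => phys Φ z F G (c p.1) (d p.1) p.2 := by
    refine ae_eq_of_ae_ae hJ.aestronglyMeasurable iJ.aestronglyMeasurable ?_
    filter_upwards [hf, hg, hDf, hDg] with t a1 a2 a3 a4
    filter_upwards [a1, a2, a3, a4] with x b1 b2 b3 b4
    simp only [b1, b2, b3, b4, phys]
  have key : ∀ φ, IsTest T φ → (∫ x, u₀ x * φ 0 x) +
      ∫ p, rser (e p.1) p.2 * tDeriv φ p ∂(spaceTime T) =
      -∫ p, fluxDiv Φ z F G (c p.1) (d p.1) p.2 * φ p.1 p.2 ∂(spaceTime T) := by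
    intro φ hφ
    have a1 : ∫ p, rser (e p.1) p.2 * tDeriv φ p ∂(spaceTime T) =
        ∫ p, u p.1 p.2 * deriv (fun s => φ s p.2) p.1 ∂(spaceTime T) :=
      integral_congr_ae (e1.mono fun p hp => by
        show _ = Function.uncurry u p * tDeriv φ p
        rw [hp])
    have a2 : ∫ p, Φ (F + f p.1 p.2) (G + g p.1 p.2) (Df p.1 p.2) (Dg p.1 p.2) *
        xDeriv 1 (φ p.1) p.2 ∂(spaceTime T) =
        ∫ p, phys Φ z F G (c p.1) (d p.1) p.2 * xDeriv 1 (φ p.1) p.2 ∂(spaceTime T) :=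
      integral_congr_ae (e2.mono fun p hp => congrArg (· * xDeriv 1 (φ p.1) p.2) hp)
    rw [a1, hweak φ hφ, a2]
    exact integral_mul_xDeriv iJ iR (fun t y => hasDerivAt_phys hΦc (h.zero_c t) (h.zero_d t)
      (h.top_ne t) y) (fun t => continuous_fluxDiv hΦc (h.zero_c t) (h.zero_d t) (h.top_ne t)) hφ
  have modes := ae_fourierC_eq hT (u := fun t => rser (e t))
    (R := fun p => fluxDiv Φ z F G (c p.1) (d p.1) p.2) hu₀ he iR key
  filter_upwards [modes, ae_restrict_mem measurableSet_Ioc] with t ht htT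
  refine ae_eq_add_integral (R := fun p => fluxDiv Φ z F G (c p.1) (d p.1) p.2) hu₀ (hs t) (hw t)
    htT.1.le ((h.integrable_fluxDiv hz hΦ hΦc).mono_measure (spaceTime_le t)) fun k => ?_
  rw [← fourierC_rser (hs t) (hw t)]
  exact ht k

/-- Every weak solution in the uniqueness class is a curve of Fourier series with bounded heights that
solves the equations in physical space. -/
theorem exists_bddCurve {d : Flow} {ρ μ : ℝ} (hρ : 0 < ρ) (hμ : 0 < μ) {f₀ g₀ : Torus → ℝ}
    (hf₀ : Integrable (fluct f₀)) (hg₀ : Integrable (fluct g₀)) {T : ℝ} (hT : 0 < T)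
    {f g : ℝ → Torus → ℝ} (h : IsWeakSolution d ρ μ f₀ g₀ T f g)
    (hf : MemLInf T f) (hf' : MemBochner (wienerNorm ((d.zeta : ℝ) + 1)) 1 T f)
    (hg : MemLInf T g) (hg' : MemBochner (wienerNorm ((d.zeta : ℝ) + 1)) 1 T g) :
    ∃ (L : ℝ) (c e : ℝ → ℤ → ℂ), BddCurve d.zeta L (mean f₀) (mean g₀) c e ∧
      (∀ᵐ t ∂(volume.restrict (Ioc 0 T)), f t =ᵐ[volume] rser (c t)) ∧
      (∀ᵐ t ∂(volume.restrict (Ioc 0 T)), g t =ᵐ[volume] rser (e t)) ∧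
      (∀ᵐ t ∂(volume.restrict (Ioc 0 T)), ∀ᵐ x, rser (c t) x = fluct f₀ x +
        ∫ s in (0 : ℝ)..t, fluxDiv (fluxF ρ) d.zeta (mean f₀) (mean g₀) (c s) (e s) x) ∧
      ∀ᵐ t ∂(volume.restrict (Ioc 0 T)), ∀ᵐ x, rser (e t) x = fluct g₀ x +
        ∫ s in (0 : ℝ)..t, fluxDiv (fluxG ρ μ) d.zeta (mean f₀) (mean g₀) (c s) (e s) x := by
  rw [show (d.zeta : ℝ) + 1 = ((d.zeta + 1 : ℕ) : ℝ) by push_cast; rfl] at hf' hg'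
  obtain ⟨L₁, c, hL₁, c1, c2, c3, c4, c5, c6, c7⟩ := exists_coef hf hf'
  obtain ⟨L₂, e, hL₂, e1, e2, e3, e4, e5, e6, e7⟩ := exists_coef hg hg'
  set L := |mean f₀| + |mean g₀| + L₁ + L₂ with hL
  have hb : BddCurve d.zeta L (mean f₀) (mean g₀) c e :=
    { sym_c := c2, sym_d := e2, zero_c := c3, zero_d := e3
      top_ne := fun t => ENNReal.add_ne_top.2 ⟨c4 t, e4 t⟩
      meas_c := c1, meas_d := e1
      abs_le_c := fun t x => (abs_add_le _ _).trans (by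
        linarith [c5 t x, abs_nonneg (mean g₀)])
      abs_le_d := fun t x => (abs_add_le _ _).trans (by
        linarith [e5 t x, abs_nonneg (mean f₀)])
      lint_ne := by
        have : ∫⁻ t in Ioi (0 : ℝ), pairNorm (d.zeta + 1) (c t) (e t) =
            (∫⁻ t in Ioi (0 : ℝ), wn (d.zeta + 1) (c t)) +
            ∫⁻ t in Ioi (0 : ℝ), wn (d.zeta + 1) (e t) :=
          lintegral_add_left (measurable_wn c1 _) _
        rw [this]
        exact ENNReal.add_ne_top.2 ⟨c6, e6⟩ }
  have hz := d.zeta_eq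
  have hL0 : 0 ≤ L := by positivity
  obtain ⟨C₁, h₁⟩ := exists_fluxBound_F hρ (L := L + 1) (by positivity)
  obtain ⟨C₂, h₂⟩ := exists_fluxBound_G hρ hμ (L := L + 1) (by positivity)
  obtain ⟨m1, m2, -, -, Df, Dg, -, -, hD, hJ1, hJ2, w1, w2⟩ := h
  have hDf : ∀ᵐ t ∂(volume.restrict (Ioc 0 T)), Df t =ᵐ[volume] rser (Dcoef d.zeta (c t)) := by
    filter_upwards [hD, c7] with t a1 a2
    exact a1.1.ae_eq (c3 t) (hb.wn_c_ne (by omega) t) a2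
  have hDg : ∀ᵐ t ∂(volume.restrict (Ioc 0 T)), Dg t =ᵐ[volume] rser (Dcoef d.zeta (e t)) := by
    filter_upwards [hD, e7] with t a1 a2
    exact a1.2.ae_eq (e3 t) (hb.wn_d_ne (by omega) t) a2
  exact ⟨L, c, e, hb, c7, e7,
    hb.ae_eq_of_weak hT hz h₁ (contDiff_fluxF ρ) c2 (hb.wn_c_ne (by omega)) (hb.integrable_c T) hf₀
      m1 c7 c7 e7 hDf hDg hJ1 w1,
    hb.ae_eq_of_weak hT hz h₂ (contDiff_fluxG ρ μ) e2 (hb.wn_d_ne (by omega))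
      (hb.swap.integrable_c T) hg₀ m2 e7 c7 e7 hDf hDg hJ2 w2⟩

/-! ### Monotonicity of the flux up to lower order terms -/

/-- The mobilities form a positive definite matrix as long as the heights are positive. -/
theorem mobility_ge {μ δ f g : ℝ} (hμ : 0 < μ) (hδ : 0 < δ) (hf : δ ≤ f) (hg : δ ≤ g) (ξ η : ℝ) :
    min (1 / 2) (2 * μ) * δ ^ 3 * (ξ ^ 2 + η ^ 2) ≤
      2 * f ^ 3 * ξ ^ 2 + 2 * (3 * f ^ 2 * g) * (ξ * η) + (2 * μ * g ^ 3 + 6 * f * g ^ 2) * η ^ 2 := by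
  have hf0 := hδ.trans_le hf
  have hf3 : δ ^ 3 ≤ f ^ 3 := pow_le_pow_left₀ hδ.le hf 3
  have hg3 : δ ^ 3 ≤ g ^ 3 := pow_le_pow_left₀ hδ.le hg 3
  have hδ3 : 0 < δ ^ 3 := pow_pos hδ 3
  have h1 : min (1 / 2) (2 * μ) * δ ^ 3 ≤ 1 / 2 * f ^ 3 :=
    mul_le_mul (min_le_left _ _) hf3 hδ3.le (by norm_num)
  have h2 : min (1 / 2) (2 * μ) * δ ^ 3 ≤ 2 * μ * g ^ 3 :=
    mul_le_mul (min_le_right _ _) hg3 hδ3.le (by positivity)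
  have h3 := mul_le_mul_of_nonneg_right h1 (sq_nonneg ξ)
  have h4 := mul_le_mul_of_nonneg_right h2 (sq_nonneg η)
  have h5 : 0 ≤ 6 * f * (g * η + f * ξ / 2) ^ 2 := by positivity
  nlinarith

theorem neg_mul_mul_le {a A : ℝ} (h : |a| ≤ A) (x y : ℝ) : -(a * x * y) ≤ A * (|x| * |y|) := by
  refine (neg_le_abs _).trans ?_
  rw [abs_mul, abs_mul, mul_assoc]
  exact mul_le_mul_of_nonneg_right h (by positivity)

theorem neg_mul_add_mul_le {r₁ r₂ R : ℝ} (h₁ : |r₁| ≤ R) (h₂ : |r₂| ≤ R) (p q : ℝ) :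
    -(r₁ * p + r₂ * q) ≤ R * (|p| + |q|) := by
  have a1 := neg_mul_mul_le h₁ p 1
  have a2 := neg_mul_mul_le h₂ q 1
  simp only [abs_one, mul_one] at a1 a2
  linarith

theorem sq_abs_add_abs_le (x y : ℝ) : (|x| + |y|) ^ 2 ≤ 2 * (x ^ 2 + y ^ 2) := by
  rw [← sq_abs x, ← sq_abs y]
  nlinarith [sq_nonneg (|x| - |y|)]

/-- The pointwise estimate for `𝒟 = ∂ₓ`: `p`, `q` are the first derivatives of the combinations of the
differences `X`, `Y`, the quadratic form with coefficients `a`, `b`, `e` is the mobility matrix, and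
`r₁`, `r₂` are the parts of the fluxes in which only the heights differ. -/
theorem gravity_dissipation_le {m C k κ A a b e p q r₁ r₂ X Y : ℝ} (hm : 0 < m)
    (hform : m * (p ^ 2 + q ^ 2) ≤ a * p ^ 2 + 2 * b * (p * q) + e * q ^ 2)
    (h₁ : |r₁| ≤ C * ((|X| + |Y|) * k)) (h₂ : |r₂| ≤ C * ((|X| + |Y|) * k)) (hk : k ^ 2 ≤ A * κ) :
    -((a * p + b * q + r₁) * p + (b * p + e * q + r₂) * q) ≤
      C ^ 2 * A / m * κ * (X ^ 2 + Y ^ 2) := by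
  have e1 := neg_mul_add_mul_le h₁ h₂ p q
  have s0 := sq_abs_add_abs_le X Y
  have s1 := sq_abs_add_abs_le p q
  set S := |X| + |Y|
  set R := |p| + |q|
  have y : C * (S * k) * R ≤ m / 2 * R ^ 2 + C ^ 2 * k ^ 2 * S ^ 2 / (2 * m) := by
    rw [← sub_nonneg, show m / 2 * R ^ 2 + C ^ 2 * k ^ 2 * S ^ 2 / (2 * m) - C * (S * k) * R =
      (m * R - C * k * S) ^ 2 / (2 * m) by field_simp; ring]
    positivity
  have y2 : C ^ 2 * k ^ 2 * S ^ 2 / (2 * m) ≤ C ^ 2 * A / m * κ * (X ^ 2 + Y ^ 2) := by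
    calc _ = C ^ 2 / (2 * m) * (k ^ 2 * S ^ 2) := by ring
      _ ≤ C ^ 2 / (2 * m) * (A * κ * (2 * (X ^ 2 + Y ^ 2))) := by
          refine mul_le_mul_of_nonneg_left ?_ (by positivity)
          exact mul_le_mul hk s0 (sq_nonneg _) ((sq_nonneg k).trans hk)
      _ = _ := by field_simp
  nlinarith

/-- The pointwise estimate for `𝒟 = -∂ₓ³`, after one integration by parts: `pⱼ`, `qⱼ` are the
derivatives of order `j` of the combinations of the differences `X`, `Y`, and `a'`, `b'`, `e'` are the
derivatives of the mobilities. The first order terms are absorbed through the term with the factor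
`s`, whose integral vanishes. -/
theorem capillary_dissipation_le {m C C₁ k₁ k₃ s B N a b e a' b' e' p₀ q₀ p₁ q₁ p₂ q₂ r₁ r₂ X Y : ℝ}
    (hm : 0 < m) (hs : 0 < s)
    (hform : m * (p₂ ^ 2 + q₂ ^ 2) ≤ a * p₂ ^ 2 + 2 * b * (p₂ * q₂) + e * q₂ ^ 2)
    (ha : |a'| ≤ C₁ * k₁) (hb : |b'| ≤ C₁ * k₁) (he : |e'| ≤ C₁ * k₁)
    (h₁ : |r₁| ≤ C * ((|X| + |Y|) * k₃)) (h₂ : |r₂| ≤ C * ((|X| + |Y|) * k₃))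
    (hk₁ : k₁ ^ 2 ≤ B * s) (hk₃ : k₃ ^ 2 ≤ B * s ^ 3) (hN : p₀ ^ 2 + q₀ ^ 2 ≤ N * (X ^ 2 + Y ^ 2)) :
    -((a' * p₁ + a * p₂ + (b' * q₁ + b * q₂)) * p₂ + (b' * p₁ + b * p₂ + (e' * q₁ + e * q₂)) * q₂ +
      (r₁ * p₁ + r₂ * q₁) + s * ((2 * C₁ ^ 2 / m + C ^ 2) * B) *
        ((p₀ * p₂ + p₁ * p₁) + (q₀ * q₂ + q₁ * q₁))) ≤
      (((2 * C₁ ^ 2 / m + C ^ 2) * B) ^ 2 * N / (2 * m) + 1) * s ^ 2 * (X ^ 2 + Y ^ 2) := by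
  set M := (2 * C₁ ^ 2 / m + C ^ 2) * B with hM
  have e1 := neg_mul_add_mul_le h₁ h₂ p₁ q₁
  have s0 := sq_abs_add_abs_le X Y
  have s1 := sq_abs_add_abs_le p₁ q₁
  have s2 := sq_abs_add_abs_le p₂ q₂
  have d1 := neg_mul_mul_le ha p₁ p₂
  have d2 := neg_mul_mul_le hb q₁ p₂
  have d3 := neg_mul_mul_le hb p₁ q₂
  have d4 := neg_mul_mul_le he q₁ q₂
  have d : -(a' * p₁ * p₂) + -(b' * q₁ * p₂) + -(b' * p₁ * q₂) + -(e' * q₁ * q₂) ≤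
      C₁ * k₁ * ((|p₁| + |q₁|) * (|p₂| + |q₂|)) := by linarith
  set S := |X| + |Y|
  set R := |p₁| + |q₁|
  set Q := |p₂| + |q₂|
  have n1 : 0 ≤ p₁ ^ 2 + q₁ ^ 2 := by positivity
  have n0 : 0 ≤ X ^ 2 + Y ^ 2 := by positivity
  -- the terms in which a derivative falls on a mobility
  have y1 : C₁ * k₁ * (R * Q) ≤ m / 2 * (p₂ ^ 2 + q₂ ^ 2) +
      2 * C₁ ^ 2 / m * B * s * (p₁ ^ 2 + q₁ ^ 2) := by
    have z1 : C₁ * k₁ * (R * Q) ≤ m / 4 * Q ^ 2 + C₁ ^ 2 / m * (k₁ ^ 2 * R ^ 2) := by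
      rw [← sub_nonneg, show m / 4 * Q ^ 2 + C₁ ^ 2 / m * (k₁ ^ 2 * R ^ 2) - C₁ * k₁ * (R * Q) =
        (m * Q / 2 - C₁ * k₁ * R) ^ 2 / m by field_simp; ring]
      positivity
    have z2 : C₁ ^ 2 / m * (k₁ ^ 2 * R ^ 2) ≤ C₁ ^ 2 / m * (B * s * (2 * (p₁ ^ 2 + q₁ ^ 2))) :=
      mul_le_mul_of_nonneg_left (mul_le_mul hk₁ s1 (sq_nonneg _) ((sq_nonneg _).trans hk₁))
        (by positivity)
    have z3 : m / 4 * Q ^ 2 ≤ m / 4 * (2 * (p₂ ^ 2 + q₂ ^ 2)) :=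
      mul_le_mul_of_nonneg_left s2 (by positivity)
    calc _ ≤ _ := z1.trans (add_le_add z3 z2)
      _ = _ := by ring
  -- the terms in which only the heights differ
  have y2 : C * (S * k₃) * R ≤ s ^ 2 * (X ^ 2 + Y ^ 2) + C ^ 2 * B * s * (p₁ ^ 2 + q₁ ^ 2) := by
    have z1 : C * (S * k₃) * R ≤ s ^ 2 / 2 * S ^ 2 + C ^ 2 / (2 * s ^ 2) * (k₃ ^ 2 * R ^ 2) := by
      rw [← sub_nonneg, show s ^ 2 / 2 * S ^ 2 + C ^ 2 / (2 * s ^ 2) * (k₃ ^ 2 * R ^ 2) -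
        C * (S * k₃) * R = (s ^ 2 * S - C * k₃ * R) ^ 2 / (2 * s ^ 2) by field_simp; ring]
      positivity
    have z2 : C ^ 2 / (2 * s ^ 2) * (k₃ ^ 2 * R ^ 2) ≤
        C ^ 2 / (2 * s ^ 2) * (B * s ^ 3 * (2 * (p₁ ^ 2 + q₁ ^ 2))) :=
      mul_le_mul_of_nonneg_left (mul_le_mul hk₃ s1 (sq_nonneg _) ((sq_nonneg _).trans hk₃))
        (by positivity)
    have z3 : s ^ 2 / 2 * S ^ 2 ≤ s ^ 2 / 2 * (2 * (X ^ 2 + Y ^ 2)) :=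
      mul_le_mul_of_nonneg_left s0 (by positivity)
    calc _ ≤ _ := z1.trans (add_le_add z3 z2)
      _ = _ := by field_simp
  -- the second order terms of the null term are absorbed in the dissipation
  have y3 : ∀ u v : ℝ, -(s * M * (u * v)) ≤ m / 2 * v ^ 2 + s ^ 2 * M ^ 2 / (2 * m) * u ^ 2 := by
    intro u v
    rw [← sub_nonneg, show m / 2 * v ^ 2 + s ^ 2 * M ^ 2 / (2 * m) * u ^ 2 - -(s * M * (u * v)) =
      (m * v + s * M * u) ^ 2 / (2 * m) by field_simp; ring]
    positivity
  have y4 : s ^ 2 * M ^ 2 / (2 * m) * (p₀ ^ 2 + q₀ ^ 2) ≤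
      s ^ 2 * M ^ 2 / (2 * m) * (N * (X ^ 2 + Y ^ 2)) :=
    mul_le_mul_of_nonneg_left hN (by positivity)
  have y5 : M * s * (p₁ ^ 2 + q₁ ^ 2) = 2 * C₁ ^ 2 / m * B * s * (p₁ ^ 2 + q₁ ^ 2) +
      C ^ 2 * B * s * (p₁ ^ 2 + q₁ ^ 2) := by rw [hM]; ring
  have y6 : (M ^ 2 * N / (2 * m) + 1) * s ^ 2 * (X ^ 2 + Y ^ 2) =
      s ^ 2 * M ^ 2 / (2 * m) * (N * (X ^ 2 + Y ^ 2)) + s ^ 2 * (X ^ 2 + Y ^ 2) := by ring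
  have y7 := y3 p₀ p₂
  have y8 := y3 q₀ q₂
  rw [y6]
  linarith

/-- Interpolation of the orders one and three between the orders zero and four. -/
theorem supNorm_pow_four_le {c d : ℤ → ℂ} (hc : c 0 = 0) (hd : d 0 = 0) (h : pairNorm 4 c d ≠ ⊤) :
    supNorm 1 c d ^ 4 ≤ 2 ^ 18 * supNorm 0 c d ^ 3 * supNorm 4 c d ∧
      supNorm 3 c d ^ 4 ≤ 2 ^ 18 * supNorm 0 c d * supNorm 4 c d ^ 3 := by
  have n : ∀ s ≤ 4, pairNorm s c d ≠ ⊤ := fun s hs => ne_top_of_le_ne_top h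
    (pairNorm_mono hs hc hd)
  have l1 := supNorm_sq_le (j := 0) hc hd (n 2 (by norm_num))
  have l2 := supNorm_sq_le (j := 1) hc hd (n 3 (by norm_num))
  have l3 := supNorm_sq_le (j := 2) hc hd (n 4 (by norm_num))
  have l4 := supNorm_one_mul_le (.inr rfl) hc hd h
  simp only [zero_add, Nat.reduceAdd] at l1 l2 l3 l4
  have m0 : 0 ≤ supNorm 0 c d := supNorm_nonneg
  have m2 : 0 ≤ supNorm 2 c d := supNorm_nonneg
  have m4 : 0 ≤ supNorm 4 c d := supNorm_nonneg
  have l5 : supNorm 2 c d ^ 2 ≤ 4096 * (supNorm 0 c d * supNorm 4 c d) := by linarith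
  constructor
  · calc supNorm 1 c d ^ 4 = (supNorm 1 c d ^ 2) ^ 2 := by ring
      _ ≤ (8 * supNorm 0 c d * supNorm 2 c d) ^ 2 := pow_le_pow_left₀ (sq_nonneg _) l1 2
      _ = 64 * supNorm 0 c d ^ 2 * supNorm 2 c d ^ 2 := by ring
      _ ≤ 64 * supNorm 0 c d ^ 2 * (4096 * (supNorm 0 c d * supNorm 4 c d)) := by gcongr
      _ = _ := by ring
  · calc supNorm 3 c d ^ 4 = (supNorm 3 c d ^ 2) ^ 2 := by ring
      _ ≤ (8 * supNorm 2 c d * supNorm 4 c d) ^ 2 := pow_le_pow_left₀ (sq_nonneg _) l3 2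
      _ = 64 * supNorm 4 c d ^ 2 * supNorm 2 c d ^ 2 := by ring
      _ ≤ 64 * supNorm 4 c d ^ 2 * (4096 * (supNorm 0 c d * supNorm 4 c d)) := by gcongr
      _ = _ := by ring

/-- The difference of the fluxes as mobility matrix applied to the combinations `ρ p + q` and `p + q`
plus a term in which only the heights differ. -/
theorem fluxF_sub (ρ f g p q f' g' p' q' : ℝ) :
    fluxF ρ f' g' p' q' - fluxF ρ f g p q =
      2 * f ^ 3 * (ρ * (p' - p) + (q' - q)) + 3 * f ^ 2 * g * (1 * (p' - p) + (q' - q)) +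
        (fluxF ρ f' g' p' q' - fluxF ρ f g p' q') := by
  unfold fluxF; ring

/-- The analogue of `fluxF_sub` for the other layer; the mobility matrix is symmetric. -/
theorem fluxG_sub (ρ μ f g p q f' g' p' q' : ℝ) :
    fluxG ρ μ f' g' p' q' - fluxG ρ μ f g p q =
      3 * f ^ 2 * g * (ρ * (p' - p) + (q' - q)) +
        (2 * μ * g ^ 3 + 6 * f * g ^ 2) * (1 * (p' - p) + (q' - q)) +
        (fluxG ρ μ f' g' p' q' - fluxG ρ μ f g p' q') := by
  unfold fluxG; ring

theorem FluxBound.abs_sub_le_of_heights {Φ : ℝ → ℝ → ℝ → ℝ → ℝ} {L C : ℝ} (h : FluxBound Φ L C)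
    {f g f' g' p q k : ℝ} (hf : |f| ≤ L) (hg : |g| ≤ L) (hf' : |f'| ≤ L) (hg' : |g'| ≤ L)
    (hk : |p| + |q| ≤ k) : |Φ f' g' p q - Φ f g p q| ≤ C * ((|f' - f| + |g' - g|) * k) := by
  have := h.lip f' g' p q f g p q hf' hg' hf hg
  rw [sub_self, sub_self, abs_zero, add_zero, mul_zero, zero_add] at this
  exact this.trans (mul_le_mul_of_nonneg_left (mul_le_mul_of_nonneg_left hk (by positivity))
    h.nonneg)

/-- The derivative of order `j` of the combination `a X + Y` of the differences `X`, `Y` of two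
pairs of Fourier series. -/
noncomputable def diffComb (a : ℝ) (c d c' d' : ℤ → ℂ) (j : ℕ) (x : Torus) : ℝ :=
  a * (rser (dcoef j c') x - rser (dcoef j c) x) + (rser (dcoef j d') x - rser (dcoef j d) x)

section diffComb

variable {n j : ℕ} {c d c' d' : ℤ → ℂ}

theorem hasDerivAt_rser_dcoef (hc : c 0 = 0) (h : wn n c ≠ ⊤) (hj : j + 1 ≤ n) (y : ℝ) :
    HasDerivAt (fun y : ℝ => rser (dcoef j c) (y : Torus)) (rser (dcoef (j + 1) c) (y : Torus)) y := by
  have := hasDerivAt_rser (c := dcoef j c) (by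
    rw [wn_dcoef, zero_add]; exact wn_ne_top_mono (by omega) hc h) (by
    rw [wn_dcoef, add_comm]; exact wn_ne_top_mono hj hc h) y
  rwa [dcoef_dcoef, add_comm] at this

theorem continuous_rser_dcoef (hc : c 0 = 0) (h : wn n c ≠ ⊤) (hj : j ≤ n) :
    Continuous (rser (dcoef j c)) :=
  continuous_rser (by rw [wn_dcoef, zero_add]; exact wn_ne_top_mono hj hc h)

theorem hasDerivAt_diffComb (a : ℝ) (hc : c 0 = 0) (hd : d 0 = 0) (hc' : c' 0 = 0) (hd' : d' 0 = 0)
    (h : pairNorm n c d ≠ ⊤) (h' : pairNorm n c' d' ≠ ⊤) (hj : j + 1 ≤ n) (y : ℝ) :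
    HasDerivAt (fun y : ℝ => diffComb a c d c' d' j (y : Torus))
      (diffComb a c d c' d' (j + 1) (y : Torus)) y := by
  obtain ⟨h1, h2⟩ := ENNReal.add_ne_top.1 h
  obtain ⟨h3, h4⟩ := ENNReal.add_ne_top.1 h'
  exact (((hasDerivAt_rser_dcoef hc' h3 hj y).sub (hasDerivAt_rser_dcoef hc h1 hj y)).const_mul
    a).add ((hasDerivAt_rser_dcoef hd' h4 hj y).sub (hasDerivAt_rser_dcoef hd h2 hj y))

theorem continuous_diffComb (a : ℝ) (hc : c 0 = 0) (hd : d 0 = 0) (hc' : c' 0 = 0) (hd' : d' 0 = 0)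
    (h : pairNorm n c d ≠ ⊤) (h' : pairNorm n c' d' ≠ ⊤) (hj : j ≤ n) :
    Continuous (diffComb a c d c' d' j) := by
  obtain ⟨h1, h2⟩ := ENNReal.add_ne_top.1 h
  obtain ⟨h3, h4⟩ := ENNReal.add_ne_top.1 h'
  exact (((continuous_rser_dcoef hc' h3 hj).sub (continuous_rser_dcoef hc h1 hj)).const_mul
    a).add ((continuous_rser_dcoef hd' h4 hj).sub (continuous_rser_dcoef hd h2 hj))

theorem sq_diffComb_zero_le (ρ : ℝ) (x : Torus) :
    diffComb ρ c d c' d' 0 x ^ 2 + diffComb 1 c d c' d' 0 x ^ 2 ≤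
      (2 * ρ ^ 2 + 4) * ((rser c' x - rser c x) ^ 2 + (rser d' x - rser d x) ^ 2) := by
  simp only [diffComb, dcoef_zero]
  set X := rser c' x - rser c x
  set Y := rser d' x - rser d x
  nlinarith [sq_nonneg (ρ * X - Y), sq_nonneg (X - Y), mul_nonneg (sq_nonneg ρ) (sq_nonneg Y)]

end diffComb

/-- The production of the energy `½ ∫ (ρ X² + 2 X Y + Y²)` of the difference of two pairs of heights
that evolve by the fluxes `fluxF` and `fluxG`. -/
noncomputable def energyProd (ρ μ : ℝ) (z : ℕ) (F G : ℝ) (c d c' d' : ℤ → ℂ) (x : Torus) : ℝ :=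
  diffComb ρ c d c' d' 0 x * (fluxDiv (fluxF ρ) z F G c' d' x - fluxDiv (fluxF ρ) z F G c d x) +
    diffComb 1 c d c' d' 0 x *
      (fluxDiv (fluxG ρ μ) z F G c' d' x - fluxDiv (fluxG ρ μ) z F G c d x)

section energyProd

variable {ρ μ δ L F G : ℝ} {z : ℕ} {c d c' d' : ℤ → ℂ}

/-- Integration by parts in the energy production: the fluxes are paired with the derivatives of the
combinations `ρ X + Y` and `X + Y`. -/
theorem integral_energyProd (hz : z = 1 ∨ z = 3) (hc : c 0 = 0) (hd : d 0 = 0) (hc' : c' 0 = 0)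
    (hd' : d' 0 = 0) (h : pairNorm (z + 1) c d ≠ ⊤) (h' : pairNorm (z + 1) c' d' ≠ ⊤) :
    (Continuous fun x => (phys (fluxF ρ) z F G c' d' x - phys (fluxF ρ) z F G c d x) *
        diffComb ρ c d c' d' 1 x + (phys (fluxG ρ μ) z F G c' d' x - phys (fluxG ρ μ) z F G c d x) *
          diffComb 1 c d c' d' 1 x) ∧ ∫ x, energyProd ρ μ z F G c d c' d' x =
      -∫ x, ((phys (fluxF ρ) z F G c' d' x - phys (fluxF ρ) z F G c d x) * diffComb ρ c d c' d' 1 x +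
        (phys (fluxG ρ μ) z F G c' d' x - phys (fluxG ρ μ) z F G c d x) *
          diffComb 1 c d c' d' 1 x) := by
  have hz1 : 1 ≤ z := by omega
  have key : ∀ (a : ℝ) (Φ : ℝ → ℝ → ℝ → ℝ → ℝ),
      (ContDiff ℝ 1 fun y : ℝ × ℝ × ℝ × ℝ => Φ y.1 y.2.1 y.2.2.1 y.2.2.2) →
      Continuous (fun x => diffComb a c d c' d' 0 x *
        (fluxDiv Φ z F G c' d' x - fluxDiv Φ z F G c d x)) ∧
      Continuous (fun x => (phys Φ z F G c' d' x - phys Φ z F G c d x) * diffComb a c d c' d' 1 x) ∧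
      ∫ x, diffComb a c d c' d' 0 x * (fluxDiv Φ z F G c' d' x - fluxDiv Φ z F G c d x) =
        -∫ x, (phys Φ z F G c' d' x - phys Φ z F G c d x) * diffComb a c d c' d' 1 x := by
    intro a Φ hΦ
    have k0 := continuous_diffComb a hc hd hc' hd' h h' (show 0 ≤ z + 1 by omega)
    have k1 := continuous_diffComb a hc hd hc' hd' h h' (show 1 ≤ z + 1 by omega)
    have k2 := (continuous_fluxDiv (F := F) (G := G) hΦ hc' hd' h').sub
      (continuous_fluxDiv (F := F) (G := G) hΦ hc hd h)
    have kp : ∀ {a b : ℤ → ℂ}, a 0 = 0 → b 0 = 0 → pairNorm (z + 1) a b ≠ ⊤ →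
        Continuous (phys Φ z F G a b) := fun {a b} ha hb hab => by
      obtain ⟨w1, w2⟩ := ENNReal.add_ne_top.1 hab
      exact continuous_phys hΦ.continuous F G (wn_ne_top_mono (by omega) ha w1)
        (wn_ne_top_mono (by omega) hb w2) (wn_ne_top_mono (by omega) ha w1)
        (wn_ne_top_mono (by omega) hb w2)
    refine ⟨k0.mul k2, ((kp hc' hd' h').sub (kp hc hd h)).mul k1, ?_⟩
    have e := integral_mul_deriv_torus (u := diffComb a c d c' d' 0) (u' := diffComb a c d c' d' 1)
      (v := fun x => phys Φ z F G c' d' x - phys Φ z F G c d x)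
      (v' := fun x => fluxDiv Φ z F G c' d' x - fluxDiv Φ z F G c d x)
      (hasDerivAt_diffComb a hc hd hc' hd' h h' (by omega))
      (fun y => (hasDerivAt_phys hΦ hc' hd' h' y).sub (hasDerivAt_phys hΦ hc hd h y)) k1 k2
    rw [e]
    simp only [mul_comm]
  obtain ⟨a1, a2, a3⟩ := key ρ (fluxF ρ) (contDiff_fluxF ρ)
  obtain ⟨b1, b2, b3⟩ := key 1 (fluxG ρ μ) (contDiff_fluxG ρ μ)
  have e1 : ∫ x, energyProd ρ μ z F G c d c' d' x = _ :=
    integral_add (Continuous.integrable_torus a1) (Continuous.integrable_torus b1)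
  refine ⟨a2.add b2, ?_⟩
  rw [e1, a3, b3, integral_add (Continuous.integrable_torus a2) (Continuous.integrable_torus b2)]
  ring

/-- The bound for the energy production for `𝒟 = ∂ₓ`. -/
theorem integral_energyProd_gravity_le {m C : ℝ} (hm : 0 < m)
    (hform : ∀ f g ξ η, δ ≤ f → δ ≤ g → m * (ξ ^ 2 + η ^ 2) ≤ 2 * f ^ 3 * ξ ^ 2 +
      2 * (3 * f ^ 2 * g) * (ξ * η) + (2 * μ * g ^ 3 + 6 * f * g ^ 2) * η ^ 2)
    (hΦ : FluxBound (fluxF ρ) L C) (hΨ : FluxBound (fluxG ρ μ) L C)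
    (hc : c 0 = 0) (hd : d 0 = 0) (hc' : c' 0 = 0) (hd' : d' 0 = 0)
    (h : pairNorm 2 c d ≠ ⊤) (h' : pairNorm 2 c' d' ≠ ⊤)
    (hcδ : ∀ x, δ ≤ F + rser c x) (hdδ : ∀ x, δ ≤ G + rser d x)
    (hcL : ∀ x, |F + rser c x| ≤ L) (hdL : ∀ x, |G + rser d x| ≤ L)
    (hcL' : ∀ x, |F + rser c' x| ≤ L) (hdL' : ∀ x, |G + rser d' x| ≤ L) :
    ∫ x, energyProd ρ μ 1 F G c d c' d' x ≤ C ^ 2 * (32 * (L + |F| + |G|)) / m *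
      (1 + supNorm 2 c d + supNorm 2 c' d') *
      ∫ x, ((rser c' x - rser c x) ^ 2 + (rser d' x - rser d x) ^ 2) := by
  have n0 : ∀ {a b : ℤ → ℂ}, a 0 = 0 → b 0 = 0 → pairNorm 2 a b ≠ ⊤ →
      Continuous (rser a) ∧ Continuous (rser b) := fun {a b} ha hb hab => by
    obtain ⟨w1, w2⟩ := ENNReal.add_ne_top.1 hab
    exact ⟨continuous_rser (wn_ne_top_mono (by omega) ha w1),
      continuous_rser (wn_ne_top_mono (by omega) hb w2)⟩
  have kX : Continuous fun x => (rser c' x - rser c x) ^ 2 + (rser d' x - rser d x) ^ 2 :=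
    (((n0 hc' hd' h').1.sub (n0 hc hd h).1).pow 2).add
      (((n0 hc' hd' h').2.sub (n0 hc hd h).2).pow 2)
  have h1' : pairNorm 1 c' d' ≠ ⊤ := ne_top_of_le_ne_top h' (pairNorm_mono (by omega) hc' hd')
  obtain ⟨kE, hE⟩ := integral_energyProd (ρ := ρ) (μ := μ) (F := F) (G := G) (.inl rfl) hc hd hc'
    hd' h h'
  rw [hE, ← integral_const_mul, ← integral_neg]
  have m2 : 0 ≤ supNorm 2 c d := supNorm_nonneg
  have m2' : 0 ≤ supNorm 2 c' d' := supNorm_nonneg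
  have hk : (2 * supNorm 1 c' d') ^ 2 ≤
      32 * (L + |F| + |G|) * (1 + supNorm 2 c d + supNorm 2 c' d') := by
    have l := supNorm_sq_le (j := 0) hc' hd' h'
    simp only [zero_add] at l
    have l0 := supNorm_zero_le hcL' hdL'
    have l1 : 0 ≤ L + |F| + |G| := (supNorm_nonneg (j := 0)).trans l0
    have l2 : supNorm 0 c' d' * supNorm 2 c' d' ≤ (L + |F| + |G|) *
        (1 + supNorm 2 c d + supNorm 2 c' d') :=
      mul_le_mul l0 (by linarith) m2' l1
    linarith
  refine integral_mono (Continuous.integrable_torus kE.neg)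
    (Continuous.integrable_torus (kX.const_mul _)) fun x => ?_
  have hk' : |rser (dcoef 1 c') x| + |rser (dcoef 1 d') x| ≤ 2 * supNorm 1 c' d' := by
    linarith [le_supNorm_left h1' x, le_supNorm_right h1' x]
  have r₁ := hΦ.abs_sub_le_of_heights (hcL x) (hdL x) (hcL' x) (hdL' x) hk'
  have r₂ := hΨ.abs_sub_le_of_heights (hcL x) (hdL x) (hcL' x) (hdL' x) hk'
  rw [add_sub_add_left_eq_sub, add_sub_add_left_eq_sub] at r₁ r₂
  have := gravity_dissipation_le hm (hform _ _ (diffComb ρ c d c' d' 1 x) (diffComb 1 c d c' d' 1 x)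
    (hcδ x) (hdδ x)) r₁ r₂ hk
  simp only [phys, rser_Dcoef_one]
  rw [fluxF_sub ρ (F + rser c x), fluxG_sub ρ μ (F + rser c x)]
  exact this

/-- The norms of orders one and three in terms of `s = (1 + ‖·‖₄ + ‖·‖₄)^{1/2}`; the weight `s` balances
the terms of `capillary_dissipation_le`. -/
theorem exists_root_bound {c d c' d' : ℤ → ℂ} {S : ℝ} (hc : c 0 = 0) (hd : d 0 = 0) (hc' : c' 0 = 0)
    (hd' : d' 0 = 0) (h : pairNorm 4 c d ≠ ⊤) (h' : pairNorm 4 c' d' ≠ ⊤)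
    (h0 : supNorm 0 c d ≤ S) (h0' : supNorm 0 c' d' ≤ S) :
    ∃ s > 0, s ^ 2 = 1 + supNorm 4 c d + supNorm 4 c' d' ∧
      supNorm 1 c d ^ 2 ≤ 4096 * (1 + S) ^ 2 * s ∧
      (2 * supNorm 3 c' d') ^ 2 ≤ 4096 * (1 + S) ^ 2 * s ^ 3 := by
  have m4 : 0 ≤ supNorm 4 c d := supNorm_nonneg
  have m4' : 0 ≤ supNorm 4 c' d' := supNorm_nonneg
  have m0 : 0 ≤ supNorm 0 c d := supNorm_nonneg
  have m0' : 0 ≤ supNorm 0 c' d' := supNorm_nonneg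
  have hS : 0 ≤ S := m0.trans h0
  have hκ : 0 < 1 + supNorm 4 c d + supNorm 4 c' d' := by positivity
  have hs := Real.sqrt_pos.2 hκ
  have hs2 := Real.sq_sqrt hκ.le
  set s := √(1 + supNorm 4 c d + supNorm 4 c' d')
  have p1 : S ^ 3 ≤ (1 + S) ^ 4 := by
    calc S ^ 3 ≤ (1 + S) ^ 3 := pow_le_pow_left₀ hS (by linarith) 3
      _ ≤ (1 + S) ^ 4 := pow_le_pow_right₀ (by linarith) (by norm_num)
  have p2 : S ≤ (1 + S) ^ 4 := by
    calc S ≤ 1 + S := by linarith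
      _ ≤ (1 + S) ^ 4 := le_self_pow₀ (by linarith) (by norm_num)
  refine ⟨s, hs, hs2, ?_, ?_⟩
  · rw [← sq_le_sq₀ (sq_nonneg _) (by positivity)]
    calc (supNorm 1 c d ^ 2) ^ 2 = supNorm 1 c d ^ 4 := by ring
      _ ≤ 2 ^ 18 * supNorm 0 c d ^ 3 * supNorm 4 c d := (supNorm_pow_four_le hc hd h).1
      _ ≤ 2 ^ 24 * (1 + S) ^ 4 * s ^ 2 := by
          rw [hs2]
          refine mul_le_mul (mul_le_mul (by norm_num)
            ((pow_le_pow_left₀ m0 h0 3).trans p1) (by positivity) (by norm_num)) (by linarith) m4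
            (by positivity)
      _ = _ := by ring
  · rw [← sq_le_sq₀ (sq_nonneg _) (by positivity)]
    calc ((2 * supNorm 3 c' d') ^ 2) ^ 2 = 16 * supNorm 3 c' d' ^ 4 := by ring
      _ ≤ 16 * (2 ^ 18 * supNorm 0 c' d' * supNorm 4 c' d' ^ 3) :=
          mul_le_mul_of_nonneg_left (supNorm_pow_four_le hc' hd' h').2 (by norm_num)
      _ = 2 ^ 22 * supNorm 0 c' d' * supNorm 4 c' d' ^ 3 := by ring
      _ ≤ 2 ^ 24 * (1 + S) ^ 4 * (s ^ 2) ^ 3 := by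
          rw [hs2]
          refine mul_le_mul (mul_le_mul (by norm_num) (h0'.trans p2) m0' (by norm_num))
            (pow_le_pow_left₀ m4' (by linarith) 3) (by positivity) (by positivity)
      _ = _ := by ring

theorem abs_mobility_deriv_le {f g f₁ g₁ k : ℝ} (hμ : 0 < μ) (hf : |f| ≤ L) (hg : |g| ≤ L)
    (hf₁ : |f₁| ≤ k) (hg₁ : |g₁| ≤ k) :
    |6 * f ^ 2 * f₁| ≤ (6 * μ + 18) * L ^ 2 * k ∧
      |6 * f * g * f₁ + 3 * f ^ 2 * g₁| ≤ (6 * μ + 18) * L ^ 2 * k ∧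
      |6 * μ * g ^ 2 * g₁ + (6 * g ^ 2 * f₁ + 12 * f * g * g₁)| ≤ (6 * μ + 18) * L ^ 2 * k := by
  have hL : 0 ≤ L := (abs_nonneg _).trans hf
  have hk : 0 ≤ k := (abs_nonneg _).trans hf₁
  have key : ∀ x y w : ℝ, |x| ≤ L → |y| ≤ L → |w| ≤ k → |x * y * w| ≤ L ^ 2 * k := by
    intro x y w hx hy hw
    rw [abs_mul, abs_mul, sq]
    gcongr
  have a1 := abs_le.1 (key f f f₁ hf hf hf₁)
  have a2 := abs_le.1 (key f f g₁ hf hf hg₁)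
  have a3 := abs_le.1 (key f g f₁ hf hg hf₁)
  have a4 := abs_le.1 (key f g g₁ hf hg hg₁)
  have a5 := abs_le.1 (key g g f₁ hg hg hf₁)
  have a6 := abs_le.1 (key g g g₁ hg hg hg₁)
  have b1 : μ * (g * g * g₁) ≤ μ * (L ^ 2 * k) := mul_le_mul_of_nonneg_left a6.2 hμ.le
  have b2 : μ * -(L ^ 2 * k) ≤ μ * (g * g * g₁) := mul_le_mul_of_nonneg_left a6.1 hμ.le
  have b3 : 0 ≤ L ^ 2 * k := by positivity
  have b4 : 0 ≤ μ * (L ^ 2 * k) := by positivity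
  refine ⟨abs_le.2 ⟨?_, ?_⟩, abs_le.2 ⟨?_, ?_⟩, abs_le.2 ⟨?_, ?_⟩⟩ <;> nlinarith

/-- The bound for the energy production for `𝒟 = -∂ₓ³`. -/
theorem integral_energyProd_capillary_le {m C : ℝ} (hm : 0 < m) (hμ : 0 < μ)
    (hform : ∀ f g ξ η, δ ≤ f → δ ≤ g → m * (ξ ^ 2 + η ^ 2) ≤ 2 * f ^ 3 * ξ ^ 2 +
      2 * (3 * f ^ 2 * g) * (ξ * η) + (2 * μ * g ^ 3 + 6 * f * g ^ 2) * η ^ 2)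
    (hΦ : FluxBound (fluxF ρ) L C) (hΨ : FluxBound (fluxG ρ μ) L C)
    (hc : c 0 = 0) (hd : d 0 = 0) (hc' : c' 0 = 0) (hd' : d' 0 = 0)
    (h : pairNorm 4 c d ≠ ⊤) (h' : pairNorm 4 c' d' ≠ ⊤)
    (hcδ : ∀ x, δ ≤ F + rser c x) (hdδ : ∀ x, δ ≤ G + rser d x)
    (hcL : ∀ x, |F + rser c x| ≤ L) (hdL : ∀ x, |G + rser d x| ≤ L)
    (hcL' : ∀ x, |F + rser c' x| ≤ L) (hdL' : ∀ x, |G + rser d' x| ≤ L) :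
    ∫ x, energyProd ρ μ 3 F G c d c' d' x ≤
      (((2 * ((6 * μ + 18) * L ^ 2) ^ 2 / m + C ^ 2) * (4096 * (1 + (L + |F| + |G|)) ^ 2)) ^ 2 *
        (2 * ρ ^ 2 + 4) / (2 * m) + 1) * (1 + supNorm 4 c d + supNorm 4 c' d') *
      ∫ x, ((rser c' x - rser c x) ^ 2 + (rser d' x - rser d x) ^ 2) := by
  obtain ⟨w1, w2⟩ := ENNReal.add_ne_top.1 h
  obtain ⟨w1', w2'⟩ := ENNReal.add_ne_top.1 h'
  have kc := continuous_rser (wn_ne_top_mono (Nat.zero_le _) hc w1)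
  have kd := continuous_rser (wn_ne_top_mono (Nat.zero_le _) hd w2)
  have kc' := continuous_rser (wn_ne_top_mono (Nat.zero_le _) hc' w1')
  have kd' := continuous_rser (wn_ne_top_mono (Nat.zero_le _) hd' w2')
  have kX : Continuous fun x => (rser c' x - rser c x) ^ 2 + (rser d' x - rser d x) ^ 2 := by fun_prop
  obtain ⟨s, hs, hs2, hk₁, hk₃⟩ := exists_root_bound hc hd hc' hd' h h' (supNorm_zero_le hcL hdL)
    (supNorm_zero_le hcL' hdL')
  have h1 : pairNorm 1 c d ≠ ⊤ := ne_top_of_le_ne_top h (pairNorm_mono (by omega) hc hd)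
  have h3' : pairNorm 3 c' d' ≠ ⊤ := ne_top_of_le_ne_top h' (pairNorm_mono (by omega) hc' hd')
  have hL : 0 ≤ L := (abs_nonneg _).trans (hcL 0)
  set M := (2 * ((6 * μ + 18) * L ^ 2) ^ 2 / m + C ^ 2) * (4096 * (1 + (L + |F| + |G|)) ^ 2)
  -- the heights, their derivatives, and the combinations of the differences
  have kf1 := continuous_rser_dcoef (j := 1) hc w1 (by norm_num)
  have kg1 := continuous_rser_dcoef (j := 1) hd w2 (by norm_num)
  have df : ∀ y : ℝ, HasDerivAt (fun y : ℝ => F + rser c (y : Torus)) (rser (dcoef 1 c) (y : Torus)) y :=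
    fun y => by
      have := hasDerivAt_rser_dcoef (j := 0) hc w1 (by norm_num) y
      rw [dcoef_zero] at this
      exact this.const_add F
  have dg : ∀ y : ℝ, HasDerivAt (fun y : ℝ => G + rser d (y : Torus)) (rser (dcoef 1 d) (y : Torus)) y :=
    fun y => by
      have := hasDerivAt_rser_dcoef (j := 0) hd w2 (by norm_num) y
      rw [dcoef_zero] at this
      exact this.const_add G
  have kP : ∀ (a : ℝ) (j : ℕ), j ≤ 4 → Continuous (diffComb a c d c' d' j) := fun a j hj =>
    continuous_diffComb a hc hd hc' hd' h h' hj
  have dP : ∀ (a : ℝ) (j : ℕ), j + 1 ≤ 4 → ∀ y : ℝ, HasDerivAt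
      (fun y : ℝ => diffComb a c d c' d' j (y : Torus)) (diffComb a c d c' d' (j + 1) (y : Torus)) y :=
    fun a j hj => hasDerivAt_diffComb a hc hd hc' hd' h h' hj
  have p0 := kP ρ 0 (by norm_num); have p1 := kP ρ 1 (by norm_num)
  have p2 := kP ρ 2 (by norm_num); have p3 := kP ρ 3 (by norm_num)
  have q0 := kP 1 0 (by norm_num); have q1 := kP 1 1 (by norm_num)
  have q2 := kP 1 2 (by norm_num); have q3 := kP 1 3 (by norm_num)
  obtain ⟨kE, hE⟩ := integral_energyProd (ρ := ρ) (μ := μ) (F := F) (G := G) (.inr rfl) hc hd hc'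
    hd' h h'
  set P := diffComb ρ c d c' d' with hP
  set Q := diffComb 1 c d c' d' with hQ
  set a : Torus → ℝ := fun x => 2 * (F + rser c x) ^ 3 with ha
  set b : Torus → ℝ := fun x => 3 * (F + rser c x) ^ 2 * (G + rser d x) with hb
  set e : Torus → ℝ := fun x => 2 * μ * (G + rser d x) ^ 3 +
    6 * (F + rser c x) * (G + rser d x) ^ 2 with he
  set a' : Torus → ℝ := fun x => 6 * (F + rser c x) ^ 2 * rser (dcoef 1 c) x with ha'
  set b' : Torus → ℝ := fun x => 6 * (F + rser c x) * (G + rser d x) * rser (dcoef 1 c) x +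
    3 * (F + rser c x) ^ 2 * rser (dcoef 1 d) x with hb'
  set e' : Torus → ℝ := fun x => 6 * μ * (G + rser d x) ^ 2 * rser (dcoef 1 d) x +
    (6 * (G + rser d x) ^ 2 * rser (dcoef 1 c) x +
      12 * (F + rser c x) * (G + rser d x) * rser (dcoef 1 d) x) with he'
  have ka : Continuous a := by fun_prop
  have kb : Continuous b := by fun_prop
  have ke : Continuous e := by fun_prop
  have ka' : Continuous a' := by fun_prop
  have kb' : Continuous b' := by fun_prop
  have ke' : Continuous e' := by fun_prop
  have da : ∀ y : ℝ, HasDerivAt (fun y : ℝ => a (y : Torus)) (a' (y : Torus)) y := fun y =>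
    (((df y).fun_pow 3).const_mul 2).congr_deriv (by simp only [ha']; push_cast; ring)
  have db : ∀ y : ℝ, HasDerivAt (fun y : ℝ => b (y : Torus)) (b' (y : Torus)) y := fun y =>
    ((((df y).fun_pow 2).const_mul 3).mul (dg y)).congr_deriv (by simp only [hb']; push_cast; ring)
  have de : ∀ y : ℝ, HasDerivAt (fun y : ℝ => e (y : Torus)) (e' (y : Torus)) y := fun y =>
    ((((dg y).fun_pow 3).const_mul (2 * μ)).add
      (((df y).const_mul 6).mul ((dg y).fun_pow 2))).congr_deriv
      (by simp only [he']; push_cast; ring)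
  -- integration by parts
  have i1 := integral_mul_deriv_torus (u := fun x => a x * P 1 x + b x * Q 1 x)
    (u' := fun x => a' x * P 1 x + a x * P 2 x + (b' x * Q 1 x + b x * Q 2 x)) (v := P 2) (v' := P 3)
    (fun y => ((da y).mul (dP ρ 1 (by norm_num) y)).add ((db y).mul (dP 1 1 (by norm_num) y)))
    (dP ρ 2 (by norm_num)) (by fun_prop) p3
  have i2 := integral_mul_deriv_torus (u := fun x => b x * P 1 x + e x * Q 1 x)
    (u' := fun x => b' x * P 1 x + b x * P 2 x + (e' x * Q 1 x + e x * Q 2 x)) (v := Q 2) (v' := Q 3)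
    (fun y => ((db y).mul (dP ρ 1 (by norm_num) y)).add ((de y).mul (dP 1 1 (by norm_num) y)))
    (dP 1 2 (by norm_num)) (by fun_prop) q3
  -- the null term that trades first order terms for dissipation
  have i3 : ∫ x, P 0 x * P 2 x = -∫ x, P 1 x * P 1 x := integral_mul_deriv_torus (dP ρ 0 (by norm_num)) (dP ρ 1 (by norm_num)) p1 p2
  have i4 : ∫ x, Q 0 x * Q 2 x = -∫ x, Q 1 x * Q 1 x := integral_mul_deriv_torus (dP 1 0 (by norm_num)) (dP 1 1 (by norm_num)) q1 q2
  -- the remainders, in which only the heights differ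
  set r₁ : Torus → ℝ := fun x => fluxF ρ (F + rser c' x) (G + rser d' x) (-rser (dcoef 3 c') x)
    (-rser (dcoef 3 d') x) - fluxF ρ (F + rser c x) (G + rser d x) (-rser (dcoef 3 c') x)
    (-rser (dcoef 3 d') x) with hr₁
  set r₂ : Torus → ℝ := fun x => fluxG ρ μ (F + rser c' x) (G + rser d' x) (-rser (dcoef 3 c') x)
    (-rser (dcoef 3 d') x) - fluxG ρ μ (F + rser c x) (G + rser d x) (-rser (dcoef 3 c') x)
    (-rser (dcoef 3 d') x) with hr₂
  obtain ⟨r, hr⟩ : ∃ r : Torus → ℝ, ∀ x, r x = r₁ x * P 1 x + r₂ x * Q 1 x := ⟨_, fun _ => rfl⟩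
  have hEr : ∀ x, (phys (fluxF ρ) 3 F G c' d' x - phys (fluxF ρ) 3 F G c d x) * P 1 x +
      (phys (fluxG ρ μ) 3 F G c' d' x - phys (fluxG ρ μ) 3 F G c d x) * Q 1 x =
      r x - ((a x * P 1 x + b x * Q 1 x) * P 3 x + (b x * P 1 x + e x * Q 1 x) * Q 3 x) := fun x => by
    simp only [phys, rser_Dcoef_three]
    rw [fluxF_sub ρ (F + rser c x), fluxG_sub ρ μ (F + rser c x)]
    simp only [hr, ha, hb, he, hr₁, hr₂, hP, hQ, diffComb]
    ring
  simp only [hEr] at kE hE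
  have kr : Continuous r := by
    have : Continuous fun x => (a x * P 1 x + b x * Q 1 x) * P 3 x +
      (b x * P 1 x + e x * Q 1 x) * Q 3 x := by fun_prop
    exact (kE.add this).congr fun x => sub_add_cancel _ _
  have e1 : ∫ x, energyProd ρ μ 3 F G c d c' d' x = ∫ x,
      -((a' x * P 1 x + a x * P 2 x + (b' x * Q 1 x + b x * Q 2 x)) * P 2 x +
        (b' x * P 1 x + b x * P 2 x + (e' x * Q 1 x + e x * Q 2 x)) * Q 2 x +
        r x + s * M * ((P 0 x * P 2 x + P 1 x * P 1 x) +
          (Q 0 x * Q 2 x + Q 1 x * Q 1 x))) := by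
    have I : ∀ {u : Torus → ℝ}, Continuous u → Integrable u := fun hu =>
      Continuous.integrable_torus hu
    rw [hE, integral_neg, integral_sub (I kr) (I (by fun_prop)), integral_add (I (by fun_prop))
      (I (by fun_prop)), i1, i2, integral_add (I (by fun_prop)) (I (by fun_prop)),
      integral_add (I (by fun_prop)) (I kr), integral_add (I (by fun_prop)) (I (by fun_prop)),
      integral_const_mul, integral_add (I (by fun_prop)) (I (by fun_prop)),
      integral_add (I (by fun_prop)) (I (by fun_prop)),
      integral_add (I (by fun_prop)) (I (by fun_prop)), i3, i4]
    ring
  rw [e1, ← integral_const_mul]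
  refine integral_mono (Continuous.integrable_torus ?_)
    (Continuous.integrable_torus (kX.const_mul _)) fun x => ?_
  · fun_prop
  have hk' : |-rser (dcoef 3 c') x| + |-rser (dcoef 3 d') x| ≤ 2 * supNorm 3 c' d' := by
    rw [abs_neg, abs_neg]
    linarith [le_supNorm_left h3' x, le_supNorm_right h3' x]
  have t₁ := hΦ.abs_sub_le_of_heights (hcL x) (hdL x) (hcL' x) (hdL' x) hk'
  have t₂ := hΨ.abs_sub_le_of_heights (hcL x) (hdL x) (hcL' x) (hdL' x) hk'
  rw [add_sub_add_left_eq_sub, add_sub_add_left_eq_sub] at t₁ t₂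
  have u1 := le_supNorm_left h1 x
  have u2 := le_supNorm_right h1 x
  have k0 : 0 ≤ supNorm 1 c d := supNorm_nonneg
  obtain ⟨v1, v2, v3⟩ := abs_mobility_deriv_le hμ (hcL x) (hdL x) u1 u2
  rw [← hs2]
  simp only [hr]
  exact capillary_dissipation_le hm hs (hform _ _ (P 2 x) (Q 2 x) (hcδ x) (hdδ x)) v1 v2 v3 t₁ t₂
    hk₁ hk₃ (sq_diffComb_zero_le ρ x)

/-- The energy of the difference of two pairs of heights, the first of which is positive, grows at
most at a rate that is linear in the norms of order `z + 1`. -/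
theorem exists_integral_energyProd_le (hz : z = 1 ∨ z = 3) (hρ : 0 < ρ) (hμ : 0 < μ) (hδ : 0 < δ)
    (hL : 0 ≤ L) (F G : ℝ) : ∃ K, 0 ≤ K ∧ ∀ c d c' d' : ℤ → ℂ, c 0 = 0 → d 0 = 0 → c' 0 = 0 →
      d' 0 = 0 → pairNorm (z + 1) c d ≠ ⊤ → pairNorm (z + 1) c' d' ≠ ⊤ →
      (∀ x, δ ≤ F + rser c x) → (∀ x, δ ≤ G + rser d x) →
      (∀ x, |F + rser c x| ≤ L) → (∀ x, |G + rser d x| ≤ L) →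
      (∀ x, |F + rser c' x| ≤ L) → (∀ x, |G + rser d' x| ≤ L) →
      ∫ x, energyProd ρ μ z F G c d c' d' x ≤
        K * (1 + supNorm (z + 1) c d + supNorm (z + 1) c' d') *
        ∫ x, ((rser c' x - rser c x) ^ 2 + (rser d' x - rser d x) ^ 2) := by
  obtain ⟨C₁, h₁⟩ := exists_fluxBound_F hρ hL
  obtain ⟨C₂, h₂⟩ := exists_fluxBound_G hρ hμ hL
  have h₁' := h₁.mono (le_max_left C₁ C₂)
  have h₂' := h₂.mono (le_max_right C₁ C₂)
  set C := max C₁ C₂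
  have hm : 0 < min (1 / 2) (2 * μ) * δ ^ 3 := mul_pos (lt_min (by norm_num) (by positivity))
    (pow_pos hδ 3)
  have hform := fun f g ξ η hf hg => mobility_ge (f := f) (g := g) hμ hδ hf hg ξ η
  rcases hz with rfl | rfl
  · exact ⟨_, by positivity, fun c d c' d' hc hd hc' hd' h h' a1 a2 a3 a4 a5 a6 =>
      integral_energyProd_gravity_le hm hform h₁' h₂' hc hd hc' hd' h h' a1 a2 a3 a4 a5 a6⟩
  · exact ⟨_, by positivity, fun c d c' d' hc hd hc' hd' h h' a1 a2 a3 a4 a5 a6 =>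
      integral_energyProd_capillary_le hm hμ hform h₁' h₂' hc hd hc' hd' h h' a1 a2 a3 a4 a5 a6⟩

end energyProd

/-! ### The energy inequality and uniqueness -/

/-- Gronwall's lemma with an integrable rate and zero initial value. -/
theorem ae_eq_zero_of_le_integral {T : ℝ} (hT : 0 < T) {κ N : ℝ → ℝ} (hκ : IntegrableOn κ (Ioc 0 T))
    (hκ0 : ∀ t, 0 ≤ κ t) (hN0 : ∀ t, 0 ≤ N t) (hκN : IntegrableOn (fun t => κ t * N t) (Ioc 0 T))
    (h : ∀ᵐ t ∂(volume.restrict (Ioc 0 T)), N t ≤ ∫ s in (0 : ℝ)..t, κ s * N s) :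
    ∀ᵐ t ∂(volume.restrict (Ioc 0 T)), N t = 0 := by
  have iκ : ∀ {a b}, 0 ≤ a → a ≤ b → b ≤ T → IntervalIntegrable κ volume a b := fun ha hab hb =>
    (intervalIntegrable_iff_integrableOn_Ioc_of_le hab).2 (hκ.mono_set (Ioc_subset_Ioc ha hb))
  have iN : ∀ {a b}, 0 ≤ a → a ≤ b → b ≤ T → IntervalIntegrable (fun t => κ t * N t) volume a b :=
    fun ha hab hb => (intervalIntegrable_iff_integrableOn_Ioc_of_le hab).2
      (hκN.mono_set (Ioc_subset_Ioc ha hb))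
  set G : ℝ → ℝ := fun t => ∫ s in (0 : ℝ)..t, κ s * N s with hG
  have hcont : ∀ {f : ℝ → ℝ}, IntervalIntegrable f volume 0 T →
      ContinuousOn (fun t => ∫ s in (0 : ℝ)..t, f s) (Icc 0 T) := fun hf => by
    have := (hf.absolutelyContinuousOnInterval_intervalIntegral left_mem_uIcc).continuousOn
    rwa [uIcc_of_le hT.le] at this
  have hGc : ContinuousOn G (Icc 0 T) := hcont (iN le_rfl hT.le le_rfl)
  have hadd : ∀ {a b}, 0 ≤ a → a ≤ b → b ≤ T → G b = G a + ∫ s in a..b, κ s * N s :=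
    fun ha hab hb => (intervalIntegral.integral_add_adjacent_intervals
      (iN le_rfl ha (hab.trans hb)) (iN ha hab hb)).symm
  have hmono : ∀ {a b}, 0 ≤ a → a ≤ b → b ≤ T → G a ≤ G b := fun ha hab hb => by
    rw [hadd ha hab hb]
    exact le_add_of_nonneg_right (intervalIntegral.integral_nonneg hab fun s _ =>
      mul_nonneg (hκ0 s) (hN0 s))
  have hG0 : G 0 = 0 := intervalIntegral.integral_same
  -- the last time at which the integral vanishes
  set Z : Set ℝ := Icc 0 T ∩ G ⁻¹' {0} with hZ
  have hZc : IsCompact Z := isCompact_Icc.of_isClosed_subset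
    (hGc.preimage_isClosed_of_isClosed isClosed_Icc isClosed_singleton) inter_subset_left
  obtain ⟨τ, ⟨hτ, hτ0⟩, hmax⟩ := hZc.exists_isGreatest ⟨0, left_mem_Icc.2 hT.le, hG0⟩
  have hτT : τ = T := by
    by_contra hne
    have hlt : τ < T := lt_of_le_of_ne hτ.2 hne
    have c1 := (hcont (iκ le_rfl hT.le le_rfl)) τ hτ
    have c2 : ∀ᶠ t in 𝓝[Icc 0 T] τ, ∫ s in (0 : ℝ)..t, κ s < (∫ s in (0 : ℝ)..τ, κ s) + 1 / 2 :=
      c1.eventually_lt_const (by linarith)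
    have c3 : ∀ᶠ t in 𝓝[>] τ, ∫ s in (0 : ℝ)..t, κ s < (∫ s in (0 : ℝ)..τ, κ s) + 1 / 2 := by
      refine (nhdsWithin_le_of_mem ?_) c2
      exact mem_of_superset (Ioc_mem_nhdsGT hlt) fun t ht => ⟨hτ.1.trans ht.1.le, ht.2⟩
    obtain ⟨t, ht1, ht2, ht3⟩ := (c3.and (Ioc_mem_nhdsGT hlt)).exists
    have hk : ∫ s in τ..t, κ s ≤ 1 / 2 := by
      have := intervalIntegral.integral_add_adjacent_intervals (iκ le_rfl hτ.1 hτ.2)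
        (iκ hτ.1 ht2.le ht3)
      linarith
    have ht0 : 0 ≤ t := hτ.1.trans ht2.le
    -- just after that time the rate has integral at most `1 / 2`, so the integral still vanishes
    have hle : G t ≤ (∫ s in τ..t, κ s) * G t := by
      rw [← intervalIntegral.integral_mul_const]
      conv_lhs => rw [hadd hτ.1 ht2.le ht3, show G τ = 0 from hτ0, zero_add]
      rw [intervalIntegral.integral_of_le ht2.le, intervalIntegral.integral_of_le ht2.le]
      refine integral_mono_ae (hκN.mono_set (Ioc_subset_Ioc hτ.1 ht3))
        ((hκ.mono_set (Ioc_subset_Ioc hτ.1 ht3)).mul_const _) ?_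
      filter_upwards [ae_mono (Measure.restrict_mono (Ioc_subset_Ioc hτ.1 ht3) le_rfl) h,
        ae_restrict_mem measurableSet_Ioc] with s h1 h2
      exact mul_le_mul_of_nonneg_left (h1.trans (hmono (hτ.1.trans h2.1.le) h2.2 ht3)) (hκ0 s)
    have hGt : 0 ≤ G t := hG0 ▸ hmono le_rfl ht0 ht3
    have hGt0 : G t = 0 := by nlinarith
    exact absurd (hmax ⟨⟨ht0, ht3⟩, hGt0⟩) (not_le.2 ht2)
  filter_upwards [h, ae_restrict_mem measurableSet_Ioc] with t h1 h2
  have h3 := hmono h2.1.le h2.2 le_rfl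
  rw [← hτT, show G τ = 0 from hτ0] at h3
  exact le_antisymm (h1.trans h3) (hN0 t)

/-- The fundamental theorem of calculus for the quadratic form `ρ A² + 2 A B + B²` of two
primitives, which are only absolutely continuous. -/
theorem quad_primitive {t : ℝ} {a b : ℝ → ℝ} (ha : IntervalIntegrable a volume 0 t)
    (hb : IntervalIntegrable b volume 0 t) (ρ : ℝ) :
    ρ * (∫ s in (0 : ℝ)..t, a s) ^ 2 + 2 * (∫ s in (0 : ℝ)..t, a s) * (∫ s in (0 : ℝ)..t, b s) +
      (∫ s in (0 : ℝ)..t, b s) ^ 2 = 2 * ∫ s in (0 : ℝ)..t,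
        ((ρ * (∫ r in (0 : ℝ)..s, a r) + ∫ r in (0 : ℝ)..s, b r) * a s +
          (1 * (∫ r in (0 : ℝ)..s, a r) + ∫ r in (0 : ℝ)..s, b r) * b s) := by
  have hA := ha.absolutelyContinuousOnInterval_intervalIntegral (c := 0) left_mem_uIcc
  have hB := hb.absolutelyContinuousOnInterval_intervalIntegral (c := 0) left_mem_uIcc
  have hV := (((hA.fun_mul hA).const_mul ρ).fun_add ((hA.fun_mul hB).const_mul 2)).fun_add
    (hB.fun_mul hB)
  have e := hV.integral_deriv_eq_sub
  simp only [intervalIntegral.integral_same, mul_zero, add_zero, sub_zero] at e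
  have e2 := intervalIntegral.integral_congr_ae (μ := volume) (a := 0) (b := t)
    (f := fun s => 2 * ((ρ * (∫ r in (0 : ℝ)..s, a r) + ∫ r in (0 : ℝ)..s, b r) * a s +
          (1 * (∫ r in (0 : ℝ)..s, a r) + ∫ r in (0 : ℝ)..s, b r) * b s))
    (g := deriv fun s => ρ * ((∫ r in (0 : ℝ)..s, a r) * ∫ r in (0 : ℝ)..s, a r) +
      2 * ((∫ r in (0 : ℝ)..s, a r) * ∫ r in (0 : ℝ)..s, b r) +
      (∫ r in (0 : ℝ)..s, b r) * ∫ r in (0 : ℝ)..s, b r) (by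
    filter_upwards [ha.ae_hasDerivAt_integral, hb.ae_hasDerivAt_integral] with s h1 h2 hs
    have d1 := h1 (uIoc_subset_uIcc hs) 0 left_mem_uIcc
    have d2 := h2 (uIoc_subset_uIcc hs) 0 left_mem_uIcc
    rw [((((d1.fun_mul d1).const_mul ρ).fun_add ((d1.fun_mul d2).const_mul 2)).fun_add
      (d2.fun_mul d2)).deriv]
    ring)
  rw [intervalIntegral.integral_const_mul, e] at e2
  rw [e2]
  ring

theorem measurable_primitive {R : ℝ × Torus → ℝ} (hR : Measurable R) :
    Measurable fun p : ℝ × Torus => ∫ s in Ioc 0 p.1, R (s, p.2) := by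
  have m1 : MeasurableSet {q : (ℝ × Torus) × ℝ | 0 < q.2} :=
    measurableSet_lt measurable_const measurable_snd
  have m2 : MeasurableSet {q : (ℝ × Torus) × ℝ | q.2 ≤ q.1.1} :=
    measurableSet_le measurable_snd (by fun_prop)
  have h1 : Measurable (({q : (ℝ × Torus) × ℝ | 0 < q.2} ∩ {q | q.2 ≤ q.1.1}).indicator
      fun q => R (q.2, q.1.2)) := (hR.comp (by fun_prop)).indicator (m1.inter m2)
  have h2 := (h1.stronglyMeasurable.integral_prod_right' (ν := (volume : Measure ℝ))).measurable
  convert h2 using 2 with p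
  rw [← integral_indicator measurableSet_Ioc]
  rfl

/-- The energy identity for functions with integrable time derivatives and zero initial values. -/
theorem ae_integral_quad_eq {T : ℝ} {X Y A B : ℝ × Torus → ℝ} (hX : Measurable X)
    (hY : Measurable Y) (hA : Measurable A) (hB : Measurable B) {M : ℝ} (hXM : ∀ p, |X p| ≤ M)
    (hYM : ∀ p, |Y p| ≤ M) (iA : Integrable A (spaceTime T)) (iB : Integrable B (spaceTime T))
    (eX : ∀ᵐ t ∂(volume.restrict (Ioc 0 T)), ∀ᵐ x, X (t, x) = ∫ s in (0 : ℝ)..t, A (s, x))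
    (eY : ∀ᵐ t ∂(volume.restrict (Ioc 0 T)), ∀ᵐ x, Y (t, x) = ∫ s in (0 : ℝ)..t, B (s, x)) (ρ : ℝ) :
    Integrable (fun p => (ρ * X p + Y p) * A p + (1 * X p + Y p) * B p) (spaceTime T) ∧
    ∀ᵐ t ∂(volume.restrict (Ioc 0 T)),
      ∫ x, (ρ * X (t, x) ^ 2 + 2 * X (t, x) * Y (t, x) + Y (t, x) ^ 2) = 2 * ∫ s in (0 : ℝ)..t, ∫ x,
        ((ρ * X (s, x) + Y (s, x)) * A (s, x) + (1 * X (s, x) + Y (s, x)) * B (s, x)) := by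
  have hbd : ∀ a p, ‖a * X p + Y p‖ ≤ |a| * M + M := fun a p => by
    refine (abs_add_le _ _).trans (add_le_add ?_ (hYM p))
    rw [abs_mul]
    exact mul_le_mul_of_nonneg_left (hXM p) (abs_nonneg a)
  have iZ : Integrable (fun p => (ρ * X p + Y p) * A p + (1 * X p + Y p) * B p) (spaceTime T) :=
    (iA.bdd_mul (c := |ρ| * M + M) ((hX.const_mul ρ).add hY).aestronglyMeasurable
      (.of_forall (hbd ρ))).add
    (iB.bdd_mul (c := |1| * M + M) ((hX.const_mul 1).add hY).aestronglyMeasurable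
      (.of_forall (hbd 1)))
  refine ⟨iZ, ?_⟩
  -- exchange of `for almost every t` and `for almost every x`
  have sw : ∀ {U R : ℝ × Torus → ℝ}, Measurable U → Measurable R →
      (∀ᵐ t ∂(volume.restrict (Ioc 0 T)), ∀ᵐ x, U (t, x) = ∫ s in (0 : ℝ)..t, R (s, x)) →
      ∀ᵐ x, ∀ᵐ t ∂(volume.restrict (Ioc 0 T)), U (t, x) = ∫ s in (0 : ℝ)..t, R (s, x) := by
    intro U R hU hR h
    have h1 : ∀ᵐ t ∂(volume.restrict (Ioc 0 T)), ∀ᵐ x, U (t, x) = ∫ s in Ioc 0 t, R (s, x) := by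
      filter_upwards [h, ae_restrict_mem measurableSet_Ioc] with t a1 a2
      simpa only [intervalIntegral.integral_of_le a2.1.le] using a1
    rw [Measure.ae_ae_comm (p := fun t x => U (t, x) = ∫ s in Ioc 0 t, R (s, x))
      (measurableSet_eq_fun hU (measurable_primitive hR))] at h1
    filter_upwards [h1] with x hx
    filter_upwards [hx, ae_restrict_mem measurableSet_Ioc] with t a1 a2
    rwa [intervalIntegral.integral_of_le a2.1.le]
  have aA : ∀ᵐ x, IntegrableOn (fun s => A (s, x)) (Ioc 0 T) := iA.prod_left_ae
  have aB : ∀ᵐ x, IntegrableOn (fun s => B (s, x)) (Ioc 0 T) := iB.prod_left_ae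
  filter_upwards [eX, eY, ae_restrict_mem measurableSet_Ioc] with t tX tY ht
  have hle : (volume.restrict (Ioc 0 t)).prod (volume : Measure Torus) ≤ spaceTime T :=
    Measure.prod_mono (Measure.restrict_mono (Ioc_subset_Ioc_right ht.2) le_rfl) le_rfl
  have iZt := iZ.mono_measure hle
  have e1 : ∫ s in (0 : ℝ)..t, ∫ x,
        ((ρ * X (s, x) + Y (s, x)) * A (s, x) + (1 * X (s, x) + Y (s, x)) * B (s, x)) =
      ∫ x, ∫ s in (0 : ℝ)..t,
        ((ρ * X (s, x) + Y (s, x)) * A (s, x) + (1 * X (s, x) + Y (s, x)) * B (s, x)) := by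
    simp only [intervalIntegral.integral_of_le ht.1.le]
    exact integral_integral_swap (f := fun s x =>
      (ρ * X (s, x) + Y (s, x)) * A (s, x) + (1 * X (s, x) + Y (s, x)) * B (s, x)) iZt
  rw [e1, ← integral_const_mul]
  refine integral_congr_ae ?_
  filter_upwards [tX, tY, aA, aB, sw hX hA eX, sw hY hB eY] with x x1 x2 x3 x4 x5 x6
  have j : ∀ {R : ℝ → ℝ}, IntegrableOn R (Ioc 0 T) → IntervalIntegrable R volume 0 t := fun hR =>
    (intervalIntegrable_iff_integrableOn_Ioc_of_le ht.1.le).2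
      (hR.mono_set (Ioc_subset_Ioc_right ht.2))
  rw [x1, x2, quad_primitive (j x3) (j x4) ρ]
  congr 1
  rw [intervalIntegral.integral_of_le ht.1.le, intervalIntegral.integral_of_le ht.1.le]
  refine integral_congr_ae ?_
  filter_upwards [ae_mono (Measure.restrict_mono (Ioc_subset_Ioc_right ht.2) le_rfl) x5,
    ae_mono (Measure.restrict_mono (Ioc_subset_Ioc_right ht.2) le_rfl) x6] with s s1 s2
  rw [s1, s2]

/-- The energy is positive definite for `ρ > 1`. -/
theorem energy_ge (ρ X Y : ℝ) :
    (ρ - 1) * (X ^ 2 + Y ^ 2) ≤ (ρ + 1) * (ρ * X ^ 2 + 2 * X * Y + Y ^ 2) := by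
  nlinarith [sq_nonneg (2 * Y + (ρ + 1) * X), mul_nonneg (sq_nonneg (ρ - 1)) (sq_nonneg X)]

theorem BddCurve.mono {z : ℕ} {L L' F G : ℝ} {c d : ℝ → ℤ → ℂ} (h : BddCurve z L F G c d)
    (hL : L ≤ L') : BddCurve z L' F G c d :=
  ⟨h.sym_c, h.sym_d, h.zero_c, h.zero_d, h.top_ne, h.meas_c, h.meas_d,
    fun t x => (h.abs_le_c t x).trans hL, fun t x => (h.abs_le_d t x).trans hL, h.lint_ne⟩

/-- Two curves of heights solving the same equations coincide if the heights of the first one are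
bounded below by a positive constant. -/
theorem BddCurve.ae_eq {z : ℕ} {L L' F G δ ρ μ T : ℝ} {c d c' d' : ℝ → ℤ → ℂ}
    (h : BddCurve z L F G c d) (h' : BddCurve z L' F G c' d') (hz : z = 1 ∨ z = 3) (hρ : 1 < ρ)
    (hμ : 0 < μ) (hδ : 0 < δ) (hT : 0 < T) (hcδ : ∀ t x, δ ≤ F + rser (c t) x)
    (hdδ : ∀ t x, δ ≤ G + rser (d t) x) {u₀ v₀ : Torus → ℝ}
    (ec : ∀ᵐ t ∂(volume.restrict (Ioc 0 T)), ∀ᵐ x, rser (c t) x = u₀ x +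
      ∫ s in (0 : ℝ)..t, fluxDiv (fluxF ρ) z F G (c s) (d s) x)
    (ed : ∀ᵐ t ∂(volume.restrict (Ioc 0 T)), ∀ᵐ x, rser (d t) x = v₀ x +
      ∫ s in (0 : ℝ)..t, fluxDiv (fluxG ρ μ) z F G (c s) (d s) x)
    (ec' : ∀ᵐ t ∂(volume.restrict (Ioc 0 T)), ∀ᵐ x, rser (c' t) x = u₀ x +
      ∫ s in (0 : ℝ)..t, fluxDiv (fluxF ρ) z F G (c' s) (d' s) x)
    (ed' : ∀ᵐ t ∂(volume.restrict (Ioc 0 T)), ∀ᵐ x, rser (d' t) x = v₀ x +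
      ∫ s in (0 : ℝ)..t, fluxDiv (fluxG ρ μ) z F G (c' s) (d' s) x) :
    ∀ᵐ t ∂(volume.restrict (Ioc 0 T)), rser (c' t) =ᵐ[volume] rser (c t) ∧
      rser (d' t) =ᵐ[volume] rser (d t) := by
  replace h := h.mono (le_max_left L L')
  replace h' := h'.mono (le_max_right L L')
  set Λ := max L L' with hΛ
  have hρ0 : 0 < ρ := one_pos.trans hρ
  have hΛ0 : 0 ≤ Λ := (abs_nonneg _).trans (h.abs_le_c 0 0)
  obtain ⟨C₁, h₁⟩ := exists_fluxBound_F hρ0 (L := Λ + 1) (by positivity)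
  obtain ⟨C₂, h₂⟩ := exists_fluxBound_G hρ0 hμ (L := Λ + 1) (by positivity)
  have i1 := (h.integrable_fluxDiv hz h₁ (contDiff_fluxF ρ)).mono_measure (spaceTime_le T)
  have i2 := (h.integrable_fluxDiv hz h₂ (contDiff_fluxG ρ μ)).mono_measure (spaceTime_le T)
  have i1' := (h'.integrable_fluxDiv hz h₁ (contDiff_fluxF ρ)).mono_measure (spaceTime_le T)
  have i2' := (h'.integrable_fluxDiv hz h₂ (contDiff_fluxG ρ μ)).mono_measure (spaceTime_le T)
  obtain ⟨K, hK, hprod⟩ := exists_integral_energyProd_le hz hρ0 hμ hδ hΛ0 F G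
  -- the equations for the differences
  have diff : ∀ {a a' : ℝ → Torus → ℝ} {w₀ : Torus → ℝ} {R R' : ℝ × Torus → ℝ},
      Integrable R (spaceTime T) → Integrable R' (spaceTime T) →
      (∀ᵐ t ∂(volume.restrict (Ioc 0 T)), ∀ᵐ x, a t x = w₀ x + ∫ s in (0 : ℝ)..t, R (s, x)) →
      (∀ᵐ t ∂(volume.restrict (Ioc 0 T)), ∀ᵐ x, a' t x = w₀ x + ∫ s in (0 : ℝ)..t, R' (s, x)) →
      ∀ᵐ t ∂(volume.restrict (Ioc 0 T)), ∀ᵐ x, a' t x - a t x =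
        ∫ s in (0 : ℝ)..t, (R' (s, x) - R (s, x)) := by
    intro a a' w₀ R R' hR hR' ha ha'
    have b1 : ∀ᵐ x, IntegrableOn (fun s => R (s, x)) (Ioc 0 T) := hR.prod_left_ae
    have b2 : ∀ᵐ x, IntegrableOn (fun s => R' (s, x)) (Ioc 0 T) := hR'.prod_left_ae
    filter_upwards [ha, ha', ae_restrict_mem measurableSet_Ioc] with t t1 t2 ht
    filter_upwards [t1, t2, b1, b2] with x x1 x2 x3 x4
    have j : ∀ {Q : ℝ → ℝ}, IntegrableOn Q (Ioc 0 T) → IntervalIntegrable Q volume 0 t := fun hQ =>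
      (intervalIntegrable_iff_integrableOn_Ioc_of_le ht.1.le).2
        (hQ.mono_set (Ioc_subset_Ioc_right ht.2))
    rw [x1, x2, intervalIntegral.integral_sub (j x4) (j x3)]
    ring
  have eX := diff i1 i1' ec ec'
  have eY := diff i2 i2' ed ed'
  have mc := measurable_rser h.meas_c (h.wn_c_ne (by omega))
  have md := measurable_rser h.meas_d (h.wn_d_ne (by omega))
  have mc' := measurable_rser h'.meas_c (h'.wn_c_ne (by omega))
  have md' := measurable_rser h'.meas_d (h'.wn_d_ne (by omega))
  have bX : ∀ p : ℝ × Torus, |rser (c' p.1) p.2 - rser (c p.1) p.2| ≤ 2 * Λ := fun p => by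
    have a1 := abs_le.1 (h.abs_le_c p.1 p.2); have a2 := abs_le.1 (h'.abs_le_c p.1 p.2)
    rw [abs_le]; constructor <;> linarith
  have bY : ∀ p : ℝ × Torus, |rser (d' p.1) p.2 - rser (d p.1) p.2| ≤ 2 * Λ := fun p => by
    have a1 := abs_le.1 (h.abs_le_d p.1 p.2); have a2 := abs_le.1 (h'.abs_le_d p.1 p.2)
    rw [abs_le]; constructor <;> linarith
  obtain ⟨iZ, hE⟩ := ae_integral_quad_eq (X := fun p => rser (c' p.1) p.2 - rser (c p.1) p.2)
    (Y := fun p => rser (d' p.1) p.2 - rser (d p.1) p.2)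
    (A := fun p => fluxDiv (fluxF ρ) z F G (c' p.1) (d' p.1) p.2 -
      fluxDiv (fluxF ρ) z F G (c p.1) (d p.1) p.2)
    (B := fun p => fluxDiv (fluxG ρ μ) z F G (c' p.1) (d' p.1) p.2 -
      fluxDiv (fluxG ρ μ) z F G (c p.1) (d p.1) p.2) (mc'.sub mc) (md'.sub md)
    ((h'.measurable_fluxDiv (contDiff_fluxF ρ)).sub (h.measurable_fluxDiv (contDiff_fluxF ρ)))
    ((h'.measurable_fluxDiv (contDiff_fluxG ρ μ)).sub (h.measurable_fluxDiv (contDiff_fluxG ρ μ)))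
    bX bY (i1'.sub i1) (i2'.sub i2) eX eY ρ
  have eprod : ∀ s x, (ρ * (rser (c' s) x - rser (c s) x) + (rser (d' s) x - rser (d s) x)) *
      (fluxDiv (fluxF ρ) z F G (c' s) (d' s) x - fluxDiv (fluxF ρ) z F G (c s) (d s) x) +
      (1 * (rser (c' s) x - rser (c s) x) + (rser (d' s) x - rser (d s) x)) *
      (fluxDiv (fluxG ρ μ) z F G (c' s) (d' s) x - fluxDiv (fluxG ρ μ) z F G (c s) (d s) x) =
      energyProd ρ μ z F G (c s) (d s) (c' s) (d' s) x := fun s x => by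
    simp only [energyProd, diffComb, dcoef_zero]
  set N : ℝ → ℝ := fun t => ∫ x, ((rser (c' t) x - rser (c t) x) ^ 2 +
    (rser (d' t) x - rser (d t) x) ^ 2) with hN
  have mN' : Measurable fun p : ℝ × Torus => (rser (c' p.1) p.2 - rser (c p.1) p.2) ^ 2 +
    (rser (d' p.1) p.2 - rser (d p.1) p.2) ^ 2 := ((mc'.sub mc).pow_const 2).add
      ((md'.sub md).pow_const 2)
  have mN : Measurable N := mN'.stronglyMeasurable.integral_prod_right'.measurable
  have hN0 : ∀ t, 0 ≤ N t := fun t => integral_nonneg fun x => by positivity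
  have kX : ∀ t, Continuous fun x => rser (c' t) x - rser (c t) x := fun t =>
    (continuous_rser (h'.wn_c_ne (by omega) t)).sub (continuous_rser (h.wn_c_ne (by omega) t))
  have kY : ∀ t, Continuous fun x => rser (d' t) x - rser (d t) x := fun t =>
    (continuous_rser (h'.wn_d_ne (by omega) t)).sub (continuous_rser (h.wn_d_ne (by omega) t))
  have iN : ∀ t, Integrable fun x => (rser (c' t) x - rser (c t) x) ^ 2 +
      (rser (d' t) x - rser (d t) x) ^ 2 := fun t =>
    Continuous.integrable_torus (((kX t).pow 2).add ((kY t).pow 2))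
  have hNb : ∀ t, ‖N t‖ ≤ ∫ _ : Torus, 2 * (2 * Λ) ^ 2 := fun t => by
    rw [Real.norm_of_nonneg (hN0 t)]
    refine integral_mono (iN t) (integrable_const _) fun x => ?_
    have a1 := sq_le_sq' (abs_le.1 (bX (t, x))).1 (abs_le.1 (bX (t, x))).2
    have a2 := sq_le_sq' (abs_le.1 (bY (t, x))).1 (abs_le.1 (bY (t, x))).2
    show _ ≤ 2 * (2 * Λ) ^ 2
    simp only at a1 a2 ⊢
    linarith
  -- the rate in Gronwall's lemma
  set κ : ℝ → ℝ := fun t => 2 * (ρ + 1) / (ρ - 1) * (K * (1 +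
    (pairNorm (z + 1) (c t) (d t)).toReal + (pairNorm (z + 1) (c' t) (d' t)).toReal)) with hκ
  have hρ1 : 0 < ρ - 1 := by linarith
  have hκ0 : ∀ t, 0 ≤ κ t := fun t => by positivity
  have iκ : IntegrableOn κ (Ioc 0 T) := by
    have a1 := (h.integrable_pairNorm le_rfl).mono_set (show Ioc 0 T ⊆ Ioi 0 from fun t ht => ht.1)
    have a2 := (h'.integrable_pairNorm le_rfl).mono_set (show Ioc 0 T ⊆ Ioi 0 from fun t ht => ht.1)
    have a3 : IntegrableOn (fun _ : ℝ => (1 : ℝ)) (Ioc 0 T) := integrableOn_const (by simp)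
    exact (((a3.add a1).add a2).const_mul K).const_mul _
  have iκN : IntegrableOn (fun t => κ t * N t) (Ioc 0 T) :=
    (iκ.integrable.bdd_mul mN.aestronglyMeasurable (.of_forall hNb)).congr
      (.of_forall fun t => mul_comm _ _)
  -- the energy identity and the bound for the energy production
  have main : ∀ᵐ t ∂(volume.restrict (Ioc 0 T)), N t ≤ ∫ s in (0 : ℝ)..t, κ s * N s := by
    filter_upwards [hE, ae_restrict_mem measurableSet_Ioc] with t ht htT
    simp only [eprod] at ht
    have iP : IntegrableOn (fun s => ∫ x, energyProd ρ μ z F G (c s) (d s) (c' s) (d' s) x)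
      (Ioc 0 T) := by
      have := iZ.integral_prod_left
      refine this.congr (.of_forall fun s => integral_congr_ae (.of_forall fun x => eprod s x))
    have hsub : Ioc 0 t ⊆ Ioc 0 T := Ioc_subset_Ioc_right htT.2
    have q1 : (ρ - 1) * N t ≤ (ρ + 1) * ∫ x, (ρ * (rser (c' t) x - rser (c t) x) ^ 2 +
        2 * (rser (c' t) x - rser (c t) x) * (rser (d' t) x - rser (d t) x) +
        (rser (d' t) x - rser (d t) x) ^ 2) := by
      rw [hN, ← integral_const_mul, ← integral_const_mul]
      refine integral_mono ((iN t).const_mul _) (Continuous.integrable_torus ?_) fun x =>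
        energy_ge _ _ _
      have := kX t; have := kY t
      fun_prop
    have q2 : ∫ s in (0 : ℝ)..t, ∫ x, energyProd ρ μ z F G (c s) (d s) (c' s) (d' s) x ≤
        ∫ s in (0 : ℝ)..t, (ρ - 1) / (2 * (ρ + 1)) * (κ s * N s) := by
      rw [intervalIntegral.integral_of_le htT.1.le, intervalIntegral.integral_of_le htT.1.le]
      refine integral_mono (iP.mono_set hsub) ((iκN.mono_set hsub).const_mul _) fun s => ?_
      refine (hprod _ _ _ _ (h.zero_c s) (h.zero_d s) (h'.zero_c s) (h'.zero_d s) (h.top_ne s)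
        (h'.top_ne s) (hcδ s) (hdδ s) (h.abs_le_c s) (h.abs_le_d s) (h'.abs_le_c s)
        (h'.abs_le_d s)).trans ?_
      have e : (ρ - 1) / (2 * (ρ + 1)) * (κ s * N s) = K * (1 +
          (pairNorm (z + 1) (c s) (d s)).toReal + (pairNorm (z + 1) (c' s) (d' s)).toReal) * N s := by
        rw [hκ]; field_simp
      show _ ≤ (ρ - 1) / (2 * (ρ + 1)) * (κ s * N s)
      rw [e]
      refine mul_le_mul_of_nonneg_right (mul_le_mul_of_nonneg_left ?_ hK) (hN0 s)
      linarith [supNorm_le_pairNorm (h.top_ne s), supNorm_le_pairNorm (h'.top_ne s)]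
    rw [intervalIntegral.integral_const_mul] at q2
    rw [ht] at q1
    have q3 : (ρ - 1) * N t ≤ (ρ - 1) * ∫ s in (0 : ℝ)..t, κ s * N s := by
      calc _ ≤ _ := q1
        _ ≤ (ρ + 1) * (2 * ((ρ - 1) / (2 * (ρ + 1)) * ∫ s in (0 : ℝ)..t, κ s * N s)) := by gcongr
        _ = _ := by field_simp
    exact le_of_mul_le_mul_left q3 hρ1
  filter_upwards [ae_eq_zero_of_le_integral hT iκ hκ0 hN0 iκN main] with t ht
  have := (integral_eq_zero_iff_of_nonneg (fun x => by positivity) (iN t)).1 ht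
  constructor
  · filter_upwards [this] with x hx
    have hx' : (rser (c' t) x - rser (c t) x) ^ 2 + (rser (d' t) x - rser (d t) x) ^ 2 = 0 := hx
    exact sub_eq_zero.1 (pow_eq_zero_iff two_ne_zero |>.1
      ((add_eq_zero_iff_of_nonneg (sq_nonneg _) (sq_nonneg _)).1 hx').1)
  · filter_upwards [this] with x hx
    have hx' : (rser (c' t) x - rser (c t) x) ^ 2 + (rser (d' t) x - rser (d t) x) ^ 2 = 0 := hx
    exact sub_eq_zero.1 (pow_eq_zero_iff two_ne_zero |>.1
      ((add_eq_zero_iff_of_nonneg (sq_nonneg _) (sq_nonneg _)).1 hx').2)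

/-- The positivity of `Σ₁` and `Σ₂` forces `ρ > 1`, which makes the energy positive definite. -/
theorem one_lt_of_Sigma_pos {ρ μ F G E : ℝ} (hρ : 0 < ρ) (hμ : 0 < μ) (hF : 0 < F) (hG : 0 < G)
    (hE : 0 ≤ E) (h₁ : 0 < Sigma1 ρ μ F G E) (h₂ : 0 < Sigma2 ρ μ F G E) : 1 < ρ := by
  rw [Sigma1] at h₁
  rw [Sigma2] at h₂
  have a1 : 0 ≤ E * ((78 + 20 * ρ + 14 * μ) * E ^ 2
      + (F * (36 * ρ + 84) + (81 + 30 * μ + 9 * ρ) * G) * E) := by positivity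
  have a2 : 0 ≤ E * ((18 * μ + 18) * G ^ 2 + (18 * ρ + 18) * F ^ 2 + (12 * ρ + 60) * G * F) := by
    positivity
  have a3 : 0 ≤ E * ((14 * μ + 15 * ρ + 83) * E ^ 2
      + ((30 * μ + 6 * ρ + 84) * G + (96 + 24 * ρ) * F) * E) := by positivity
  have a4 : 0 ≤ E * ((18 * μ + 18) * G ^ 2 + (27 + 9 * ρ) * F ^ 2 + (6 * ρ + 66) * F * G) := by
    positivity
  have a5 : 0 < μ * G ^ 3 := by positivity
  have b1 : 2 * μ * G ^ 3 + 6 * F * G ^ 2 < 2 * ρ * F ^ 3 + 3 * F ^ 2 * G * (1 - ρ) := by linarith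
  have b2 : 2 * F ^ 3 < 2 * μ * G ^ 3 + 6 * F * G ^ 2 := by linarith
  by_contra hle
  rw [not_lt] at hle
  have b3 : 0 < (1 - ρ) * (F ^ 2 * (3 * G - 2 * F)) := by
    have : 2 * F ^ 3 < 2 * ρ * F ^ 3 + 3 * F ^ 2 * G * (1 - ρ) := b2.trans b1
    linarith
  have b4 : 0 < F ^ 2 * (3 * G - 2 * F) := pos_of_mul_pos_right b3 (by linarith)
  have b5 : 2 * F < 3 * G := by
    have := pos_of_mul_pos_right b4 (by positivity)
    linarith
  have b6 : 6 * G ^ 2 < 2 * ρ * F ^ 2 + 3 * F * G * (1 - ρ) := by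
    refine lt_of_mul_lt_mul_left (a := F) ?_ hF.le
    linarith
  nlinarith [mul_pos hF hG, mul_nonneg hρ.le (mul_pos hF hG).le, mul_pos hG (sub_pos.2 b5),
    mul_nonneg hρ.le (mul_pos hF (sub_pos.2 b5)).le]

/-- Every weak solution in the uniqueness class agrees with the constructed one. -/
theorem Solution.ae_eq {d : Flow} {ρ μ E σ : ℝ} {f₀ g₀ : Torus → ℝ}
    (S : Solution (fluxF ρ) (fluxG ρ μ) d.zeta (mean f₀) (mean g₀) E σ (fourierC (fluct f₀))
      (fourierC (fluct g₀))) (hρ : 1 < ρ) (hμ : 0 < μ) (hE : 0 ≤ E) (hF : E < mean f₀)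
    (hG : E < mean g₀) (hf₀ : Integrable (fluct f₀)) (hg₀ : Integrable (fluct g₀)) {T : ℝ}
    (hT : 0 < T) {f g : ℝ → Torus → ℝ} (h : IsWeakSolution d ρ μ f₀ g₀ T f g)
    (hf : MemLInf T f) (hf' : MemBochner (wienerNorm ((d.zeta : ℝ) + 1)) 1 T f)
    (hg : MemLInf T g) (hg' : MemBochner (wienerNorm ((d.zeta : ℝ) + 1)) 1 T g) :
    ∀ᵐ t ∂(volume.restrict (Ioc 0 T)), f t =ᵐ[volume] rser (S.c t) ∧ g t =ᵐ[volume] rser (S.d t) := by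
  have hρ0 : 0 < ρ := one_pos.trans hρ
  have hF0 := hE.trans hF.le
  have hG0 := hE.trans hG.le
  obtain ⟨L, c, e, hb, a1, a2, a3, a4⟩ := exists_bddCurve hρ0 hμ hf₀ hg₀ hT h hf hf' hg hg'
  have hδ : 0 < min (mean f₀) (mean g₀) - E := sub_pos.2 (lt_min hF hG)
  have res : ∀ {p : ℝ → Prop}, (∀ᵐ t ∂(volume.restrict (Ioi (0 : ℝ))), p t) →
      ∀ᵐ t ∂(volume.restrict (Ioc 0 T)), p t := fun hp =>
    ae_mono (Measure.restrict_mono (fun t ht => ht.1) le_rfl) hp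
  have low : ∀ {b : ℝ} (u : ℤ → ℂ), min (mean f₀) (mean g₀) ≤ b → wn 0 u ≤ ENNReal.ofReal E →
      ∀ x, min (mean f₀) (mean g₀) - E ≤ b + rser u x := fun u hb hu x => by
    have := (abs_le.1 (abs_rser_le_of_le hE hu x)).1
    linarith
  have := (S.isCurve.bddCurve hF0 hG0 hE).ae_eq hb d.zeta_eq hρ hμ hδ hT
    (fun t => low _ (min_le_left _ _) (le_self_add.trans (S.le_E t)))
    (fun t => low _ (min_le_right _ _) (le_add_self.trans (S.le_E t)))
    (res (S.ae_eq_c d.zeta_eq hρ0 hF0 hG0 hE hf₀)) (res (S.ae_eq_d d.zeta_eq hρ0 hμ hF0 hG0 hE hg₀))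
    a3 a4
  filter_upwards [this, a1, a2] with t t1 t2 t3
  exact ⟨t2.trans t1.1, t3.trans t1.2⟩

end ThinFilmStokes

theorem theorem5 (d : ThinFilmStokes.Flow) (ρ μ : ℝ) (hρ : 0 < ρ) (hμ : 0 < μ)
    (f₀ g₀ : ThinFilmStokes.Torus → ℝ)
    (hf₀ : ThinFilmStokes.wienerNorm 0 (ThinFilmStokes.fluct f₀) < ⊤)
    (hg₀ : ThinFilmStokes.wienerNorm 0 (ThinFilmStokes.fluct g₀) < ⊤)
    (hsmall : ThinFilmStokes.energy0 f₀ g₀ <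
      min (ThinFilmStokes.mean f₀) (ThinFilmStokes.mean g₀))
    (hSigma : 0 < min
      (ThinFilmStokes.Sigma1 ρ μ (ThinFilmStokes.mean f₀) (ThinFilmStokes.mean g₀)
        (ThinFilmStokes.energy0 f₀ g₀))
      (ThinFilmStokes.Sigma2 ρ μ (ThinFilmStokes.mean f₀) (ThinFilmStokes.mean g₀)
        (ThinFilmStokes.energy0 f₀ g₀))) :
    (∃ ε : ℝ, 0 < ε ∧ ∃ f g : ℝ → ThinFilmStokes.Torus → ℝ,
      (∀ T : ℝ, 0 < T →
        ThinFilmStokes.IsWeakSolution d ρ μ f₀ g₀ T f g ∧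
        ThinFilmStokes.HasRegularity d T f ∧ ThinFilmStokes.HasRegularity d T g) ∧
      (∀ T : ℝ, 0 ≤ T →
        eLpNorm (f T) ⊤ volume + eLpNorm (g T) ⊤ volume
          ≤ ENNReal.ofReal (ThinFilmStokes.energy0 f₀ g₀ * Real.exp (-ε * T)))) ∧
    (∀ T : ℝ, 0 < T → ∀ f₁ g₁ f₂ g₂ : ℝ → ThinFilmStokes.Torus → ℝ,
      ThinFilmStokes.IsWeakSolution d ρ μ f₀ g₀ T f₁ g₁ →
      ThinFilmStokes.IsWeakSolution d ρ μ f₀ g₀ T f₂ g₂ →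
      (∀ u ∈ ({f₁, g₁, f₂, g₂} : Set (ℝ → ThinFilmStokes.Torus → ℝ)),
        ThinFilmStokes.MemLInf T u ∧
        ThinFilmStokes.MemBochner (ThinFilmStokes.wienerNorm ((d.zeta : ℝ) + 1)) 1 T u) →
      Function.uncurry f₁ =ᵐ[ThinFilmStokes.spaceTime T] Function.uncurry f₂ ∧
      Function.uncurry g₁ =ᵐ[ThinFilmStokes.spaceTime T] Function.uncurry g₂) := by
  obtain ⟨i1, _, _⟩ := ThinFilmStokes.integrable_fluct_of_wienerNorm hf₀
  obtain ⟨i2, _, _⟩ := ThinFilmStokes.integrable_fluct_of_wienerNorm hg₀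
  have hE : 0 ≤ ThinFilmStokes.energy0 f₀ g₀ :=
    add_nonneg ENNReal.toReal_nonneg ENNReal.toReal_nonneg
  obtain ⟨h1, h2⟩ := lt_min_iff.1 hsmall
  obtain ⟨σ, hσ, ⟨S⟩⟩ := ThinFilmStokes.exists_solution d hρ hμ hf₀ hg₀ hsmall hSigma
  refine ⟨⟨σ, hσ, fun t => ThinFilmStokes.rser (S.c t), fun t => ThinFilmStokes.rser (S.d t),
    fun T hT => ⟨S.isWeakSolution hρ hμ (hE.trans h1.le) (hE.trans h2.le) hE i1 i2 hT,
      S.hasRegularity T⟩, fun T hT => ?_⟩, fun T hT f₁ g₁ f₂ g₂ h₁ h₂ hreg => ?_⟩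
  · exact (add_le_add (ThinFilmStokes.eLpNorm_top_rser_le _)
      (ThinFilmStokes.eLpNorm_top_rser_le _)).trans (S.decay T hT)
  · obtain ⟨s1, s2⟩ := lt_min_iff.1 hSigma
    have hρ1 := ThinFilmStokes.one_lt_of_Sigma_pos hρ hμ (hE.trans_lt h1) (hE.trans_lt h2) hE s1 s2
    have r₁ := hreg f₁ (by simp)
    have r₂ := hreg g₁ (by simp)
    have r₃ := hreg f₂ (by simp)
    have r₄ := hreg g₂ (by simp)
    have e₁ := S.ae_eq hρ1 hμ hE h1 h2 i1 i2 hT h₁ r₁.1 r₁.2 r₂.1 r₂.2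
    have e₂ := S.ae_eq hρ1 hμ hE h1 h2 i1 i2 hT h₂ r₃.1 r₃.2 r₄.1 r₄.2
    constructor
    · refine ThinFilmStokes.ae_eq_of_ae_ae h₁.1 h₂.1 ?_
      filter_upwards [e₁, e₂] with t t₁ t₂
      exact t₁.1.trans t₂.1.symm
    · refine ThinFilmStokes.ae_eq_of_ae_ae h₁.2.1 h₂.2.1 ?_
      filter_upwards [e₁, e₂] with t t₁ t₂
      exact t₁.2.trans t₂.2.symm
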